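/- Let $\ell$ be a prime, $\nu_\ell$ the $\ell$-adic valuation, and $n$ a positive integer. For a finite group $H$ let $\operatorname{Irr}(H)$ be the set of complex irreducible characters of $H$, and for $\chi\in\operatorname{Irr}(H)$ put $\operatorname{def}(\chi)=\nu_\ell(|H|)-\nu_\ell(\chi(1))$. Write $\operatorname{Irr}_{\ell'}(H)=\{\chi\in\operatorname{Irr}(H)\mid \ell\nmid\chi(1)\}$ and $\operatorname{dz}(H)=\{\chi\in\operatorname{Irr}(H)\mid \operatorname{def}(\chi)=0\}$. Let $G$ be one of the following groups: the symmetric group $\mathfrak{S}_n$; the wreath product $C_e\wr\mathfrak{S}_n=C_e^n\rtimes\mathfrak{S}_n$ of a cyclic group of order $e$ with $\mathfrak S_n$, where $e\ge 1$ and $\ell\nmid e$; or the imprimitive complex reflection group $G(2e,2,n)=N\rtimes\mathfrak{S}_n$, where $e\ge1$, $\ell\nmid 2e$ and $N$ is the index-2 subgroup of $C_{2e}^n$ of all $(a_1,\dots,a_n)$ with $(a_1\cdots a_n)^e=1$. An $\ell$-Young subgroup of $\mathfrak{S}_n$ is a conjugate of a Young subgroup $\mathfrak{S}_{\mu}=\mathfrak{S}_{\{1,\dots,\mu_1\}}\times\mathfrak{S}_{\{\mu_1+1,\dots,\mu_1+\mu_2\}}\times\cdots$,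 where $\mu=(\mu_1,\dots,\mu_k)$ is a partition of $n$ each of whose parts is a power $\ell^i$ ($i\ge0$) of $\ell$. The $\ell$-Young subgroups of $C_e\wr\mathfrak{S}_n$ are the subgroups $C_e\wr Y'=C_e^n\rtimes Y'$, and those of $G(2e,2,n)=N\rtimes\mathfrak{S}_n$ are the subgroups $N\rtimes Y'$, where in both cases $Y'$ runs over the $\ell$-Young subgroups of $\mathfrak{S}_n$. For a subgroup $Y\le G$ and $\zeta\in\operatorname{Irr}(Y)$ let $\operatorname{N}_G(Y)_\zeta$ be the stabilizer of $\zeta$ in the normalizer $\operatorname{N}_G(Y)$. Consider the triples $(Y,\zeta,\lambda)$, where $Y$ is an $\ell$-Young subgroup of $G$, $\zeta\in\operatorname{Irr}_{\ell'}(Y)$ and $\lambda\in\operatorname{dz}(\operatorname{N}_G(Y)_\zeta/Y)$; $G$ acts on them by simultaneous conjugation. Then there is a bijection between $\operatorname{Irr}(G)$ and the set of $G$-conjugacy classes of such triples such that $\operatorname{def}(\chi)=\nu_\ell(|Y|)$ whenever $\chi\in\operatorname{Irr}(G)$ corresponds to the class of $(Y,\zeta,\lambda)$. -/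

import Mathlib

/-! ### Ordinary irreducible characters, defect -/

/-- The set `Irr(G)` of ordinary (complex) irreducible characters of `G`: the functions on `G` that
are the character of an irreducible finite-dimensional complex representation (which may be taken
on some `ℂ ^ d`). Two elements are equal iff they are equal as functions. -/
@[ext]
structure Irr (G : Type*) [Group G] where
  /-- the underlying function -/
  toFun : G → ℂ
  exists_rep : ∃ (d : ℕ) (ρ : Representation ℂ G (Fin d → ℂ)),
    ρ.IsIrreducible ∧ ρ.character = toFun

namespace Irr

variable {G : Type*} [Group G]

instance : CoeFun (Irr G) (fun _ => G → ℂ) := ⟨toFun⟩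

theorem exists_degree (χ : Irr G) : ∃ d : ℕ, (d : ℂ) = χ 1 := by
  obtain ⟨d, ρ, -, h⟩ := χ.exists_rep
  exact ⟨d, by rw [← h, Representation.char_one]; simp⟩

/-- The degree `χ(1)`, as a natural number. -/
noncomputable def degree (χ : Irr G) : ℕ := χ.exists_degree.choose

theorem degree_eq (χ : Irr G) : (χ.degree : ℂ) = χ 1 := χ.exists_degree.choose_spec

/-- The `ℓ`-defect `def(χ) = ν_ℓ(|G|) - ν_ℓ(χ(1))`. -/
noncomputable def defect (ℓ : ℕ) (χ : Irr G) : ℤ :=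
  (padicValNat ℓ (Nat.card G) : ℤ) - (padicValNat ℓ χ.degree : ℤ)

end Irr

/-! ### Triples `(Y, ζ, λ)` and their conjugacy classes -/

section Triples

variable {G : Type*} [Group G]

/-- `N_G(Y)_ζ`: the stabilizer of the character `ζ` of `Y` in the normalizer of `Y` in `G`. -/
def normalizerStabilizer (Y : Subgroup G) (ζ : Irr Y) : Subgroup G where
  carrier := {g | g ∈ Subgroup.normalizer (Y : Set G) ∧
    ∀ y y' : Y, (y' : G) = g * y * g⁻¹ → ζ y' = ζ y}
  one_mem' := ⟨one_mem _, fun y y' h => by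
    have : y' = y := Subtype.ext (by simpa using h)
    rw [this]⟩
  mul_mem' := by
    rintro a b ⟨ha, ha'⟩ ⟨hb, hb'⟩
    refine ⟨mul_mem ha hb, fun y y' h => ?_⟩
    have hm : b * (y : G) * b⁻¹ ∈ Y := (Subgroup.mem_normalizer_iff.1 hb _).1 y.2
    rw [ha' ⟨_, hm⟩ y' (by rw [h]; group), hb' y ⟨_, hm⟩ rfl]
  inv_mem' := by
    rintro a ⟨ha, ha'⟩
    refine ⟨inv_mem ha, fun y y' h => (ha' y' y ?_).symm⟩
    rw [h]; group

/-- `Y`, viewed as a subgroup of `N_G(Y)_ζ`. -/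
abbrev subgroupInStabilizer (Y : Subgroup G) (ζ : Irr Y) :
    Subgroup (normalizerStabilizer Y ζ) :=
  Y.subgroupOf (normalizerStabilizer Y ζ)

instance subgroupInStabilizer_normal (Y : Subgroup G) (ζ : Irr Y) :
    (subgroupInStabilizer Y ζ).Normal where
  conj_mem := by
    rintro x hx ⟨g, hg⟩
    rw [Subgroup.mem_subgroupOf] at hx ⊢
    exact (Subgroup.mem_normalizer_iff.1 hg.1 _).1 hx

theorem Irr.apply_conj {H : Type*} [Group H] (χ : Irr H) (h x : H) : χ (h * x * h⁻¹) = χ x := by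
  obtain ⟨d, ρ, -, e⟩ := χ.exists_rep
  rw [← e]; exact ρ.char_conj x h

/-- `Y ≤ N_G(Y)_ζ`, so that `subgroupInStabilizer Y ζ` is all of `Y`. -/
theorem le_normalizerStabilizer (Y : Subgroup G) (ζ : Irr Y) : Y ≤ normalizerStabilizer Y ζ := by
  intro g hg
  refine ⟨Subgroup.le_normalizer hg, fun y y' h => ?_⟩
  have : y' = ⟨g, hg⟩ * y * ⟨g, hg⟩⁻¹ := Subtype.ext h
  rw [this, Irr.apply_conj]

/-- Triples `(Y, ζ, λ)` where `Y` belongs to the given family `𝒴` of subgroups of `G`,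
`ζ ∈ Irr_{ℓ'}(Y)` and `λ ∈ dz(N_G(Y)_ζ / Y)`. -/
structure DZTriple (ℓ : ℕ) (𝒴 : Set (Subgroup G)) where
  Y : Subgroup G
  Y_mem : Y ∈ 𝒴
  /-- the character `ζ` of `Y`, of degree prime to `ℓ` -/
  ζ : Irr Y
  ζ_degree : ¬ ℓ ∣ ζ.degree
  /-- the character `λ` of `N_G(Y)_ζ / Y`, of `ℓ`-defect zero -/
  lam : Irr (normalizerStabilizer Y ζ ⧸ subgroupInStabilizer Y ζ)
  lam_defect : lam.defect ℓ = 0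

namespace DZTriple

variable {ℓ : ℕ} {𝒴 : Set (Subgroup G)}

/-- `S.ConjBy g T` means that conjugation `x ↦ g x g⁻¹` takes the triple `S` to the triple `T`. -/
structure ConjBy (g : G) (S T : DZTriple ℓ 𝒴) : Prop where
  Y_eq : ∀ x : G, x ∈ S.Y ↔ g * x * g⁻¹ ∈ T.Y
  ζ_eq : ∀ (y : S.Y) (y' : T.Y), (y' : G) = g * y * g⁻¹ → T.ζ y' = S.ζ y
  lam_eq : ∀ (t : normalizerStabilizer S.Y S.ζ) (t' : normalizerStabilizer T.Y T.ζ),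
    (t' : G) = g * t * g⁻¹ → T.lam (QuotientGroup.mk t') = S.lam (QuotientGroup.mk t)

theorem ConjBy.one (S : DZTriple ℓ 𝒴) : ConjBy 1 S S where
  Y_eq x := by simp
  ζ_eq y y' h := by
    have : y' = y := Subtype.ext (by simpa using h)
    rw [this]
  lam_eq t t' h := by
    have : t' = t := Subtype.ext (by simpa using h)
    rw [this]

theorem ConjBy.inv {g : G} {S T : DZTriple ℓ 𝒴} (h : ConjBy g S T) : ConjBy g⁻¹ T S where
  Y_eq x := by
    rw [h.Y_eq]
    have : g * (g⁻¹ * x * g⁻¹⁻¹) * g⁻¹ = x := by group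
    rw [this]
  ζ_eq y y' e := (h.ζ_eq y' y (by rw [e]; group)).symm
  lam_eq t t' e := (h.lam_eq t' t (by rw [e]; group)).symm

/-- Conjugation by `g` takes `N_G(Y)_ζ` to the corresponding stabilizer of the conjugate pair. -/
theorem ConjBy.mem_stabilizer {g : G} {S T : DZTriple ℓ 𝒴} (h : ConjBy g S T) {t : G}
    (ht : t ∈ normalizerStabilizer S.Y S.ζ) :
    g * t * g⁻¹ ∈ normalizerStabilizer T.Y T.ζ := by
  have key : ∀ x : G, x ∈ T.Y ↔ g⁻¹ * x * g ∈ S.Y := fun x => by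
    simpa using h.inv.Y_eq x
  refine ⟨Subgroup.mem_normalizer_iff.2 fun x => ?_, fun y y' e => ?_⟩
  · rw [key, key]
    have e : g⁻¹ * (g * t * g⁻¹ * x * (g * t * g⁻¹)⁻¹) * g = t * (g⁻¹ * x * g) * t⁻¹ := by group
    rw [e]
    exact Subgroup.mem_normalizer_iff.1 ht.1 _
  · rw [h.ζ_eq ⟨_, (key _).1 y.2⟩ y (by simp; group),
      h.ζ_eq ⟨_, (key _).1 y'.2⟩ y' (by simp; group)]
    exact ht.2 _ _ (by simp [e]; group)

theorem ConjBy.mul {g k : G} {S T U : DZTriple ℓ 𝒴} (h : ConjBy g S T) (h' : ConjBy k T U) :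
    ConjBy (k * g) S U where
  Y_eq x := by
    rw [h.Y_eq, h'.Y_eq]
    have : k * (g * x * g⁻¹) * k⁻¹ = k * g * x * (k * g)⁻¹ := by group
    rw [this]
  ζ_eq y y' e := by
    rw [h'.ζ_eq ⟨_, (h.Y_eq _).1 y.2⟩ y' (by rw [e]; group), h.ζ_eq y _ rfl]
  lam_eq t t' e := by
    rw [h'.lam_eq ⟨_, h.mem_stabilizer t.2⟩ t' (by rw [e]; group), h.lam_eq t _ rfl]

/-- `G`-conjugacy of triples. -/
instance conjSetoid (ℓ : ℕ) (𝒴 : Set (Subgroup G)) : Setoid (DZTriple ℓ 𝒴) where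
  r S T := ∃ g : G, ConjBy g S T
  iseqv :=
    { refl := fun S => ⟨1, ConjBy.one S⟩
      symm := fun ⟨g, h⟩ => ⟨g⁻¹, h.inv⟩
      trans := fun ⟨g, h⟩ ⟨k, h'⟩ => ⟨k * g, h.mul h'⟩ }

end DZTriple

/-- The set of `G`-conjugacy classes of triples `(Y, ζ, λ)`. -/
abbrev DZTripleClass (ℓ : ℕ) (𝒴 : Set (Subgroup G)) : Type _ :=
  Quotient (DZTriple.conjSetoid ℓ 𝒴)

end Triples

/-! ### The groups and their `ℓ`-Young subgroups -/

/-- The Young subgroup `𝔖_μ` of `𝔖_n`: the permutations that preserve each of the consecutive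
blocks of lengths `μ_1, μ_2, …` of `{1, …, n}`. -/
def youngSubgroup {n : ℕ} (μ : Composition n) : Subgroup (Equiv.Perm (Fin n)) where
  carrier := {σ | ∀ i, μ.index (σ i) = μ.index i}
  one_mem' := fun _ => rfl
  mul_mem' := fun {a b} ha hb i => (ha (b i)).trans (hb i)
  inv_mem' := fun {a} ha i => by
    have h := ha (a⁻¹ i)
    rw [← Equiv.Perm.mul_apply, mul_inv_cancel, Equiv.Perm.one_apply] at h
    exact h.symm

/-- The `ℓ`-Young subgroups of `𝔖_n`: the conjugates of the Young subgroups `𝔖_μ` where `μ` is a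
partition `μ_1 ≥ μ_2 ≥ …` of `n` all of whose parts are powers of `ℓ`. -/
def symYoungSubgroups (ℓ n : ℕ) : Set (Subgroup (Equiv.Perm (Fin n))) :=
  {Y | ∃ μ : Composition n, μ.blocks.Pairwise (· ≥ ·) ∧ (∀ b ∈ μ.blocks, ∃ i : ℕ, b = ℓ ^ i) ∧
    ∃ g : Equiv.Perm (Fin n), Y = (youngSubgroup μ).map (MulAut.conj g).toMonoidHom}

/-- The wreath product `C_e ≀ 𝔖_n = C_e ^ n ⋊ 𝔖_n`, with `𝔖_n` permuting the coordinates. -/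
abbrev CyclicWreath (e n : ℕ) : Type :=
  (Fin n → Multiplicative (ZMod e)) ⋊[mulAutArrow] Equiv.Perm (Fin n)

/-- The `ℓ`-Young subgroups `C_e ≀ Y' = C_e ^ n ⋊ Y'` of `C_e ≀ 𝔖_n`, for `Y'` an `ℓ`-Young
subgroup of `𝔖_n`. -/
def wreathYoungSubgroups (ℓ e n : ℕ) : Set (Subgroup (CyclicWreath e n)) :=
  {Y | ∃ Y' ∈ symYoungSubgroups ℓ n, Y = Y'.comap SemidirectProduct.rightHom}

/-- The imprimitive complex reflection group `G(m, p, n)`, for `p ∣ m`: the subgroup of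
`G(m, 1, n) = C_m ≀ 𝔖_n` (monomial matrices whose nonzero entries are `m`-th roots of unity) of
the elements for which the product of the `n` nonzero entries is an `(m / p)`-th root of unity. -/
def complexReflectionGroup (m p n : ℕ) : Subgroup (CyclicWreath m n) where
  carrier := {x | (∏ i, x.left i) ^ (m / p) = 1}
  one_mem' := by simp
  mul_mem' := by
    intro a b ha hb
    have h : ∏ i, (mulAutArrow a.right b.left) i = ∏ i, b.left i :=
      Equiv.prod_comp (a.right⁻¹) b.left
    simp only [Set.mem_ofPred_eq, SemidirectProduct.mul_left, Pi.mul_apply,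
      Finset.prod_mul_distrib, h, mul_pow] at ha hb ⊢
    rw [ha, hb, one_mul]
  inv_mem' := by
    intro a ha
    have h : ∏ i, (mulAutArrow a.right⁻¹ a.left⁻¹) i = ∏ i, (a.left⁻¹) i :=
      Equiv.prod_comp (a.right⁻¹⁻¹) a.left⁻¹
    simp only [Set.mem_ofPred_eq, SemidirectProduct.inv_left, h, Pi.inv_apply,
      Finset.prod_inv_distrib, inv_pow] at ha ⊢
    rw [ha, inv_one]

/-- The `ℓ`-Young subgroups `N ⋊ Y'` of `G(m, p, n) = N ⋊ 𝔖_n`, for `Y'` an `ℓ`-Young subgroup of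
`𝔖_n`; here `N` is the kernel of the projection to `𝔖_n`. -/
def reflectionYoungSubgroups (ℓ m p n : ℕ) : Set (Subgroup (complexReflectionGroup m p n)) :=
  {Y | ∃ Y' ∈ symYoungSubgroups ℓ n,
    Y = Y'.comap (SemidirectProduct.rightHom.comp (complexReflectionGroup m p n).subtype)}

/-! The bijection is obtained by counting. For every `d`, the characters of defect `d` are as many
as the classes of triples with `ν_ℓ(|Y|) = d`, and `exists_equiv_of_card_eq` glues arbitrary
bijections between these finite sets. No canonical map is constructed.

All three groups are split extensions `N ⋊ 𝔖_n` with `N` abelian of order prime to `ℓ`, and the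
linear characters of `N` are the labellings of `{1, …, n}` by a finite set `C`, modulo an involution
`δ` of `C` (`WreathExt`). For `𝔖_n` the set `C` is a point. For `C_e ≀ 𝔖_n` it is the dual of `C_e`,
with `δ = id`. For `G(2e,2,n)` it is the dual of `C_{2e}`, and `δ` is multiplication by the
character of order two; this `δ` has no fixed point, and `ℓ` is odd.

Characters. Clifford theory (`SplitExt.card_mul_irrCount`) reduces the count to the stabilizers of
labellings. Each is a product of symmetric groups, possibly extended by a group of order two, and
for `A` of index two in `K` with `s ∉ A` one has `2 |Irr K| = |Irr A| + 3 |Irr(A)^s|` in each defect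
(`two_mul_irrCount`). Hence `|⟨δ⟩|` times the number of characters of defect `d` is the number of
families `(λ_c)`, `c ∈ C`, of characters of symmetric groups with total size `n` and total defect
`d`, where a family fixed by `δ ≠ id` has weight 4 and all others weight 1 (`WreathExt.card_irr`).

Triples. If `ζ` has degree prime to `ℓ`, the labelling of `N` below it is constant on the blocks of
`Y`; otherwise the stabilizer would lose part of the `ℓ`-part of `Y`
(`WreathExt.exists_eq_blockIrr`). So up to conjugacy a pair `(Y, ζ)` is a multiset of blocks
labelled by an `ℓ'`-character of some `𝔖_{ℓ^i}` and an element of `C`, modulo `δ`, and `N_G(Y)_ζ /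
Y` is the group of permutations of the blocks preserving the labels up to `δ`. The same index-two
count now gives a weighted number of families of defect zero characters of symmetric groups, indexed
by such labels (`WreathExt.card_classes`).

The two weighted counts agree by the theory of core towers (`sum_twistWeight_tower`). Iterating the
decomposition of a partition into its `ℓ`-core and `ℓ`-quotient, a character of a symmetric group
becomes a family of cores placed in a tower with `ℓ^i` places at level `i`; its size is `∑ ℓ^i |κ|`
and its defect is `∑ ν_ℓ(ℓ^i!) |κ|`. Since `𝔖_{ℓ^i}` has exactly `ℓ^i` characters of degree prime to
`ℓ`, these characters can serve as names of the places. The input on symmetric groups, namely the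
classification by sets of first column hook lengths and the hook formula, comes from the
Jacobi–Trudi alternating sums and Cauchy's determinant. -/

set_option linter.unusedSectionVars false

/-! ### Complex characters of finite groups: orthogonality, completeness, virtual characters -/

section

open Module

universe u

/-- The bilinear form `⟨f, h⟩ = |G|⁻¹ ∑ f(g) h(g⁻¹)` on functions on a finite group. -/
noncomputable def ip {G : Type*} [Group G] (f h : G → ℂ) : ℂ :=
  (Nat.card G : ℂ)⁻¹ * ∑ᶠ g, f g * h g⁻¹

section IrrBasics

variable {G : Type*} [Group G]

theorem ip_eq [Fintype G] (f h : G → ℂ) :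
    ip f h = (Nat.card G : ℂ)⁻¹ * ∑ g, f g * h g⁻¹ := by
  rw [ip, finsum_eq_sum_of_fintype]

/-- Conjugation-invariant functions. -/
def IsClassFun (f : G → ℂ) : Prop := ∀ h g, f (h * g * h⁻¹) = f g

/-- Characters of finite-dimensional representations. -/
def IsChar (f : G → ℂ) : Prop :=
  ∃ (d : ℕ) (ρ : Representation ℂ G (Fin d → ℂ)), ρ.character = f

theorem IsChar.isClassFun {f : G → ℂ} (hf : IsChar f) : IsClassFun f := by
  obtain ⟨d, ρ, rfl⟩ := hf
  exact fun h g => ρ.char_conj g h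

theorem Irr.isChar (χ : Irr G) : IsChar χ.toFun := by
  obtain ⟨d, ρ, -, h⟩ := χ.exists_rep
  exact ⟨d, ρ, h⟩

theorem Irr.isClassFun (χ : Irr G) : IsClassFun χ.toFun := χ.isChar.isClassFun

/-- Transport of a representation along a linear equivalence. -/
noncomputable def Representation.conjLinear {V W : Type*} [AddCommGroup V] [Module ℂ V]
    [AddCommGroup W] [Module ℂ W] (ρ : Representation ℂ G V) (e : V ≃ₗ[ℂ] W) :
    Representation ℂ G W where
  toFun g := e.conj (ρ g)
  map_one' := by ext; simp
  map_mul' x y := by ext; simp [LinearEquiv.conj_apply]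

noncomputable def Representation.conjLinearEquiv {V W : Type*} [AddCommGroup V] [Module ℂ V]
    [AddCommGroup W] [Module ℂ W] (ρ : Representation ℂ G V) (e : V ≃ₗ[ℂ] W) :
    Representation.Equiv ρ (ρ.conjLinear e) :=
  Representation.Equiv.mk e (fun g => by ext; simp [conjLinear, LinearEquiv.conj_apply])

theorem isChar_character {V : Type*} [AddCommGroup V] [Module ℂ V] [FiniteDimensional ℂ V]
    (ρ : Representation ℂ G V) : IsChar ρ.character := by
  let e : V ≃ₗ[ℂ] (Fin (finrank ℂ V) → ℂ) := (finBasis ℂ V).equivFun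
  exact ⟨_, ρ.conjLinear e, (Representation.char_iso (ρ.conjLinearEquiv e)).symm⟩

theorem Representation.IsIrreducible.of_equiv {V W : Type*} [AddCommGroup V] [Module ℂ V]
    [AddCommGroup W] [Module ℂ W] {ρ : Representation ℂ G V} {σ : Representation ℂ G W}
    (h : ρ.IsIrreducible) (e : Representation.Equiv ρ σ) : σ.IsIrreducible := by
  have key : ∀ g w, e.toLinearEquiv.symm (σ g w) = ρ g (e.toLinearEquiv.symm w) := by
    intro g w
    apply e.toLinearEquiv.injective
    rw [LinearEquiv.apply_symm_apply]
    have := Representation.IntertwiningMap.isIntertwining ρ σ e.toIntertwiningMap g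
      (e.toLinearEquiv.symm w)
    have h2 : e.toIntertwiningMap (e.toLinearEquiv.symm w) = w :=
      e.toLinearEquiv.apply_symm_apply w
    rw [h2] at this
    exact this.symm
  have key2 : ∀ g v, e.toLinearEquiv (ρ g v) = σ g (e.toLinearEquiv v) := fun g v =>
    Representation.IntertwiningMap.isIntertwining ρ σ e.toIntertwiningMap g v
  let O : Subrepresentation ρ ≃o Subrepresentation σ :=
    { toFun := fun U => ⟨U.toSubmodule.map e.toLinearEquiv.toLinearMap, by
        rintro g w ⟨v, hv, rfl⟩
        exact ⟨ρ g v, U.apply_mem_toSubmodule g hv, key2 g v⟩⟩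
      invFun := fun U => ⟨U.toSubmodule.comap e.toLinearEquiv.toLinearMap, by
        intro g v hv
        change e.toLinearEquiv _ ∈ U.toSubmodule
        rw [key2]
        exact U.apply_mem_toSubmodule g hv⟩
      left_inv := fun U => Subrepresentation.toSubmodule_injective
        (Submodule.comap_map_eq_of_injective e.toLinearEquiv.injective _)
      right_inv := fun U => Subrepresentation.toSubmodule_injective
        (Submodule.map_comap_eq_of_surjective e.toLinearEquiv.surjective _)
      map_rel_iff' := by
        intro U V
        exact Submodule.map_le_map_iff_of_injective e.toLinearEquiv.injective _ _ }
  exact O.symm.isSimpleOrder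

theorem exists_irr_eq_character {V : Type*} [AddCommGroup V] [Module ℂ V] [FiniteDimensional ℂ V]
    (ρ : Representation ℂ G V) (h : ρ.IsIrreducible) : ∃ χ : Irr G, χ.toFun = ρ.character := by
  let e : V ≃ₗ[ℂ] (Fin (finrank ℂ V) → ℂ) := (finBasis ℂ V).equivFun
  exact ⟨⟨ρ.character, _, ρ.conjLinear e, h.of_equiv (ρ.conjLinearEquiv e),
    (Representation.char_iso (ρ.conjLinearEquiv e)).symm⟩, rfl⟩

variable [Finite G]

theorem card_ne_zero_complex : (Nat.card G : ℂ) ≠ 0 :=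
  Nat.cast_ne_zero.2 Nat.card_pos.ne'

theorem ip_comm (f h : G → ℂ) : ip f h = ip h f := by
  cases nonempty_fintype G
  rw [ip_eq, ip_eq, ← Equiv.sum_comp (Equiv.inv G)]
  simp [mul_comm]

theorem ip_add_left (f f' h : G → ℂ) : ip (f + f') h = ip f h + ip f' h := by
  cases nonempty_fintype G
  simp [ip_eq, add_mul, Finset.sum_add_distrib, mul_add]

theorem ip_smul_left (c : ℂ) (f h : G → ℂ) : ip (c • f) h = c * ip f h := by
  cases nonempty_fintype G
  simp only [ip_eq, Pi.smul_apply, smul_eq_mul, mul_assoc, ← Finset.mul_sum]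
  ring

theorem ip_add_right (f h h' : G → ℂ) : ip f (h + h') = ip f h + ip f h' := by
  rw [ip_comm, ip_add_left, ip_comm h, ip_comm h']

theorem ip_smul_right (c : ℂ) (f h : G → ℂ) : ip f (c • h) = c * ip f h := by
  rw [ip_comm, ip_smul_left, ip_comm h]

theorem ip_zero_left (h : G → ℂ) : ip 0 h = 0 := by
  have := ip_smul_left 0 0 h
  simpa using this

theorem ip_sum_left {ι : Type*} (s : Finset ι) (f : ι → G → ℂ) (h : G → ℂ) :
    ip (∑ i ∈ s, f i) h = ∑ i ∈ s, ip (f i) h := by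
  classical
  induction s using Finset.induction_on with
  | empty => simpa using ip_zero_left h
  | insert a s ha ih => rw [Finset.sum_insert ha, ip_add_left, ih, Finset.sum_insert ha]

theorem ip_sum_right {ι : Type*} (s : Finset ι) (f : ι → G → ℂ) (h : G → ℂ) :
    ip h (∑ i ∈ s, f i) = ∑ i ∈ s, ip h (f i) := by
  rw [ip_comm, ip_sum_left]
  exact Finset.sum_congr rfl fun i _ => ip_comm _ _

theorem ip_sub_left (f f' h : G → ℂ) : ip (f - f') h = ip f h - ip f' h := by
  have : f - f' = f + (-1 : ℂ) • f' := by simp [sub_eq_add_neg]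
  rw [this, ip_add_left, ip_smul_left]; ring

/-- Integrality of multiplicities and the orthogonality relations are both read off from this
dimension, the latter through Schur's lemma. -/
theorem ip_character {V W : Type*} [AddCommGroup V] [Module ℂ V] [FiniteDimensional ℂ V]
    [AddCommGroup W] [Module ℂ W] [FiniteDimensional ℂ W]
    (ρ : Representation ℂ G V) (σ : Representation ℂ G W) :
    ip σ.character ρ.character = (finrank ℂ (Representation.IntertwiningMap ρ σ) : ℂ) := by
  cases nonempty_fintype G
  have : Invertible (Nat.card G : ℂ) := invertibleOfNonzero card_ne_zero_complex
  rw [ip_eq, Representation.card_inv_mul_sum_char_mul_char_eq_finrank]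

theorem IsChar.ip_nat {f h : G → ℂ} (hf : IsChar f) (hh : IsChar h) : ∃ m : ℕ, ip f h = m := by
  obtain ⟨d, ρ, rfl⟩ := hf
  obtain ⟨d', σ, rfl⟩ := hh
  exact ⟨_, ip_character σ ρ⟩

theorem Irr.ip_self (χ : Irr G) : ip χ.toFun χ.toFun = 1 := by
  obtain ⟨d, ρ, h, e⟩ := χ.exists_rep
  rw [← e, ip_character]
  simp

theorem Irr.ip_ne {χ ψ : Irr G} (hne : χ ≠ ψ) : ip χ.toFun ψ.toFun = 0 := by
  obtain ⟨d, ρ, h, e⟩ := χ.exists_rep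
  obtain ⟨d', σ, h', e'⟩ := ψ.exists_rep
  cases isEmpty_or_nonempty (Representation.Equiv σ ρ)
  · rw [← e, ← e', ip_character]
    simp [finrank_eq_zero_of_subsingleton]
  · rename_i hn
    obtain ⟨φ⟩ := hn
    exact absurd (Irr.ext (by rw [← e, ← e', Representation.char_iso φ])) hne

open Classical in
theorem Irr.ip_eq_ite (χ ψ : Irr G) : ip χ.toFun ψ.toFun = if χ = ψ then 1 else 0 := by
  split_ifs with h
  · rw [h, Irr.ip_self]
  · exact Irr.ip_ne h

theorem Irr.linearIndependent : LinearIndependent ℂ (fun χ : Irr G => χ.toFun) := by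
  classical
  rw [linearIndependent_iff']
  intro s c hc χ hχ
  have := congrArg (fun f => ip f χ.toFun) hc
  simp only [ip_sum_left, ip_smul_left, Irr.ip_eq_ite, ip_zero_left] at this
  simpa [hχ] using this

instance Irr.finite : Finite (Irr G) :=
  Irr.linearIndependent.finite

/-- The operator `∑ f(g) ρ(g⁻¹)` vanishes when `f` is a class function orthogonal to all
irreducible characters. -/
theorem sum_smul_rep_eq_zero [Fintype G] (f : G → ℂ) (hf : IsClassFun f)
    (h0 : ∀ χ : Irr G, ip f χ.toFun = 0) (m : ℕ) :
    ∀ {V : Type u} [AddCommGroup V] [Module ℂ V] [FiniteDimensional ℂ V]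
      (ρ : Representation ℂ G V), finrank ℂ V = m → ∑ g, f g • ρ g⁻¹ = 0 := by
  induction m using Nat.strong_induction_on with
  | _ m ih =>
  intro V _ _ _ ρ hm
  have : NeZero (Nat.card G : ℂ) := ⟨card_ne_zero_complex⟩
  by_cases hirr : ρ.IsIrreducible
  -- The operator commutes with the group because `f` is a class function, so by Schur's lemma it is
  -- a scalar. Its trace is `|G|` times an inner product assumed to vanish, so the scalar is zero.
  · let T : Representation.IntertwiningMap ρ ρ := ⟨∑ g, f g • ρ g⁻¹, by
      intro k
      ext v
      simp only [LinearMap.comp_apply, LinearMap.sum_apply, LinearMap.smul_apply, map_sum, map_smul]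
      rw [← (MulAut.conj k).toEquiv.sum_comp]
      refine Finset.sum_congr rfl fun g _ => ?_
      simp only [MulEquiv.toEquiv_eq_coe, MulEquiv.coe_toEquiv, MulAut.conj_apply, hf k g]
      rw [← Module.End.mul_apply, ← Module.End.mul_apply, ← map_mul, ← map_mul]
      congr 3
      group⟩
    obtain ⟨c, hc⟩ :=
      (Representation.IsIrreducible.algebraMap_intertwiningMap_bijective_of_isAlgClosed
        (ρ := ρ)).2 T
    have hT : (∑ g, f g • ρ g⁻¹) = c • (LinearMap.id : V →ₗ[ℂ] V) := by
      have := congrArg Representation.IntertwiningMap.toLinearMap hc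
      exact this.symm
    obtain ⟨χ, hχ⟩ := exists_irr_eq_character ρ hirr
    have h1 := congrArg (LinearMap.trace ℂ V) hT
    simp only [map_sum, map_smul, LinearMap.trace_id] at h1
    have h2 := h0 χ
    rw [ip_eq, hχ] at h2
    have h3 : ∑ g, f g * ρ.character g⁻¹ = 0 :=
      (mul_eq_zero.1 h2).resolve_left (inv_ne_zero card_ne_zero_complex)
    have h4 : c • (finrank ℂ V : ℂ) = 0 := by
      rw [← h1, ← h3]; rfl
    have h5 : (finrank ℂ V : ℂ) ≠ 0 := by
      have : Nontrivial V := by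
        by_contra hV
        rw [not_nontrivial_iff_subsingleton] at hV
        obtain ⟨x, y, hxy⟩ := hirr.toNontrivial
        exact hxy (SetLike.ext fun v => by
          rw [Subsingleton.elim v 0]
          exact ⟨fun _ => y.toSubmodule.zero_mem, fun _ => x.toSubmodule.zero_mem⟩)
      exact Nat.cast_ne_zero.2 finrank_pos.ne'
    rw [hT, (mul_eq_zero.1 h4).resolve_right h5, zero_smul]
  · rcases subsingleton_or_nontrivial V with hV | hV
    · ext v; exact Subsingleton.elim _ _
    have hnt : Nontrivial (Subrepresentation ρ) := ⟨⊥, ⊤, fun h => by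
      obtain ⟨v, hv⟩ := exists_ne (0 : V)
      have : v ∈ (⊥ : Subrepresentation ρ).toSubmodule := by rw [h]; trivial
      exact hv ((Submodule.mem_bot ℂ).1 this)⟩
    have : ∃ U : Subrepresentation ρ, U ≠ ⊥ ∧ U ≠ ⊤ := by
      by_contra hcon
      push Not at hcon
      exact hirr { eq_bot_or_eq_top := fun U => or_iff_not_imp_left.2 (hcon U) }
    obtain ⟨U, hU1, hU2⟩ := this
    -- Maschke's theorem: both `U` and the complement `W` have smaller dimension, so induction
    -- applies to each.
    obtain ⟨W, hW⟩ := exists_isCompl U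
    have hW2 : W ≠ ⊤ := fun h => hU1 (by simpa [h] using hW.inf_eq_bot)
    have key : ∀ U : Subrepresentation ρ, U ≠ ⊤ → ∀ v ∈ U.toSubmodule,
        (∑ g, f g • ρ g⁻¹) v = 0 := by
      intro U hU v hv
      have hlt : finrank ℂ U.toSubmodule < m := by
        rw [← hm]
        exact Submodule.finrank_lt (fun h => hU (Subrepresentation.toSubmodule_injective h))
      have := ih _ hlt U.toRepresentation rfl
      have h2 := congrArg (fun T => ((T ⟨v, hv⟩ : U.toSubmodule) : V)) this
      simpa [LinearMap.sum_apply, Subrepresentation.toRepresentation] using h2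
    ext v
    have hv : v ∈ (U ⊔ W).toSubmodule := by rw [hW.sup_eq_top]; trivial
    obtain ⟨a, ha, b, hb, rfl⟩ := Submodule.mem_sup.1 hv
    rw [map_add, key U hU2 a ha, key W hW2 b hb]
    simp

/-- A class function orthogonal to all irreducible characters is zero. -/
theorem IsClassFun.eq_zero {f : G → ℂ} (hf : IsClassFun f)
    (h0 : ∀ χ : Irr G, ip f χ.toFun = 0) : f = 0 := by
  classical
  cases nonempty_fintype G
  let ρ : Representation ℂ G (G → ℂ) :=
    { toFun := fun g => LinearMap.funLeft ℂ ℂ (fun x => g⁻¹ * x)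
      map_one' := by ext; simp
      map_mul' := by intro x y; ext; simp [LinearMap.funLeft_apply, mul_assoc] }
  have h := sum_smul_rep_eq_zero f hf h0 _ ρ rfl
  funext k
  -- In the regular representation, applying the zero operator to the delta function at `1` and
  -- evaluating at `k⁻¹` leaves only the coefficient `f k`.
  have h2 := congrArg (fun T => T (Pi.single 1 1) k⁻¹) h
  simp only [LinearMap.sum_apply, LinearMap.smul_apply, Finset.sum_apply, Pi.smul_apply,
    LinearMap.zero_apply, Pi.zero_apply] at h2
  rw [Finset.sum_eq_single k] at h2
  · simpa [ρ, LinearMap.funLeft_apply] using h2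
  · intro b _ hb
    have : b * k⁻¹ ≠ 1 := fun h => hb (mul_inv_eq_one.1 h)
    simp [ρ, LinearMap.funLeft_apply, this]
  · simp

omit [Finite G] in
theorem isClassFun_sum {ι : Type*} (s : Finset ι) (c : ι → ℂ) (f : ι → G → ℂ)
    (hf : ∀ i ∈ s, IsClassFun (f i)) : IsClassFun (∑ i ∈ s, c i • f i) := by
  intro h g
  simp only [Finset.sum_apply, Pi.smul_apply]
  exact Finset.sum_congr rfl fun i hi => by rw [hf i hi]

/-- Fourier expansion of class functions. -/
theorem IsClassFun.eq_sum [Fintype (Irr G)] {f : G → ℂ} (hf : IsClassFun f) :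
    f = ∑ χ : Irr G, ip f χ.toFun • χ.toFun := by
  classical
  rw [← sub_eq_zero]
  have hs : IsClassFun (∑ χ : Irr G, ip f χ.toFun • χ.toFun) :=
    isClassFun_sum _ _ _ fun χ _ => χ.isClassFun
  apply IsClassFun.eq_zero
  · intro h g
    simp only [Pi.sub_apply, hf h g, hs h g]
  · intro χ
    rw [ip_sub_left, ip_sum_left]
    simp [ip_smul_left, Irr.ip_eq_ite]

/-- Parseval's identity. -/
theorem IsClassFun.ip_eq_sum [Fintype (Irr G)] {f : G → ℂ} (hf : IsClassFun f) (h : G → ℂ) :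
    ip f h = ∑ χ : Irr G, ip f χ.toFun * ip χ.toFun h := by
  conv_lhs => rw [hf.eq_sum]
  simp [ip_sum_left, ip_smul_left]

/-- Class functions with integral Fourier coefficients. -/
def IsVirtual (f : G → ℂ) : Prop := IsClassFun f ∧ ∀ χ : Irr G, ∃ z : ℤ, ip f χ.toFun = z

theorem IsChar.isVirtual {f : G → ℂ} (hf : IsChar f) : IsVirtual f :=
  ⟨hf.isClassFun, fun χ => by
    obtain ⟨m, hm⟩ := hf.ip_nat χ.isChar
    exact ⟨m, by rw [hm]; simp⟩⟩

theorem IsVirtual.sum {ι : Type*} (s : Finset ι) (c : ι → ℤ) (f : ι → G → ℂ)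
    (hf : ∀ i ∈ s, IsVirtual (f i)) : IsVirtual (∑ i ∈ s, (c i : ℂ) • f i) := by
  refine ⟨isClassFun_sum _ _ _ fun i hi => (hf i hi).1, fun χ => ?_⟩
  have : ∀ i ∈ s, ∃ z : ℤ, ip (f i) χ.toFun = z := fun i hi => (hf i hi).2 χ
  choose! z hz using this
  refine ⟨∑ i ∈ s, c i * z i, ?_⟩
  rw [ip_sum_left]
  push_cast
  exact Finset.sum_congr rfl fun i hi => by rw [ip_smul_left, hz i hi]

/-- By Parseval the integral Fourier coefficients have squares summing to one, so exactly one of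
them is nonzero, and it is `±1`. -/
theorem IsVirtual.exists_eq_or_neg {f : G → ℂ} (hf : IsVirtual f) (h1 : ip f f = 1) :
    ∃ χ : Irr G, f = χ.toFun ∨ f = -χ.toFun := by
  classical
  cases nonempty_fintype (Irr G)
  choose z hz using hf.2
  have h2 := hf.1.ip_eq_sum f
  rw [h1] at h2
  have h3 : ∑ χ : Irr G, z χ * z χ = 1 := by
    have : ((∑ χ : Irr G, z χ * z χ : ℤ) : ℂ) = (1 : ℤ) := by
      push_cast
      rw [h2]
      exact Finset.sum_congr rfl fun χ _ => by rw [ip_comm χ.toFun, hz]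
    exact_mod_cast this
  have h4 : ∃ χ, z χ ≠ 0 := by
    by_contra hcon
    push Not at hcon
    simp [hcon] at h3
  obtain ⟨χ, hχ⟩ := h4
  rw [← Finset.add_sum_erase _ _ (Finset.mem_univ χ)] at h3
  have h5 : 1 ≤ z χ * z χ := by
    have := mul_self_pos.2 hχ
    omega
  have h6 : ∑ ψ ∈ Finset.univ.erase χ, z ψ * z ψ = 0 := by
    have : 0 ≤ ∑ ψ ∈ Finset.univ.erase χ, z ψ * z ψ :=
      Finset.sum_nonneg fun ψ _ => mul_self_nonneg _
    omega
  have h7 : ∀ ψ ≠ χ, z ψ = 0 := by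
    intro ψ hψ
    have := (Finset.sum_eq_zero_iff_of_nonneg (fun ψ _ => mul_self_nonneg (z ψ))).1 h6 ψ
      (Finset.mem_erase.2 ⟨hψ, Finset.mem_univ _⟩)
    exact mul_self_eq_zero.1 this
  have h8 : z χ * z χ = 1 := by omega
  have h9 : f = (z χ : ℂ) • χ.toFun := by
    conv_lhs => rw [hf.1.eq_sum]
    rw [Finset.sum_eq_single χ]
    · rw [hz]
    · intro ψ _ hψ
      rw [hz, h7 ψ hψ]; simp
    · simp
  rcases mul_self_eq_one_iff.1 h8 with h | h
  · exact ⟨χ, Or.inl (by rw [h9, h]; simp)⟩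
  · exact ⟨χ, Or.inr (by rw [h9, h]; simp)⟩

theorem Irr.degree_pos (χ : Irr G) : 0 < χ.degree := by
  rw [Nat.pos_iff_ne_zero]
  intro h
  obtain ⟨d, ρ, hρ, e⟩ := χ.exists_rep
  have h1 := χ.degree_eq
  rw [← e, Representation.char_one, h] at h1
  simp only [Nat.cast_zero, finrank_fintype_fun_eq_card, Fintype.card_fin] at h1
  have : d = 0 := by exact_mod_cast h1.symm
  subst this
  have h2 := χ.ip_self
  rw [← e] at h2
  have h3 : ρ.character = 0 := by
    funext g
    simp only [Representation.character, Pi.zero_apply]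
    rw [Subsingleton.elim (ρ g) 0, map_zero]
  rw [h3, ip_zero_left] at h2
  exact zero_ne_one h2

/-- A virtual character of norm one with positive value at `1` is irreducible. -/
theorem IsVirtual.exists_irr {f : G → ℂ} (hf : IsVirtual f) (h1 : ip f f = 1) {m : ℕ}
    (hm : f 1 = m) : ∃ χ : Irr G, χ.toFun = f := by
  obtain ⟨χ, h | h⟩ := hf.exists_eq_or_neg h1
  · exact ⟨χ, h.symm⟩
  · exfalso
    rw [h, Pi.neg_apply, ← χ.degree_eq] at hm
    have : (χ.degree + m : ℕ) = 0 := by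
      have : ((χ.degree + m : ℕ) : ℂ) = 0 := by push_cast; rw [← hm]; ring
      exact_mod_cast this
    have := χ.degree_pos
    omega

omit [Finite G] in
theorem IsChar.exists_nat_eq {f : G → ℂ} (hf : IsChar f) : ∃ m : ℕ, f 1 = m := by
  obtain ⟨d, ρ, rfl⟩ := hf
  exact ⟨_, Representation.char_one ρ⟩

theorem IsChar.exists_irr {f : G → ℂ} (hf : IsChar f) (h1 : ip f f = 1) :
    ∃ χ : Irr G, χ.toFun = f := by
  obtain ⟨m, hm⟩ := hf.exists_nat_eq
  exact hf.isVirtual.exists_irr h1 hm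

end IrrBasics

/-! ### Products of characters and transport along homomorphisms -/

section Transport

variable {G H : Type*} [Group G] [Group H]

theorem IsChar.comp {f : G → ℂ} (hf : IsChar f) (φ : H →* G) : IsChar (f ∘ φ) := by
  obtain ⟨d, ρ, rfl⟩ := hf
  exact ⟨d, ρ.comp φ, rfl⟩

theorem IsChar.mul {f f' : G → ℂ} (hf : IsChar f) (hf' : IsChar f') : IsChar (f * f') := by
  obtain ⟨d, ρ, rfl⟩ := hf
  obtain ⟨d', σ, rfl⟩ := hf'
  rw [← Representation.char_tensor]
  exact isChar_character _

theorem isChar_one : IsChar (1 : G → ℂ) := by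
  have : (1 : G → ℂ) = (Representation.trivial ℂ G ℂ).character := by
    funext g; simp [Representation.character, Representation.trivial]
  rw [this]
  exact isChar_character _

theorem isChar_monoidHom (θ : G →* ℂˣ) : IsChar (fun g => (θ g : ℂ)) := by
  let ρ : Representation ℂ G ℂ :=
    { toFun := fun g => (θ g : ℂ) • LinearMap.id
      map_one' := by ext; simp
      map_mul' := by intro x y; ext; simp [mul_comm] }
  have : (fun g => (θ g : ℂ)) = ρ.character := by
    funext g; simp [Representation.character, ρ]
  rw [this]
  exact isChar_character _

theorem IsChar.prod {ι : Type*} (s : Finset ι) (f : ι → G → ℂ) (hf : ∀ i ∈ s, IsChar (f i)) :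
    IsChar (∏ i ∈ s, f i) := by
  classical
  induction s using Finset.induction_on with
  | empty => simpa using isChar_one
  | insert a s ha ih =>
    rw [Finset.prod_insert ha]
    exact (hf a (Finset.mem_insert_self _ _)).mul
      (ih fun i hi => hf i (Finset.mem_insert_of_mem hi))

theorem Irr.degree_eq_of_apply_one {χ : Irr G} {m : ℕ} (h : χ.toFun 1 = m) : χ.degree = m := by
  have := χ.degree_eq
  rw [h] at this
  exact_mod_cast this

/-- Transport of irreducible characters along an isomorphism. -/
noncomputable def Irr.congr (e : G ≃* H) : Irr G ≃ Irr H where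
  toFun χ := ⟨χ.toFun ∘ e.symm, by
    obtain ⟨d, ρ, hρ, h⟩ := χ.exists_rep
    refine ⟨d, ρ.comp e.symm.toMonoidHom, ?_, by rw [← h]; rfl⟩
    let O : Subrepresentation (ρ.comp e.symm.toMonoidHom) ≃o Subrepresentation ρ :=
      { toFun := fun U => ⟨U.toSubmodule, fun g v hv => by
          simpa using U.apply_mem_toSubmodule (e g) hv⟩
        invFun := fun U => ⟨U.toSubmodule, fun g v hv => U.apply_mem_toSubmodule (e.symm g) hv⟩
        left_inv := fun U => rfl
        right_inv := fun U => rfl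
        map_rel_iff' := Iff.rfl }
    have := hρ
    exact O.isSimpleOrder⟩
  invFun χ := ⟨χ.toFun ∘ e, by
    obtain ⟨d, ρ, hρ, h⟩ := χ.exists_rep
    refine ⟨d, ρ.comp e.toMonoidHom, ?_, by rw [← h]; rfl⟩
    let O : Subrepresentation (ρ.comp e.toMonoidHom) ≃o Subrepresentation ρ :=
      { toFun := fun U => ⟨U.toSubmodule, fun g v hv => by
          simpa using U.apply_mem_toSubmodule (e.symm g) hv⟩
        invFun := fun U => ⟨U.toSubmodule, fun g v hv => U.apply_mem_toSubmodule (e g) hv⟩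
        left_inv := fun U => rfl
        right_inv := fun U => rfl
        map_rel_iff' := Iff.rfl }
    have := hρ
    exact O.isSimpleOrder⟩
  left_inv χ := by ext; simp
  right_inv χ := by ext; simp

theorem Irr.congr_apply (e : G ≃* H) (χ : Irr G) (h : H) :
    (Irr.congr e χ).toFun h = χ.toFun (e.symm h) := rfl

theorem Irr.degree_congr (e : G ≃* H) (χ : Irr G) : (Irr.congr e χ).degree = χ.degree :=
  Irr.degree_eq_of_apply_one (by rw [congr_apply, map_one, ← χ.degree_eq])

theorem Irr.defect_congr (ℓ : ℕ) (e : G ≃* H) (χ : Irr G) :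
    (Irr.congr e χ).defect ℓ = χ.defect ℓ := by
  rw [Irr.defect, Irr.defect, Irr.degree_congr, Nat.card_congr e.toEquiv]

/-- The number of irreducible characters of given defect. -/
noncomputable def irrCount (ℓ : ℕ) (G : Type*) [Group G] (d : ℤ) : ℕ :=
  Nat.card {χ : Irr G // χ.defect ℓ = d}

theorem irrCount_congr (ℓ : ℕ) (e : G ≃* H) (d : ℤ) : irrCount ℓ G d = irrCount ℓ H d :=
  Nat.card_congr ((Irr.congr e).subtypeEquiv fun χ => by rw [Irr.defect_congr])

end Transport

/-! ### The number of irreducible characters -/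

section ConjClasses

variable {G : Type*} [Group G] [Finite G]

/-- Both numbers are the dimension of the space of class functions. The equality serves to show that
outer products exhaust the characters of a direct product. -/
theorem card_irr_eq_card_conjClasses : Nat.card (Irr G) = Nat.card (ConjClasses G) := by
  classical
  cases nonempty_fintype G
  cases nonempty_fintype (Irr G)
  have e : ∀ (χ : Irr G) (a b : G), IsConj a b → χ.toFun a = χ.toFun b := by
    intro χ a b h
    obtain ⟨c, rfl⟩ := isConj_iff.1 h
    exact (χ.isClassFun c a).symm
  let b : Irr G → (ConjClasses G → ℂ) := fun χ => Quotient.lift χ.toFun (e χ)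
  have hb : ∀ χ g, b χ (ConjClasses.mk g) = χ.toFun g := fun χ g => rfl
  have hli : LinearIndependent ℂ b := by
    rw [Fintype.linearIndependent_iff]
    intro c hc
    refine Fintype.linearIndependent_iff.1 (Irr.linearIndependent (G := G)) c ?_
    funext g
    have := congrFun hc (ConjClasses.mk g)
    simpa [hb] using this
  have hsp : ⊤ ≤ Submodule.span ℂ (Set.range b) := by
    intro f _
    have hf : IsClassFun (fun g => f (ConjClasses.mk g)) := fun h g =>
      congrArg f (ConjClasses.mk_eq_mk_iff_isConj.2 (IsConj.symm (isConj_iff.2 ⟨h, rfl⟩)))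
    have : f = ∑ χ : Irr G, ip (fun g => f (ConjClasses.mk g)) χ.toFun • b χ := by
      funext c
      obtain ⟨g, rfl⟩ := ConjClasses.mk_surjective c
      have h2 := congrFun hf.eq_sum g
      simpa [hb] using h2
    rw [this]
    exact Submodule.sum_mem _ fun χ _ => Submodule.smul_mem _ _
      (Submodule.subset_span ⟨χ, rfl⟩)
  have := finrank_eq_card_basis (Basis.mk hli hsp)
  rw [Nat.card_eq_fintype_card, Nat.card_eq_fintype_card, ← this]
  simp

end ConjClasses

/-! ### Direct products -/

section Pi

variable {ι : Type*} [Fintype ι] {G : ι → Type*} [∀ i, Group (G i)] [∀ i, Finite (G i)]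

omit [∀ i, Finite (G i)] in
theorem card_conjClasses_pi :
    Nat.card (ConjClasses (∀ i, G i)) = ∏ i, Nat.card (ConjClasses (G i)) := by
  classical
  rw [← Nat.card_pi]
  let f : ConjClasses (∀ i, G i) → ∀ i, ConjClasses (G i) :=
    Quotient.lift (fun g i => ConjClasses.mk (g i)) (fun a b h => by
      funext i
      obtain ⟨c, rfl⟩ := isConj_iff.1 h
      exact ConjClasses.mk_eq_mk_iff_isConj.2 (isConj_iff.2 ⟨c i, rfl⟩))
  refine Nat.card_congr (Equiv.ofBijective f ⟨?_, ?_⟩)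
  · intro a b h
    obtain ⟨a, rfl⟩ := ConjClasses.mk_surjective a
    obtain ⟨b, rfl⟩ := ConjClasses.mk_surjective b
    have h' : ∀ i, ∃ c, c * a i * c⁻¹ = b i := fun i =>
      isConj_iff.1 (ConjClasses.mk_eq_mk_iff_isConj.1 (congrFun h i))
    choose c hc using h'
    exact ConjClasses.mk_eq_mk_iff_isConj.2 (isConj_iff.2 ⟨c, funext hc⟩)
  · intro c
    choose g hg using fun i => ConjClasses.mk_surjective (c i)
    exact ⟨ConjClasses.mk g, funext hg⟩

omit [∀ i, Finite (G i)] in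
theorem isChar_pi (f : ∀ i, G i → ℂ) (hf : ∀ i, IsChar (f i)) :
    IsChar (fun g : ∀ i, G i => ∏ i, f i (g i)) := by
  have := IsChar.prod Finset.univ (fun i => f i ∘ Pi.evalMonoidHom G i)
    (fun i _ => (hf i).comp _)
  convert this using 1
  funext g
  simp

theorem ip_pi (f h : ∀ i, G i → ℂ) :
    ip (fun g : ∀ i, G i => ∏ i, f i (g i)) (fun g => ∏ i, h i (g i)) = ∏ i, ip (f i) (h i) := by
  classical
  have := fun i => Fintype.ofFinite (G i)
  simp only [ip_eq, Finset.prod_mul_distrib, Nat.card_pi, Nat.cast_prod, Finset.prod_inv_distrib]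
  congr 1
  rw [Finset.prod_univ_sum, Fintype.piFinset_univ]
  exact Finset.sum_congr rfl fun g _ => by simp [Finset.prod_mul_distrib]

theorem exists_irr_pi (χ : ∀ i, Irr (G i)) :
    ∃ ψ : Irr (∀ i, G i), ψ.toFun = fun g => ∏ i, (χ i).toFun (g i) :=
  (isChar_pi _ fun i => (χ i).isChar).exists_irr (by simp [ip_pi, Irr.ip_self])

/-- The outer product of irreducible characters. -/
noncomputable def Irr.pi (χ : ∀ i, Irr (G i)) : Irr (∀ i, G i) := (exists_irr_pi χ).choose

theorem Irr.pi_apply (χ : ∀ i, Irr (G i)) (g : ∀ i, G i) :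
    (Irr.pi χ).toFun g = ∏ i, (χ i).toFun (g i) :=
  congrFun (exists_irr_pi χ).choose_spec g

theorem Irr.pi_injective : Function.Injective (Irr.pi (G := G)) := by
  classical
  intro χ ψ h
  have h1 : ip (Irr.pi χ).toFun (Irr.pi ψ).toFun = 1 := by rw [h, Irr.ip_self]
  have e : ∀ χ : ∀ i, Irr (G i), (Irr.pi χ).toFun = fun g => ∏ i, (χ i).toFun (g i) :=
    fun χ => funext (Irr.pi_apply χ)
  rw [e, e, ip_pi] at h1
  funext i
  by_contra hne
  rw [Finset.prod_eq_zero (Finset.mem_univ i) (Irr.ip_ne hne)] at h1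
  exact zero_ne_one h1

/-- Orthogonality gives injectivity. The cardinalities agree because conjugacy classes of a product
are products of conjugacy classes. -/
theorem Irr.pi_bijective : Function.Bijective (Irr.pi (G := G)) := by
  classical
  have := fun i => Fintype.ofFinite (Irr (G i))
  have := Fintype.ofFinite (Irr (∀ i, G i))
  rw [Fintype.bijective_iff_injective_and_card]
  refine ⟨Irr.pi_injective, ?_⟩
  rw [← Nat.card_eq_fintype_card, ← Nat.card_eq_fintype_card, card_irr_eq_card_conjClasses,
    card_conjClasses_pi, Nat.card_pi]
  exact Finset.prod_congr rfl fun i _ => card_irr_eq_card_conjClasses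

theorem Irr.degree_pi (χ : ∀ i, Irr (G i)) : (Irr.pi χ).degree = ∏ i, (χ i).degree :=
  Irr.degree_eq_of_apply_one (by
    rw [Irr.pi_apply]; push_cast
    exact Finset.prod_congr rfl fun i _ => ((χ i).degree_eq).symm)

theorem Irr.defect_pi {ℓ : ℕ} (hℓ : ℓ.Prime) (χ : ∀ i, Irr (G i)) :
    (Irr.pi χ).defect ℓ = ∑ i, (χ i).defect ℓ := by
  have := Fact.mk hℓ
  have key : ∀ f : ι → ℕ, (∀ i, f i ≠ 0) → padicValNat ℓ (∏ i, f i) = ∑ i, padicValNat ℓ (f i) := by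
    classical
    intro f hf
    induction (Finset.univ : Finset ι) using Finset.induction_on with
    | empty => simp
    | insert a s ha ih =>
      rw [Finset.prod_insert ha, Finset.sum_insert ha,
        padicValNat.mul (hf a) (Finset.prod_ne_zero_iff.2 fun i _ => hf i), ih]
  simp only [Irr.defect]
  rw [Irr.degree_pi, Nat.card_pi, key _ fun i => Nat.card_pos.ne',
    key _ fun i => (χ i).degree_pos.ne', Finset.sum_sub_distrib]
  push_cast
  rfl

end Pi

/-! ### Clifford theory for split extensions by abelian groups -/

/-- A split extension `G = N ⋊ H` of a group `H` by a commutative group `N`, together with a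
parametrization of the linear characters of `N` by an `H`-set `Z`. -/
structure SplitExt (N H G Z : Type*) [CommGroup N] [Group H] [Group G] [MulAction H Z] where
  i : N →* G
  s : H →* G
  cj : H →* MulAut N
  conj : ∀ h ν, s h * i ν * (s h)⁻¹ = i (cj h ν)
  bij : Function.Bijective (fun p : N × H => i p.1 * s p.2)
  ch : Z ≃ (N →* ℂˣ)
  ch_smul : ∀ h z ν, ch (h • z) (cj h ν) = ch z ν

namespace SplitExt

variable {N H G Z : Type*} [CommGroup N] [Group H] [Group G] [MulAction H Z]
  (E : SplitExt N H G Z)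

theorem s_mul_i (h : H) (ν : N) : E.s h * E.i ν = E.i (E.cj h ν) * E.s h := by
  rw [← E.conj]; group

theorem mul_eq (ν μ : N) (h k : H) :
    E.i ν * E.s h * (E.i μ * E.s k) = E.i (ν * E.cj h μ) * E.s (h * k) := by
  rw [map_mul, map_mul, mul_assoc, ← mul_assoc (E.s h), s_mul_i]
  simp only [mul_assoc]

theorem inv_eq (ν : N) (h : H) :
    (E.i ν * E.s h)⁻¹ = E.i (E.cj h⁻¹ ν⁻¹) * E.s h⁻¹ := by
  rw [mul_inv_rev, ← map_inv, ← map_inv, s_mul_i]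

theorem conj_eq (k : H) (ν : N) (h : H) :
    E.s k * (E.i ν * E.s h) * (E.s k)⁻¹ = E.i (E.cj k ν) * E.s (k * h * k⁻¹) := by
  rw [← mul_assoc, s_mul_i, map_mul, map_mul, map_inv]
  simp only [mul_assoc]

theorem ch_cj_of_mem {h : H} {z : Z} (hz : h ∈ MulAction.stabilizer H z) (ν : N) :
    E.ch z (E.cj h ν) = E.ch z ν := by
  have := E.ch_smul h z ν
  rwa [MulAction.mem_stabilizer_iff.1 hz] at this

include E in
theorem card_eq : Nat.card G = Nat.card N * Nat.card H := by
  rw [← Nat.card_congr (Equiv.ofBijective _ E.bij), Nat.card_prod]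

theorem sum_eq [Fintype N] [Fintype H] [Fintype G] (f : G → ℂ) :
    ∑ g, f g = ∑ ν : N, ∑ h : H, f (E.i ν * E.s h) := by
  rw [← Fintype.sum_prod_type' (f := fun ν h => f (E.i ν * E.s h))]
  exact ((Equiv.ofBijective _ E.bij).sum_comp f).symm

/-- The `z`-isotypic component of a function on `G`. -/
noncomputable def comp (f : G → ℂ) (z : Z) (h : H) : ℂ :=
  (Nat.card N : ℂ)⁻¹ * ∑ᶠ ν : N, f (E.i ν * E.s h) * ((E.ch z ν)⁻¹ : ℂˣ)

theorem comp_eq [Fintype N] (f : G → ℂ) (z : Z) (h : H) :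
    E.comp f z h = (Nat.card N : ℂ)⁻¹ * ∑ ν : N, f (E.i ν * E.s h) * ((E.ch z ν)⁻¹ : ℂˣ) := by
  rw [comp, finsum_eq_sum_of_fintype]

variable [Finite N]

omit [Finite N] in
theorem sum_ch [Fintype N] [DecidableEq Z] (z z' : Z) :
    ∑ ν : N, (E.ch z ν : ℂ) * ((E.ch z' ν)⁻¹ : ℂˣ) = if z = z' then (Nat.card N : ℂ) else 0 := by
  split_ifs with h
  · subst h; simp [Nat.card_eq_fintype_card]
  · have hne : E.ch z * (E.ch z')⁻¹ ≠ 1 := fun h' => h (E.ch.injective (mul_inv_eq_one.1 h'))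
    obtain ⟨μ, hμ⟩ : ∃ μ, (E.ch z * (E.ch z')⁻¹) μ ≠ 1 := by
      by_contra hcon
      push Not at hcon
      exact hne (MonoidHom.ext hcon)
    set θ := E.ch z * (E.ch z')⁻¹ with hθ
    have e : ∀ ν, (E.ch z ν : ℂ) * ((E.ch z' ν)⁻¹ : ℂˣ) = (θ ν : ℂ) := fun ν => by
      rw [hθ]; simp
    simp only [e]
    have h1 : ∑ ν, (θ ν : ℂ) = (θ μ : ℂ) * ∑ ν, (θ ν : ℂ) := by
      rw [Finset.mul_sum, ← Equiv.sum_comp (Equiv.mulLeft μ)]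
      simp
    have h2 : ((θ μ : ℂ) - 1) * ∑ ν, (θ ν : ℂ) = 0 := by rw [sub_mul, ← h1]; ring
    refine (mul_eq_zero.1 h2).resolve_left fun h3 => hμ ?_
    exact Units.ext (sub_eq_zero.1 h3)

include E in
theorem finite_chars : Finite Z := by
  have : Finite (N →* ℂˣ) := inferInstance
  exact Finite.of_equiv _ E.ch.symm

theorem sum_ch_dual [Fintype Z] [DecidableEq N] (ν μ : N) :
    ∑ z : Z, (E.ch z ν : ℂ) * ((E.ch z μ)⁻¹ : ℂˣ) = if ν = μ then (Nat.card N : ℂ) else 0 := by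
  have e : ∀ z, (E.ch z ν : ℂ) * ((E.ch z μ)⁻¹ : ℂˣ) = (E.ch z (ν * μ⁻¹) : ℂ) := fun z => by simp
  simp only [e]
  have := Fintype.ofFinite (N →* ℂˣ)
  rw [Equiv.sum_comp E.ch (fun θ : N →* ℂˣ => (θ (ν * μ⁻¹) : ℂ))]
  split_ifs with h
  · subst h
    simp only [mul_inv_cancel, map_one, Units.val_one, Finset.sum_const, Finset.card_univ,
      nsmul_eq_mul, mul_one]
    rw [← Nat.card_eq_fintype_card, CommGroup.card_monoidHom_of_hasEnoughRootsOfUnity]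
  · obtain ⟨η, hη⟩ := CommGroup.exists_apply_ne_one_of_hasEnoughRootsOfUnity N ℂ
      (a := ν * μ⁻¹) (fun h' => h (mul_inv_eq_one.1 h'))
    set x := ν * μ⁻¹
    have h1 : ∑ θ : N →* ℂˣ, (θ x : ℂ) = (η x : ℂ) * ∑ θ : N →* ℂˣ, (θ x : ℂ) := by
      rw [Finset.mul_sum, ← Equiv.sum_comp (Equiv.mulLeft η)]
      simp
    have h2 : ((η x : ℂ) - 1) * ∑ θ : N →* ℂˣ, (θ x : ℂ) = 0 := by rw [sub_mul, ← h1]; ring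
    refine (mul_eq_zero.1 h2).resolve_left fun h3 => hη ?_
    exact Units.ext (sub_eq_zero.1 h3)

theorem eq_sum_comp [Fintype Z] (f : G → ℂ) (ν : N) (h : H) :
    f (E.i ν * E.s h) = ∑ z : Z, E.comp f z h * E.ch z ν := by
  classical
  cases nonempty_fintype N
  simp only [comp_eq, mul_assoc, Finset.sum_mul, ← Finset.mul_sum]
  rw [Finset.sum_comm]
  have : ∀ μ : N, ∑ z : Z, f (E.i μ * E.s h) * (((E.ch z μ)⁻¹ : ℂˣ) * (E.ch z ν : ℂ)) =
      if ν = μ then f (E.i μ * E.s h) * (Nat.card N : ℂ) else 0 := by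
    intro μ
    rw [← Finset.mul_sum]
    simp_rw [mul_comm (((E.ch _ μ)⁻¹ : ℂˣ) : ℂ)]
    rw [sum_ch_dual]
    split_ifs <;> simp
  rw [Finset.sum_congr rfl fun μ _ => this μ]
  simp only [Finset.sum_ite_eq, Finset.mem_univ, if_true]
  field_simp

theorem comp_conj {f : G → ℂ} (hf : IsClassFun f) (z : Z) (k h : H) :
    E.comp f (k • z) (k * h * k⁻¹) = E.comp f z h := by
  cases nonempty_fintype N
  rw [comp_eq, comp_eq, ← Equiv.sum_comp (E.cj k).toEquiv]
  congr 1
  refine Finset.sum_congr rfl fun ν _ => ?_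
  simp only [MulEquiv.toEquiv_eq_coe, MulEquiv.coe_toEquiv]
  rw [← E.conj_eq, hf, E.ch_smul]

/-- If `h` moves `z`, some `μ` in `N` has `ch z (cj h μ) ≠ ch z μ`. Conjugation by `i μ` does not
change `f`, but it forces the component at `h` to equal itself times a scalar different from 1. -/
theorem comp_eq_zero {f : G → ℂ} (hf : IsClassFun f) {z : Z} {h : H}
    (hz : h ∉ MulAction.stabilizer H z) : E.comp f z h = 0 := by
  cases nonempty_fintype N
  obtain ⟨μ, hμ⟩ : ∃ μ, E.ch z (E.cj h μ) ≠ E.ch z μ := by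
    by_contra hcon
    push Not at hcon
    apply hz
    rw [MulAction.mem_stabilizer_iff]
    apply E.ch.injective
    ext ν
    obtain ⟨ν, rfl⟩ := (E.cj h).surjective ν
    rw [E.ch_smul, hcon]
  have key : E.comp f z h = ((E.ch z μ)⁻¹ * E.ch z (E.cj h μ) : ℂˣ) * E.comp f z h := by
    rw [comp_eq]
    nth_rewrite 1 [← Equiv.sum_comp (Equiv.mulLeft (μ * (E.cj h μ)⁻¹))]
    rw [mul_left_comm, Finset.mul_sum Finset.univ _ (((E.ch z μ)⁻¹ * E.ch z (E.cj h μ) : ℂˣ) : ℂ)]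
    congr 1
    refine Finset.sum_congr rfl fun ν _ => ?_
    have e : E.i (μ * (E.cj h μ)⁻¹ * ν) * E.s h = E.i μ * (E.i ν * E.s h) * (E.i μ)⁻¹ := by
      have h1 : E.i μ * (E.i ν * E.s h) * (E.i μ)⁻¹ =
          E.i μ * (E.i ν * (E.s h * E.i μ⁻¹)) := by rw [map_inv]; simp only [mul_assoc]
      rw [h1, s_mul_i, ← mul_assoc (E.i ν), ← mul_assoc (E.i μ), ← map_mul, ← map_mul, map_inv,
        mul_assoc μ, mul_comm ν]
    simp only [Equiv.coe_mulLeft]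
    rw [e, hf]
    simp only [map_mul, map_inv, mul_inv, inv_inv]
    push_cast
    ring
  have h2 : ((E.ch z μ)⁻¹ * E.ch z (E.cj h μ) : ℂˣ) ≠ 1 := fun h3 => hμ (inv_mul_eq_one.1 h3).symm
  have h3 : ((((E.ch z μ)⁻¹ * E.ch z (E.cj h μ) : ℂˣ) : ℂ) - 1) * E.comp f z h = 0 := by
    rw [sub_mul, ← key]; ring
  exact (mul_eq_zero.1 h3).resolve_left fun h4 => h2 (Units.ext (sub_eq_zero.1 h4))

/-- The isotypic component as a function on the inertia group. -/
noncomputable def res (f : G → ℂ) (z : Z) : MulAction.stabilizer H z → ℂ := fun h => E.comp f z h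

/-- The operator `e` projects onto the `z`-isotypic subspace for `N`. The stabilizer of `z` commutes
with `e` and therefore acts on its image, and the component of the character is the trace of this
action. -/
theorem isChar_res {f : G → ℂ} (hf : IsChar f) (z : Z) : IsChar (E.res f z) := by
  cases nonempty_fintype N
  obtain ⟨d, ρ, rfl⟩ := hf
  let e : (Fin d → ℂ) →ₗ[ℂ] (Fin d → ℂ) :=
    (Nat.card N : ℂ)⁻¹ • ∑ ν : N, ((E.ch z ν)⁻¹ : ℂˣ).val • ρ (E.i ν)
  have hcard : (Nat.card N : ℂ) ≠ 0 := card_ne_zero_complex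
  have hfix : ∀ μ, ρ (E.i μ) ∘ₗ e = (E.ch z μ : ℂ) • e := by
    intro μ
    refine LinearMap.ext fun v => ?_
    simp only [e, LinearMap.comp_smul, LinearMap.smul_apply, LinearMap.comp_apply,
      LinearMap.sum_apply, map_sum, map_smul]
    rw [smul_comm]
    congr 1
    rw [Finset.smul_sum, ← Equiv.sum_comp (Equiv.mulLeft μ) fun ν =>
      (E.ch z μ : ℂ) • ((E.ch z ν)⁻¹ : ℂˣ).val • ρ (E.i ν) v]
    refine Finset.sum_congr rfl fun ν _ => ?_
    simp only [Equiv.coe_mulLeft, map_mul, mul_inv, Units.val_mul, smul_smul, Module.End.mul_apply]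
    rw [← mul_assoc, Units.mul_inv, one_mul]
  have hidem : e ∘ₗ e = e := by
    have : e ∘ₗ e = (Nat.card N : ℂ)⁻¹ • ∑ ν : N, ((E.ch z ν)⁻¹ : ℂˣ).val • (ρ (E.i ν) ∘ₗ e) := by
      refine LinearMap.ext fun v => ?_
      conv_lhs => rw [LinearMap.comp_apply]; enter [1]; simp only [e]
      simp [LinearMap.sum_apply]
    rw [this]
    simp only [hfix, smul_smul, Units.inv_mul, one_smul, Finset.sum_const, Finset.card_univ,
      ← Nat.card_eq_fintype_card]
    rw [← Nat.cast_smul_eq_nsmul ℂ, smul_smul, inv_mul_cancel₀ hcard, one_smul]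
  have hcomm : ∀ h ∈ MulAction.stabilizer H z, ρ (E.s h) ∘ₗ e = e ∘ₗ ρ (E.s h) := by
    intro h hh
    refine LinearMap.ext fun v => ?_
    simp only [e, LinearMap.smul_apply, LinearMap.comp_apply,
      LinearMap.sum_apply, map_sum, map_smul]
    congr 1
    rw [← Equiv.sum_comp (E.cj h).toEquiv fun ν => ((E.ch z ν)⁻¹ : ℂˣ).val • ρ (E.i ν) (ρ (E.s h) v)]
    refine Finset.sum_congr rfl fun ν _ => ?_
    simp only [MulEquiv.toEquiv_eq_coe, MulEquiv.coe_toEquiv, E.ch_cj_of_mem hh]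
    rw [← Module.End.mul_apply, ← Module.End.mul_apply, ← map_mul, ← map_mul, s_mul_i]
  let W : Submodule ℂ (Fin d → ℂ) := LinearMap.range e
  have hW : ∀ h ∈ MulAction.stabilizer H z, ∀ v ∈ W, ρ (E.s h) v ∈ W := by
    rintro h hh _ ⟨v, rfl⟩
    exact ⟨ρ (E.s h) v, (LinearMap.congr_fun (hcomm h hh) v).symm⟩
  let σ : Representation ℂ (MulAction.stabilizer H z) W :=
    { toFun := fun h => (ρ (E.s h)).restrict (hW h h.2)
      map_one' := by ext; simp
      map_mul' := by intro x y; ext; simp }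
  have : E.res ρ.character z = σ.character := by
    funext h
    have h1 : ∀ v, (ρ (E.s h) ∘ₗ e) v ∈ W := fun v => hW h h.2 _ ⟨v, rfl⟩
    have h2 : σ h = (ρ (E.s h) ∘ₗ e).restrict (fun v _ => h1 v) := by
      ext v
      obtain ⟨v, w, rfl⟩ := v
      have := LinearMap.congr_fun hidem w
      simp only [LinearMap.comp_apply] at this
      simp [σ, this]
    rw [Representation.character, h2, LinearMap.trace_restrict_eq_of_forall_mem _ _ h1, hcomm h h.2]
    have h3 : e ∘ₗ ρ (E.s h) =
        (Nat.card N : ℂ)⁻¹ • ∑ ν : N, ((E.ch z ν)⁻¹ : ℂˣ).val • (ρ (E.i ν) * ρ (E.s h)) := by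
      refine LinearMap.ext fun v => ?_
      simp [e, LinearMap.sum_apply]
    simp only [h3, res, comp_eq, Representation.character, map_smul, map_sum, smul_eq_mul]
    congr 1
    refine Finset.sum_congr rfl fun ν _ => ?_
    rw [mul_comm, map_mul]
  rw [this]
  exact isChar_character σ

end SplitExt

theorem IsChar.eq_zero_of_ip_self {G : Type*} [Group G] [Finite G] {f : G → ℂ} (hf : IsChar f)
    (h : ip f f = 0) : f = 0 := by
  classical
  cases nonempty_fintype (Irr G)
  refine hf.isClassFun.eq_zero fun χ => ?_
  choose m hm using fun χ : Irr G => hf.ip_nat χ.isChar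
  have h2 := hf.isClassFun.ip_eq_sum f
  rw [h] at h2
  have h3 : ∑ χ : Irr G, m χ * m χ = 0 := by
    have : ((∑ χ : Irr G, m χ * m χ : ℕ) : ℂ) = (0 : ℕ) := by
      push_cast
      rw [h2]
      exact Finset.sum_congr rfl fun χ _ => by rw [ip_comm χ.toFun, hm]
    exact_mod_cast this
  have := Finset.sum_eq_zero_iff.1 h3 χ (Finset.mem_univ χ)
  rw [hm, mul_self_eq_zero.1 this, Nat.cast_zero]

/-- Some irreducible character is not orthogonal to a given function that does not vanish at `1`. -/
theorem exists_ip_ne_zero {G : Type*} [Group G] [Finite G] {f : G → ℂ} (hf : f 1 ≠ 0) :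
    ∃ χ : Irr G, ip f χ.toFun ≠ 0 := by
  cases nonempty_fintype G
  by_contra hcon
  push Not at hcon
  -- Averaging over conjugation gives a class function. Its inner products with irreducible
  -- characters are multiples of those of `f`, and its value at 1 is `|G| f 1`.
  have hF : IsClassFun (fun g => ∑ x : G, f (x * g * x⁻¹)) := by
    intro k g
    simp only
    rw [← Equiv.sum_comp (Equiv.mulRight k) (fun x => f (x * g * x⁻¹))]
    refine Finset.sum_congr rfl fun x _ => ?_
    simp only [Equiv.coe_mulRight]
    congr 1; group
  have h0 := hF.eq_zero fun χ => by
    have h1 : (fun g => ∑ x : G, f (x * g * x⁻¹)) = ∑ x : G, fun g => f (x * g * x⁻¹) := by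
      funext g; simp
    rw [h1, ip_sum_left]
    refine Finset.sum_eq_zero fun x _ => ?_
    rw [← hcon χ, ip_eq, ip_eq]
    congr 1
    rw [← Equiv.sum_comp (MulAut.conj x).toEquiv fun g => f g * χ.toFun g⁻¹]
    refine Finset.sum_congr rfl fun g _ => ?_
    simp only [MulEquiv.toEquiv_eq_coe, MulEquiv.coe_toEquiv, MulAut.conj_apply]
    rw [← χ.isClassFun x g⁻¹]
    congr 2
    group
  have h1 := congrFun h0 1
  simp only [mul_one, mul_inv_cancel, Finset.sum_const, Pi.zero_apply, nsmul_eq_mul] at h1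
  rcases mul_eq_zero.1 h1 with h | h
  · exact (Nat.cast_ne_zero.2 Fintype.card_ne_zero) h
  · exact hf h

namespace SplitExt

variable {N H G Z : Type*} [CommGroup N] [Group H] [Group G] [MulAction H Z]
  (E : SplitExt N H G Z) [Finite N] [Finite H]

include E in
theorem finite_group : Finite G := Finite.of_surjective _ E.bij.2

/-- Expand both functions along the linear characters of `N`; orthogonality removes the cross terms,
and components vanish off stabilizers. This identity takes the place of induction from inertia
groups: the whole Clifford correspondence below is extracted from it by comparing nonnegative
integers. -/
theorem card_mul_ip [Fintype Z] {f f' : G → ℂ} (hf : IsClassFun f) (hf' : IsClassFun f') :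
    (Nat.card H : ℂ) * ip f f' = ∑ z : Z, (Nat.card (MulAction.stabilizer H z) : ℂ) *
      ip (E.res f z) (E.res f' z) := by
  classical
  have := E.finite_group
  cases nonempty_fintype N
  cases nonempty_fintype H
  cases nonempty_fintype G
  have hN : (Nat.card N : ℂ) ≠ 0 := card_ne_zero_complex
  have hH : (Nat.card H : ℂ) ≠ 0 := card_ne_zero_complex
  have key : ∀ h : H, ∑ ν : N, f (E.i ν * E.s h) * f' (E.i ν * E.s h)⁻¹ =
      (Nat.card N : ℂ) * ∑ z : Z, E.comp f z h * E.comp f' z h⁻¹ := by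
    intro h
    have h1 : ∀ ν, f (E.i ν * E.s h) * f' (E.i ν * E.s h)⁻¹ = ∑ z : Z, ∑ z' : Z,
        E.comp f z h * E.comp f' z' h⁻¹ * ((E.ch z ν : ℂ) * ((E.ch z' ν)⁻¹ : ℂˣ)) := by
      intro ν
      rw [E.inv_eq, E.eq_sum_comp f, E.eq_sum_comp f', Finset.sum_mul_sum]
      refine Finset.sum_congr rfl fun z _ => Finset.sum_congr rfl fun z' _ => ?_
      -- The twist by `cj h⁻¹` coming from the inverse is harmless: either `h⁻¹` fixes `z'`, or the
      -- component is zero.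
      by_cases hz : h⁻¹ ∈ MulAction.stabilizer H z'
      · rw [E.ch_cj_of_mem hz, map_inv]; ring
      · rw [E.comp_eq_zero hf' hz]; ring
    simp only [h1]
    rw [Finset.sum_comm, Finset.mul_sum]
    refine Finset.sum_congr rfl fun z _ => ?_
    rw [Finset.sum_comm]
    simp only [← Finset.mul_sum, E.sum_ch]
    simp
    ring
  rw [ip_eq, E.sum_eq, Finset.sum_comm]
  simp only [key, ← Finset.mul_sum]
  rw [E.card_eq]
  push_cast
  rw [mul_inv, ← mul_assoc, ← mul_assoc, mul_comm (Nat.card N : ℂ)⁻¹, ← mul_assoc,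
    mul_inv_cancel₀ hH, one_mul, inv_mul_cancel₀ hN, one_mul, Finset.sum_comm]
  refine Finset.sum_congr rfl fun z _ => ?_
  rw [ip_eq, ← mul_assoc, mul_inv_cancel₀ card_ne_zero_complex, one_mul]
  have : ∀ h, h ∉ MulAction.stabilizer H z → E.comp f z h * E.comp f' z h⁻¹ = 0 := fun h hh => by
    rw [E.comp_eq_zero hf hh, zero_mul]
  rw [← Finset.sum_subset (Finset.subset_univ
    (Finset.univ.filter fun h => h ∈ MulAction.stabilizer H z)) (fun h _ hh => this h (by
      simpa using hh))]
  exact (Finset.sum_subtype (Finset.univ.filter fun h => h ∈ MulAction.stabilizer H z)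
    (by simp) (fun h => E.comp f z h * E.comp f' z h⁻¹))

theorem ip_res_smul {f f' : G → ℂ} (hf : IsClassFun f) (hf' : IsClassFun f') (k : H) (z : Z) :
    ip (E.res f (k • z)) (E.res f' (k • z)) = ip (E.res f z) (E.res f' z) := by
  classical
  cases nonempty_fintype H
  let e := MulAction.stabilizerEquivStabilizer (g := k) (a := z) (b := k • z) rfl
  have he : ∀ h, ((e h : MulAction.stabilizer H (k • z)) : H) = k * h * k⁻¹ := fun h => by
    simp [e, MulAction.stabilizerEquivStabilizer]
  rw [ip_eq, ip_eq, Nat.card_congr e.toEquiv]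
  congr 1
  rw [← Equiv.sum_comp e.toEquiv]
  refine Finset.sum_congr rfl fun h _ => ?_
  have e1 : ∀ (f : G → ℂ), IsClassFun f → ∀ h, E.res f (k • z) (e h) = E.res f z h :=
    fun f hf h => by
      rw [res, he, E.comp_conj hf]
      rfl
  simp only [MulEquiv.toEquiv_eq_coe, MulEquiv.coe_toEquiv]
  rw [← map_inv, e1 f hf, e1 f' hf']

omit [Finite H] in
theorem res_smul_apply_one {f : G → ℂ} (hf : IsClassFun f) (k : H) (z : Z) :
    E.res f (k • z) 1 = E.res f z 1 := by
  have := E.comp_conj hf z k 1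
  simpa [res] using this

/-- The multiplicity of a restriction to the isotypic component is at most one. -/
theorem ip_res_self (χ : Irr G) (z : Z) :
    ip (E.res χ.toFun z) (E.res χ.toFun z) = 0 ∨ ip (E.res χ.toFun z) (E.res χ.toFun z) = 1 := by
  classical
  have := E.finite_group
  have := E.finite_chars
  cases nonempty_fintype Z
  choose m hm using fun z => (E.isChar_res χ.isChar z).ip_nat (E.isChar_res χ.isChar z)
  have h1 := E.card_mul_ip χ.isClassFun χ.isClassFun
  rw [χ.ip_self] at h1
  simp only [hm] at h1 ⊢
  have h2 : Nat.card H = ∑ z : Z, Nat.card (MulAction.stabilizer H z) * m z := by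
    have : ((Nat.card H : ℕ) : ℂ) = (∑ z : Z, Nat.card (MulAction.stabilizer H z) * m z : ℕ) := by
      push_cast; rw [← h1, mul_one]
    exact_mod_cast this
  have hinv : ∀ z' ∈ MulAction.orbit H z, m z' = m z ∧
      Nat.card (MulAction.stabilizer H z') = Nat.card (MulAction.stabilizer H z) := by
    rintro _ ⟨k, rfl⟩
    constructor
    · have := E.ip_res_smul χ.isClassFun χ.isClassFun k z
      rw [hm, hm] at this
      exact_mod_cast this
    · exact (Nat.card_congr (MulAction.stabilizerEquivStabilizer (g := k) rfl).toEquiv).symm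
  -- The orbit of `z` alone contributes `|H| · m z` to a sum of nonnegative terms equal to `|H|`, so
  -- `m z ≤ 1`.
  have h3 : Nat.card H * m z ≤ Nat.card H := by
    calc Nat.card H * m z = ∑ z' ∈ (MulAction.orbit H z).toFinset,
        Nat.card (MulAction.stabilizer H z') * m z' := by
          rw [Finset.sum_congr rfl (g := fun _ => Nat.card (MulAction.stabilizer H z) * m z)]
          · rw [Finset.sum_const, smul_eq_mul, ← mul_assoc, Set.toFinset_card,
              ← Nat.card_eq_fintype_card]
            congr 1
            cases nonempty_fintype H
            have := MulAction.card_orbit_mul_card_stabilizer_eq_card_group H z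
            simp only [← Nat.card_eq_fintype_card] at this
            exact this.symm
          · intro z' hz'
            obtain ⟨a, b⟩ := hinv z' (by simpa using hz')
            rw [a, b]
      _ ≤ ∑ z : Z, Nat.card (MulAction.stabilizer H z) * m z :=
          Finset.sum_le_sum_of_subset (Finset.subset_univ _)
      _ = Nat.card H := h2.symm
  have h4 : m z ≤ 1 := by
    by_contra hcon
    have := Nat.card_pos (α := H)
    nlinarith
  interval_cases m z <;> simp

theorem sum_card_stabilizer [Fintype Z] (χ : Irr G) [DecidablePred fun z => E.res χ.toFun z ≠ 0] :
    ∑ z : Z with E.res χ.toFun z ≠ 0, Nat.card (MulAction.stabilizer H z) = Nat.card H := by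
  have h1 := E.card_mul_ip χ.isClassFun χ.isClassFun
  have := E.finite_group
  rw [χ.ip_self, mul_one] at h1
  have : ((∑ z : Z with E.res χ.toFun z ≠ 0, Nat.card (MulAction.stabilizer H z) : ℕ) : ℂ) =
      Nat.card H := by
    rw [h1, Finset.sum_filter]
    push_cast
    refine Finset.sum_congr rfl fun z _ => ?_
    split_ifs with h
    · rw [(E.ip_res_self χ z).resolve_left fun h' =>
        h ((E.isChar_res χ.isChar z).eq_zero_of_ip_self h'), mul_one]
    · rw [not_not] at h
      rw [h, ip_zero_left, mul_zero]
  exact_mod_cast this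

theorem exists_irr_res (χ : Irr G) {z : Z} (hz : E.res χ.toFun z ≠ 0) :
    ∃ φ : Irr (MulAction.stabilizer H z), φ.toFun = E.res χ.toFun z :=
  (E.isChar_res χ.isChar z).exists_irr ((E.ip_res_self χ z).resolve_left fun h =>
    hz ((E.isChar_res χ.isChar z).eq_zero_of_ip_self h))

/-- For distinct characters the left side of `card_mul_ip` is zero, so every term on the right
vanishes. The term at `z` would be the norm of a nonzero character. -/
theorem res_injective {χ χ' : Irr G} {z : Z} (hz : E.res χ.toFun z ≠ 0)
    (h : E.res χ.toFun z = E.res χ'.toFun z) : χ = χ' := by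
  classical
  have := E.finite_group
  have := E.finite_chars
  cases nonempty_fintype Z
  by_contra hne
  have h1 := E.card_mul_ip χ.isClassFun χ'.isClassFun
  rw [Irr.ip_ne hne, mul_zero] at h1
  choose m hm using fun z => (E.isChar_res χ.isChar z).ip_nat (E.isChar_res χ'.isChar z)
  have h2 : ∑ z : Z, Nat.card (MulAction.stabilizer H z) * m z = 0 := by
    have : ((∑ z : Z, Nat.card (MulAction.stabilizer H z) * m z : ℕ) : ℂ) = 0 := by
      push_cast; rw [h1]; simp only [hm]
    exact_mod_cast this
  have h3 := Finset.sum_eq_zero_iff.1 h2 z (Finset.mem_univ z)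
  have h4 : m z = 1 := by
    have : (m z : ℂ) = 1 := by
      rw [← hm, ← h]
      exact (E.ip_res_self χ z).resolve_left fun h' =>
        hz ((E.isChar_res χ.isChar z).eq_zero_of_ip_self h')
    exact_mod_cast this
  rw [h4, mul_one] at h3
  exact Nat.card_pos.ne' h3

/-- Let `f0` be `ch z` times `φ` on `N ⋊ H_z`, extended by zero. Its inner product with `χ` is a
nonzero multiple of that of `φ` with the `z`-component of `χ`. If `φ` occurred in no such component,
`f0` would be orthogonal to every irreducible character although `f0 1 ≠ 0`. -/
theorem exists_res_eq (z : Z) (φ : Irr (MulAction.stabilizer H z)) :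
    ∃ χ : Irr G, E.res χ.toFun z = φ.toFun := by
  classical
  have := E.finite_group
  have := E.finite_chars
  cases nonempty_fintype N
  cases nonempty_fintype H
  cases nonempty_fintype G
  have key : ∃ χ : Irr G, ip φ.toFun (E.res χ.toFun z) ≠ 0 := by
    by_contra hcon
    push Not at hcon
    let b := Equiv.ofBijective _ E.bij
    let f0 : G → ℂ := fun g => if h : (b.symm g).2 ∈ MulAction.stabilizer H z then
      E.ch z (b.symm g).1 * φ.toFun ⟨_, h⟩ else 0
    have hf0 : ∀ ν h, f0 (E.i ν * E.s h) = if h : h ∈ MulAction.stabilizer H z then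
        E.ch z ν * φ.toFun ⟨_, h⟩ else 0 := by
      intro ν h
      have : b.symm (E.i ν * E.s h) = (ν, h) := by
        rw [Equiv.symm_apply_eq]; rfl
      simp only [f0, this]
    have h1 : f0 1 ≠ 0 := by
      have := hf0 1 1
      rw [map_one, map_one, mul_one, dif_pos (one_mem _)] at this
      rw [this, map_one, Units.val_one, one_mul]
      have h1 := φ.degree_eq
      change _ = φ.toFun 1 at h1
      intro h2
      have h3 : φ.toFun 1 = 0 := h2
      rw [h3] at h1
      exact φ.degree_pos.ne' (by exact_mod_cast h1)
    obtain ⟨χ, hχ⟩ := exists_ip_ne_zero h1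
    apply hχ
    have h2 := hcon χ
    rw [ip_eq] at h2 ⊢
    have h3 := (mul_eq_zero.1 h2).resolve_left (inv_ne_zero card_ne_zero_complex)
    rw [E.sum_eq, Finset.sum_comm]
    have h4 : ∀ h : H, ∑ ν : N, f0 (E.i ν * E.s h) * χ.toFun (E.i ν * E.s h)⁻¹ =
        if hh : h ∈ MulAction.stabilizer H z then
          (Nat.card N : ℂ) * (φ.toFun ⟨h, hh⟩ * E.comp χ.toFun z h⁻¹) else 0 := by
      intro h
      simp only [hf0]
      split_ifs with hh
      · rw [comp_eq, ← Equiv.sum_comp ((Equiv.inv N).trans (E.cj h⁻¹).toEquiv) fun ν =>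
          χ.toFun (E.i ν * E.s h⁻¹) * ((E.ch z ν)⁻¹ : ℂˣ), Finset.mul_sum, Finset.mul_sum,
          Finset.mul_sum]
        refine Finset.sum_congr rfl fun ν _ => ?_
        simp only [Equiv.trans_apply, Equiv.inv_apply, MulEquiv.toEquiv_eq_coe,
          MulEquiv.coe_toEquiv]
        rw [E.ch_cj_of_mem (inv_mem hh), E.inv_eq, map_inv (E.ch z), inv_inv]
        have : (Nat.card N : ℂ) ≠ 0 := card_ne_zero_complex
        field_simp
      · simp
    simp only [h4]
    rw [← Finset.sum_filter_add_sum_filter_not _ (fun h => h ∈ MulAction.stabilizer H z)]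
    rw [Finset.sum_eq_zero (s := Finset.univ.filter fun h => h ∉ MulAction.stabilizer H z)
      (fun h hh => dif_neg (by simpa using hh)), add_zero,
      Finset.sum_subtype (p := fun h => h ∈ MulAction.stabilizer H z) _ (by simp)]
    rw [Finset.sum_congr rfl fun (x : MulAction.stabilizer H z) _ => dif_pos x.2,
      ← Finset.mul_sum]
    have h5 : ∑ x : MulAction.stabilizer H z, φ.toFun x * E.comp χ.toFun z (x : H)⁻¹ = 0 := h3
    convert mul_zero _
    convert mul_zero _
  obtain ⟨χ, hχ⟩ := key
  have hne : E.res χ.toFun z ≠ 0 := fun h => hχ (by rw [h, ip_comm, ip_zero_left])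
  obtain ⟨ψ, hψ⟩ := E.exists_irr_res χ hne
  refine ⟨χ, ?_⟩
  rw [← hψ] at hχ ⊢
  by_contra hcon
  exact hχ (Irr.ip_ne fun h => hcon (by rw [h]))

/-- The degree of the irreducible character corresponding to a character of an inertia group. -/
theorem degree_eq (χ : Irr G) (z : Z) (φ : Irr (MulAction.stabilizer H z))
    (h : φ.toFun = E.res χ.toFun z) :
    χ.degree * Nat.card (MulAction.stabilizer H z) = Nat.card H * φ.degree := by
  classical
  have := E.finite_group
  have := E.finite_chars
  cases nonempty_fintype Z
  cases nonempty_fintype H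
  have hφ : φ.toFun ≠ 0 := fun h => by
    have := φ.ip_self
    rw [h, ip_zero_left] at this
    exact zero_ne_one this
  have horb : (MulAction.orbit H z).toFinset.card * Nat.card (MulAction.stabilizer H z) =
      Nat.card H := by
    have := MulAction.card_orbit_mul_card_stabilizer_eq_card_group H z
    simp only [← Nat.card_eq_fintype_card] at this
    rw [← this, Set.toFinset_card, ← Nat.card_eq_fintype_card]
  -- The linear characters below `χ` form a single orbit: they include the orbit of `z`, and the
  -- stabilizer orders over that orbit already add up to `|H|`, the total over all of them.
  have hS : (Finset.univ.filter fun z => E.res χ.toFun z ≠ 0) = (MulAction.orbit H z).toFinset := by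
    symm
    have hsub : (MulAction.orbit H z).toFinset ⊆
        Finset.univ.filter fun z => E.res χ.toFun z ≠ 0 := by
      intro z' hz'
      obtain ⟨k, rfl⟩ := Set.mem_toFinset.1 hz'
      refine Finset.mem_filter.2 ⟨Finset.mem_univ _, fun h0 => ?_⟩
      have h1 := E.ip_res_smul χ.isClassFun χ.isClassFun k z
      rw [← h, φ.ip_self] at h1
      have h2 : E.res χ.toFun (k • z) = 0 := h0
      rw [h2, ip_zero_left] at h1
      exact zero_ne_one h1
    by_contra hne
    obtain ⟨y, hy, hy'⟩ := Finset.exists_of_ssubset (Finset.ssubset_iff_subset_ne.2 ⟨hsub, hne⟩)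
    have h1 := Finset.sum_lt_sum_of_subset (f := fun z => Nat.card (MulAction.stabilizer H z))
      hsub hy hy' Nat.card_pos (fun _ _ _ => Nat.zero_le _)
    rw [E.sum_card_stabilizer χ, ← horb] at h1
    rw [Finset.sum_congr rfl (g := fun _ => Nat.card (MulAction.stabilizer H z)),
      Finset.sum_const, smul_eq_mul] at h1
    · exact lt_irrefl _ h1
    · intro z' hz'
      obtain ⟨k, rfl⟩ := Set.mem_toFinset.1 hz'
      exact (Nat.card_congr (MulAction.stabilizerEquivStabilizer (g := k) rfl).toEquiv).symm
  have h1 := E.eq_sum_comp χ.toFun 1 1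
  have h2 : χ.toFun 1 = (MulAction.orbit H z).toFinset.card * φ.toFun 1 := by
    rw [map_one, map_one, mul_one] at h1
    rw [h1, ← nsmul_eq_mul, ← Finset.sum_const, ← hS, Finset.sum_filter]
    refine Finset.sum_congr rfl fun z' _ => ?_
    rw [map_one, Units.val_one, mul_one]
    split_ifs with h3
    · have : z' ∈ (MulAction.orbit H z).toFinset := by rw [← hS]; simpa using h3
      obtain ⟨k, rfl⟩ := Set.mem_toFinset.1 this
      rw [h]
      exact E.res_smul_apply_one χ.isClassFun k z
    · exact congrFun (not_not.1 h3) 1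
  have h3 : χ.degree = (MulAction.orbit H z).toFinset.card * φ.degree := by
    refine Irr.degree_eq_of_apply_one ?_
    rw [h2]; push_cast; rw [φ.degree_eq]
  rw [h3, ← horb]; ring

/-- The degrees differ by the index of the stabilizer, exactly as the group orders do up to the
factor `|N|`, which is prime to `ℓ`. -/
theorem defect_eq {ℓ : ℕ} (hℓ : ℓ.Prime) (hN : ¬ ℓ ∣ Nat.card N) (χ : Irr G) (z : Z)
    (φ : Irr (MulAction.stabilizer H z)) (h : φ.toFun = E.res χ.toFun z) :
    χ.defect ℓ = φ.defect ℓ := by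
  have := Fact.mk hℓ
  have h1 := congrArg (padicValNat ℓ) (E.degree_eq χ z φ h)
  have := E.finite_group
  rw [padicValNat.mul χ.degree_pos.ne' Nat.card_pos.ne',
    padicValNat.mul Nat.card_pos.ne' φ.degree_pos.ne'] at h1
  rw [Irr.defect, Irr.defect, E.card_eq, padicValNat.mul Nat.card_pos.ne' Nat.card_pos.ne',
    padicValNat.eq_zero_of_not_dvd hN]
  simp only [Nat.cast_add, Nat.cast_zero]
  omega

theorem irrCount_stabilizer {ℓ : ℕ} (hℓ : ℓ.Prime) (hN : ¬ ℓ ∣ Nat.card N) (d : ℤ) (z : Z) :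
    irrCount ℓ (MulAction.stabilizer H z) d =
      Nat.card {χ : Irr G // χ.defect ℓ = d ∧ E.res χ.toFun z ≠ 0} := by
  symm
  choose φ hφ using fun χ : {χ : Irr G // χ.defect ℓ = d ∧ E.res χ.toFun z ≠ 0} =>
    E.exists_irr_res χ.1 χ.2.2
  refine Nat.card_congr (Equiv.ofBijective (fun χ => ⟨φ χ, ?_⟩) ⟨?_, ?_⟩)
  · rw [← χ.2.1, E.defect_eq hℓ hN χ.1 z (φ χ) (hφ χ)]
  · intro χ χ' h
    have h1 : φ χ = φ χ' := congrArg Subtype.val h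
    exact Subtype.ext (E.res_injective χ.2.2 (by rw [← hφ, ← hφ, h1]))
  · rintro ⟨ψ, hψ⟩
    obtain ⟨χ, hχ⟩ := E.exists_res_eq z ψ
    have hne : E.res χ.toFun z ≠ 0 := fun h => by
      have := ψ.ip_self
      rw [← hχ, h, ip_zero_left] at this
      exact zero_ne_one this
    refine ⟨⟨χ, by rw [← hψ, E.defect_eq hℓ hN χ z ψ hχ.symm], hne⟩, ?_⟩
    exact Subtype.ext (Irr.ext (by rw [hφ, hχ]))

include E in
/-- Clifford theory for split extensions by commutative groups, as a count. -/
theorem card_mul_irrCount [Fintype Z] {ℓ : ℕ} (hℓ : ℓ.Prime) (hN : ¬ ℓ ∣ Nat.card N) (d : ℤ) :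
    Nat.card H * irrCount ℓ G d =
      ∑ z : Z, Nat.card (MulAction.stabilizer H z) * irrCount ℓ (MulAction.stabilizer H z) d := by
  classical
  have := E.finite_group
  cases nonempty_fintype (Irr G)
  have key : ∀ p : Irr G → Prop, Nat.card {χ // p χ} = ∑ χ : Irr G, if p χ then 1 else 0 :=
    fun p => by
      rw [Nat.card_eq_fintype_card, Fintype.card_subtype, Finset.card_filter]
  simp only [E.irrCount_stabilizer hℓ hN, key]
  rw [irrCount, key]
  simp only [Finset.mul_sum, mul_ite, mul_one, mul_zero]
  -- After exchanging the sums, a character `χ` of defect `d` contributes the sum of `|H_z|` over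
  -- the `z` below it, which is `|H|`.
  rw [Finset.sum_comm]
  refine Finset.sum_congr rfl fun χ _ => ?_
  split_ifs with h
  · rw [← E.sum_card_stabilizer χ, Finset.sum_filter]
    simp [h]
  · simp [h]

end SplitExt

/-! ### Clifford theory for subgroups of index two -/

section IndexTwo

variable {K : Type*} [Group K] [Finite K] (A : Subgroup K)

/-- Restriction of functions to a subgroup. -/
def resSub (f : K → ℂ) : A → ℂ := fun a => f a

omit [Finite K] in
theorem isChar_resSub {f : K → ℂ} (hf : IsChar f) : IsChar (resSub A f) := hf.comp A.subtype

/-- The conjugate of a function on a normal subgroup. -/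
def conjFun [hA : A.Normal] (s : K) (f : A → ℂ) : A → ℂ :=
  fun a => f ⟨s * a * s⁻¹, hA.conj_mem a a.2 s⟩

open Classical in
/-- The function on `K` induced from a subgroup of index two. -/
noncomputable def indTwo [A.Normal] (s : K) (f : A → ℂ) : K → ℂ :=
  fun g => if h : g ∈ A then f ⟨g, h⟩ + conjFun A s f ⟨g, h⟩ else 0

variable {A} [A.Normal]

omit [Finite K] in
theorem resSub_indTwo (s : K) (f : A → ℂ) : resSub A (indTwo A s f) = f + conjFun A s f := by
  funext a
  simp [resSub, indTwo]

omit [Finite K] in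
theorem conjFun_of_mem {s : K} (hs : s ∈ A) {f : A → ℂ} (hf : IsClassFun f) :
    conjFun A s f = f := by
  funext a
  have := hf ⟨s, hs⟩ a
  rw [← this]
  rfl

omit [Finite K] in
theorem conjFun_conjFun (s t : K) (f : A → ℂ) : conjFun A s (conjFun A t f) = conjFun A (t * s) f := by
  funext a
  simp only [conjFun]
  congr 2
  group

omit [Finite K] in
theorem isClassFun_indTwo (hA : A.index = 2) {s : K} (hs : s ∉ A) {f : A → ℂ} (hf : IsClassFun f) :
    IsClassFun (indTwo A s f) := by
  have hss : ∀ {k}, k ∉ A → k * s ∈ A := fun {k} hk =>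
    (Subgroup.mul_mem_iff_of_index_two hA).2 (iff_of_false hk hs)
  have hss' : ∀ {k}, k ∉ A → k * s⁻¹ ∈ A := fun {k} hk =>
    (Subgroup.mul_mem_iff_of_index_two hA).2 (iff_of_false hk (by simpa using hs))
  have hinv : ∀ k : K, conjFun A k (f + conjFun A s f) = f + conjFun A s f := by
    intro k
    have e : conjFun A k (f + conjFun A s f) = conjFun A k f + conjFun A k (conjFun A s f) := rfl
    have hswap : ∀ t, t ∉ A → conjFun A t f = conjFun A s f := by
      intro t ht
      have : t = (t * s⁻¹) * s := by group
      rw [this, ← conjFun_conjFun, conjFun_of_mem (hss' ht) hf]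
    rw [e, conjFun_conjFun]
    by_cases hk : k ∈ A
    · rw [conjFun_of_mem hk hf, hswap (s * k)]
      intro h
      exact hs ((Subgroup.mul_mem_cancel_right A hk).1 h)
    · have hsk : s * k ∈ A := (Subgroup.mul_mem_iff_of_index_two hA).2 (iff_of_false hs hk)
      rw [hswap k hk, conjFun_of_mem hsk hf, add_comm]
  intro k g
  by_cases hg : g ∈ A
  · have hg' : k * g * k⁻¹ ∈ A := ‹A.Normal›.conj_mem g hg k
    simp only [indTwo, hg, hg', dif_pos]
    exact congrFun (hinv k) ⟨g, hg⟩
  · have hg' : k * g * k⁻¹ ∉ A := fun h => hg (by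
      have := ‹A.Normal›.conj_mem _ h k⁻¹
      simpa [mul_assoc] using this)
    simp only [indTwo, hg, hg', dif_neg, not_false_eq_true]

theorem ip_conjFun (s : K) (f h : A → ℂ) : ip (conjFun A s f) (conjFun A s h) = ip f h := by
  cases nonempty_fintype A
  let e : A ≃ A :=
    { toFun := fun a => ⟨s * a * s⁻¹, ‹A.Normal›.conj_mem a a.2 s⟩
      invFun := fun a => ⟨s⁻¹ * a * s, by
        simpa using ‹A.Normal›.conj_mem a a.2 s⁻¹⟩
      left_inv := fun a => by ext; simp [mul_assoc]
      right_inv := fun a => by ext; simp [mul_assoc] }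
  rw [ip_eq, ip_eq]
  congr 1
  rw [← Equiv.sum_comp e fun a => f a * h a⁻¹]
  refine Finset.sum_congr rfl fun a _ => ?_
  simp only [conjFun, e]
  congr 2
  ext
  simp
  group

omit [Finite K] in
theorem conjFun_resSub (s : K) {f : K → ℂ} (hf : IsClassFun f) :
    conjFun A s (resSub A f) = resSub A f := by
  funext a
  exact hf s a

/-- Frobenius reciprocity; `h` is a class function, so the conjugate summand pairs with its
restriction exactly as `f` does. -/
theorem ip_indTwo (hA : A.index = 2) (s : K) (f : A → ℂ) {h : K → ℂ} (hh : IsClassFun h) :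
    ip (indTwo A s f) h = ip f (resSub A h) := by
  classical
  cases nonempty_fintype K
  have h1 : ip (f + conjFun A s f) (resSub A h) = 2 * ip f (resSub A h) := by
    rw [ip_add_left]
    nth_rewrite 2 [← conjFun_resSub s hh]
    rw [ip_conjFun]; ring
  have h2 : ip (indTwo A s f) h * 2 = ip (f + conjFun A s f) (resSub A h) := by
    rw [ip_eq, ip_eq, ← A.card_mul_index, hA]
    push_cast
    have h3 : ∑ g : K, indTwo A s f g * h g⁻¹ = ∑ a : A, (f + conjFun A s f) a * resSub A h a⁻¹ := by
      rw [← Finset.sum_filter_add_sum_filter_not _ (fun g => g ∈ A)]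
      rw [Finset.sum_eq_zero (s := Finset.univ.filter fun g => g ∉ A)
        (fun g hg => by
          have : g ∉ A := by simpa using hg
          simp [indTwo, this]), add_zero,
        Finset.sum_subtype (p := fun g => g ∈ A) _ (by simp)]
      refine Finset.sum_congr rfl fun a _ => ?_
      rw [← resSub_indTwo]
      rfl
    rw [h3, mul_inv]
    ring
  rw [h1] at h2
  linear_combination h2 / 2

omit [Finite K] in
theorem isChar_conjFun (s : K) {f : A → ℂ} (hf : IsChar f) : IsChar (conjFun A s f) := by
  have := hf.comp (MulAut.conjNormal s : A ≃* A).toMonoidHom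
  exact this

/-- The conjugate of an irreducible character. -/
noncomputable def Irr.conjBy (s : K) (ψ : Irr A) : Irr A :=
  ((isChar_conjFun s ψ.isChar).exists_irr (by rw [ip_conjFun, ψ.ip_self])).choose

theorem Irr.conjBy_toFun (s : K) (ψ : Irr A) : (ψ.conjBy s).toFun = conjFun A s ψ.toFun :=
  ((isChar_conjFun s ψ.isChar).exists_irr (by rw [ip_conjFun, ψ.ip_self])).choose_spec

/-- An induced irreducible character has norm 1 or 2 here, so its constituents have multiplicity one
and their number is the norm. -/
theorem card_support_of_sum_sq {ι : Type*} [Fintype ι] (m : ι → ℕ)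
    (h : ∑ i, m i * m i = 1 ∨ ∑ i, m i * m i = 2) :
    (∀ i, m i ≠ 0 → m i = 1) ∧ (Finset.univ.filter fun i => m i ≠ 0).card = ∑ i, m i * m i := by
  have h1 : ∀ i, m i ≠ 0 → m i = 1 := by
    intro i hi
    have : m i * m i ≤ ∑ i, m i * m i :=
      Finset.single_le_sum (f := fun i => m i * m i) (fun i _ => Nat.zero_le _) (Finset.mem_univ i)
    have h2 : m i < 2 := by
      by_contra hcon
      have : 2 * 2 ≤ m i * m i := Nat.mul_le_mul (by omega) (by omega)
      omega
    omega
  refine ⟨h1, ?_⟩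
  rw [Finset.card_filter]
  refine Finset.sum_congr rfl fun i _ => ?_
  split_ifs with hi
  · rw [h1 i hi]
  · rw [not_not.1 hi]

theorem ip_resSub_indTwo (hA : A.index = 2) {s : K} (hs : s ∉ A) (ψ : Irr A) :
    ip (indTwo A s ψ.toFun) (indTwo A s ψ.toFun) = 1 + ip ψ.toFun (conjFun A s ψ.toFun) := by
  rw [ip_indTwo hA s _ (isClassFun_indTwo hA hs ψ.isClassFun), resSub_indTwo, ip_add_right,
    ψ.ip_self]

theorem ip_indTwo_eq_sum [Fintype (Irr K)] (hA : A.index = 2) {s : K} (hs : s ∉ A) (ψ : Irr A)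
    (m : Irr K → ℕ) (hm : ∀ χ, ip ψ.toFun (resSub A χ.toFun) = m χ) :
    ip (indTwo A s ψ.toFun) (indTwo A s ψ.toFun) = (∑ χ, m χ * m χ : ℕ) := by
  rw [(isClassFun_indTwo hA hs ψ.isClassFun).ip_eq_sum]
  push_cast
  refine Finset.sum_congr rfl fun χ _ => ?_
  rw [ip_comm χ.toFun, ip_indTwo hA s _ χ.isClassFun, hm]

open Classical in
theorem card_over [Fintype (Irr K)] (hA : A.index = 2) {s : K} (hs : s ∉ A) (ψ : Irr A) :
    (Finset.univ.filter fun χ : Irr K => ip ψ.toFun (resSub A χ.toFun) ≠ 0).card =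
      if ψ.conjBy s = ψ then 2 else 1 := by
  choose m hm using fun χ : Irr K => ψ.isChar.ip_nat (isChar_resSub A χ.isChar)
  have h1 := ip_indTwo_eq_sum hA hs ψ m hm
  rw [ip_resSub_indTwo hA hs, ← Irr.conjBy_toFun, Irr.ip_eq_ite] at h1
  have h2 : ∑ χ, m χ * m χ = if ψ.conjBy s = ψ then 2 else 1 := by
    rw [eq_comm (a := ψ.conjBy s)]
    split_ifs at h1 ⊢ with h
    · have : ((2 : ℕ) : ℂ) = (∑ χ, m χ * m χ : ℕ) := by rw [← h1]; norm_num
      exact_mod_cast this.symm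
    · have : ((1 : ℕ) : ℂ) = (∑ χ, m χ * m χ : ℕ) := by rw [← h1]; norm_num
      exact_mod_cast this.symm
  rw [← h2, ← (card_support_of_sum_sq m (by rw [h2]; split_ifs <;> simp)).2]
  congr 1
  ext χ
  simp [hm]

/-- If `ψ` is invariant, restricting the induced character gives `2ψ`, so no other constituent can
lie below `χ`. If `ψ` is not invariant, the induced character has norm 1 and is therefore `χ`
itself. -/
theorem resSub_eq_of_over (hA : A.index = 2) {s : K} (hs : s ∉ A) {ψ : Irr A} {χ : Irr K}
    (h : ip ψ.toFun (resSub A χ.toFun) ≠ 0) :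
    (ψ.conjBy s = ψ → resSub A χ.toFun = ψ.toFun) ∧
    (ψ.conjBy s ≠ ψ → resSub A χ.toFun = ψ.toFun + (ψ.conjBy s).toFun) := by
  classical
  cases nonempty_fintype (Irr K)
  cases nonempty_fintype (Irr A)
  choose m hm using fun (ψ : Irr A) (χ : Irr K) => ψ.isChar.ip_nat (isChar_resSub A χ.isChar)
  have h1 := ip_indTwo_eq_sum hA hs ψ (m ψ) (hm ψ)
  rw [ip_resSub_indTwo hA hs, ← Irr.conjBy_toFun, Irr.ip_eq_ite] at h1
  have hexp : indTwo A s ψ.toFun = ∑ χ : Irr K, (m ψ χ : ℂ) • χ.toFun := by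
    conv_lhs => rw [(isClassFun_indTwo hA hs ψ.isClassFun).eq_sum]
    refine Finset.sum_congr rfl fun χ _ => ?_
    rw [ip_indTwo hA s _ χ.isClassFun, hm]
  have hmχ : m ψ χ ≠ 0 := by rw [hm] at h; exact_mod_cast h
  constructor
  · intro hinv
    rw [if_pos hinv.symm] at h1
    have h2 : ∑ χ, m ψ χ * m ψ χ = 2 := by
      have : ((2 : ℕ) : ℂ) = (∑ χ, m ψ χ * m ψ χ : ℕ) := by rw [← h1]; norm_num
      exact_mod_cast this.symm
    have h3 := (card_support_of_sum_sq _ (Or.inr h2)).1 χ hmχ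
    have h4 : ∀ ψ' ≠ ψ, m ψ' χ = 0 := by
      intro ψ' hne
      have e : ip ψ'.toFun (resSub A (indTwo A s ψ.toFun)) = 0 := by
        rw [resSub_indTwo, ← Irr.conjBy_toFun, hinv, ip_add_right, Irr.ip_ne hne, add_zero]
      have e2 : resSub A (indTwo A s ψ.toFun) = ∑ χ : Irr K, (m ψ χ : ℂ) • resSub A χ.toFun := by
        rw [hexp]; funext a; simp [resSub]
      rw [e2, ip_sum_right] at e
      simp only [ip_smul_right, hm] at e
      have e3 : ∑ χ : Irr K, m ψ χ * m ψ' χ = 0 := by exact_mod_cast e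
      have := Finset.sum_eq_zero_iff.1 e3 χ (Finset.mem_univ χ)
      exact (Nat.mul_eq_zero.1 this).resolve_left hmχ
    conv_lhs => rw [(isChar_resSub A χ.isChar).isClassFun.eq_sum]
    rw [Finset.sum_eq_single ψ]
    · rw [ip_comm, hm, h3]; simp
    · intro ψ' _ hne
      rw [ip_comm, hm, h4 ψ' hne]; simp
    · simp
  · intro hinv
    rw [if_neg (Ne.symm hinv), add_zero] at h1
    have h2 : ∑ χ, m ψ χ * m ψ χ = 1 := by
      have : ((1 : ℕ) : ℂ) = (∑ χ, m ψ χ * m ψ χ : ℕ) := by rw [← h1]; norm_num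
      exact_mod_cast this.symm
    obtain ⟨h3, h4⟩ := card_support_of_sum_sq _ (Or.inl h2)
    rw [h2, Finset.card_eq_one] at h4
    obtain ⟨χ', h4⟩ := h4
    have h5 : ∀ χ'', m ψ χ'' ≠ 0 ↔ χ'' = χ' := fun χ'' => by
      have := congrArg (fun S => χ'' ∈ S) h4
      simpa using this
    have h6 : indTwo A s ψ.toFun = χ.toFun := by
      rw [hexp, Finset.sum_eq_single χ]
      · rw [h3 χ hmχ]; simp
      · intro χ'' _ hne
        have : m ψ χ'' = 0 := by
          by_contra h0
          exact hne (((h5 χ'').1 h0).trans ((h5 χ).1 hmχ).symm)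
        rw [this]; simp
      · simp
    rw [← h6, resSub_indTwo, Irr.conjBy_toFun]

omit [A.Normal] in
theorem exists_under (χ : Irr K) : ∃ ψ : Irr A, ip ψ.toFun (resSub A χ.toFun) ≠ 0 := by
  by_contra hcon
  push Not at hcon
  have h1 := (isChar_resSub A χ.isChar).isClassFun.eq_zero fun ψ => by rw [ip_comm, hcon]
  have h2 := congrFun h1 1
  have h3 : χ.toFun 1 = 0 := h2
  have h4 := χ.degree_eq
  have h5 : (χ.degree : ℂ) = 0 := by rw [h4]; exact h3
  exact χ.degree_pos.ne' (by exact_mod_cast h5)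

theorem conjBy_conjBy (hA : A.index = 2) {s : K} (hs : s ∉ A) (ψ : Irr A) :
    (ψ.conjBy s).conjBy s = ψ := by
  apply Irr.ext
  rw [Irr.conjBy_toFun, Irr.conjBy_toFun, conjFun_conjFun, conjFun_of_mem _ ψ.isClassFun]
  exact (Subgroup.mul_mem_iff_of_index_two hA).2 (iff_of_false hs hs)

open Classical in
theorem sum_under [Fintype (Irr A)] (hA : A.index = 2) {s : K} (hs : s ∉ A) (χ : Irr K) :
    (∑ ψ : Irr A with ip ψ.toFun (resSub A χ.toFun) ≠ 0, if ψ.conjBy s = ψ then 2 else 1) = 2 := by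
  obtain ⟨ψ, hψ⟩ := exists_under (A := A) χ
  obtain ⟨h1, h2⟩ := resSub_eq_of_over hA hs hψ
  by_cases hinv : ψ.conjBy s = ψ
  · have : (Finset.univ.filter fun ψ : Irr A => ip ψ.toFun (resSub A χ.toFun) ≠ 0) = {ψ} := by
      ext ψ'
      simp [h1 hinv, Irr.ip_eq_ite]
    rw [this, Finset.sum_singleton, if_pos hinv]
  · have : (Finset.univ.filter fun ψ : Irr A => ip ψ.toFun (resSub A χ.toFun) ≠ 0) =
        {ψ, ψ.conjBy s} := by
      ext ψ'
      simp only [h2 hinv, ip_add_right, Irr.ip_eq_ite, Finset.mem_filter, Finset.mem_univ, true_and,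
        Finset.mem_insert, Finset.mem_singleton]
      split_ifs with h3 h4 h4 <;> simp [h3, h4]
    rw [this, Finset.sum_pair (Ne.symm hinv), if_neg hinv, if_neg]
    rw [conjBy_conjBy hA hs]
    exact Ne.symm hinv

theorem defect_eq_of_over (hA : A.index = 2) {s : K} (hs : s ∉ A) {ℓ : ℕ} (hℓ : ℓ.Prime)
    (h2 : ℓ ≠ 2) {ψ : Irr A} {χ : Irr K} (h : ip ψ.toFun (resSub A χ.toFun) ≠ 0) :
    χ.defect ℓ = ψ.defect ℓ := by
  have := Fact.mk hℓ
  have v2 : padicValNat ℓ 2 = 0 := padicValNat.eq_zero_of_not_dvd fun hd =>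
    h2 ((Nat.prime_dvd_prime_iff_eq hℓ Nat.prime_two).1 hd)
  have hdeg : χ.degree = ψ.degree ∨ χ.degree = 2 * ψ.degree := by
    obtain ⟨h1, h2⟩ := resSub_eq_of_over hA hs h
    have e : (ψ.conjBy s).toFun 1 = ψ.toFun 1 := by
      rw [Irr.conjBy_toFun]; simp only [conjFun]; congr 1; ext; simp
    by_cases hinv : ψ.conjBy s = ψ
    · left
      refine Irr.degree_eq_of_apply_one ?_
      rw [ψ.degree_eq]
      exact congrFun (h1 hinv) 1
    · right
      refine Irr.degree_eq_of_apply_one ?_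
      push_cast
      rw [ψ.degree_eq]
      have := congrFun (h2 hinv) 1
      rw [Pi.add_apply, e, ← two_mul] at this
      exact this
  have hv : padicValNat ℓ χ.degree = padicValNat ℓ ψ.degree := by
    rcases hdeg with h | h
    · rw [h]
    · rw [h, padicValNat.mul two_ne_zero ψ.degree_pos.ne', v2, zero_add]
  rw [Irr.defect, Irr.defect, hv, ← A.card_mul_index, hA,
    padicValNat.mul Nat.card_pos.ne' two_ne_zero, v2, add_zero]

theorem nat_card_subtype_eq_sum {α : Type*} [Fintype α] (p : α → Prop) [DecidablePred p] :
    Nat.card {a // p a} = ∑ a, if p a then 1 else 0 := by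
  rw [Nat.card_eq_fintype_card, Fintype.card_subtype, Finset.card_filter]

/-- Clifford theory for subgroups of index two, as a count. -/
theorem two_mul_irrCount (hA : A.index = 2) {s : K} (hs : s ∉ A) {ℓ : ℕ} (hℓ : ℓ.Prime)
    (h2 : ℓ ≠ 2) (d : ℤ) :
    2 * irrCount ℓ K d = irrCount ℓ A d +
      3 * Nat.card {ψ : Irr A // ψ.defect ℓ = d ∧ conjFun A s ψ.toFun = ψ.toFun} := by
  classical
  cases nonempty_fintype (Irr K)
  cases nonempty_fintype (Irr A)
  have e : ∀ ψ : Irr A, conjFun A s ψ.toFun = ψ.toFun ↔ ψ.conjBy s = ψ := fun ψ => by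
    rw [← Irr.conjBy_toFun]
    exact ⟨fun h => Irr.ext h, fun h => by rw [h]⟩
  simp only [irrCount, nat_card_subtype_eq_sum, Finset.mul_sum, ← Finset.sum_add_distrib, e]
  -- Double count pairs with `ψ` below `χ`, with weight 2 when `ψ` is invariant and 1 otherwise.
  -- Each `χ` receives total weight 2. Each `ψ` receives `2 · 2` or `1 · 1`, that is, 1 plus 3 if it
  -- is invariant.
  have h3 : ∀ χ : Irr K, (2 * if χ.defect ℓ = d then 1 else 0) = ∑ ψ : Irr A,
      if ψ.defect ℓ = d ∧ ip ψ.toFun (resSub A χ.toFun) ≠ 0 then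
        (if ψ.conjBy s = ψ then 2 else 1) else 0 := by
    intro χ
    have h4 := sum_under hA hs χ
    rw [Finset.sum_filter] at h4
    nth_rewrite 1 [← h4]
    rw [Finset.sum_mul]
    refine Finset.sum_congr rfl fun ψ _ => ?_
    by_cases h5 : ip ψ.toFun (resSub A χ.toFun) ≠ 0
    · rw [defect_eq_of_over hA hs hℓ h2 h5]
      by_cases h6 : ψ.defect ℓ = d <;> simp [h5, h6]
    · simp [h5]
  rw [Finset.sum_congr rfl fun χ _ => h3 χ, Finset.sum_comm]
  refine Finset.sum_congr rfl fun ψ _ => ?_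
  by_cases h6 : ψ.defect ℓ = d
  · simp only [h6, true_and, if_true]
    rw [← Finset.sum_filter, Finset.sum_const, card_over hA hs]
    split_ifs <;> simp
  · simp [h6]

end IndexTwo

end

/-! ### Characters of symmetric groups on arbitrary finite sets -/

section

open Module Equiv

/-- The irreducible characters of all symmetric groups. -/
abbrev SymIrr : Type := Σ n : ℕ, Irr (Perm (Fin n))

namespace SymIrr

open Classical in
/-- The character of `Perm B`, for any set `B` of the right size. -/
noncomputable def char (lam : SymIrr) {B : Type*} (τ : Perm B) : ℂ :=
  if h : Nonempty (B ≃ Fin lam.1) then lam.2.toFun (permCongr h.some τ) else 0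

theorem char_eq (lam : SymIrr) {B : Type*} (e : B ≃ Fin lam.1) (τ : Perm B) :
    lam.char τ = lam.2.toFun (permCongr e τ) := by
  have h : Nonempty (B ≃ Fin lam.1) := ⟨e⟩
  rw [char, dif_pos h]
  have := lam.2.isClassFun (h.some.symm.trans e) (permCongr h.some τ)
  rw [← this]
  congr 1
  ext b
  simp [Perm.mul_apply]

theorem char_permCongr (lam : SymIrr) {B B' : Type*} (e : B ≃ B') (τ : Perm B) :
    lam.char (permCongr e τ) = lam.char τ := by
  by_cases h : Nonempty (B' ≃ Fin lam.1)
  · obtain ⟨f⟩ := h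
    rw [lam.char_eq f, lam.char_eq (e.trans f)]
    congr 1
  · rw [char, dif_neg h, char, dif_neg fun h' => h ⟨e.symm.trans h'.some⟩]

/-- The irreducible character of `Perm B` given by `lam`. -/
noncomputable def toIrr (lam : SymIrr) {B : Type*} (e : B ≃ Fin lam.1) : Irr (Perm B) :=
  Irr.congr (permCongrHom e).symm lam.2

theorem toIrr_toFun (lam : SymIrr) {B : Type*} (e : B ≃ Fin lam.1) :
    (lam.toIrr e).toFun = lam.char := by
  funext τ
  rw [lam.char_eq e]
  rfl

theorem defect_toIrr (ℓ : ℕ) (lam : SymIrr) {B : Type*} (e : B ≃ Fin lam.1) :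
    (lam.toIrr e).defect ℓ = lam.2.defect ℓ := Irr.defect_congr _ _ _

theorem exists_toFun_eq {B : Type*} [Finite B] (χ : Irr (Perm B)) :
    ∃ lam : SymIrr, lam.1 = Nat.card B ∧ lam.char = χ.toFun ∧ ∀ ℓ, lam.2.defect ℓ = χ.defect ℓ := by
  let e := Finite.equivFin B
  refine ⟨⟨_, Irr.congr (permCongrHom e) χ⟩, rfl, ?_, fun ℓ => Irr.defect_congr _ _ _⟩
  funext τ
  rw [char_eq _ e]
  change χ.toFun ((permCongrHom e).symm (permCongrHom e τ)) = _
  rw [MulEquiv.symm_apply_apply]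

theorem ext_char {lam mu : SymIrr} {B : Type*} [Finite B] (h1 : lam.1 = Nat.card B)
    (h2 : mu.1 = Nat.card B) (h : (lam.char : Perm B → ℂ) = mu.char) : lam = mu := by
  obtain ⟨n, χ⟩ := lam
  obtain ⟨m, ψ⟩ := mu
  simp only at h1 h2
  obtain rfl : n = m := h1.trans h2.symm
  congr 1
  ext τ
  have e : B ≃ Fin n := (Finite.equivFin B).trans (finCongr h1.symm)
  have := congrFun h ((permCongr e).symm τ)
  rw [char_eq _ e, char_eq _ e] at this
  rwa [show permCongr e ((permCongr e).symm τ) = τ from (permCongr e).apply_symm_apply τ] at this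

end SymIrr

/-! ### Stabilizers of labellings and their characters -/

section Labels

variable {B X : Type*}

/-- The number of points with a given label. -/
noncomputable def labelType (x : B → X) (a : X) : ℕ := Nat.card {b // x b = a}

/-- The group of label-preserving permutations. -/
def labelStab (x : B → X) : Subgroup (Perm B) where
  carrier := {τ | ∀ b, x (τ b) = x b}
  one_mem' := fun _ => rfl
  mul_mem' := fun {s t} hs ht b => (hs (t b)).trans (ht b)
  inv_mem' := fun {s} hs b => by
    have := hs (s⁻¹ b)
    rw [show s (s⁻¹ b) = b from s.apply_symm_apply b] at this
    exact this.symm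

/-- The group of permutations which preserve the labels up to an involution. -/
def twistedStab (δ : X → X) (hδ : Function.Involutive δ) (x : B → X) : Subgroup (Perm B) where
  carrier := {τ | (∀ b, x (τ b) = x b) ∨ ∀ b, x (τ b) = δ (x b)}
  one_mem' := Or.inl fun _ => rfl
  mul_mem' := by
    rintro s t (hs | hs) (ht | ht)
    · exact Or.inl fun b => (hs (t b)).trans (ht b)
    · exact Or.inr fun b => (hs (t b)).trans (ht b)
    · exact Or.inr fun b => (hs (t b)).trans (by rw [ht b])
    · exact Or.inl fun b => (hs (t b)).trans (by rw [ht b, hδ])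
  inv_mem' := by
    rintro s (hs | hs)
    · refine Or.inl fun b => ?_
      have := hs (s⁻¹ b)
      rw [show s (s⁻¹ b) = b from s.apply_symm_apply b] at this
      exact this.symm
    · refine Or.inr fun b => ?_
      have := hs (s⁻¹ b)
      rw [show s (s⁻¹ b) = b from s.apply_symm_apply b] at this
      rw [this, hδ]

theorem labelStab_le_twistedStab (δ : X → X) (hδ : Function.Involutive δ) (x : B → X) :
    labelStab x ≤ twistedStab δ hδ x := fun _ h => Or.inl h

/-- The restriction of a label-preserving permutation to the points with a given label. -/
def fiberPerm (x : B → X) : labelStab x →* ∀ a, Perm {b // x b = a} where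
  toFun τ a := τ.1.subtypePerm (fun b => by rw [τ.2 b])
  map_one' := by ext; rfl
  map_mul' s t := by ext; rfl

theorem fiberPerm_bijective (x : B → X) : Function.Bijective (fiberPerm x) := by
  constructor
  · intro s t h
    ext b
    have := congrFun h (x b)
    have := congrArg (fun π => ((π ⟨b, rfl⟩ : {b' // x b' = x b}) : B)) this
    simpa [fiberPerm] using this
  · intro π
    let τ : Perm B := ((sigmaFiberEquiv x).symm.trans (sigmaCongrRight π)).trans (sigmaFiberEquiv x)
    have hτ : ∀ a (b : {b // x b = a}), τ b.1 = (π a b : B) := by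
      rintro a ⟨b, rfl⟩
      rfl
    refine ⟨⟨τ, fun b => ?_⟩, ?_⟩
    · rw [hτ (x b) ⟨b, rfl⟩]; exact (π (x b) ⟨b, rfl⟩).2
    · funext a
      ext b
      exact hτ a b

/-- Label-preserving permutations as a product of symmetric groups. -/
noncomputable def labelStabEquiv (x : B → X) : labelStab x ≃* ∀ a, Perm {b // x b = a} :=
  MulEquiv.ofBijective (fiberPerm x) (fiberPerm_bijective x)

variable [Finite B] [Fintype X]

/-- The product character of `labelStab x` attached to a family of characters of symmetric
groups. -/
noncomputable def labelChar (x : B → X) (lam : X → SymIrr) (τ : labelStab x) : ℂ :=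
  ∏ a, (lam a).char (fiberPerm x τ a)

theorem exists_irr_labelChar (x : B → X) (lam : X → SymIrr)
    (h : ∀ a, (lam a).1 = labelType x a) :
    ∃ χ : Irr (labelStab x), χ.toFun = labelChar x lam := by
  have e : ∀ a, Nonempty ({b // x b = a} ≃ Fin (lam a).1) := fun a =>
    ⟨(Finite.equivFin _).trans (finCongr (h a).symm)⟩
  refine ⟨Irr.congr (labelStabEquiv x).symm (Irr.pi fun a => (lam a).toIrr (e a).some), ?_⟩
  funext τ
  rw [Irr.congr_apply, Irr.pi_apply]
  simp only [SymIrr.toIrr_toFun]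
  rfl

/-- The irreducible character of `labelStab x` attached to a family of characters of symmetric
groups of the right sizes. -/
noncomputable def labelIrr (x : B → X)
    (lam : {lam : X → SymIrr // ∀ a, (lam a).1 = labelType x a}) : Irr (labelStab x) :=
  (exists_irr_labelChar x lam.1 lam.2).choose

theorem labelIrr_toFun (x : B → X)
    (lam : {lam : X → SymIrr // ∀ a, (lam a).1 = labelType x a}) :
    (labelIrr x lam).toFun = labelChar x lam.1 :=
  (exists_irr_labelChar x lam.1 lam.2).choose_spec

theorem labelIrr_eq (x : B → X)
    (lam : {lam : X → SymIrr // ∀ a, (lam a).1 = labelType x a})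
    (e : ∀ a, {b // x b = a} ≃ Fin (lam.1 a).1) :
    labelIrr x lam =
      Irr.congr (labelStabEquiv x).symm (Irr.pi fun a => (lam.1 a).toIrr (e a)) := by
  apply Irr.ext
  rw [labelIrr_toFun]
  funext τ
  rw [Irr.congr_apply, Irr.pi_apply]
  simp only [SymIrr.toIrr_toFun]
  rfl

omit [Fintype X] in
theorem labelEquiv (x : B → X)
    (lam : {lam : X → SymIrr // ∀ a, (lam a).1 = labelType x a}) (a : X) :
    Nonempty ({b // x b = a} ≃ Fin (lam.1 a).1) :=
  ⟨(Finite.equivFin _).trans (finCongr (lam.2 a).symm)⟩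

theorem labelIrr_bijective (x : B → X) : Function.Bijective (labelIrr x) := by
  constructor
  · intro lam mu h
    rw [labelIrr_eq x lam fun a => (labelEquiv x lam a).some,
      labelIrr_eq x mu fun a => (labelEquiv x mu a).some] at h
    have h1 := Irr.pi_injective ((Irr.congr _).injective h)
    refine Subtype.ext (funext fun a => ?_)
    refine SymIrr.ext_char (B := {b // x b = a}) (lam.2 a) (mu.2 a) ?_
    have := congrArg Irr.toFun (congrFun h1 a)
    simpa only [SymIrr.toIrr_toFun] using this
  · intro χ
    obtain ⟨ψ, hψ⟩ := Irr.pi_bijective.2 (Irr.congr (labelStabEquiv x) χ)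
    choose lam h1 h2 h3 using fun a => SymIrr.exists_toFun_eq (ψ a)
    refine ⟨⟨lam, h1⟩, ?_⟩
    apply Irr.ext
    rw [labelIrr_toFun]
    funext τ
    have h4 : χ.toFun τ = (Irr.pi ψ).toFun (labelStabEquiv x τ) := by
      rw [hψ, Irr.congr_apply, MulEquiv.symm_apply_apply]
    rw [h4, Irr.pi_apply, labelChar]
    exact Finset.prod_congr rfl fun a _ => congrFun (h2 a) _

theorem defect_labelIrr {ℓ : ℕ} (hℓ : ℓ.Prime) (x : B → X)
    (lam : {lam : X → SymIrr // ∀ a, (lam a).1 = labelType x a}) :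
    (labelIrr x lam).defect ℓ = ∑ a, (lam.1 a).2.defect ℓ := by
  rw [labelIrr_eq x lam fun a => (labelEquiv x lam a).some, Irr.defect_congr, Irr.defect_pi hℓ]
  exact Finset.sum_congr rfl fun a _ => SymIrr.defect_toIrr _ _ _

omit [Finite B] in
-- A permutation inducing `δ` on labels carries the points labelled `a` to the points labelled `δ
-- a`, so conjugation by it permutes the family of characters through `δ`.
theorem labelChar_conj {δ : X → X} (hδ : Function.Involutive δ) (x : B → X) (lam : X → SymIrr)
    {s : Perm B} (hs : ∀ b, x (s b) = δ (x b)) (τ τ' : labelStab x)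
    (h : (τ' : Perm B) = s * τ * s⁻¹) :
    labelChar x lam τ' = labelChar x (lam ∘ δ) τ := by
  rw [labelChar, labelChar, ← Equiv.prod_comp hδ.toPerm]
  refine Finset.prod_congr rfl fun a _ => ?_
  let e : {b // x b = a} ≃ {b // x b = δ a} :=
    s.subtypeEquiv fun b => by rw [hs, hδ.injective.eq_iff]
  change (lam (δ a)).char _ = (lam (δ a)).char _
  rw [← SymIrr.char_permCongr _ e]
  congr 1
  ext b
  have : (τ' : Perm B) b = s (τ.1 (s⁻¹ b)) := by rw [h]; rfl
  exact this

end Labels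

/-! ### Counting characters of stabilizers, summed over all labellings -/

section LabelCount

variable {B X : Type*} [Finite B] [Fintype X]

theorem sum_labelType (x : B → X) : ∑ a, labelType x a = Nat.card B := by
  classical
  rw [← Nat.card_congr (sigmaFiberEquiv x), Nat.card_sigma]
  rfl

variable (X) in
theorem finite_size_eq (k : ℕ) : {lam : X → SymIrr | ∑ a, (lam a).1 = k}.Finite := by
  classical
  have h0 : (Set.univ : Set (Σ n : Fin (k + 1), Irr (Perm (Fin n)))).Finite := Set.finite_univ
  let f : (Σ n : Fin (k + 1), Irr (Perm (Fin n))) → SymIrr := fun p => ⟨p.1, p.2⟩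
  refine (Set.Finite.pi (fun _ : X => h0.image f)).subset fun lam h a _ => ?_
  have h1 : (lam a).1 ≤ k := by
    rw [← show ∑ a, (lam a).1 = k from h]
    exact Finset.single_le_sum (f := fun a => (lam a).1) (fun _ _ => Nat.zero_le _)
      (Finset.mem_univ a)
  exact ⟨⟨⟨(lam a).1, Nat.lt_succ_of_le h1⟩, (lam a).2⟩, trivial, rfl⟩

variable (X) in
/-- The families of characters of symmetric groups with given total size. -/
noncomputable def labelFamilies (k : ℕ) : Finset (X → SymIrr) := (finite_size_eq X k).toFinset

theorem mem_labelFamilies {k : ℕ} {lam : X → SymIrr} :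
    lam ∈ labelFamilies X k ↔ ∑ a, (lam a).1 = k := by
  simp [labelFamilies]

/-- The total defect of a family. -/
noncomputable def totalDefect (ℓ : ℕ) (lam : X → SymIrr) : ℤ := ∑ a, (lam a).2.defect ℓ

open Classical in
/-- The weight of a family in counting formulas twisted by an involution. -/
noncomputable def twistWeight (δ : X → X) (lam : X → SymIrr) : ℕ :=
  -- The 4 is `1 + 3`, from the coefficients in `two_mul_irrCount`.
  if δ ≠ id ∧ lam ∘ δ = lam then 4 else 1

open Classical in
theorem card_labelIrr_eq_sum {ℓ : ℕ} (hℓ : ℓ.Prime) (x : B → X) (d : ℤ)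
    (p : Irr (labelStab x) → Prop) (q : (X → SymIrr) → Prop)
    (hpq : ∀ lam, p (labelIrr x lam) ↔ q lam.1) :
    Nat.card {χ : Irr (labelStab x) // χ.defect ℓ = d ∧ p χ} =
      ∑ lam ∈ labelFamilies X (Nat.card B),
        if (∀ a, (lam a).1 = labelType x a) ∧ totalDefect ℓ lam = d ∧ q lam then 1 else 0 := by
  rw [← Finset.card_filter]
  symm
  rw [← Nat.subtype_card (p := fun lam : X → SymIrr => (∀ a, (lam a).1 = labelType x a) ∧
    totalDefect ℓ lam = d ∧ q lam)]
  · refine Nat.card_congr (Equiv.ofBijective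
      (fun lam => ⟨labelIrr x ⟨lam.1, lam.2.1⟩, ?_, ?_⟩) ⟨?_, ?_⟩)
    · rw [defect_labelIrr hℓ]; exact lam.2.2.1
    · exact (hpq _).2 lam.2.2.2
    · intro lam mu h
      have := (labelIrr_bijective x).1 (Subtype.ext_iff.1 h :
        labelIrr x ⟨lam.1, lam.2.1⟩ = labelIrr x ⟨mu.1, mu.2.1⟩)
      exact Subtype.ext (Subtype.mk.inj this)
    · rintro ⟨χ, h1, h2⟩
      obtain ⟨lam, rfl⟩ := (labelIrr_bijective x).2 χ
      exact ⟨⟨lam.1, lam.2, by rw [← h1, defect_labelIrr hℓ]; rfl, (hpq _).1 h2⟩, rfl⟩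
  · intro lam
    rw [Finset.mem_filter, mem_labelFamilies, and_iff_right_of_imp]
    rintro ⟨h, -⟩
    rw [← sum_labelType x]
    exact Finset.sum_congr rfl fun a _ => h a

/-- An involution used to identify labels: it is trivial, or it is free and `ℓ` is odd. -/
def IsTwist (ℓ : ℕ) (δ : X → X) : Prop := δ = id ∨ (∀ a, δ a ≠ a) ∧ ℓ ≠ 2

-- If some permutation induces `δ ≠ id` on the labels, the label stabilizer has index two and
-- `two_mul_irrCount` produces the weights. If none does, the two groups coincide. In that case a
-- family fixed by `δ ≠ id` cannot have the sizes prescribed by `x`, since equal sizes on `a` and `δ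
-- a` would allow such a permutation to be built; so only weight 1 occurs.
open Classical in
theorem card_twistedStab_mul_irrCount [Nonempty B] {ℓ : ℕ} (hℓ : ℓ.Prime) {δ : X → X}
    (hδ : Function.Involutive δ) (hδ' : IsTwist ℓ δ) (x : B → X) (d : ℤ) :
    Nat.card (twistedStab δ hδ x) * irrCount ℓ (twistedStab δ hδ x) d =
      Nat.card (labelStab x) * ∑ lam ∈ labelFamilies X (Nat.card B),
        if (∀ a, (lam a).1 = labelType x a) ∧ totalDefect ℓ lam = d then
          twistWeight δ lam else 0 := by
  have hplain : irrCount ℓ (labelStab x) d = ∑ lam ∈ labelFamilies X (Nat.card B),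
        if (∀ a, (lam a).1 = labelType x a) ∧ totalDefect ℓ lam = d then 1 else 0 := by
    have := card_labelIrr_eq_sum hℓ x d (fun _ => True) (fun _ => True) (fun _ => Iff.rfl)
    simpa only [and_true, irrCount] using this
  by_cases hs : δ ≠ id ∧ ∃ s : Perm B, ∀ b, x (s b) = δ (x b)
  · obtain ⟨hne, s, hs⟩ := hs
    obtain ⟨hfree, h2⟩ := hδ'.resolve_left hne
    let K := twistedStab δ hδ x
    let sK : K := ⟨s, Or.inr hs⟩
    let A : Subgroup K := (labelStab x).subgroupOf K
    have hsA : sK ∉ A := by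
      intro h
      obtain ⟨b⟩ := ‹Nonempty B›
      have h1 : x (s b) = x b := (Subgroup.mem_subgroupOf.1 h) b
      exact hfree (x b) (by rw [← hs, h1])
    have hA : A.index = 2 := by
      rw [Subgroup.index_eq_two_iff]
      refine ⟨sK, fun t => ?_⟩
      have hfree' : ∀ t : Perm B, (∀ b, x (t b) = δ (x b)) → ¬ ∀ b, x (t b) = x b := by
        intro t h h'
        obtain ⟨b⟩ := ‹Nonempty B›
        exact hfree (x b) (by rw [← h, h'])
      rcases t with ⟨t, ht | ht⟩
      · refine Or.inr ⟨Subgroup.mem_subgroupOf.2 ht, fun h => ?_⟩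
        refine hfree' (t * s) (fun b => ?_) (Subgroup.mem_subgroupOf.1 h)
        exact (ht (s b)).trans (hs b)
      · refine Or.inl ⟨Subgroup.mem_subgroupOf.2 fun b => ?_, fun h => ?_⟩
        · exact (ht (s b)).trans (by rw [hs, hδ])
        · exact hfree' t ht (Subgroup.mem_subgroupOf.1 h)
    have hAn : A.Normal := Subgroup.normal_of_index_eq_two hA
    let e : A ≃* labelStab x := Subgroup.subgroupOfEquivOfLe (labelStab_le_twistedStab δ hδ x)
    have h3 := two_mul_irrCount hA hsA hℓ h2 d
    have hcard : Nat.card K = 2 * Nat.card (labelStab x) := by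
      rw [← A.card_mul_index, hA, Nat.card_congr e.toEquiv, mul_comm]
    have htype : ∀ a, labelType x (δ a) = labelType x a := by
      intro a
      refine Nat.card_congr (s.subtypeEquiv fun b => ?_).symm
      rw [hs, hδ.injective.eq_iff]
    have hinv : Nat.card {ψ : Irr A // ψ.defect ℓ = d ∧ conjFun A sK ψ.toFun = ψ.toFun} =
        ∑ lam ∈ labelFamilies X (Nat.card B),
          if (∀ a, (lam a).1 = labelType x a) ∧ totalDefect ℓ lam = d ∧ lam ∘ δ = lam
            then 1 else 0 := by
      refine Eq.trans ?_ ((card_labelIrr_eq_sum hℓ x d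
        (fun χ => ∀ τ τ' : labelStab x, (τ' : Perm B) = s * τ * s⁻¹ → χ.toFun τ' = χ.toFun τ)
        (fun lam => lam ∘ δ = lam) ?_).trans (by congr!))
      · refine Nat.card_congr ((Irr.congr e).subtypeEquiv fun ψ => ?_)
        rw [Irr.defect_congr]
        refine and_congr_right fun _ => ⟨fun h τ τ' hτ => ?_, fun h => ?_⟩
        · have := congrFun h (e.symm τ)
          rw [Irr.congr_apply, Irr.congr_apply, ← this, conjFun]
          congr 1
          exact Subtype.ext (Subtype.ext hτ)
        · funext a
          have := h (e a) (e ⟨sK * a * sK⁻¹, hAn.conj_mem a a.2 sK⟩) rfl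
          rw [Irr.congr_apply, Irr.congr_apply, MulEquiv.symm_apply_apply,
            MulEquiv.symm_apply_apply] at this
          exact this
      · intro lam
        have hsz : ∀ a, ((lam.1 ∘ δ) a).1 = labelType x a := fun a =>
          (lam.2 (δ a)).trans (htype a)
        have key : (lam.1 ∘ δ = lam.1) ↔ labelChar x (lam.1 ∘ δ) = labelChar x lam.1 := by
          refine ⟨fun h => by rw [h], fun h => ?_⟩
          rw [← labelIrr_toFun x lam, ← labelIrr_toFun x ⟨_, hsz⟩] at h
          exact congrArg Subtype.val ((labelIrr_bijective x).1 (Irr.ext h))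
        rw [key, labelIrr_toFun]
        constructor
        · intro h
          funext τ
          have hmem : s * τ * s⁻¹ ∈ labelStab x := by
            intro b
            have h1 : x (s (τ.1 (s⁻¹ b))) = δ (x (τ.1 (s⁻¹ b))) := hs _
            have h2 : x (τ.1 (s⁻¹ b)) = x (s⁻¹ b) := τ.2 _
            have h3 := hs (s⁻¹ b)
            rw [show s (s⁻¹ b) = b from s.apply_symm_apply b] at h3
            rw [h3, ← h2, ← h1]
            rfl
          rw [← labelChar_conj hδ x lam.1 hs τ ⟨_, hmem⟩ rfl]
          exact h τ ⟨_, hmem⟩ rfl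
        · intro h τ τ' hτ
          rw [labelChar_conj hδ x lam.1 hs τ τ' hτ, h]
    rw [hcard, mul_right_comm, mul_comm, h3, irrCount_congr ℓ e, hplain, hinv, Finset.mul_sum,
      ← Finset.sum_add_distrib]
    congr 1
    refine Finset.sum_congr rfl fun lam _ => ?_
    by_cases h4 : (∀ a, (lam a).1 = labelType x a) ∧ totalDefect ℓ lam = d
    · by_cases h5 : lam ∘ δ = lam <;> simp [h4.1, h4.2, twistWeight, h5, hne]
    · have h6 : ¬ ((∀ a, (lam a).1 = labelType x a) ∧ totalDefect ℓ lam = d ∧ lam ∘ δ = lam) :=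
        fun h => h4 ⟨h.1, h.2.1⟩
      simp only [h4, h6, if_false, mul_zero, add_zero]
  · have hK : twistedStab δ hδ x = labelStab x := by
      refine le_antisymm (fun t ht => ?_) (labelStab_le_twistedStab δ hδ x)
      rcases ht with ht | ht
      · exact ht
      · by_cases h : δ = id
        · subst h; exact ht
        · exact absurd ⟨h, t, ht⟩ hs
    rw [hK, hplain]
    congr 1
    refine Finset.sum_congr rfl fun lam _ => ?_
    by_cases h4 : (∀ a, (lam a).1 = labelType x a) ∧ totalDefect ℓ lam = d
    · rw [if_pos h4, if_pos h4, twistWeight, if_neg]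
      rintro ⟨h5, h6⟩
      apply hs
      refine ⟨h5, ?_⟩
      have h7 : ∀ a, Nonempty ({b // x b = a} ≃ {b // x b = δ a}) := fun a => by
        refine Finite.card_eq.1 ?_
        have h8 := h4.1 a
        have h9 := h4.1 (δ a)
        have h10 : lam (δ a) = lam a := congrFun h6 a
        rw [h10, h8] at h9
        exact h9
      let f : B → B := fun b => ((h7 (x b)).some ⟨b, rfl⟩ : {b' // x b' = δ (x b)})
      have hf : ∀ b, x (f b) = δ (x b) := fun b => ((h7 (x b)).some ⟨b, rfl⟩).2
      have hinj : Function.Injective f := by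
        intro b b' h
        have h11 : x b = x b' := hδ.injective (by rw [← hf, ← hf, h])
        have h12 : ∀ a (c c' : {b // x b = a}), (((h7 a).some c : {b' // x b' = δ a}) : B) =
            ((h7 a).some c' : {b' // x b' = δ a}) → c = c' := fun a c c' h =>
          (h7 a).some.injective (Subtype.ext h)
        have h13 : ∀ a (hb : x b = a) , f b = ((h7 a).some ⟨b, hb⟩ : {b' // x b' = δ a}) := by
          rintro _ rfl; rfl
        have h14 : ∀ a (hb : x b' = a) , f b' = ((h7 a).some ⟨b', hb⟩ : {b' // x b' = δ a}) := by
          rintro _ rfl; rfl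
        rw [h13 (x b') h11, h14 (x b') rfl] at h
        exact congrArg Subtype.val (h12 _ _ _ h)
      exact ⟨Equiv.ofBijective f (Finite.injective_iff_bijective.1 hinj), hf⟩
    · rw [if_neg h4, if_neg h4]

theorem exists_labelType_eq [Fintype B] (m : X → ℕ) (hm : ∑ a, m a = Nat.card B) :
    ∃ x : B → X, ∀ a, labelType x a = m a := by
  classical
  have e : B ≃ Σ a, Fin (m a) := (Finite.card_eq.1 (by
    rw [Nat.card_sigma, ← hm]; simp)).some
  refine ⟨fun b => (e b).1, fun a => ?_⟩
  have : {b // (e b).1 = a} ≃ {p : Σ a, Fin (m a) // p.1 = a} := e.subtypeEquiv fun b => Iff.rfl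
  have e2 : Fin (m a) ≃ {p : Σ a, Fin (m a) // p.1 = a} :=
    Equiv.ofBijective (fun i => ⟨⟨a, i⟩, rfl⟩)
      ⟨fun i j h => by simpa using h, by rintro ⟨⟨a, i⟩, rfl⟩; exact ⟨i, rfl⟩⟩
  rw [labelType, Nat.card_congr (this.trans e2.symm)]
  simp

-- Orbit and stabilizer: the labellings of a given type form one orbit, and the permutations `τ`
-- with `x0 ∘ τ = x` form a coset of `labelStab x`.
open Classical in
theorem sum_card_labelStab [Fintype B] (m : X → ℕ) (hm : ∑ a, m a = Nat.card B) :
    (∑ x : B → X, if ∀ a, m a = labelType x a then Nat.card (labelStab x) else 0) =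
      (Nat.card B).factorial := by
  obtain ⟨x0, hx0⟩ := exists_labelType_eq m hm
  rw [← Nat.card_perm, Nat.card_eq_fintype_card, ← Finset.card_univ]
  rw [Finset.card_eq_sum_card_fiberwise (f := fun τ : Perm B => x0 ∘ τ) (t := Finset.univ)
    (fun _ _ => Finset.mem_univ _)]
  refine Finset.sum_congr rfl fun x _ => ?_
  split_ifs with h
  · have : ∃ τ0 : Perm B, x0 ∘ τ0 = x := by
      have e : ∀ a, {b // x b = a} ≃ {b // x0 b = a} := fun a =>
        (Finite.card_eq.1 ((h a).symm.trans (hx0 a).symm)).some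
      refine ⟨((sigmaFiberEquiv x).symm.trans (sigmaCongrRight e)).trans (sigmaFiberEquiv x0), ?_⟩
      funext b
      exact (e (x b) ⟨b, rfl⟩).2
    obtain ⟨τ0, hτ0⟩ := this
    rw [Nat.card_eq_fintype_card, ← Finset.card_univ]
    refine Finset.card_bij (fun τ _ => τ0 * τ.1) ?_ ?_ ?_
    · intro τ _
      simp only [Finset.mem_filter, Finset.mem_univ, true_and]
      funext b
      have h1 := τ.2 b
      exact (congrFun hτ0 (τ.1 b)).trans h1
    · intro τ _ τ' _ h
      exact Subtype.ext (mul_left_cancel h)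
    · intro σ hσ
      simp only [Finset.mem_filter, Finset.mem_univ, true_and] at hσ
      refine ⟨⟨τ0⁻¹ * σ, fun b => ?_⟩, Finset.mem_univ _, by simp⟩
      have h1 : x (τ0⁻¹ (σ b)) = x0 (τ0 (τ0⁻¹ (σ b))) := by rw [← hτ0]; rfl
      rw [show τ0 (τ0⁻¹ (σ b)) = σ b from τ0.apply_symm_apply _] at h1
      exact h1.trans (congrFun hσ b)
  · symm
    rw [Finset.card_eq_zero, Finset.filter_eq_empty_iff]
    rintro τ - rfl
    apply h
    intro a
    rw [← hx0]
    exact Nat.card_congr (τ.subtypeEquiv fun b => Iff.rfl).symm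

open Classical in
/-- The number of characters of twisted label stabilizers, summed over all labellings. -/
theorem sum_twistedStab [Fintype B] [Nonempty B] {ℓ : ℕ} (hℓ : ℓ.Prime) {δ : X → X}
    (hδ : Function.Involutive δ) (hδ' : IsTwist ℓ δ) (d : ℤ) (P : (X → ℕ) → Prop) :
    (∑ x : B → X, if P (labelType x) then
      Nat.card (twistedStab δ hδ x) * irrCount ℓ (twistedStab δ hδ x) d else 0) =
    (Nat.card B).factorial * ∑ lam ∈ labelFamilies X (Nat.card B),
      if P (fun a => (lam a).1) ∧ totalDefect ℓ lam = d then twistWeight δ lam else 0 := by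
  simp only [card_twistedStab_mul_irrCount hℓ hδ hδ']
  rw [Finset.mul_sum]
  have : ∀ x : B → X, (if P (labelType x) then Nat.card (labelStab x) *
      ∑ lam ∈ labelFamilies X (Nat.card B),
        (if (∀ a, (lam a).1 = labelType x a) ∧ totalDefect ℓ lam = d then
          twistWeight δ lam else 0) else 0) =
      ∑ lam ∈ labelFamilies X (Nat.card B),
        (if P (fun a => (lam a).1) ∧ totalDefect ℓ lam = d then twistWeight δ lam else 0) *
          (if ∀ a, (lam a).1 = labelType x a then Nat.card (labelStab x) else 0) := by
    intro x
    split_ifs with h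
    · rw [Finset.mul_sum]
      refine Finset.sum_congr rfl fun lam _ => ?_
      by_cases h1 : ∀ a, (lam a).1 = labelType x a
      · have h2 : (fun a => (lam a).1) = labelType x := funext h1
        simp only [h1, h, implies_true, true_and, if_true]
        ring
      · simp [h1]
    · symm
      refine Finset.sum_eq_zero fun lam _ => ?_
      by_cases h1 : ∀ a, (lam a).1 = labelType x a
      · have h2 : (fun a => (lam a).1) = labelType x := funext h1
        simp [h2, h]
      · simp [h1]
  rw [Finset.sum_congr rfl fun x _ => this x, Finset.sum_comm]
  refine Finset.sum_congr rfl fun lam hlam => ?_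
  rw [← Finset.mul_sum, sum_card_labelStab (fun a => (lam a).1) (mem_labelFamilies.1 hlam), mul_comm]

end LabelCount

/-! ### Cauchy's determinant without denominators -/

section Cauchy

variable {K : ℕ}

/-- Column `j` consists of the values at the `x i` of a polynomial of degree less than `K`, so the
matrix is the Vandermonde matrix of `x` times a matrix `C` not depending on `x`. For `x i = (y i)⁻¹`
the matrix becomes diagonal, and this determines `det C`. -/
theorem det_prod_one_sub_mul_of_field {F : Type*} [Field F] (x y : Fin K → F)
    (hy : ∀ j, y j ≠ 0) (hy' : Function.Injective y) :
    (Matrix.of fun i j => ∏ k ∈ Finset.univ.erase j, (1 - x i * y k)).det =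
      (Matrix.vandermonde x).det * (Matrix.vandermonde y).det := by
  classical
  let P : Fin K → Polynomial F := fun j =>
    ∏ k ∈ Finset.univ.erase j, (1 - Polynomial.C (y k) * Polynomial.X)
  have hP : ∀ j, (P j).natDegree < K := fun j => by
    have h1 : (P j).natDegree ≤ ∑ k ∈ Finset.univ.erase j, 1 := by
      refine (Polynomial.natDegree_prod_le _ _).trans (Finset.sum_le_sum fun k _ => ?_)
      compute_degree
    have h2 : (Finset.univ.erase j).card < K := by
      rw [Finset.card_erase_of_mem (Finset.mem_univ j)]
      simp only [Finset.card_univ, Fintype.card_fin]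
      exact Nat.sub_lt j.pos one_pos
    simp only [Finset.sum_const, smul_eq_mul, mul_one] at h1
    omega
  let C : Matrix (Fin K) (Fin K) F := Matrix.of fun k j => (P j).coeff k
  have hmul : ∀ x : Fin K → F,
      (Matrix.of fun i j => ∏ k ∈ Finset.univ.erase j, (1 - x i * y k)) =
        Matrix.vandermonde x * C := by
    intro x
    ext i j
    have h1 : (P j).eval (x i) = ∏ k ∈ Finset.univ.erase j, (1 - x i * y k) := by
      simp only [P, Polynomial.eval_prod]
      refine Finset.prod_congr rfl fun k _ => ?_
      rw [Polynomial.eval_sub, Polynomial.eval_mul, Polynomial.eval_one, Polynomial.eval_C,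
        Polynomial.eval_X, mul_comm]
    rw [Matrix.of_apply, ← h1, Polynomial.eval_eq_sum_range' (hP j), Matrix.mul_apply,
      ← Fin.sum_univ_eq_sum_range (fun k => (P j).coeff k * x i ^ k)]
    refine Finset.sum_congr rfl fun k _ => ?_
    exact mul_comm _ _
  rw [hmul, Matrix.det_mul]
  congr 1
  have h0 : (Matrix.vandermonde fun i => (y i)⁻¹).det ≠ 0 :=
    Matrix.det_vandermonde_ne_zero_iff.2 fun i j h => hy' (inv_injective h)
  apply mul_left_cancel₀ h0
  rw [← Matrix.det_mul, ← hmul]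
  have hd : (Matrix.of fun i j => ∏ k ∈ Finset.univ.erase j, (1 - (y i)⁻¹ * y k)) =
      Matrix.diagonal fun i => ∏ k ∈ Finset.univ.erase i, (1 - (y i)⁻¹ * y k) := by
    ext i j
    by_cases hij : i = j
    · subst hij; simp
    · rw [Matrix.diagonal_apply_ne _ hij, Matrix.of_apply]
      refine Finset.prod_eq_zero (Finset.mem_erase.2 ⟨hij, Finset.mem_univ i⟩) ?_
      rw [inv_mul_cancel₀ (hy i), sub_self]
  rw [hd, Matrix.det_diagonal, Matrix.det_vandermonde, Matrix.det_vandermonde,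
    ← Finset.prod_mul_distrib]
  have h1 := Finset.prod_prod_Ioi_mul_eq_prod_prod_off_diag (fun i k => 1 - (y k)⁻¹ * y i)
  have h2 : ∀ i : Fin K, ({i}ᶜ : Finset (Fin K)) = Finset.univ.erase i := fun i => by
    ext k; simp
  simp only [h2] at h1
  rw [← h1]
  refine Finset.prod_congr rfl fun i _ => ?_
  rw [← Finset.prod_mul_distrib]
  refine Finset.prod_congr rfl fun j _ => ?_
  have := hy i
  have := hy j
  field_simp

theorem det_prod_one_sub_mul {R : Type*} [CommRing R] [IsDomain R] (x y : Fin K → R)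
    (hy : ∀ j, y j ≠ 0) (hy' : Function.Injective y) :
    (Matrix.of fun i j => ∏ k ∈ Finset.univ.erase j, (1 - x i * y k)).det =
      (Matrix.vandermonde x).det * (Matrix.vandermonde y).det := by
  have hinj := FaithfulSMul.algebraMap_injective R (FractionRing R)
  apply hinj
  have h := det_prod_one_sub_mul_of_field (fun i => algebraMap R (FractionRing R) (x i))
    (fun i => algebraMap R (FractionRing R) (y i))
    (fun j hj => hy j (hinj (by rw [hj, map_zero]))) (fun i j h => hy' (hinj h))
  rw [map_mul, RingHom.map_det, RingHom.map_det, RingHom.map_det]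
  have e1 : ∀ v : Fin K → R, (algebraMap R (FractionRing R)).mapMatrix (Matrix.vandermonde v) =
      Matrix.vandermonde fun i => algebraMap R (FractionRing R) (v i) := fun v => by
    ext i j; simp [Matrix.vandermonde_apply]
  rw [e1, e1, ← h]
  refine congrArg Matrix.det ?_
  ext i j
  simp only [RingHom.mapMatrix_apply, Matrix.map_apply, Matrix.of_apply, map_prod, map_sub,
    map_one, map_mul]

end Cauchy

/-! ### Generating functions of contingency tables -/

section Tables

variable {K : ℕ}

/-- The nonnegative integer matrices, supported on `T`, with given row sums and column sums. -/
def tables (T : Finset (Fin K × Fin K)) (a a' : Fin K → ℕ) : Set (Fin K × Fin K → ℕ) :=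
  {m | (∀ p, p ∉ T → m p = 0) ∧ (∀ i, ∑ j, m (i, j) = a i) ∧ ∀ j, ∑ i, m (i, j) = a' j}

theorem tables_finite (T : Finset (Fin K × Fin K)) (a a' : Fin K → ℕ) : (tables T a a').Finite := by
  refine (Set.finite_Iic (fun p : Fin K × Fin K => a p.1)).subset fun m hm p => ?_
  change m p ≤ a p.1
  rw [← hm.2.1 p.1]
  exact Finset.single_le_sum (f := fun j => m (p.1, j)) (fun _ _ => Nat.zero_le _)
    (Finset.mem_univ p.2)

/-- The generating function of `tables T`. -/
noncomputable def tableSeries (T : Finset (Fin K × Fin K)) :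
    MvPowerSeries (Fin K ⊕ Fin K) ℤ :=
  fun c => ((tables T (fun i => c (Sum.inl i)) (fun j => c (Sum.inr j))).ncard : ℤ)

theorem coeff_tableSeries (T : Finset (Fin K × Fin K)) (c : Fin K ⊕ Fin K →₀ ℕ) :
    MvPowerSeries.coeff c (tableSeries T) =
      ((tables T (fun i => c (Sum.inl i)) (fun j => c (Sum.inr j))).ncard : ℤ) := rfl

theorem sum_single_prod_left (p : Fin K × Fin K) (i : Fin K) :
    ∑ j, (Pi.single p 1 : Fin K × Fin K → ℕ) (i, j) = (Pi.single p.1 1 : Fin K → ℕ) i := by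
  obtain ⟨u, v⟩ := p
  by_cases h : i = u
  · subst h
    rw [Finset.sum_eq_single v]
    · simp
    · intro j _ hj; rw [Pi.single_eq_of_ne]; simpa using hj
    · simp
  · rw [Pi.single_eq_of_ne h]
    refine Finset.sum_eq_zero fun j _ => ?_
    rw [Pi.single_eq_of_ne]; simp [h]

theorem sum_single_prod_right (p : Fin K × Fin K) (j : Fin K) :
    ∑ i, (Pi.single p 1 : Fin K × Fin K → ℕ) (i, j) = (Pi.single p.2 1 : Fin K → ℕ) j := by
  obtain ⟨u, v⟩ := p
  by_cases h : j = v
  · subst h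
    rw [Finset.sum_eq_single u]
    · simp
    · intro i _ hi; rw [Pi.single_eq_of_ne]; simpa using hi
    · simp
  · rw [Pi.single_eq_of_ne h]
    refine Finset.sum_eq_zero fun i _ => ?_
    rw [Pi.single_eq_of_ne]; simp [h]

/-- Tables on `insert p T` with entry 0 at `p` are tables on `T`. Those with positive entry at `p`
are all tables on `insert p T`, shifted by one in that cell; the shift multiplies the series by the
two variables of `p`. -/
theorem one_sub_mul_tableSeries {T : Finset (Fin K × Fin K)} {p : Fin K × Fin K} (hp : p ∉ T) :
    (1 - MvPowerSeries.X (Sum.inl p.1) * MvPowerSeries.X (Sum.inr p.2)) *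
      tableSeries (insert p T) = tableSeries T := by
  classical
  rw [sub_mul, one_mul, sub_eq_iff_eq_add]
  ext c
  have hX : (MvPowerSeries.X (Sum.inl p.1) * MvPowerSeries.X (Sum.inr p.2) :
      MvPowerSeries (Fin K ⊕ Fin K) ℤ) =
      MvPowerSeries.monomial (Finsupp.single (Sum.inl p.1) 1 + Finsupp.single (Sum.inr p.2) 1) 1 := by
    rw [MvPowerSeries.X_def, MvPowerSeries.X_def, MvPowerSeries.monomial_mul_monomial, one_mul]
  rw [map_add, hX, MvPowerSeries.coeff_monomial_mul]
  simp only [coeff_tableSeries, one_mul]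
  set c0 : Fin K ⊕ Fin K →₀ ℕ := Finsupp.single (Sum.inl p.1) 1 + Finsupp.single (Sum.inr p.2) 1
    with hc0
  have hl : ∀ i, c0 (Sum.inl i) = (Pi.single p.1 1 : Fin K → ℕ) i := fun i => by
    simp [hc0, Finsupp.single_apply, Pi.single_apply, eq_comm]
  have hr : ∀ i, c0 (Sum.inr i) = (Pi.single p.2 1 : Fin K → ℕ) i := fun i => by
    simp [hc0, Finsupp.single_apply, Pi.single_apply, eq_comm]
  set A := tables (insert p T) (fun i => c (Sum.inl i)) (fun j => c (Sum.inr j)) with hA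
  have hAf : A.Finite := tables_finite _ _ _
  have hsplit : A.ncard = {m ∈ A | m p = 0}.ncard + {m ∈ A | m p ≠ 0}.ncard := by
    rw [← Set.ncard_union_eq _ (hAf.subset fun _ h => h.1) (hAf.subset fun _ h => h.1)]
    · congr 1; ext m; simp only [Set.mem_union, Set.mem_ofPred_eq]; tauto
    · rw [Set.disjoint_left]; rintro m h h'; exact h'.2 h.2
  have h0 : {m ∈ A | m p = 0} = tables T (fun i => c (Sum.inl i)) (fun j => c (Sum.inr j)) := by
    ext m
    constructor
    · rintro ⟨⟨h1, h2⟩, h3⟩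
      refine ⟨fun q hq => ?_, h2⟩
      by_cases hqp : q = p
      · rw [hqp, h3]
      · exact h1 q (by simp [hqp, hq])
    · rintro ⟨h1, h2⟩
      exact ⟨⟨fun q hq => h1 q fun h => hq (Finset.mem_insert_of_mem h), h2⟩, h1 p hp⟩
  have hadd : ∀ m : Fin K × Fin K → ℕ, ∀ a a' : Fin K → ℕ, m ∈ tables (insert p T) a a' ↔
      m + Pi.single p 1 ∈ tables (insert p T) (a + Pi.single p.1 1) (a' + Pi.single p.2 1) := by
    intro m a a'
    simp only [tables, Set.mem_ofPred_eq, Pi.add_apply, Finset.sum_add_distrib,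
      sum_single_prod_left, sum_single_prod_right, add_left_inj]
    refine and_congr_left fun _ => forall_congr' fun q => imp_congr_right fun hq => ?_
    have : q ≠ p := fun h => hq (by simp [h])
    rw [Pi.single_eq_of_ne this, add_zero]
  have hsub : ∀ m : Fin K × Fin K → ℕ, m p ≠ 0 → m - Pi.single p 1 + Pi.single p 1 = m := by
    intro m hm
    apply tsub_add_cancel_of_le
    intro q
    by_cases hq : q = p
    · subst hq; simp; omega
    · simp [Pi.single_eq_of_ne hq]
  rw [hsplit, h0]
  push_cast
  congr 1
  split_ifs with hle
  · congr 1
    have e1 : (fun i => c (Sum.inl i)) = (fun i => (c - c0) (Sum.inl i)) + Pi.single p.1 1 := by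
      funext i
      have := hle (Sum.inl i)
      rw [hl] at this
      simp only [Pi.add_apply, Finsupp.coe_tsub, Pi.sub_apply, hl]
      omega
    have e2 : (fun i => c (Sum.inr i)) = (fun i => (c - c0) (Sum.inr i)) + Pi.single p.2 1 := by
      funext i
      have := hle (Sum.inr i)
      rw [hr] at this
      simp only [Pi.add_apply, Finsupp.coe_tsub, Pi.sub_apply, hr]
      omega
    symm
    refine Set.ncard_congr (fun m _ => m + Pi.single p 1) ?_ ?_ ?_
    · intro m hm
      refine ⟨?_, by simp⟩
      rw [hA, e1, e2]
      exact (hadd _ _ _).1 hm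
    · intro m m' _ _ h
      exact add_right_cancel h
    · rintro m ⟨hm, hmp⟩
      refine ⟨m - Pi.single p 1, ?_, hsub m hmp⟩
      rw [hadd, hsub m hmp]
      rw [hA, e1, e2] at hm
      exact hm
  · rw [Nat.cast_eq_zero, Set.ncard_eq_zero (hAf.subset fun _ h => h.1),
      Set.eq_empty_iff_forall_notMem]
    rintro m ⟨hm, hmp⟩
    apply hle
    have hm' := hm.2
    have h1 : 1 ≤ m p := Nat.one_le_iff_ne_zero.2 hmp
    rintro (i | i)
    · rw [hl]
      by_cases hi : i = p.1
      · subst hi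
        rw [Pi.single_eq_same]
        refine (h1.trans ?_).trans (hm'.1 p.1).le
        exact (Finset.single_le_sum (f := fun j => m (p.1, j)) (fun _ _ => Nat.zero_le _)
          (Finset.mem_univ p.2))
      · rw [Pi.single_eq_of_ne hi]; exact Nat.zero_le _
    · rw [hr]
      by_cases hi : i = p.2
      · subst hi
        rw [Pi.single_eq_same]
        refine (h1.trans ?_).trans (hm'.2 p.2).le
        exact (Finset.single_le_sum (f := fun j => m (j, p.2)) (fun _ _ => Nat.zero_le _)
          (Finset.mem_univ p.1))
      · rw [Pi.single_eq_of_ne hi]; exact Nat.zero_le _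

theorem prod_one_sub_mul_tableSeries (T S : Finset (Fin K × Fin K)) (h : Disjoint S T) :
    (∏ p ∈ S, (1 - MvPowerSeries.X (Sum.inl p.1) * MvPowerSeries.X (Sum.inr p.2))) *
      tableSeries (S ∪ T) = tableSeries T := by
  classical
  induction S using Finset.induction_on with
  | empty => simp
  | insert p S hp ih =>
    rw [Finset.disjoint_insert_left] at h
    rw [Finset.prod_insert hp, Finset.insert_union, mul_right_comm, one_sub_mul_tableSeries,
      mul_comm, ih h.2]
    rw [Finset.mem_union]; tauto

/-- Cauchy's identity, multiplied out. -/
theorem vandermonde_mul_tableSeries :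
    (Matrix.vandermonde fun i : Fin K => (MvPowerSeries.X (Sum.inl i) :
      MvPowerSeries (Fin K ⊕ Fin K) ℤ)).det *
    (Matrix.vandermonde fun i : Fin K => (MvPowerSeries.X (Sum.inr i) :
      MvPowerSeries (Fin K ⊕ Fin K) ℤ)).det * tableSeries Finset.univ =
    ∑ w : Perm (Fin K), ((Perm.sign w : ℤ) : MvPowerSeries (Fin K ⊕ Fin K) ℤ) *
      tableSeries (Finset.univ.filter fun p => w p.1 = p.2) := by
  classical
  have : IsDomain (MvPowerSeries (Fin K ⊕ Fin K) ℤ) := NoZeroDivisors.to_isDomain _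
  rw [← det_prod_one_sub_mul, ← Matrix.det_transpose, Matrix.det_apply', Finset.sum_mul]
  · refine Finset.sum_congr rfl fun w _ => ?_
    rw [mul_assoc]
    congr 1
    -- The term of `w` in the expanded determinant carries the factors of all cells off the graph of
    -- `w`. They cancel those cells from the full series, leaving tables supported on the graph.
    have h := prod_one_sub_mul_tableSeries (Finset.univ.filter fun p : Fin K × Fin K => w p.1 = p.2)
      (Finset.univ.filter fun p : Fin K × Fin K => ¬ w p.1 = p.2)
      (Finset.disjoint_filter_filter_not _ _ _).symm
    rw [Finset.union_comm, Finset.filter_union_filter_not_eq] at h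
    rw [← h]
    congr 1
    rw [Finset.prod_filter, Fintype.prod_prod_type]
    refine Finset.prod_congr rfl fun i _ => ?_
    rw [Matrix.transpose_apply, Matrix.of_apply, ← Finset.filter_ne', Finset.prod_filter]
    refine Finset.prod_congr rfl fun k _ => ?_
    simp only [eq_comm, ne_eq]
  · intro j
    rw [MvPowerSeries.X_def]
    intro h
    have := congrArg (MvPowerSeries.coeff (Finsupp.single (Sum.inr j) 1)) h
    simp at this
  · intro i j h
    exact Sum.inr_injective (MvPowerSeries.X_inj.1 h)

end Tables

/-! ### Young permutation characters -/

section YoungChar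

variable {B X : Type*}

theorem labelType_comp_perm (f : B → X) (σ : Perm B) : labelType (f ∘ σ) = labelType f := by
  funext a
  exact Nat.card_congr (σ.subtypeEquiv fun b => Iff.rfl)

/-- The permutation character of the symmetric group on the labellings of a given type. -/
noncomputable def youngChar (a : X → ℕ) (σ : Perm B) : ℂ :=
  (Nat.card {f : B → X // labelType f = a ∧ f ∘ σ = f} : ℂ)

/-- The permutation representation on the labellings of a given type. -/
noncomputable def youngRep (B : Type*) {X : Type*} (a : X → ℕ) :
    Representation ℂ (Perm B) ({f : B → X // labelType f = a} → ℂ) where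
  toFun σ := LinearMap.funLeft ℂ ℂ fun f => ⟨f.1 ∘ σ, (labelType_comp_perm f.1 σ).trans f.2⟩
  map_one' := rfl
  map_mul' _ _ := rfl

variable [Fintype B] [Fintype X]

theorem isChar_youngChar (a : X → ℕ) : IsChar (youngChar a : Perm B → ℂ) := by
  classical
  suffices key : (youngChar a : Perm B → ℂ) = (youngRep B a).character by
    rw [key]; exact isChar_character _
  funext σ
  change _ = LinearMap.trace ℂ _ (youngRep B a σ)
  rw [LinearMap.trace_eq_matrix_trace ℂ (Pi.basisFun ℂ _), Matrix.trace,
    youngChar]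
  have : ∀ f : {f : B → X // labelType f = a},
      (LinearMap.toMatrix (Pi.basisFun ℂ _) (Pi.basisFun ℂ _) (youngRep B a σ)).diag f =
        if f.1 ∘ σ = f.1 then 1 else 0 := by
    intro f
    rw [Matrix.diag_apply, LinearMap.toMatrix_apply, Pi.basisFun_repr, Pi.basisFun_apply]
    change (Pi.single f 1 : {f : B → X // labelType f = a} → ℂ)
      ⟨f.1 ∘ σ, (labelType_comp_perm f.1 σ).trans f.2⟩ = _
    rw [Pi.single_apply]
    exact if_congr Subtype.ext_iff rfl rfl
  rw [Finset.sum_congr rfl fun f _ => this f, Finset.sum_boole, ← Nat.subtype_card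
    (p := fun f : {f : B → X // labelType f = a} => f.1 ∘ σ = f.1) _ (by simp)]
  congr 1
  exact Nat.card_congr (subtypeSubtypeEquivSubtypeInter _ _).symm

omit [Fintype X] in
theorem labelType_fst {Y : Type*} [Fintype Y] (x : B → X × Y) (i : X) :
    labelType (fun b => (x b).1) i = ∑ j, labelType x (i, j) := by
  classical
  rw [labelType]
  simp only [labelType]
  rw [← Nat.card_sigma]
  refine Nat.card_congr ⟨fun b => ⟨(x b.1).2, b.1, Prod.ext b.2 rfl⟩,
    fun p => ⟨p.2.1, by rw [p.2.2]⟩, fun _ => rfl, ?_⟩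
  rintro ⟨j, b, hb⟩
  obtain rfl : (x b).2 = j := by rw [hb]
  rfl

theorem labelType_snd {Y : Type*} [Fintype Y] (x : B → X × Y) (j : Y) :
    labelType (fun b => (x b).2) j = ∑ i, labelType x (i, j) := by
  classical
  rw [labelType]
  simp only [labelType]
  rw [← Nat.card_sigma]
  refine Nat.card_congr ⟨fun b => ⟨(x b.1).1, b.1, Prod.ext rfl b.2⟩,
    fun p => ⟨p.2.1, by rw [p.2.2]⟩, fun _ => rfl, ?_⟩
  rintro ⟨j, b, hb⟩
  obtain rfl : (x b).1 = j := by rw [hb]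
  rfl

theorem youngChar_eq_zero {a : X → ℕ} (h : ∑ i, a i ≠ Nat.card B) :
    (youngChar a : Perm B → ℂ) = 0 := by
  funext σ
  rw [youngChar, Pi.zero_apply, Nat.cast_eq_zero]
  have : IsEmpty {f : B → X // labelType f = a ∧ f ∘ σ = f} :=
    ⟨fun f => h (by rw [← f.2.1, sum_labelType])⟩
  exact Nat.card_of_isEmpty

/-- A pair of labellings fixed by `σ` is one labelling by pairs fixed by `σ`, and its joint type is
a table with the given margins. Exchanging the sums, each table contributes the total of the
stabilizer orders of the labellings of that type, which is `|B|!`. -/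
theorem ip_youngChar {K : ℕ} {a : Fin K → ℕ} (a' : Fin K → ℕ) (ha : ∑ i, a i = Nat.card B) :
    ip (youngChar a : Perm B → ℂ) (youngChar a') = ((tables Finset.univ a a').ncard : ℂ) := by
  classical
  have hcard : (Nat.card (Perm B) : ℂ) ≠ 0 := Nat.cast_ne_zero.2 Nat.card_pos.ne'
  rw [ip_eq, inv_mul_eq_iff_eq_mul₀ hcard]
  let M : (B → Fin K × Fin K) → Prop := fun x =>
    labelType (fun b => (x b).1) = a ∧ labelType (fun b => (x b).2) = a'
  have h1 : ∀ σ : Perm B, youngChar a σ * youngChar a' σ⁻¹ =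
      ((∑ x : B → Fin K × Fin K, if M x ∧ x ∘ σ = x then 1 else 0 : ℕ) : ℂ) := by
    intro σ
    rw [youngChar, youngChar, ← Nat.cast_mul, ← Nat.card_prod, Finset.sum_boole,
      ← Nat.subtype_card (p := fun x : B → Fin K × Fin K => M x ∧ x ∘ σ = x) _ (by simp)]
    refine congrArg Nat.cast (Nat.card_congr
      ⟨fun p => ⟨fun b => (p.1.1 b, p.2.1 b), ⟨p.1.2.1, p.2.2.1⟩, ?_⟩,
       fun x => ⟨⟨fun b => (x.1 b).1, x.2.1.1, ?_⟩, ⟨fun b => (x.1 b).2, x.2.1.2, ?_⟩⟩,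
       fun _ => rfl, fun _ => rfl⟩)
    · funext b
      have e1 := congrFun p.1.2.2 b
      have e2 := congrFun p.2.2.2 (σ b)
      simp only [Function.comp_apply, show σ⁻¹ (σ b) = b from σ.symm_apply_apply b] at e1 e2
      simp only [Function.comp_apply, e1, ← e2]
    · funext b
      exact congrArg Prod.fst (congrFun x.2.2 b)
    · funext b
      have e2 := congrArg Prod.snd (congrFun x.2.2 (σ⁻¹ b))
      simp only [Function.comp_apply, show σ (σ⁻¹ b) = b from σ.apply_symm_apply b] at e2
      exact e2.symm
  rw [Finset.sum_congr rfl fun σ _ => h1 σ, ← Nat.cast_sum, ← Nat.cast_mul]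
  refine congrArg Nat.cast ?_
  rw [Finset.sum_comm]
  have h2 : ∀ x : B → Fin K × Fin K, (∑ σ : Perm B, if M x ∧ x ∘ σ = x then 1 else 0) =
      ∑ m ∈ (tables_finite Finset.univ a a').toFinset,
        if ∀ p, m p = labelType x p then Nat.card (labelStab x) else 0 := by
    intro x
    have hM : M x ↔ labelType x ∈ tables Finset.univ a a' := by
      simp only [M, tables, Set.mem_ofPred_eq, funext_iff, labelType_fst, labelType_snd]
      simp
    by_cases hx : M x
    · rw [Finset.sum_eq_single (labelType x)]
      · simp only [implies_true, if_true, hx, true_and, Finset.sum_boole]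
        rw [← Nat.subtype_card (p := fun σ : Perm B => x ∘ σ = x) _ (by simp)]
        refine Nat.card_congr (subtypeEquivRight fun σ => ?_)
        rw [funext_iff]; rfl
      · intro m _ hm
        rw [if_neg fun h => hm (funext h)]
      · intro h
        exact absurd ((Set.Finite.mem_toFinset _).2 (hM.1 hx)) h
    · simp only [hx, false_and, if_false, Finset.sum_const_zero]
      symm
      refine Finset.sum_eq_zero fun m hm => ?_
      rw [if_neg]
      intro h
      obtain rfl : m = labelType x := funext h
      exact hx (hM.2 ((Set.Finite.mem_toFinset _).1 hm))
  rw [Finset.sum_congr rfl fun x _ => h2 x, Finset.sum_comm]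
  have h3 : ∀ m ∈ (tables_finite Finset.univ a a').toFinset,
      (∑ x : B → Fin K × Fin K, if ∀ p, m p = labelType x p then Nat.card (labelStab x) else 0) =
        (Nat.card B).factorial := by
    intro m hm
    apply sum_card_labelStab
    rw [Fintype.sum_prod_type, ← ha]
    exact Finset.sum_congr rfl fun i _ => ((Set.Finite.mem_toFinset _).1 hm).2.1 i
  rw [Finset.sum_congr rfl h3, Finset.sum_const, smul_eq_mul, mul_comm, Nat.card_perm,
    ← Set.ncard_eq_toFinset_card _ (tables_finite _ _ _)]

theorem card_labelStab (x : B → X) : Nat.card (labelStab x) = ∏ a, (labelType x a).factorial := by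
  rw [Nat.card_congr (labelStabEquiv x).toEquiv, Nat.card_pi]
  exact Finset.prod_congr rfl fun a _ => Nat.card_perm

theorem youngChar_one_mul {a : X → ℕ} (ha : ∑ i, a i = Nat.card B) :
    (youngChar a : Perm B → ℂ) 1 * ∏ i, ((a i).factorial : ℂ) = ((Nat.card B).factorial : ℂ) := by
  classical
  rw [← sum_card_labelStab a ha, youngChar, ← Nat.cast_prod, ← Nat.cast_mul]
  refine congrArg Nat.cast ?_
  have : ∀ x : B → X, (if ∀ i, a i = labelType x i then Nat.card (labelStab x) else 0) =
      if labelType x = a then ∏ i, (a i).factorial else 0 := by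
    intro x
    by_cases h : labelType x = a
    · subst h
      simp only [implies_true, if_true, card_labelStab]
    · rw [if_neg h, if_neg fun h' => h (funext h').symm]
  rw [Finset.sum_congr rfl fun x _ => this x, ← Finset.sum_filter, Finset.sum_const, smul_eq_mul]
  congr 1
  rw [← Nat.subtype_card (p := fun x : B → X => labelType x = a) _ (by simp)]
  exact Nat.card_congr (subtypeEquivRight fun f => by simp)

end YoungChar

/-! ### Jacobi–Trudi sums and the irreducible characters of symmetric groups -/

section Alternant

variable {K : ℕ} {B : Type*} [Fintype B]

/-- The sign of `w`, or zero if the exponent `b - w` is not defined. -/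
def altSign (b : Fin K → ℕ) (w : Perm (Fin K)) : ℤ :=
  if ∀ i, (w i : ℕ) ≤ b i then Perm.sign w else 0

/-- The Jacobi–Trudi alternating sum of permutation characters attached to a sequence of first
column hook lengths. -/
noncomputable def altChar (b : Fin K → ℕ) : Perm B → ℂ :=
  ∑ w : Perm (Fin K), (altSign b w : ℂ) • youngChar fun i => b i - (w i : ℕ)

theorem isVirtual_altChar (b : Fin K → ℕ) : IsVirtual (altChar b : Perm B → ℂ) :=
  IsVirtual.sum _ _ _ fun _ _ => (isChar_youngChar _).isVirtual

theorem sum_perm_val (w : Perm (Fin K)) : ∑ i, (w i : ℕ) = ∑ i : Fin K, (i : ℕ) :=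
  Equiv.sum_comp w fun i => (i : ℕ)

theorem sum_sub_perm {b : Fin K → ℕ} {w : Perm (Fin K)} (hw : ∀ i, (w i : ℕ) ≤ b i) :
    ∑ i, (b i - (w i : ℕ)) + ∑ i : Fin K, (i : ℕ) = ∑ i, b i := by
  rw [← sum_perm_val w, ← Finset.sum_add_distrib]
  exact Finset.sum_congr rfl fun i _ => Nat.sub_add_cancel (hw i)

theorem det_vandermonde_eq_sum {R : Type*} [CommRing R] (v : Fin K → R) :
    (Matrix.vandermonde v).det = ∑ w : Perm (Fin K), ((Perm.sign w : ℤ) : R) *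
      ∏ i, v i ^ (w i : ℕ) := by
  rw [← Matrix.det_transpose, Matrix.det_apply']
  rfl

theorem prod_X_pow {σ : Type*} {R : Type*} [CommRing R] (t : Fin K → σ) (w : Fin K → ℕ) :
    (∏ i, (MvPowerSeries.X (t i) : MvPowerSeries σ R) ^ w i) =
      MvPowerSeries.monomial (∑ i, Finsupp.single (t i) (w i)) 1 := by
  classical
  have h : ∀ s : Finset (Fin K), (∏ i ∈ s, (MvPowerSeries.X (t i) : MvPowerSeries σ R) ^ w i) =
      MvPowerSeries.monomial (∑ i ∈ s, Finsupp.single (t i) (w i)) 1 := by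
    intro s
    induction s using Finset.induction_on with
    | empty => simp [MvPowerSeries.monomial_zero_one]
    | insert i s hi ih =>
      rw [Finset.prod_insert hi, Finset.sum_insert hi, ih, MvPowerSeries.X_pow_eq,
        MvPowerSeries.monomial_mul_monomial, one_mul]
  exact h _

/-- Multiplying a generating series by the Vandermonde determinant performs on its coefficients the
alternating sum that defines `altChar`. -/
theorem coeff_vandermonde_mul {R : Type*} [CommRing R] {σ : Type*} {t : Fin K → σ}
    (ht : Function.Injective t) (Q : MvPowerSeries σ R) (c : σ →₀ ℕ) :
    MvPowerSeries.coeff c ((Matrix.vandermonde fun i => (MvPowerSeries.X (t i) :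
      MvPowerSeries σ R)).det * Q) =
    ∑ w : Perm (Fin K), (altSign (fun i => c (t i)) w : R) *
      MvPowerSeries.coeff (c - ∑ i, Finsupp.single (t i) (w i : ℕ)) Q := by
  classical
  rw [det_vandermonde_eq_sum, Finset.sum_mul, map_sum]
  refine Finset.sum_congr rfl fun w _ => ?_
  have hC : ((Perm.sign w : ℤ) : MvPowerSeries σ R) = MvPowerSeries.C ((Perm.sign w : ℤ) : R) := by
    simp
  rw [hC, mul_assoc, MvPowerSeries.coeff_C_mul, prod_X_pow, MvPowerSeries.coeff_monomial_mul,
    altSign]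
  have hle : (∑ i, Finsupp.single (t i) (w i : ℕ)) ≤ c ↔ ∀ i, (w i : ℕ) ≤ c (t i) := by
    have hs : ∀ i, (∑ j, Finsupp.single (t j) (w j : ℕ)) (t i) = (w i : ℕ) := fun i => by
      rw [Finsupp.finsetSum_apply, Finset.sum_eq_single i]
      · simp
      · intro j _ hj
        rw [Finsupp.single_apply, if_neg fun h => hj (ht h)]
      · simp
    constructor
    · intro h i
      rw [← hs i]
      exact h _
    · intro h s
      by_cases h1 : ∃ i, t i = s
      · obtain ⟨i, rfl⟩ := h1
        rw [hs]; exact h i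
      · rw [Finsupp.finsetSum_apply, Finset.sum_eq_zero]
        · exact Nat.zero_le _
        · intro j _
          rw [Finsupp.single_apply, if_neg fun h => h1 ⟨j, h⟩]
  by_cases h : ∀ i, (w i : ℕ) ≤ c (t i)
  · rw [if_pos (hle.2 h), if_pos h, one_mul]
  · rw [if_neg (fun h' => h (hle.1 h')), if_neg h]
    simp

theorem sum_single_apply {σ : Type*} {t : Fin K → σ} (ht : Function.Injective t) (w : Fin K → ℕ)
    (i : Fin K) : (∑ j, Finsupp.single (t j) (w j)) (t i) = w i := by
  classical
  rw [Finsupp.finsetSum_apply, Finset.sum_eq_single i]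
  · simp
  · intro j _ hj
    rw [Finsupp.single_apply, if_neg fun h => hj (ht h)]
  · simp

theorem sum_single_apply_of_ne {σ : Type*} {t : Fin K → σ} (w : Fin K → ℕ) {s : σ}
    (hs : ∀ i, t i ≠ s) : (∑ j, Finsupp.single (t j) (w j)) s = 0 := by
  classical
  rw [Finsupp.finsetSum_apply, Finset.sum_eq_zero]
  intro j _
  rw [Finsupp.single_apply, if_neg (hs j)]

/-- The margins of a table supported on the graph of `w` force `b' ∘ w = b`. Since both sequences
increase strictly, `w` is then increasing, hence the identity. -/
theorem ncard_tables_perm {b b' : Fin K → ℕ} (hb : StrictMono b) (hb' : StrictMono b')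
    (w : Perm (Fin K)) :
    (tables (Finset.univ.filter fun p => w p.1 = p.2) b b').ncard =
      if w = 1 ∧ b = b' then 1 else 0 := by
  classical
  have key : ∀ m ∈ tables (Finset.univ.filter fun p => w p.1 = p.2) b b', ∀ i,
      m (i, w i) = b i ∧ b' (w i) = b i := by
    rintro m ⟨h1, h2, h3⟩ i
    have e1 : m (i, w i) = b i := by
      rw [← h2 i, Finset.sum_eq_single (w i)]
      · intro j _ hj
        exact h1 _ (by simpa using fun h => hj h.symm)
      · simp
    refine ⟨e1, ?_⟩
    rw [← e1, ← h3 (w i), Finset.sum_eq_single i]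
    · intro j _ hj
      exact h1 _ (by simpa using hj)
    · simp
  split_ifs with h
  · obtain ⟨rfl, rfl⟩ := h
    rw [Set.ncard_eq_one]
    refine ⟨fun p => if p.1 = p.2 then b p.1 else 0, Set.eq_singleton_iff_unique_mem.2 ⟨?_, ?_⟩⟩
    · refine ⟨fun p hp => ?_, fun i => ?_, fun i => ?_⟩
      · have : p.1 ≠ p.2 := fun h => hp (by rw [Finset.mem_filter]; exact ⟨Finset.mem_univ _, h⟩)
        exact if_neg this
      · simp
      · simp
    · intro m hm
      funext ⟨i, j⟩
      by_cases hij : i = j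
      · subst hij; simpa using (key m hm i).1
      · rw [if_neg hij]
        exact hm.1 _ fun h => hij (Finset.mem_filter.1 h).2
  · rw [Set.ncard_eq_zero (tables_finite _ _ _), Set.eq_empty_iff_forall_notMem]
    intro m hm
    apply h
    have h1 : ∀ i, b' (w i) = b i := fun i => (key m hm i).2
    have hw : StrictMono w := fun i j hij => by
      rw [← hb'.lt_iff_lt, h1, h1]; exact hb hij
    have h2 : w = 1 := by
      have := Subsingleton.elim (hw.orderIsoOfSurjective w w.surjective) (OrderIso.refl _)
      ext i
      exact congrArg (fun e : Fin K ≃o Fin K => (e i : ℕ)) this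
    subst h2
    exact ⟨rfl, funext fun i => (h1 i).symm⟩

/-- By `ip_youngChar` the inner product is a coefficient of the product of both Vandermonde
determinants with the series of all tables. Cauchy's identity rewrites that product as a signed sum
over permutations, of which only the identity contributes. -/
theorem ip_altChar {b b' : Fin K → ℕ} (hb : StrictMono b) (hb' : StrictMono b')
    (hn : ∑ i, b i = Nat.card B + ∑ i : Fin K, (i : ℕ)) :
    ip (altChar b : Perm B → ℂ) (altChar b') = if b = b' then 1 else 0 := by
  classical
  have h1 : ip (altChar b : Perm B → ℂ) (altChar b') =
      ((∑ w : Perm (Fin K), altSign b w * ∑ w' : Perm (Fin K), altSign b' w' *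
        ((tables Finset.univ (fun i => b i - (w i : ℕ)) (fun i => b' i - (w' i : ℕ))).ncard : ℤ) : ℤ) :
        ℂ) := by
    rw [altChar, ip_sum_left, Int.cast_sum]
    refine Finset.sum_congr rfl fun w _ => ?_
    rw [ip_smul_left, Int.cast_mul]
    by_cases hw : ∀ i, (w i : ℕ) ≤ b i
    · congr 1
      rw [altChar, ip_sum_right, Int.cast_sum]
      refine Finset.sum_congr rfl fun w' _ => ?_
      rw [ip_smul_right, Int.cast_mul, ip_youngChar]
      · rfl
      · have := sum_sub_perm hw
        omega
    · simp [altSign, hw]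
  rw [h1]
  let c : Fin K ⊕ Fin K →₀ ℕ := Finsupp.equivFunOnFinite.symm (Sum.elim b b')
  have h2 := congrArg (MvPowerSeries.coeff c) (vandermonde_mul_tableSeries (K := K))
  rw [mul_assoc, coeff_vandermonde_mul Sum.inl_injective] at h2
  have hl : ∀ w : Perm (Fin K), ∀ i, (c - ∑ i, Finsupp.single (Sum.inl i) (w i : ℕ) : Fin K ⊕ Fin K →₀ ℕ) (Sum.inl i) =
      b i - (w i : ℕ) := fun w i => by
    rw [Finsupp.tsub_apply, sum_single_apply Sum.inl_injective]; rfl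
  have hr : ∀ w : Perm (Fin K), ∀ i, (c - ∑ i, Finsupp.single (Sum.inl i) (w i : ℕ) : Fin K ⊕ Fin K →₀ ℕ) (Sum.inr i) =
      b' i := fun w i => by
    rw [Finsupp.tsub_apply, sum_single_apply_of_ne _ (by simp)]; rfl
  have h3 : ∀ w : Perm (Fin K), MvPowerSeries.coeff (c - ∑ i, Finsupp.single (Sum.inl i) (w i : ℕ))
      ((Matrix.vandermonde fun i : Fin K => (MvPowerSeries.X (Sum.inr i) :
      MvPowerSeries (Fin K ⊕ Fin K) ℤ)).det * tableSeries Finset.univ) =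
      ∑ w' : Perm (Fin K), altSign b' w' *
        ((tables Finset.univ (fun i => b i - (w i : ℕ)) (fun i => b' i - (w' i : ℕ))).ncard : ℤ) := by
    intro w
    rw [coeff_vandermonde_mul Sum.inr_injective]
    simp only [hr]
    refine Finset.sum_congr rfl fun w' _ => ?_
    congr 1
    rw [coeff_tableSeries]
    congr 3
    · funext i
      rw [Finsupp.tsub_apply, hl, sum_single_apply_of_ne _ (by simp)]; rfl
    · funext i
      rw [Finsupp.tsub_apply, hr, sum_single_apply Sum.inr_injective]
  simp only [h3] at h2
  have hb0 : (fun i => c (Sum.inl i)) = b := rfl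
  have hb0' : (fun i => c (Sum.inr i)) = b' := rfl
  rw [hb0] at h2
  simp only [Int.cast_id] at h2
  rw [h2, map_sum]
  have h4 : ∀ w : Perm (Fin K), MvPowerSeries.coeff c (((Perm.sign w : ℤ) :
      MvPowerSeries (Fin K ⊕ Fin K) ℤ) *
      tableSeries (Finset.univ.filter fun p => w p.1 = p.2)) =
      (Perm.sign w : ℤ) * if w = 1 ∧ b = b' then 1 else 0 := by
    intro w
    have hC : ((Perm.sign w : ℤ) : MvPowerSeries (Fin K ⊕ Fin K) ℤ) =
      MvPowerSeries.C (Perm.sign w : ℤ) := by simp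
    rw [hC, MvPowerSeries.coeff_C_mul, coeff_tableSeries, hb0, hb0', ncard_tables_perm hb hb']
    push_cast
    rfl
  rw [Finset.sum_congr rfl fun w _ => h4 w, Finset.sum_eq_single 1]
  · simp
  · intro w _ hw
    simp [hw]
  · simp

/-- After multiplication by `∏ (b i)!`, the term of `w` becomes `|B|!` times a product of descending
factorials; when `w i > b i` for some `i`, both sides vanish. The sum is a determinant in the monic
polynomials `descPochhammer`, hence a Vandermonde determinant. -/
theorem altChar_one_mul {b : Fin K → ℕ} (hn : ∑ i, b i = Nat.card B + ∑ i : Fin K, (i : ℕ)) :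
    (altChar b : Perm B → ℂ) 1 * ∏ i, ((b i).factorial : ℂ) =
      ((Nat.card B).factorial : ℂ) * ∏ i, ∏ j ∈ Finset.Ioi i, ((b j : ℂ) - b i) := by
  classical
  have hd : (Matrix.of fun i j : Fin K => (((b i).descFactorial j : ℕ) : ℂ)).det =
      ∏ i, ∏ j ∈ Finset.Ioi i, ((b j : ℂ) - b i) := by
    rw [← Matrix.det_vandermonde, Matrix.det_eval_matrixOfPolynomials_eq_det_vandermonde
      (fun i => (b i : ℂ)) (fun j => descPochhammer ℂ j)]
    · congr 1
      ext i j
      rw [Matrix.of_apply, Matrix.of_apply, descPochhammer_eval_eq_descFactorial]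
    · exact fun i => descPochhammer_natDegree _ _
    · exact fun i => monic_descPochhammer _ _
  rw [← hd, ← Matrix.det_transpose, Matrix.det_apply', altChar, Finset.sum_apply, Finset.sum_mul,
    Finset.mul_sum]
  refine Finset.sum_congr rfl fun w _ => ?_
  simp only [Pi.smul_apply, smul_eq_mul, Matrix.transpose_apply, Matrix.of_apply]
  by_cases hw : ∀ i, (w i : ℕ) ≤ b i
  · have h1 : ∑ i, (b i - (w i : ℕ)) = Nat.card B := by
      have := sum_sub_perm hw
      omega
    have h2 : ∏ i, ((b i).factorial : ℂ) = (∏ i, ((b i - (w i : ℕ)).factorial : ℂ)) *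
        ∏ i, (((b i).descFactorial (w i) : ℕ) : ℂ) := by
      rw [← Finset.prod_mul_distrib]
      refine Finset.prod_congr rfl fun i _ => ?_
      rw [← Nat.cast_mul, Nat.factorial_mul_descFactorial (hw i)]
    rw [h2, altSign, if_pos hw, ← youngChar_one_mul h1]
    ring
  · rw [altSign, if_neg hw]
    push Not at hw
    obtain ⟨i, hi⟩ := hw
    rw [Finset.prod_eq_zero (Finset.mem_univ i) (f := fun i => (((b i).descFactorial (w i) : ℕ) : ℂ))]
    · simp
    · rw [Nat.descFactorial_of_lt hi, Nat.cast_zero]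

theorem altChar_one_eq_int (b : Fin K → ℕ) : ∃ z : ℤ, (altChar b : Perm B → ℂ) 1 = z := by
  refine ⟨∑ w : Perm (Fin K), altSign b w *
    (Nat.card {f : B → Fin K // labelType f = (fun i => b i - (w i : ℕ)) ∧ f ∘ (1 : Perm B) = f} : ℤ),
    ?_⟩
  rw [altChar, Finset.sum_apply]
  push_cast
  rfl

/-- The sum is a virtual character of norm one, and the degree formula shows that its value at 1 is
positive because `b` increases. -/
theorem exists_irr_altChar {b : Fin K → ℕ} (hb : StrictMono b)
    (hn : ∑ i, b i = Nat.card B + ∑ i : Fin K, (i : ℕ)) :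
    ∃ χ : Irr (Perm B), χ.toFun = altChar b := by
  obtain ⟨z, hz⟩ := altChar_one_eq_int (B := B) b
  have h := altChar_one_mul (B := B) hn
  rw [hz] at h
  have h' : z * ∏ i, ((b i).factorial : ℤ) =
      ((Nat.card B).factorial : ℤ) * ∏ i, ∏ j ∈ Finset.Ioi i, ((b j : ℤ) - b i) := by
    exact_mod_cast h
  have hpos : 0 < z * ∏ i, ((b i).factorial : ℤ) := by
    rw [h']
    refine mul_pos (by exact_mod_cast Nat.factorial_pos _) (Finset.prod_pos fun i _ =>
      Finset.prod_pos fun j hj => ?_)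
    have := hb (Finset.mem_Ioi.1 hj)
    omega
  have hz0 : 0 < z := pos_of_mul_pos_left hpos
    (Finset.prod_nonneg fun i _ => by exact_mod_cast Nat.zero_le _)
  lift z to ℕ using hz0.le
  exact (isVirtual_altChar b).exists_irr (by rw [ip_altChar hb hb hn, if_pos rfl]) (by simpa using hz)

theorem youngChar_comp_perm (a : Fin K → ℕ) (t : Perm (Fin K)) :
    (youngChar (a ∘ t) : Perm B → ℂ) = youngChar a := by
  funext σ
  rw [youngChar, youngChar]
  have hl : ∀ f : B → Fin K, labelType (t ∘ f) = a ↔ labelType f = a ∘ t := by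
    intro f
    have h1 : ∀ i, labelType (t ∘ f) (t i) = labelType f i := fun i =>
      Nat.card_congr (subtypeEquivRight fun b => t.injective.eq_iff)
    constructor
    · rintro rfl
      exact funext fun i => (h1 i).symm
    · intro h
      funext i
      obtain ⟨j, rfl⟩ := t.surjective i
      rw [h1, h]; rfl
  refine congrArg Nat.cast (Nat.card_congr
    (Equiv.subtypeEquiv (Equiv.arrowCongr (Equiv.refl B) t) fun f => ?_))
  refine and_congr (hl f).symm ?_
  constructor
  · intro h
    funext b
    exact congrArg t (congrFun h b)
  · intro h
    funext b
    exact t.injective (congrFun h b)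

/-- This antisymmetry lets arbitrary exponent sequences be sorted, and annihilates those with a
repeated entry. -/
theorem altChar_comp_perm (b : Fin K → ℕ) (t : Perm (Fin K)) :
    (altChar (b ∘ t) : Perm B → ℂ) = ((Perm.sign t : ℤ) : ℂ) • altChar b := by
  rw [altChar, altChar, Finset.smul_sum]
  refine Fintype.sum_equiv (Equiv.mulRight t⁻¹) _ _ fun w => ?_
  have h1 : (fun i => (b ∘ t) i - (w i : ℕ)) =
      (fun i => b i - ((Equiv.mulRight t⁻¹ w) i : ℕ)) ∘ t := by
    funext i
    simp
  rw [h1, youngChar_comp_perm, smul_smul]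
  congr 1
  rw [altSign, altSign]
  have h2 : (∀ i, (w i : ℕ) ≤ (b ∘ t) i) ↔ ∀ i, ((Equiv.mulRight t⁻¹ w) i : ℕ) ≤ b i := by
    rw [← t.forall_congr_right (q := fun i => ((Equiv.mulRight t⁻¹ w) i : ℕ) ≤ b i)]
    simp
  by_cases h : ∀ i, (w i : ℕ) ≤ (b ∘ t) i
  · rw [if_pos h, if_pos (h2.1 h), ← Int.cast_mul]
    simp only [coe_mulRight, map_mul, map_inv]
    rcases Int.units_eq_one_or (Perm.sign t) with h | h <;> simp [h]
  · rw [if_neg h, if_neg fun h' => h (h2.2 h')]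
    simp

/-- A character `ψ` missed by the construction is orthogonal to every `altChar b`: sort `b`, or note
that the sum vanishes when entries repeat or the size is wrong. Hence the series of its
multiplicities in Young characters is annihilated by a Vandermonde determinant, so it is zero in a
domain. Yet `ψ` occurs in the regular character, which is a Young character. -/
theorem exists_strictMono_altChar_eq (hK : Nat.card B ≤ K) (ψ : Irr (Perm B)) :
    ∃ b : Fin K → ℕ, StrictMono b ∧ ∑ i, b i = Nat.card B + ∑ i : Fin K, (i : ℕ) ∧
      ψ.toFun = altChar b := by
  classical
  by_contra hcon
  have h0 : ∀ b : Fin K → ℕ, StrictMono b → ∑ i, b i = Nat.card B + ∑ i : Fin K, (i : ℕ) →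
      ip (altChar b) ψ.toFun = 0 := by
    intro b hb hn
    obtain ⟨χ, hχ⟩ := exists_irr_altChar (B := B) hb hn
    rw [← hχ]
    apply Irr.ip_ne
    rintro rfl
    exact hcon ⟨b, hb, hn, hχ⟩
  have h1 : ∀ b : Fin K → ℕ, ip (altChar b) ψ.toFun = 0 := by
    intro b
    by_cases hn : ∑ i, b i = Nat.card B + ∑ i : Fin K, (i : ℕ)
    · by_cases hinj : Function.Injective b
      · have hs := (Tuple.monotone_sort b).strictMono_of_injective
          (hinj.comp (Tuple.sort b).injective)
        have := h0 _ hs (by rw [← hn]; exact Equiv.sum_comp _ b)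
        rw [altChar_comp_perm, ip_smul_left] at this
        rcases mul_eq_zero.1 this with h | h
        · exfalso
          rcases Int.units_eq_one_or (Perm.sign (Tuple.sort b)) with h' | h' <;> simp [h'] at h
        · exact h
      · rw [Function.not_injective_iff] at hinj
        obtain ⟨i, j, hij, hne⟩ := hinj
        have h := altChar_comp_perm (B := B) b (Equiv.swap i j)
        have hb : b ∘ Equiv.swap i j = b := by
          funext k
          rw [Function.comp_apply, Equiv.swap_apply_def]
          split_ifs with h1 h2
          · rw [h1, hij]
          · rw [h2, hij]
          · rfl
        rw [hb, Perm.sign_swap hne] at h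
        have h2 := congrArg (fun f => ip f ψ.toFun) h
        simp only [ip_smul_left] at h2
        push_cast at h2
        linear_combination h2 / 2
    · have : (altChar b : Perm B → ℂ) = 0 := by
        rw [altChar]
        refine Finset.sum_eq_zero fun w _ => ?_
        by_cases hw : ∀ i, (w i : ℕ) ≤ b i
        · rw [youngChar_eq_zero, smul_zero]
          have := sum_sub_perm hw
          omega
        · simp [altSign, hw]
      rw [this, ip_zero_left]
  let Q : MvPowerSeries (Fin K) ℂ := fun c => ip (youngChar fun i => c i : Perm B → ℂ) ψ.toFun
  have hQ : Q = 0 := by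
    have : IsDomain (MvPowerSeries (Fin K) ℂ) := NoZeroDivisors.to_isDomain _
    have hV : (Matrix.vandermonde fun i => (MvPowerSeries.X i : MvPowerSeries (Fin K) ℂ)).det ≠ 0 :=
      Matrix.det_vandermonde_ne_zero_iff.2 fun i j h => MvPowerSeries.X_inj.1 h
    refine (mul_eq_zero.1 (?_ : _ * Q = 0)).resolve_left hV
    ext c
    rw [show (Matrix.vandermonde fun i => (MvPowerSeries.X i : MvPowerSeries (Fin K) ℂ)) =
      Matrix.vandermonde fun i => MvPowerSeries.X (id i) from rfl,
      coeff_vandermonde_mul Function.injective_id, MvPowerSeries.coeff_zero,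
      ← h1 fun i => c i, altChar, ip_sum_left]
    refine Finset.sum_congr rfl fun w _ => ?_
    rw [ip_smul_left]
    congr 1
    change ip (youngChar _) _ = _
    congr 2
    funext i
    rw [Finsupp.tsub_apply]
    congr 1
    exact sum_single_apply (t := id) Function.injective_id _ i
  -- Here `|B| ≤ K` enters: only the identity fixes an injective labelling, so the Young character
  -- of its type vanishes off 1.
  obtain ⟨f0⟩ : Nonempty (B ↪ Fin K) := by
    rw [Function.Embedding.nonempty_iff_card_le, Fintype.card_fin, ← Nat.card_eq_fintype_card]
    exact hK
  have h2 : ip (youngChar (labelType f0) : Perm B → ℂ) ψ.toFun = 0 :=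
    congrArg (MvPowerSeries.coeff (Finsupp.equivFunOnFinite.symm (labelType f0))) hQ
  have hle : ∀ i, labelType f0 i ≤ 1 := fun i => by
    rw [labelType, Finite.card_le_one_iff_subsingleton]
    exact ⟨fun p q => Subtype.ext (f0.injective (p.2.trans q.2.symm))⟩
  have hinj : ∀ f : B → Fin K, labelType f = labelType f0 → Function.Injective f := by
    intro f hf b b' h
    have := hle (f b)
    rw [← hf, labelType, Finite.card_le_one_iff_subsingleton] at this
    exact congrArg Subtype.val (this.elim ⟨b, rfl⟩ ⟨b', h.symm⟩)
  rw [ip_eq, Finset.sum_eq_single 1] at h2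
  · rcases mul_eq_zero.1 h2 with h | h
    · exact inv_ne_zero (Nat.cast_ne_zero.2 Nat.card_pos.ne') h
    · rcases mul_eq_zero.1 h with h | h
      · rw [youngChar, Nat.cast_eq_zero] at h
        have : Nonempty {f : B → Fin K // labelType f = labelType f0 ∧ f ∘ (1 : Perm B) = f} :=
          ⟨⟨f0, rfl, rfl⟩⟩
        exact Nat.card_pos.ne' h
      · rw [inv_one, ← ψ.degree_eq, Nat.cast_eq_zero] at h
        exact ψ.degree_pos.ne' h
  · intro σ _ hσ
    rw [youngChar]
    have : IsEmpty {f : B → Fin K // labelType f = labelType f0 ∧ f ∘ σ = f} := by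
      refine ⟨fun f => hσ ?_⟩
      ext b
      exact hinj f.1 f.2.1 (congrFun f.2.2 b)
    rw [Nat.card_of_isEmpty, Nat.cast_zero, zero_mul]
  · simp

/-- The classification of the irreducible characters of a symmetric group by sequences of first
column hook lengths, and the hook formula in Frobenius' form. -/
theorem exists_irr_perm_equiv (hK : Nat.card B ≤ K) :
    ∃ e : {b : Fin K → ℕ // StrictMono b ∧ ∑ i, b i = Nat.card B + ∑ i : Fin K, (i : ℕ)} ≃
        Irr (Perm B),
      ∀ b, (e b).degree * ∏ i, (b.1 i).factorial =
        (Nat.card B).factorial * ∏ i, ∏ j ∈ Finset.Ioi i, (b.1 j - b.1 i) := by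
  classical
  have h : ∀ b : {b : Fin K → ℕ // StrictMono b ∧ ∑ i, b i = Nat.card B + ∑ i : Fin K, (i : ℕ)},
      ∃ χ : Irr (Perm B), χ.toFun = altChar b.1 := fun b => exists_irr_altChar b.2.1 b.2.2
  choose e he using h
  refine ⟨Equiv.ofBijective e ⟨?_, ?_⟩, fun b => ?_⟩
  · intro b b' hbb
    have h1 := ip_altChar (B := B) b.2.1 b'.2.1 b.2.2
    rw [← he b, ← he b', hbb, Irr.ip_self] at h1
    by_contra hne
    rw [if_neg fun h => hne (Subtype.ext h)] at h1
    exact one_ne_zero h1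
  · intro ψ
    obtain ⟨b, hb, hn, hψ⟩ := exists_strictMono_altChar_eq hK ψ
    exact ⟨⟨b, hb, hn⟩, Irr.ext ((he _).trans hψ.symm)⟩
  · have h1 := altChar_one_mul (B := B) b.2.2
    rw [← he b, ← Irr.degree_eq] at h1
    apply Nat.cast_injective (R := ℂ)
    push_cast
    refine h1.trans ?_
    congr 1
    refine Finset.prod_congr rfl fun i _ => Finset.prod_congr rfl fun j hj => ?_
    rw [Nat.cast_sub (b.2.1 (Finset.mem_Ioi.1 hj)).le]

end Alternant

/-! ### First column hook lengths and the hook formula -/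

section BetaSets

/-- The size of the partition with the given set of first column hook lengths. -/
def betaSize (X : Finset ℕ) : ℕ := ∑ y ∈ X, (Finset.range y \ X).card

/-- The defect of the character with the given set of first column hook lengths: the valuation of
the product of the hook lengths. -/
def betaDefect (ℓ : ℕ) (X : Finset ℕ) : ℕ :=
  ∑ y ∈ X, ∑ x ∈ Finset.range y \ X, padicValNat ℓ (y - x)

theorem sum_card_filter_lt (X : Finset ℕ) :
    ∑ y ∈ X, (X ∩ Finset.range y).card = ∑ i ∈ Finset.range X.card, i := by
  induction X using Finset.induction_on_max with
  | empty => simp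
  | insert a X ha ih =>
    have ha' : a ∉ X := fun h => lt_irrefl _ (ha a h)
    rw [Finset.sum_insert ha', Finset.card_insert_of_notMem ha', Finset.sum_range_succ, ← ih,
      add_comm]
    congr 1
    · refine Finset.sum_congr rfl fun y hy => ?_
      rw [Finset.insert_inter_of_notMem]
      rw [Finset.mem_range]
      exact (ha y hy).le.not_gt
    · rw [Finset.insert_inter_of_notMem (by simp), Finset.inter_eq_left.2]
      exact fun x hx => Finset.mem_range.2 (ha x hx)

theorem sum_eq_betaSize_add (X : Finset ℕ) :
    ∑ y ∈ X, y = betaSize X + ∑ i ∈ Finset.range X.card, i := by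
  rw [← sum_card_filter_lt, betaSize, ← Finset.sum_add_distrib]
  refine Finset.sum_congr rfl fun y _ => ?_
  rw [Finset.inter_comm, Finset.card_sdiff_add_card_inter, Finset.card_range]

/-- In `y! = ∏ (y - x)` over `x < y`, the factors with `x ∈ X` form the Vandermonde product and
those with `x ∉ X` are hook lengths. Frobenius' degree formula thereby becomes the hook formula. -/
theorem prod_factorial_eq (X : Finset ℕ) :
    ∏ y ∈ X, y.factorial = (∏ y ∈ X, ∏ x ∈ Finset.range y \ X, (y - x)) *
      ∏ y ∈ X, ∏ x ∈ X ∩ Finset.range y, (y - x) := by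
  rw [← Finset.prod_mul_distrib]
  refine Finset.prod_congr rfl fun y _ => ?_
  rw [← Nat.descFactorial_self, Nat.descFactorial_eq_prod_range, Finset.inter_comm, mul_comm,
    Finset.prod_inter_mul_prod_sdiff]

theorem betaDefect_eq_padicValNat {ℓ : ℕ} (hℓ : ℓ.Prime) (X : Finset ℕ) :
    betaDefect ℓ X = padicValNat ℓ (∏ y ∈ X, ∏ x ∈ Finset.range y \ X, (y - x)) := by
  have h0 : ∀ y, ∀ x ∈ Finset.range y \ X, y - x ≠ 0 := fun y x hx => by
    have := Finset.mem_range.1 (Finset.mem_sdiff.1 hx).1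
    omega
  rw [betaDefect, ← Nat.factorization_def _ hℓ, Nat.factorization_prod_apply
    fun y _ => Finset.prod_ne_zero_iff.2 (h0 y)]
  refine Finset.sum_congr rfl fun y _ => ?_
  rw [Nat.factorization_prod_apply (h0 y)]
  exact Finset.sum_congr rfl fun x _ => (Nat.factorization_def _ hℓ).symm

theorem image_strictMono_prod {K : ℕ} {b : Fin K → ℕ} (hb : StrictMono b) :
    ∏ i, ∏ j ∈ Finset.Ioi i, (b j - b i) = ∏ y ∈ Finset.univ.image b,
      ∏ x ∈ Finset.univ.image b ∩ Finset.range y, (y - x) := by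
  rw [Finset.prod_image fun i _ j _ h => hb.injective h]
  have h1 : ∀ j, ∏ x ∈ Finset.univ.image b ∩ Finset.range (b j), (b j - x) =
      ∏ i ∈ Finset.Iio j, (b j - b i) := by
    intro j
    have : Finset.univ.image b ∩ Finset.range (b j) = (Finset.Iio j).image b := by
      ext x
      simp only [Finset.mem_inter, Finset.mem_image, Finset.mem_univ, true_and, Finset.mem_range,
        Finset.mem_Iio]
      constructor
      · rintro ⟨⟨i, rfl⟩, h⟩
        exact ⟨i, hb.lt_iff_lt.1 h, rfl⟩
      · rintro ⟨i, h, rfl⟩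
        exact ⟨⟨i, rfl⟩, hb h⟩
    rw [this, Finset.prod_image fun i _ j _ h => hb.injective h]
  rw [Finset.prod_congr rfl fun j _ => h1 j]
  exact Finset.prod_comm' (by simp)

/-- Strictly increasing sequences are finite sets. The degree times the product of the hook lengths
is `n!`, so the defect is the valuation of that product. -/
theorem exists_betaEquiv {k n : ℕ} (h : n ≤ k) :
    ∃ e : {X : Finset ℕ // X.card = k ∧ betaSize X = n} ≃ Irr (Perm (Fin n)),
      ∀ X ℓ, ℓ.Prime → (e X).defect ℓ = betaDefect ℓ X.1 := by
  classical
  obtain ⟨e, he⟩ := exists_irr_perm_equiv (B := Fin n) (K := k) (by simpa using h)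
  have hcard : ∀ {b : Fin k → ℕ}, StrictMono b → (Finset.univ.image b).card = k := fun hb => by
    rw [Finset.card_image_of_injective _ hb.injective]; simp
  have hsum : ∀ {b : Fin k → ℕ}, StrictMono b →
      ∑ i, b i = betaSize (Finset.univ.image b) + ∑ i : Fin k, (i : ℕ) := fun {b} hb => by
    have := sum_eq_betaSize_add (Finset.univ.image b)
    rw [hcard hb, Finset.sum_image fun i _ j _ h => hb.injective h] at this
    rw [this, Finset.sum_range]
  let f : {b : Fin k → ℕ // StrictMono b ∧ ∑ i, b i = Nat.card (Fin n) + ∑ i : Fin k, (i : ℕ)} →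
      {X : Finset ℕ // X.card = k ∧ betaSize X = n} := fun b =>
    ⟨Finset.univ.image b.1, hcard b.2.1, by
      have h1 := hsum b.2.1
      have h2 := b.2.2
      simp only [Nat.card_eq_fintype_card, Fintype.card_fin] at h2
      omega⟩
  have hf : Function.Bijective f := by
    constructor
    · intro b b' hbb
      have h1 := congrArg Subtype.val hbb
      refine Subtype.ext (b.2.1.range_inj b'.2.1 |>.1 ?_)
      have h2 := congrArg (fun X : Finset ℕ => (X : Set ℕ)) h1
      simpa [f] using h2
    · rintro ⟨X, hX, hn⟩
      have hX' : Finset.univ.image (X.orderEmbOfFin hX) = X := Finset.image_orderEmbOfFin_univ X hX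
      refine ⟨⟨X.orderEmbOfFin hX, (X.orderEmbOfFin hX).strictMono, ?_⟩, Subtype.ext hX'⟩
      rw [hsum (X.orderEmbOfFin hX).strictMono, hX', hn]
      simp
  refine ⟨(Equiv.ofBijective f hf).symm.trans e, fun X ℓ hℓ => ?_⟩
  obtain ⟨b, rfl⟩ := hf.2 X
  have h1 : (Equiv.ofBijective f hf).symm (f b) = b := (Equiv.ofBijective f hf).symm_apply_apply b
  rw [Equiv.trans_apply, h1]
  have h2 := he b
  have h3 := prod_factorial_eq (Finset.univ.image b.1)
  rw [Finset.prod_image fun i _ j _ h => b.2.1.injective h] at h3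
  have hpos : 0 < ∏ y ∈ Finset.univ.image b.1,
      ∏ x ∈ Finset.univ.image b.1 ∩ Finset.range y, (y - x) :=
    Finset.prod_pos fun y _ => Finset.prod_pos fun x hx => by
      have := Finset.mem_range.1 (Finset.mem_inter.1 hx).2
      omega
  rw [h3, image_strictMono_prod b.2.1, ← mul_assoc] at h2
  have h4 := Nat.eq_of_mul_eq_mul_right hpos h2
  have h5 : ∏ y ∈ Finset.univ.image b.1, ∏ x ∈ Finset.range y \ Finset.univ.image b.1, (y - x) ≠ 0 :=
    Finset.prod_ne_zero_iff.2 fun y _ => Finset.prod_ne_zero_iff.2 fun x hx => by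
      have := Finset.mem_range.1 (Finset.mem_sdiff.1 hx).1
      omega
  have : Fact ℓ.Prime := ⟨hℓ⟩
  rw [Irr.defect, Nat.card_perm, ← h4, padicValNat.mul (Irr.degree_pos _).ne' h5]
  have h6 : betaDefect ℓ (f b).1 = _ := betaDefect_eq_padicValNat hℓ (f b).1
  rw [h6, Nat.cast_add, add_sub_cancel_left]

namespace SymIrr

open Classical in
/-- The set of `k` first column hook lengths of the partition labelling a character of a symmetric
group, for `k` at least the size. -/
noncomputable def beta (k : ℕ) (lam : SymIrr) : Finset ℕ :=
  if h : lam.1 ≤ k then ((exists_betaEquiv h).choose.symm lam.2).1 else ∅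

variable {k : ℕ} {lam mu : SymIrr}

theorem card_beta (h : lam.1 ≤ k) : (lam.beta k).card = k := by
  rw [beta, dif_pos h]
  exact ((exists_betaEquiv h).choose.symm lam.2).2.1

theorem betaSize_beta (h : lam.1 ≤ k) : betaSize (lam.beta k) = lam.1 := by
  rw [beta, dif_pos h]
  exact ((exists_betaEquiv h).choose.symm lam.2).2.2

theorem betaDefect_beta {ℓ : ℕ} (hℓ : ℓ.Prime) (h : lam.1 ≤ k) :
    (betaDefect ℓ (lam.beta k) : ℤ) = lam.2.defect ℓ := by
  rw [beta, dif_pos h, ← (exists_betaEquiv h).choose_spec _ ℓ hℓ, Equiv.apply_symm_apply]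

theorem beta_injective (h : lam.1 ≤ k) (h' : mu.1 ≤ k) (e : lam.beta k = mu.beta k) : lam = mu := by
  have h1 : lam.1 = mu.1 := by rw [← betaSize_beta h, e, betaSize_beta h']
  obtain ⟨n, χ⟩ := lam
  obtain ⟨m, ψ⟩ := mu
  simp only at h1 h h'
  subst h1
  rw [beta, dif_pos h, beta, dif_pos h'] at e
  exact congrArg _ ((exists_betaEquiv h).choose.symm.injective (Subtype.ext e))

theorem exists_beta_eq (X : Finset ℕ) (h : betaSize X ≤ X.card) :
    ∃ lam : SymIrr, lam.1 = betaSize X ∧ lam.beta X.card = X := by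
  refine ⟨⟨betaSize X, (exists_betaEquiv h).choose ⟨X, rfl, rfl⟩⟩, rfl, ?_⟩
  rw [beta, dif_pos h]
  simp

theorem defect_nonneg {ℓ : ℕ} (hℓ : ℓ.Prime) (lam : SymIrr) : 0 ≤ lam.2.defect ℓ := by
  rw [← betaDefect_beta hℓ le_rfl]
  exact Int.natCast_nonneg _

end SymIrr

end BetaSets

/-! ### The abacus with `ℓ` runners -/

section Runners

variable {ℓ : ℕ}

/-- The beads on the `j`-th runner of an abacus. -/
def runner (ℓ : ℕ) (X : Finset ℕ) (j : Fin ℓ) : Finset ℕ :=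
  (X.filter fun y => y % ℓ = j).image fun y => y / ℓ

theorem mem_runner {X : Finset ℕ} {j : Fin ℓ} {x : ℕ} : x ∈ runner ℓ X j ↔ ℓ * x + j ∈ X := by
  have h0 : 0 < ℓ := j.pos
  simp only [runner, Finset.mem_image, Finset.mem_filter]
  constructor
  · rintro ⟨y, ⟨h1, h2⟩, rfl⟩
    rwa [← h2, Nat.div_add_mod]
  · intro h
    refine ⟨_, ⟨h, ?_⟩, ?_⟩
    · rw [Nat.mul_add_mod, Nat.mod_eq_of_lt j.2]
    · rw [Nat.mul_add_div h0, Nat.div_eq_of_lt j.2, add_zero]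

/-- The abacus with the given runners. -/
def joinRunners (F : Fin ℓ → Finset ℕ) : Finset ℕ :=
  Finset.univ.biUnion fun j => (F j).image fun x => ℓ * x + j

theorem runner_joinRunners (F : Fin ℓ → Finset ℕ) (j : Fin ℓ) :
    runner ℓ (joinRunners F) j = F j := by
  have h0 : 0 < ℓ := j.pos
  ext x
  rw [mem_runner, joinRunners, Finset.mem_biUnion]
  constructor
  · rintro ⟨i, -, h⟩
    obtain ⟨y, hy, h⟩ := Finset.mem_image.1 h
    have h1 : (i : ℕ) = j := by
      have := congrArg (· % ℓ) h
      simpa [Nat.mul_add_mod, Nat.mod_eq_of_lt i.2, Nat.mod_eq_of_lt j.2] using this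
    obtain rfl : i = j := Fin.ext h1
    have : ℓ * y = ℓ * x := by omega
    rwa [← Nat.eq_of_mul_eq_mul_left h0 this]
  · intro h
    exact ⟨j, Finset.mem_univ _, Finset.mem_image_of_mem _ h⟩

theorem runner_ext (hℓ : 0 < ℓ) {X Y : Finset ℕ} (h : ∀ j, runner ℓ X j = runner ℓ Y j) : X = Y := by
  ext y
  have h1 := Nat.div_add_mod y ℓ
  have h2 : y / ℓ ∈ runner ℓ X ⟨y % ℓ, Nat.mod_lt _ hℓ⟩ ↔ y / ℓ ∈ runner ℓ Y ⟨y % ℓ, Nat.mod_lt _ hℓ⟩ := by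
    rw [h]
  rwa [mem_runner, mem_runner, h1] at h2

theorem sum_runner (hℓ : 0 < ℓ) {M : Type*} [AddCommMonoid M] (X : Finset ℕ) (f : ℕ → M) :
    ∑ y ∈ X, f y = ∑ j : Fin ℓ, ∑ x ∈ runner ℓ X j, f (ℓ * x + j) := by
  rw [← Finset.sum_fiberwise_of_maps_to (t := (Finset.univ : Finset (Fin ℓ)))
    (g := fun y => (⟨y % ℓ, Nat.mod_lt _ hℓ⟩ : Fin ℓ)) (fun _ _ => Finset.mem_univ _)]
  refine Finset.sum_congr rfl fun j _ => ?_
  symm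
  refine Finset.sum_bij (fun x _ => ℓ * x + j) ?_ ?_ ?_ ?_
  · intro x hx
    rw [Finset.mem_filter]
    refine ⟨mem_runner.1 hx, Fin.ext ?_⟩
    simp [Nat.mod_eq_of_lt j.2]
  · intro x _ x' _ h
    have : ℓ * x = ℓ * x' := by omega
    exact Nat.eq_of_mul_eq_mul_left hℓ this
  · intro y hy
    rw [Finset.mem_filter] at hy
    have h1 : y % ℓ = j := congrArg Fin.val hy.2
    have h2 : ℓ * (y / ℓ) + j = y := by rw [← h1, Nat.div_add_mod]
    exact ⟨y / ℓ, mem_runner.2 (by rw [h2]; exact hy.1), h2⟩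
  · intro x _; rfl

theorem card_eq_sum_runner (hℓ : 0 < ℓ) (X : Finset ℕ) :
    X.card = ∑ j : Fin ℓ, (runner ℓ X j).card := by
  have := sum_runner hℓ X fun _ => 1
  simpa using this

theorem runner_sdiff (j : Fin ℓ) (X : Finset ℕ) (u : ℕ) :
    runner ℓ (Finset.range (ℓ * u + j) \ X) j = Finset.range u \ runner ℓ X j := by
  ext x
  rw [mem_runner, Finset.mem_sdiff, Finset.mem_sdiff, mem_runner, Finset.mem_range,
    Finset.mem_range, Nat.add_lt_add_iff_right, Nat.mul_lt_mul_left j.pos]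

/-- A difference `y - x` is divisible by `ℓ` only when both positions lie on the same runner, and
then its valuation is one more than that of the difference along the runner. The extra ones add up
to the sizes of the runners. -/
theorem betaDefect_runner (hℓ : ℓ.Prime) (X : Finset ℕ) :
    betaDefect ℓ X = ∑ j : Fin ℓ, (betaSize (runner ℓ X j) + betaDefect ℓ (runner ℓ X j)) := by
  have : Fact ℓ.Prime := ⟨hℓ⟩
  rw [betaDefect, sum_runner hℓ.pos]
  refine Finset.sum_congr rfl fun j _ => ?_
  rw [betaSize, betaDefect, ← Finset.sum_add_distrib]
  refine Finset.sum_congr rfl fun u _ => ?_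
  rw [sum_runner hℓ.pos, Finset.sum_eq_single j]
  · rw [runner_sdiff, Finset.card_eq_sum_ones, ← Finset.sum_add_distrib]
    refine Finset.sum_congr rfl fun x hx => ?_
    have hlt := Finset.mem_range.1 (Finset.mem_sdiff.1 hx).1
    have h1 : ℓ * u + j - (ℓ * x + j) = ℓ * (u - x) := by
      rw [Nat.mul_sub, Nat.add_sub_add_right]
    rw [h1, padicValNat.mul hℓ.ne_zero (by omega), padicValNat_self]
  · intro i _ hij
    refine Finset.sum_eq_zero fun x hx => ?_
    apply padicValNat.eq_zero_of_not_dvd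
    intro hdvd
    apply hij
    rw [mem_runner] at hx
    have hlt := Finset.mem_range.1 (Finset.mem_sdiff.1 hx).1
    have := (Nat.modEq_iff_dvd' hlt.le).2 hdvd
    rw [Nat.ModEq, Nat.mul_add_mod, Nat.mul_add_mod, Nat.mod_eq_of_lt i.2,
      Nat.mod_eq_of_lt j.2] at this
    exact Fin.ext this
  · simp

theorem two_mul_sum_range (k : ℕ) : 2 * ((∑ i ∈ Finset.range k, i : ℕ) : ℤ) = (k : ℤ) ^ 2 - k := by
  induction k with
  | zero => simp
  | succ k ih => rw [Finset.sum_range_succ]; push_cast at *; linear_combination ih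

/-- Twice the size of the core with the given charges. -/
def chargeForm (c : Fin ℓ → ℤ) : ℤ := ℓ * ∑ j, c j ^ 2 + 2 * ∑ j : Fin ℓ, (j : ℤ) * c j

/-- Compute the sum of all bead positions in two ways, applying `sum_eq_betaSize_add` to `X` and to
each runner. The part depending only on the numbers of beads is `chargeForm`. -/
theorem two_mul_betaSize (hℓ : 0 < ℓ) {X : Finset ℕ} {K : ℕ} (hX : X.card = ℓ * K) :
    2 * (betaSize X : ℤ) = chargeForm (fun j => ((runner ℓ X j).card : ℤ) - K) +
      2 * ℓ * ∑ j, (betaSize (runner ℓ X j) : ℤ) := by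
  have h1 := sum_eq_betaSize_add X
  rw [sum_runner hℓ, hX] at h1
  have h2 : ∀ j : Fin ℓ, 2 * ((∑ x ∈ runner ℓ X j, (ℓ * x + j) : ℕ) : ℤ) =
      2 * ℓ * betaSize (runner ℓ X j) + ℓ * (((runner ℓ X j).card : ℤ) ^ 2 - (runner ℓ X j).card) +
        2 * j * (runner ℓ X j).card := by
    intro j
    rw [Finset.sum_add_distrib, ← Finset.mul_sum, sum_eq_betaSize_add, ← two_mul_sum_range]
    push_cast
    simp only [Finset.sum_const, nsmul_eq_mul]
    ring
  have h3 := congrArg (fun t : ℕ => 2 * (t : ℤ)) h1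
  simp only [Nat.cast_sum, Finset.mul_sum] at h3
  have h4 : ∑ j : Fin ℓ, (2 * ℓ * (betaSize (runner ℓ X j) : ℤ) +
      ℓ * (((runner ℓ X j).card : ℤ) ^ 2 - (runner ℓ X j).card) +
        2 * j * (runner ℓ X j).card) = 2 * (betaSize X : ℤ) + (((ℓ * K : ℕ) : ℤ) ^ 2 - (ℓ * K : ℕ)) := by
    rw [← two_mul_sum_range, ← Finset.sum_congr rfl fun j _ => h2 j, ← Finset.mul_sum,
      ← Nat.cast_sum, h1]
    push_cast
    ring
  have h5 : (∑ j : Fin ℓ, ((runner ℓ X j).card : ℤ)) = ℓ * K := by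
    rw [← Nat.cast_sum, ← card_eq_sum_runner hℓ, hX]; push_cast; rfl
  have h6 : 2 * (∑ j : Fin ℓ, (j : ℤ)) = (ℓ : ℤ) ^ 2 - ℓ := by
    rw [← two_mul_sum_range, Finset.sum_range]; push_cast; rfl
  have h7 : chargeForm (fun j => ((runner ℓ X j).card : ℤ) - K) =
      ℓ * (∑ j : Fin ℓ, ((runner ℓ X j).card : ℤ) ^ 2) -
      2 * ℓ * K * (∑ j : Fin ℓ, ((runner ℓ X j).card : ℤ)) + ℓ * ℓ * K ^ 2 +
      2 * (∑ j : Fin ℓ, (j : ℤ) * ((runner ℓ X j).card : ℤ)) - K * (2 * ∑ j : Fin ℓ, (j : ℤ)) := by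
    rw [chargeForm]
    have e1 : ∑ j : Fin ℓ, (((runner ℓ X j).card : ℤ) - K) ^ 2 =
        (∑ j : Fin ℓ, ((runner ℓ X j).card : ℤ) ^ 2) -
        2 * K * (∑ j : Fin ℓ, ((runner ℓ X j).card : ℤ)) + ℓ * K ^ 2 := by
      rw [Finset.mul_sum, ← Finset.sum_sub_distrib]
      have : (ℓ : ℤ) * K ^ 2 = ∑ _j : Fin ℓ, (K : ℤ) ^ 2 := by simp
      rw [this, ← Finset.sum_add_distrib]
      exact Finset.sum_congr rfl fun j _ => by ring
    have e2 : ∑ j : Fin ℓ, (j : ℤ) * (((runner ℓ X j).card : ℤ) - K) =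
        (∑ j : Fin ℓ, (j : ℤ) * ((runner ℓ X j).card : ℤ)) - K * ∑ j : Fin ℓ, (j : ℤ) := by
      rw [Finset.mul_sum, ← Finset.sum_sub_distrib]
      exact Finset.sum_congr rfl fun j _ => by ring
    rw [e1, e2]
    ring
  rw [h7, h5, h6]
  simp only [Finset.sum_add_distrib, ← Finset.mul_sum, Finset.sum_sub_distrib, mul_assoc] at h4
  rw [h5] at h4
  push_cast at h4
  linear_combination -h4

/-- As the charges sum to zero, the linear coefficient `2j` may be replaced by `2j - (ℓ - 1)`, of
absolute value at most `ℓ - 1`. Each term is then at least `ℓ c² - (ℓ - 1)|c| ≥ |c|`. The bound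
makes core sizes nonnegative and limits charges in terms of them. -/
theorem sum_abs_le_chargeForm (c : Fin ℓ → ℤ) (hc : ∑ j, c j = 0) :
    ∑ j, |c j| ≤ chargeForm c := by
  have h1 : chargeForm c = ∑ j : Fin ℓ, (ℓ * c j ^ 2 + (2 * j - (ℓ - 1)) * c j) := by
    rw [chargeForm, Finset.sum_add_distrib, ← Finset.mul_sum]
    congr 1
    simp only [sub_mul, Finset.sum_sub_distrib, ← Finset.mul_sum, hc, mul_zero, sub_zero, mul_assoc]
  rw [h1]
  refine Finset.sum_le_sum fun j _ => ?_
  have hj : (j : ℤ) + 1 ≤ ℓ := by exact_mod_cast j.2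
  have hj0 : (0 : ℤ) ≤ j := Int.natCast_nonneg _
  have h2 : |c j| ≤ c j ^ 2 := by
    rw [← sq_abs]
    nlinarith [abs_nonneg (c j), Int.abs_lt_one_iff (a := c j), sq_nonneg (|c j|),
      (by by_cases h : c j = 0
          · simp [h]
          · have := Int.one_le_abs h; nlinarith : |c j| ≤ |c j| ^ 2)]
  have h3 : |(2 * (j : ℤ) - (ℓ - 1)) * c j| ≤ (ℓ - 1) * |c j| := by
    rw [abs_mul]
    exact mul_le_mul_of_nonneg_right (abs_le.2 ⟨by linarith, by linarith⟩) (abs_nonneg _)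
  have h4 := (abs_le.1 h3).1
  nlinarith

theorem even_chargeForm (c : Fin ℓ → ℤ) (hc : ∑ j, c j = 0) : 2 ∣ chargeForm c := by
  refine dvd_add (Dvd.dvd.mul_left ?_ _) (dvd_mul_right _ _)
  have : ∑ j, c j ^ 2 = ∑ j, (c j ^ 2 - c j) := by rw [Finset.sum_sub_distrib, hc, sub_zero]
  rw [this]
  refine Finset.dvd_sum fun j _ => ?_
  rw [sq, ← mul_sub_one]
  exact (Int.even_mul_pred_self (c j)).two_dvd

end Runners

/-! ### Cores, quotients and core towers -/

section CoreQuotient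

variable {ℓ : ℕ}

/-- The vectors of charges of the runners of an abacus. -/
abbrev Charge (ℓ : ℕ) : Type := {c : Fin ℓ → ℤ // ∑ j, c j = 0}

/-- The size of the core with the given charges. -/
def coreSize (c : Charge ℓ) : ℕ := (chargeForm c.1 / 2).toNat

theorem two_mul_coreSize (c : Charge ℓ) : 2 * (coreSize c : ℤ) = chargeForm c.1 := by
  have h1 := sum_abs_le_chargeForm c.1 c.2
  have h2 : 0 ≤ ∑ j, |c.1 j| := Finset.sum_nonneg fun j _ => abs_nonneg _
  have h3 := even_chargeForm c.1 c.2
  rw [coreSize, Int.toNat_of_nonneg (by omega)]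
  omega

theorem abs_charge_le (c : Charge ℓ) (j : Fin ℓ) : |c.1 j| ≤ 2 * coreSize c := by
  rw [two_mul_coreSize]
  exact (Finset.single_le_sum (f := fun j => |c.1 j|) (fun _ _ => abs_nonneg _)
    (Finset.mem_univ j)).trans (sum_abs_le_chargeForm c.1 c.2)

theorem SymIrr.eq_of_size_eq_zero {lam mu : SymIrr} (h : lam.1 = 0) (h' : mu.1 = 0) : lam = mu := by
  refine SymIrr.beta_injective (k := 0) h.le h'.le ?_
  rw [Finset.card_eq_zero.1 (SymIrr.card_beta h.le), Finset.card_eq_zero.1 (SymIrr.card_beta h'.le)]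

theorem SymIrr.exists_size_eq_zero : ∃ lam : SymIrr, lam.1 = 0 := by
  obtain ⟨lam, h, -⟩ := SymIrr.exists_beta_eq ∅ (by simp [betaSize])
  exact ⟨lam, by simpa [betaSize] using h⟩

theorem SymIrr.defect_of_size_eq_zero (hℓ : ℓ.Prime) {lam : SymIrr} (h : lam.1 = 0) :
    lam.2.defect ℓ = 0 := by
  rw [← SymIrr.betaDefect_beta (k := 0) hℓ h.le, Finset.card_eq_zero.1 (SymIrr.card_beta h.le)]
  simp [betaDefect]

theorem betaSize_singleton (x : ℕ) : betaSize {x} = x := by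
  rw [betaSize, Finset.sum_singleton, Finset.sdiff_eq_self_of_disjoint (by simp), Finset.card_range]

theorem SymIrr.beta_one {lam : SymIrr} (h : lam.1 = 1) : lam.beta 1 = {1} := by
  obtain ⟨x, hx⟩ := Finset.card_eq_one.1 (SymIrr.card_beta (k := 1) h.le)
  have h1 := SymIrr.betaSize_beta (k := 1) h.le
  rw [hx, h] at h1
  rw [betaSize_singleton] at h1
  rw [hx, h1]

theorem SymIrr.eq_of_size_eq_one {lam mu : SymIrr} (h : lam.1 = 1) (h' : mu.1 = 1) : lam = mu :=
  SymIrr.beta_injective (k := 1) h.le h'.le (by rw [SymIrr.beta_one h, SymIrr.beta_one h'])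

theorem SymIrr.exists_size_eq_one : ∃ lam : SymIrr, lam.1 = 1 := by
  obtain ⟨lam, h, -⟩ := SymIrr.exists_beta_eq {1} (by rw [betaSize_singleton]; simp)
  exact ⟨lam, by rw [h, betaSize_singleton]⟩

theorem SymIrr.defect_of_size_eq_one (hℓ : ℓ.Prime) {lam : SymIrr} (h : lam.1 = 1) :
    lam.2.defect ℓ = 0 := by
  rw [← SymIrr.betaDefect_beta (k := 1) hℓ h.le, SymIrr.beta_one h, betaDefect,
    Finset.sum_singleton, Finset.sdiff_eq_self_of_disjoint (by simp)]
  simp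

/-- Characters of symmetric groups are parametrized by charges and quotients. -/
theorem exists_chargeQuotientEquiv (hℓ : ℓ.Prime) :
    ∃ e : Charge ℓ × (Fin ℓ → SymIrr) ≃ SymIrr, ∀ p,
      (e p).1 = coreSize p.1 + ℓ * ∑ j, (p.2 j).1 ∧
      (e p).2.defect ℓ = ∑ j, (((p.2 j).1 : ℤ) + (p.2 j).2.defect ℓ) := by
  let N : Charge ℓ × (Fin ℓ → SymIrr) → ℕ := fun p => coreSize p.1 + ℓ * ∑ j, (p.2 j).1
  -- The number of beads on runner `j`. A charge is at most `2 N` in absolute value, so starting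
  -- from `3 N` beads leaves at least `N` on each runner, enough to represent every component of the
  -- quotient.
  let k : Charge ℓ × (Fin ℓ → SymIrr) → Fin ℓ → ℕ := fun p j => (((3 * N p : ℕ) : ℤ) + p.1.1 j).toNat
  have hk : ∀ p j, (k p j : ℤ) = ((3 * N p : ℕ) : ℤ) + p.1.1 j ∧ N p ≤ k p j := fun p j => by
    have h1 := (abs_le.1 (abs_charge_le p.1 j)).1
    have h2 : coreSize p.1 ≤ N p := Nat.le_add_right _ _
    have h3 : (k p j : ℤ) = ((3 * N p : ℕ) : ℤ) + p.1.1 j := Int.toNat_of_nonneg (by push_cast; omega)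
    refine ⟨h3, ?_⟩
    push_cast at h3
    omega
  have hle : ∀ p j, (p.2 j).1 ≤ k p j := fun p j => by
    refine le_trans ?_ (hk p j).2
    refine le_trans ?_ (Nat.le_add_left _ _)
    refine le_trans (Finset.single_le_sum (f := fun j => (p.2 j).1) (fun _ _ => Nat.zero_le _)
      (Finset.mem_univ j)) ?_
    exact Nat.le_mul_of_pos_left _ hℓ.pos
  let X : Charge ℓ × (Fin ℓ → SymIrr) → Finset ℕ := fun p =>
    joinRunners fun j => (p.2 j).beta (k p j)
  have hXr : ∀ p j, runner ℓ (X p) j = (p.2 j).beta (k p j) := fun p j => runner_joinRunners _ _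
  have hcard : ∀ p, (X p).card = ℓ * (3 * N p) := fun p => by
    rw [card_eq_sum_runner hℓ.pos]
    apply Nat.cast_injective (R := ℤ)
    rw [Nat.cast_sum]
    have : ∀ j, ((runner ℓ (X p) j).card : ℤ) = ((3 * N p : ℕ) : ℤ) + p.1.1 j := fun j => by
      rw [hXr, SymIrr.card_beta (hle p j), (hk p j).1]
    rw [Finset.sum_congr rfl fun j _ => this j, Finset.sum_add_distrib, p.1.2]
    simp
  have hsize : ∀ p, betaSize (X p) = N p := fun p => by
    have h1 := two_mul_betaSize hℓ.pos (hcard p)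
    have h2 : (fun j => ((runner ℓ (X p) j).card : ℤ) - ((3 * N p : ℕ) : ℤ)) = p.1.1 := by
      funext j
      rw [hXr, SymIrr.card_beta (hle p j), (hk p j).1]; ring
    have h3 : ∀ j, betaSize (runner ℓ (X p) j) = (p.2 j).1 := fun j => by
      rw [hXr, SymIrr.betaSize_beta (hle p j)]
    rw [h2, ← two_mul_coreSize] at h1
    simp only [h3] at h1
    have h4 : 2 * (N p : ℤ) = 2 * (coreSize p.1 : ℤ) + 2 * ℓ * ∑ j, ((p.2 j).1 : ℤ) := by
      simp only [N]; push_cast; ring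
    omega
  have hN : ∀ M : ℕ, M ≤ ℓ * (3 * M) := fun M => by nlinarith [hℓ.one_lt]
  have hex : ∀ p, ∃ lam : SymIrr, lam.1 = N p ∧ lam.beta (ℓ * (3 * N p)) = X p := fun p => by
    obtain ⟨lam, h1, h2⟩ := SymIrr.exists_beta_eq (X p) (by rw [hsize, hcard]; exact hN _)
    exact ⟨lam, h1.trans (hsize p), by rw [← hcard]; exact h2⟩
  choose g hg1 hg2 using hex
  have hinj : Function.Injective g := by
    intro p p' h
    have h1 : N p = N p' := by rw [← hg1, h, hg1]
    have h2 : X p = X p' := by rw [← hg2, ← hg2, h, h1]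
    have h3 : ∀ j, (p.2 j).beta (k p j) = (p'.2 j).beta (k p' j) := fun j => by
      rw [← hXr, ← hXr, h2]
    have h4 : ∀ j, k p j = k p' j := fun j => by
      rw [← SymIrr.card_beta (hle p j), h3, SymIrr.card_beta (hle p' j)]
    refine Prod.ext (Subtype.ext (funext fun j => ?_)) (funext fun j => ?_)
    · have h5 := (hk p j).1
      have h6 := (hk p' j).1
      rw [h4, h6, h1] at h5
      linarith
    · have h5 := h3 j
      rw [h4] at h5
      exact SymIrr.beta_injective (h4 j ▸ hle p j) (hle p' j) h5
  have hsurj : Function.Surjective g := by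
    intro lam
    set n := lam.1 with hn
    have hnle : lam.1 ≤ ℓ * (3 * n) := hN n
    set Y := lam.beta (ℓ * (3 * n)) with hY
    have hYc : Y.card = ℓ * (3 * n) := SymIrr.card_beta hnle
    have hYs : betaSize Y = n := SymIrr.betaSize_beta hnle
    have h1 := two_mul_betaSize hℓ.pos hYc
    have hc0 : ∑ j : Fin ℓ, (((runner ℓ Y j).card : ℤ) - ((3 * n : ℕ) : ℤ)) = 0 := by
      rw [Finset.sum_sub_distrib, ← Nat.cast_sum, ← card_eq_sum_runner hℓ.pos, hYc]
      simp
    let c : Charge ℓ := ⟨fun j => ((runner ℓ Y j).card : ℤ) - ((3 * n : ℕ) : ℤ), hc0⟩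
    have h2 : (n : ℤ) = coreSize c + ℓ * ∑ j, (betaSize (runner ℓ Y j) : ℤ) := by
      have := two_mul_coreSize c
      rw [hYs] at h1
      have h3 : chargeForm c.1 = chargeForm fun j => ((runner ℓ Y j).card : ℤ) - ((3 * n : ℕ) : ℤ) :=
        rfl
      rw [← h3, ← this] at h1
      linarith
    have h2' : n = coreSize c + ℓ * ∑ j, betaSize (runner ℓ Y j) := by exact_mod_cast h2
    have h3 : ∀ j, betaSize (runner ℓ Y j) ≤ (runner ℓ Y j).card := fun j => by
      have e1 : betaSize (runner ℓ Y j) ≤ n := by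
        rw [h2']
        refine le_trans ?_ (Nat.le_add_left _ _)
        refine le_trans (Finset.single_le_sum (f := fun j => betaSize (runner ℓ Y j))
          (fun _ _ => Nat.zero_le _) (Finset.mem_univ j)) ?_
        exact Nat.le_mul_of_pos_left _ hℓ.pos
      have e2 := (abs_le.1 (abs_charge_le c j)).1
      have e3 : c.1 j = ((runner ℓ Y j).card : ℤ) - ((3 * n : ℕ) : ℤ) := rfl
      have e4 : coreSize c ≤ n := by omega
      push_cast at e3
      omega
    have h4 := fun j => SymIrr.exists_beta_eq (runner ℓ Y j) (h3 j)
    choose F hF1 hF2 using h4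
    refine ⟨(c, F), ?_⟩
    have hNn : N (c, F) = n := by
      simp only [N, hF1]; exact h2'.symm
    have hkc : ∀ j, k (c, F) j = (runner ℓ Y j).card := fun j => by
      have := (hk (c, F) j).1
      rw [hNn] at this
      have e3 : c.1 j = ((runner ℓ Y j).card : ℤ) - ((3 * n : ℕ) : ℤ) := rfl
      simp only [e3] at this
      omega
    have hXY : X (c, F) = Y := runner_ext hℓ.pos fun j => by
      rw [hXr, hkc]; exact hF2 j
    refine SymIrr.beta_injective (k := ℓ * (3 * n)) (by rw [hg1, hNn]; exact hN n) hnle ?_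
    have := hg2 (c, F)
    rw [hNn, hXY] at this
    exact this
  refine ⟨Equiv.ofBijective g ⟨hinj, hsurj⟩, fun p => ⟨hg1 p, ?_⟩⟩
  change (g p).2.defect ℓ = _
  rw [← SymIrr.betaDefect_beta hℓ ((hg1 p).trans_le (hN _)), hg2, betaDefect_runner hℓ, Nat.cast_sum]
  refine Finset.sum_congr rfl fun j _ => ?_
  rw [hXr, SymIrr.betaSize_beta (hle p j), Nat.cast_add, SymIrr.betaDefect_beta hℓ (hle p j)]

/-- The characters of defect zero of symmetric groups. -/
abbrev SymCore (ℓ : ℕ) : Type := {lam : SymIrr // lam.2.defect ℓ = 0}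

/-- Characters of symmetric groups are parametrized by cores and quotients. -/
theorem exists_coreQuotientEquiv (hℓ : ℓ.Prime) :
    ∃ e : SymCore ℓ × (Fin ℓ → SymIrr) ≃ SymIrr, ∀ p,
      (e p).1 = p.1.1.1 + ℓ * ∑ j, (p.2 j).1 ∧
      (e p).2.defect ℓ = ∑ j, (((p.2 j).1 : ℤ) + (p.2 j).2.defect ℓ) := by
  obtain ⟨e, he⟩ := exists_chargeQuotientEquiv hℓ
  obtain ⟨o, ho⟩ := SymIrr.exists_size_eq_zero
  let f : Charge ℓ → SymCore ℓ := fun c => ⟨e (c, fun _ => o), by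
    rw [(he _).2]
    refine Finset.sum_eq_zero fun j _ => ?_
    simp only [SymIrr.defect_of_size_eq_zero hℓ ho, ho]; rfl⟩
  -- All summands of the defect are nonnegative, so defect zero means that the quotient is empty;
  -- such a character is determined by its charges.
  have hf : Function.Bijective f := by
    constructor
    · intro c c' h
      exact congrArg Prod.fst (e.injective (congrArg Subtype.val h))
    · rintro ⟨lam, h⟩
      obtain ⟨⟨c, F⟩, rfl⟩ := e.surjective lam
      refine ⟨c, Subtype.ext (congrArg e (Prod.ext rfl (funext fun j => ?_)))⟩
      rw [(he _).2, Finset.sum_eq_zero_iff_of_nonneg fun j _ =>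
        add_nonneg (Int.natCast_nonneg _) (SymIrr.defect_nonneg hℓ _)] at h
      have h1 := h j (Finset.mem_univ j)
      have h2 := SymIrr.defect_nonneg hℓ (F j)
      have h3 : (F j).1 = 0 := by simp only at h1; omega
      exact SymIrr.eq_of_size_eq_zero ho h3
  refine ⟨(Equiv.prodCongr (Equiv.ofBijective f hf).symm (Equiv.refl _)).trans e, fun p => ?_⟩
  obtain ⟨κ, F⟩ := p
  obtain ⟨c, rfl⟩ := hf.2 κ
  have h1 : ((Equiv.prodCongr (Equiv.ofBijective f hf).symm (Equiv.refl (Fin ℓ → SymIrr))).trans e)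
      (f c, F) = e (c, F) :=
    congrArg (fun c => e (c, F)) ((Equiv.ofBijective f hf).symm_apply_apply c)
  rw [h1]
  refine ⟨?_, (he _).2⟩
  have h2 : (f c).1.1 = coreSize c := by
    change (e (c, fun _ => o)).1 = _
    rw [(he _).1]
    simp [ho]
  rw [(he _).1, h2]

/-- Towers of cores: characters of symmetric groups of bounded size are parametrized by families of
characters of defect zero. -/
theorem exists_towerEquiv (hℓ : ℓ.Prime) (r : ℕ) :
    ∃ (L : Type) (_ : Fintype L) (lev : L → ℕ),
      (∀ b, lev b < r) ∧ (∀ i < r, Nat.card {b // lev b = i} = ℓ ^ i) ∧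
      ∃ e : {lam : SymIrr // lam.1 < ℓ ^ r} ≃
          {κ : L → SymCore ℓ // ∑ b, ℓ ^ lev b * (κ b).1.1 < ℓ ^ r},
        ∀ lam, lam.1.1 = ∑ b, ℓ ^ lev b * ((e lam).1 b).1.1 ∧
          lam.1.2.defect ℓ =
            ((∑ b, padicValNat ℓ (ℓ ^ lev b).factorial * ((e lam).1 b).1.1 : ℕ) : ℤ) := by
  classical
  have : Fact ℓ.Prime := ⟨hℓ⟩
  induction r with
  | zero =>
    obtain ⟨o, ho⟩ := SymIrr.exists_size_eq_zero
    refine ⟨Empty, inferInstance, Empty.elim, fun b => b.elim, fun i hi => absurd hi (by simp), ?_⟩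
    refine ⟨⟨fun _ => ⟨Empty.elim, by simp⟩, fun _ => ⟨o, by simp [ho]⟩, fun lam => ?_, fun κ => ?_⟩,
      fun lam => ?_⟩
    · have h1 : lam.1.1 = 0 := Nat.lt_one_iff.1 (lam.2.trans_eq (pow_zero _))
      exact Subtype.ext (SymIrr.eq_of_size_eq_zero ho h1)
    · exact Subtype.ext (Subsingleton.elim _ _)
    · have h1 : lam.1.1 = 0 := Nat.lt_one_iff.1 (lam.2.trans_eq (pow_zero _))
      refine ⟨by simp [h1], by simp [SymIrr.defect_of_size_eq_zero hℓ h1]⟩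
  | succ r ih =>
    obtain ⟨L, hL, lev, hlev, hcard, e, he⟩ := ih
    obtain ⟨e0, he0⟩ := exists_coreQuotientEquiv hℓ
    -- The place `none` holds the core; `some (j, b)` is the place `b` in the tower of the `j`-th
    -- component of the quotient, one level deeper.
    let lev' : Option (Fin ℓ × L) → ℕ := fun b => b.elim 0 fun p => lev p.2 + 1
    have hlt : ∀ p : SymCore ℓ × (Fin ℓ → SymIrr), (e0 p).1 < ℓ ^ (r + 1) →
        ∀ j, (p.2 j).1 < ℓ ^ r := by
      intro p hp j
      rw [(he0 p).1, pow_succ'] at hp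
      have h1 : (p.2 j).1 ≤ ∑ j, (p.2 j).1 := Finset.single_le_sum (f := fun j => (p.2 j).1)
        (fun _ _ => Nat.zero_le _) (Finset.mem_univ j)
      exact lt_of_le_of_lt h1 (Nat.lt_of_mul_lt_mul_left (lt_of_le_of_lt (Nat.le_add_left _ _) hp))
    have hsum : ∀ (w : ℕ → ℕ) (κ : Option (Fin ℓ × L) → SymCore ℓ),
        ∑ b, w (lev' b) * (κ b).1.1 =
          w 0 * (κ none).1.1 + ∑ j, ∑ b, w (lev b + 1) * (κ (some (j, b))).1.1 := by
      intro w κ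
      rw [Fintype.sum_option, Fintype.sum_prod_type]
      rfl
    let F : ∀ p : SymCore ℓ × (Fin ℓ → SymIrr), (e0 p).1 < ℓ ^ (r + 1) →
        Option (Fin ℓ × L) → SymCore ℓ := fun p hp b =>
      b.elim p.1 fun q => (e ⟨p.2 q.1, hlt p hp q.1⟩).1 q.2
    have hF1 : ∀ p hp, (e0 p).1 = ∑ b, ℓ ^ lev' b * (F p hp b).1.1 := by
      intro p hp
      rw [hsum (fun i => ℓ ^ i), (he0 p).1, pow_zero, one_mul, Finset.mul_sum]
      refine congrArg₂ _ rfl (Finset.sum_congr rfl fun j _ => ?_)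
      have h1 := (he ⟨p.2 j, hlt p hp j⟩).1
      simp only at h1
      rw [h1, Finset.mul_sum]
      refine Finset.sum_congr rfl fun b _ => ?_
      rw [pow_succ', mul_assoc]
      rfl
    have hF2 : ∀ p hp, (e0 p).2.defect ℓ =
        ((∑ b, padicValNat ℓ (ℓ ^ lev' b).factorial * (F p hp b).1.1 : ℕ) : ℤ) := by
      intro p hp
      rw [hsum (fun i => padicValNat ℓ (ℓ ^ i).factorial), (he0 p).2, pow_zero, Nat.factorial_one,
        padicValNat_one_right, zero_mul, zero_add, Nat.cast_sum]
      refine Finset.sum_congr rfl fun j _ => ?_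
      have h1 := he ⟨p.2 j, hlt p hp j⟩
      simp only at h1
      rw [h1.2, h1.1, ← Nat.cast_add, ← Finset.sum_add_distrib]
      refine congrArg Nat.cast (Finset.sum_congr rfl fun b _ => ?_)
      -- The recursion `ν_ℓ((ℓ m)!) = ν_ℓ(m!) + m` matches the rule that the defect is the sum of
      -- size and defect over the quotient.
      rw [pow_succ', padicValNat_factorial_mul, add_mul, add_comm]
      rfl
    let E : {lam : SymIrr // lam.1 < ℓ ^ (r + 1)} →
        {κ : Option (Fin ℓ × L) → SymCore ℓ // ∑ b, ℓ ^ lev' b * (κ b).1.1 < ℓ ^ (r + 1)} :=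
      fun lam => ⟨F (e0.symm lam.1) (by rw [Equiv.apply_symm_apply]; exact lam.2), by
        have h1 : (e0 (e0.symm lam.1)).1 < ℓ ^ (r + 1) := by
          rw [Equiv.apply_symm_apply]; exact lam.2
        exact (hF1 _ h1).symm.trans_lt h1⟩
    have hE : Function.Bijective E := by
      constructor
      · intro lam mu h
        have h1 : ∀ b, _ = _ := congrFun (congrArg Subtype.val h)
        refine Subtype.ext (e0.symm.injective (Prod.ext (h1 none) (funext fun j => ?_)))
        refine congrArg Subtype.val (e.injective (a₁ := ⟨(e0.symm lam.1).2 j, hlt _ (by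
          rw [Equiv.apply_symm_apply]; exact lam.2) j⟩) (a₂ := ⟨(e0.symm mu.1).2 j, hlt _ (by
          rw [Equiv.apply_symm_apply]; exact mu.2) j⟩) (Subtype.ext (funext fun b => ?_)))
        exact h1 (some (j, b))
      · rintro ⟨κ, hκ⟩
        have hκ' := hκ
        rw [hsum (fun i => ℓ ^ i), pow_succ'] at hκ'
        have h1 : ∀ j, ∑ b, ℓ ^ lev b * (κ (some (j, b))).1.1 < ℓ ^ r := by
          intro j
          refine Nat.lt_of_mul_lt_mul_left (a := ℓ) (lt_of_le_of_lt ?_ hκ')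
          refine le_trans ?_ (Nat.le_add_left _ _)
          refine le_trans (le_of_eq ?_) (Finset.single_le_sum
            (f := fun j => ∑ b, ℓ ^ (lev b + 1) * (κ (some (j, b))).1.1)
            (fun _ _ => Nat.zero_le _) (Finset.mem_univ j))
          rw [Finset.mul_sum]
          exact Finset.sum_congr rfl fun b _ => by rw [pow_succ', mul_assoc]
        let p : SymCore ℓ × (Fin ℓ → SymIrr) := (κ none, fun j => (e.symm ⟨_, h1 j⟩).1)
        have h3 : ∀ j b, (e (e.symm ⟨_, h1 j⟩)).1 b = κ (some (j, b)) := fun j b => by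
          rw [Equiv.apply_symm_apply]
        have h2 : (e0 p).1 = ∑ b, ℓ ^ lev' b * (κ b).1.1 := by
          rw [hsum (fun i => ℓ ^ i), (he0 p).1, pow_zero, one_mul, Finset.mul_sum]
          refine congrArg₂ _ rfl (Finset.sum_congr rfl fun j _ => ?_)
          have h4 := (he (e.symm ⟨_, h1 j⟩)).1
          simp only [h3] at h4
          change ℓ * (e.symm ⟨_, h1 j⟩).1.1 = _
          rw [h4, Finset.mul_sum]
          exact Finset.sum_congr rfl fun b _ => by rw [pow_succ', mul_assoc]
        refine ⟨⟨e0 p, h2.trans_lt hκ⟩, Subtype.ext (funext fun b => ?_)⟩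
        have h5 : ∀ q (hq : (e0 q).1 < ℓ ^ (r + 1)), q = p → F q hq b = κ b := by
          rintro _ hq rfl
          rcases b with _ | ⟨j, b⟩
          · rfl
          · exact h3 j b
        exact h5 _ (by rw [Equiv.apply_symm_apply]; exact h2.trans_lt hκ) (e0.symm_apply_apply p)
    refine ⟨Option (Fin ℓ × L), inferInstance, lev', ?_, ?_, Equiv.ofBijective E hE, fun lam => ?_⟩
    · rintro (_ | ⟨j, b⟩)
      · exact Nat.succ_pos r
      · exact Nat.succ_lt_succ (hlev b)
    · intro i hi
      rcases i with _ | i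
      · rw [pow_zero, Nat.card_eq_one_iff_unique]
        refine ⟨⟨?_⟩, ⟨⟨none, rfl⟩⟩⟩
        rintro ⟨_ | b, hb⟩ ⟨_ | b', hb'⟩
        · rfl
        · exact absurd hb' (Nat.succ_ne_zero _)
        · exact absurd hb (Nat.succ_ne_zero _)
        · exact absurd hb (Nat.succ_ne_zero _)
      · have hprod : Nat.card (Fin ℓ × {b // lev b = i}) = ℓ ^ (i + 1) := by
          rw [Nat.card_prod, Nat.card_fin, hcard i (Nat.lt_of_succ_lt_succ hi), pow_succ']
        refine (Nat.card_congr (Equiv.ofBijective (fun p : Fin ℓ × {b // lev b = i} =>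
          (⟨some (p.1, p.2.1), congrArg Nat.succ p.2.2⟩ : {b // lev' b = i + 1}))
            ⟨?_, ?_⟩).symm).trans hprod
        · intro p p' h
          have h1 := Prod.mk.inj (Option.some_injective _ (congrArg Subtype.val h))
          exact Prod.ext h1.1 (Subtype.ext h1.2)
        · rintro ⟨_ | ⟨j, b⟩, hb⟩
          · exact absurd hb.symm (Nat.succ_ne_zero _)
          · exact ⟨(j, ⟨b, Nat.succ_injective hb⟩), rfl⟩
    · have h1 : ∀ q (hq : (e0 q).1 < ℓ ^ (r + 1)), e0 q = lam.1 →
          lam.1.1 = ∑ b, ℓ ^ lev' b * (F q hq b).1.1 ∧ lam.1.2.defect ℓ =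
            ((∑ b, padicValNat ℓ (ℓ ^ lev' b).factorial * (F q hq b).1.1 : ℕ) : ℤ) := by
        rintro q hq h
        rw [← h]
        exact ⟨hF1 q hq, hF2 q hq⟩
      exact h1 _ (by rw [Equiv.apply_symm_apply]; exact lam.2) (e0.apply_symm_apply lam.1)

end CoreQuotient

/-! ### Naming the places of the tower by characters of degree prime to `ℓ` -/

section TowerCount

variable {ℓ : ℕ}

theorem sub_one_mul_padicValNat_pow_factorial (hℓ : ℓ.Prime) (i : ℕ) :
    (ℓ - 1) * padicValNat ℓ (ℓ ^ i).factorial + 1 = ℓ ^ i := by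
  have : Fact ℓ.Prime := ⟨hℓ⟩
  induction i with
  | zero => simp
  | succ i ih =>
    have h1 : ℓ - 1 + 1 = ℓ := Nat.sub_add_cancel hℓ.one_le
    rw [pow_succ', padicValNat_factorial_mul, mul_add, add_right_comm, ih]
    calc _ = ℓ ^ i * (ℓ - 1 + 1) := by ring
      _ = _ := by rw [h1]; ring

theorem exists_eq_ite_of_sum_eq_one {L : Type*} [Fintype L] [DecidableEq L] {f : L → ℕ}
    (h : ∑ b, f b = 1) : ∃ b, ∀ c, f c = if c = b then 1 else 0 := by
  obtain ⟨b, -, hb⟩ := Finset.exists_ne_zero_of_sum_ne_zero (h.trans_ne one_ne_zero)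
  refine ⟨b, fun c => ?_⟩
  rw [← Finset.add_sum_erase _ _ (Finset.mem_univ b)] at h
  split_ifs with hc
  · subst hc; omega
  · have := Finset.single_le_sum (f := f) (fun _ _ => Nat.zero_le _)
      (Finset.mem_erase.2 ⟨hc, Finset.mem_univ c⟩)
    omega

theorem Irr.not_dvd_degree_iff {G : Type*} [Group G] [Finite G] (hℓ : ℓ.Prime) (χ : Irr G) :
    ¬ ℓ ∣ χ.degree ↔ χ.defect ℓ = padicValNat ℓ (Nat.card G) := by
  have : Fact ℓ.Prime := ⟨hℓ⟩
  rw [Irr.defect, dvd_iff_padicValNat_ne_zero χ.degree_pos.ne']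
  omega

/-- The irreducible characters of degree prime to `ℓ` of symmetric groups of degree `ℓ ^ i`,
for `i < r`. -/
abbrev LabelIrr (ℓ r : ℕ) : Type :=
  {φ : SymIrr // (∃ i < r, φ.1 = ℓ ^ i) ∧ ¬ ℓ ∣ φ.2.degree}

/-- Degree prime to `ℓ` means that the defect is `ν_ℓ(ℓ^i!)`. Since `ℓ^j - (ℓ - 1) ν_ℓ(ℓ^j!) = 1`
for all `j`, subtracting `ℓ - 1` times the defect from the size shows that the cores of the tower
have total size 1. There is thus one core of size 1, placed at level `i`, which has `ℓ^i` places. -/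
theorem card_irr_not_dvd_degree (hℓ : ℓ.Prime) (i : ℕ) :
    Nat.card {φ : SymIrr // φ.1 = ℓ ^ i ∧ ¬ ℓ ∣ φ.2.degree} = ℓ ^ i := by
  classical
  obtain ⟨L, hL, lev, hlev, hcard, e, he⟩ := exists_towerEquiv hℓ (i + 1)
  refine Eq.trans ?_ (hcard i (Nat.lt_succ_self i))
  obtain ⟨o, ho⟩ := SymIrr.exists_size_eq_zero
  obtain ⟨u, hu⟩ := SymIrr.exists_size_eq_one
  let κ : L → L → SymCore ℓ := fun b c => if c = b then
    ⟨u, SymIrr.defect_of_size_eq_one hℓ hu⟩ else ⟨o, SymIrr.defect_of_size_eq_zero hℓ ho⟩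
  have hκ : ∀ b c, (κ b c).1.1 = if c = b then 1 else 0 := fun b c => by
    simp only [κ]
    split_ifs
    · exact hu
    · exact ho
  have hκs : ∀ (w : L → ℕ) b, ∑ c, w c * (κ b c).1.1 = w b := fun w b => by
    simp [hκ]
  have hlt : ∀ b : {b // lev b = i}, ∑ c, ℓ ^ lev c * (κ b c).1.1 < ℓ ^ (i + 1) := fun b => by
    rw [hκs (fun c => ℓ ^ lev c), b.2]
    exact Nat.pow_lt_pow_right hℓ.one_lt (Nat.lt_succ_self i)
  have hdeg : ∀ φ : SymIrr, φ.1 = ℓ ^ i →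
      (¬ ℓ ∣ φ.2.degree ↔ φ.2.defect ℓ = padicValNat ℓ (ℓ ^ i).factorial) := fun φ h => by
    rw [Irr.not_dvd_degree_iff hℓ, Nat.card_perm, Nat.card_fin, ← h]
  have h1 : ∀ b : {b // lev b = i}, (e.symm ⟨κ b, hlt b⟩).1.1 = ℓ ^ i := fun b => by
    rw [(he _).1, Equiv.apply_symm_apply, hκs (fun c => ℓ ^ lev c), b.2]
  have h2 : ∀ b : {b // lev b = i}, ¬ ℓ ∣ (e.symm ⟨κ b, hlt b⟩).1.2.degree := fun b => by
    rw [hdeg _ (h1 b), (he _).2, Equiv.apply_symm_apply,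
      hκs (fun c => padicValNat ℓ (ℓ ^ lev c).factorial), b.2]
  symm
  refine Nat.card_congr (Equiv.ofBijective (fun b : {b // lev b = i} =>
    (⟨(e.symm ⟨κ b, hlt b⟩).1, h1 b, h2 b⟩ : {φ : SymIrr // φ.1 = ℓ ^ i ∧ ¬ ℓ ∣ φ.2.degree}))
    ⟨?_, ?_⟩)
  · intro b b' h
    have h0 : (e.symm ⟨κ b, hlt b⟩).1 = (e.symm ⟨κ b', hlt b'⟩).1 :=
      congrArg (fun φ : {φ : SymIrr // φ.1 = ℓ ^ i ∧ ¬ ℓ ∣ φ.2.degree} => φ.1) h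
    have h3 := congrArg Subtype.val (e.symm.injective (Subtype.ext h0))
    have h4 := congrArg (fun c : SymCore ℓ => c.1.1) (congrFun h3 b)
    simp only [hκ] at h4
    by_contra hne
    rw [if_pos trivial, if_neg fun h => hne (Subtype.ext h)] at h4
    exact one_ne_zero h4
  · rintro ⟨φ, hφ1, hφ2⟩
    have hφ : φ.1 < ℓ ^ (i + 1) := by
      rw [hφ1]; exact Nat.pow_lt_pow_right hℓ.one_lt (Nat.lt_succ_self i)
    rw [hdeg _ hφ1] at hφ2
    have h3 := (he ⟨φ, hφ⟩).1
    have h4 := (he ⟨φ, hφ⟩).2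
    simp only [hφ2, Nat.cast_inj] at h4
    simp only [hφ1] at h3
    have h5 : ∑ c, ((e ⟨φ, hφ⟩).1 c).1.1 = 1 := by
      have h6 : (ℓ - 1) * ∑ c, padicValNat ℓ (ℓ ^ lev c).factorial * ((e ⟨φ, hφ⟩).1 c).1.1 +
          ∑ c, ((e ⟨φ, hφ⟩).1 c).1.1 = ℓ ^ i := by
        rw [h3, Finset.mul_sum, ← Finset.sum_add_distrib]
        refine Finset.sum_congr rfl fun c _ => ?_
        have := sub_one_mul_padicValNat_pow_factorial hℓ (lev c)
        calc _ = ((ℓ - 1) * padicValNat ℓ (ℓ ^ lev c).factorial + 1) * ((e ⟨φ, hφ⟩).1 c).1.1 := by ring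
          _ = _ := by rw [this]
      rw [← h4] at h6
      have := sub_one_mul_padicValNat_pow_factorial hℓ i
      omega
    obtain ⟨b, hb⟩ := exists_eq_ite_of_sum_eq_one h5
    have h7 : (e ⟨φ, hφ⟩).1 = κ b := by
      funext c
      apply Subtype.ext
      by_cases hc : c = b
      · exact SymIrr.eq_of_size_eq_one (by rw [hb, if_pos hc]) (by rw [hκ, if_pos hc])
      · exact SymIrr.eq_of_size_eq_zero (by rw [hb, if_neg hc]) (by rw [hκ, if_neg hc])
    have h8 : lev b = i := by
      simp only [h7, hκs (fun c => ℓ ^ lev c)] at h3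
      exact (Nat.pow_right_injective hℓ.two_le h3).symm
    refine ⟨⟨b, h8⟩, Subtype.ext ?_⟩
    have h9 : e.symm ⟨κ b, hlt ⟨b, h8⟩⟩ = ⟨φ, hφ⟩ := by
      rw [Equiv.symm_apply_eq]
      exact Subtype.ext h7.symm
    exact congrArg (fun lam : {lam : SymIrr // lam.1 < ℓ ^ (i + 1)} => lam.1) h9

/-- At every level the places are as many as the `ℓ'`-characters of the symmetric group of that
degree, so the former may be renamed by the latter. The renaming is an arbitrary choice. -/
theorem exists_labelTowerEquiv (hℓ : ℓ.Prime) (r : ℕ) :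
    ∃ (_ : Fintype (LabelIrr ℓ r)),
      ∃ e : {lam : SymIrr // lam.1 < ℓ ^ r} ≃
          {κ : LabelIrr ℓ r → SymCore ℓ // ∑ b, b.1.1 * (κ b).1.1 < ℓ ^ r},
        ∀ lam, lam.1.1 = ∑ b, b.1.1 * ((e lam).1 b).1.1 ∧
          lam.1.2.defect ℓ =
            ((∑ b, padicValNat ℓ (b.1.1).factorial * ((e lam).1 b).1.1 : ℕ) : ℤ) := by
  classical
  obtain ⟨L, hL, lev, hlev, hcard, e, he⟩ := exists_towerEquiv hℓ r
  have hfin : ∀ i : Fin r, Nonempty ({b // lev b = i} ≃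
      {φ : SymIrr // φ.1 = ℓ ^ (i : ℕ) ∧ ¬ ℓ ∣ φ.2.degree}) := by
    intro i
    have h1 := card_irr_not_dvd_degree hℓ i
    have : Finite {φ : SymIrr // φ.1 = ℓ ^ (i : ℕ) ∧ ¬ ℓ ∣ φ.2.degree} :=
      Nat.finite_of_card_ne_zero (by rw [h1]; exact pow_ne_zero _ hℓ.ne_zero)
    exact Finite.card_eq.1 ((hcard i i.2).trans h1.symm)
  let s : L → LabelIrr ℓ r := fun b => ⟨((hfin ⟨lev b, hlev b⟩).some ⟨b, rfl⟩).1,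
    ⟨lev b, hlev b, ((hfin ⟨lev b, hlev b⟩).some ⟨b, rfl⟩).2.1⟩,
    ((hfin ⟨lev b, hlev b⟩).some ⟨b, rfl⟩).2.2⟩
  have hs1 : ∀ b, (s b).1.1 = ℓ ^ lev b := fun b => ((hfin ⟨lev b, hlev b⟩).some ⟨b, rfl⟩).2.1
  have hs2 : ∀ (i : Fin r) (b : {b // lev b = i}), (s b).1 = ((hfin i).some b).1 := by
    rintro ⟨i, hi⟩ ⟨b, hb⟩
    simp only at hb
    subst hb
    rfl
  have hs : Function.Bijective s := by
    constructor
    · intro b b' h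
      have h1 : lev b = lev b' := Nat.pow_right_injective hℓ.two_le
        ((hs1 b).symm.trans ((congrArg (fun φ : LabelIrr ℓ r => φ.1.1) h).trans (hs1 b')))
      have h2 := hs2 ⟨lev b, hlev b⟩ ⟨b, rfl⟩
      have h3 := hs2 ⟨lev b, hlev b⟩ ⟨b', h1.symm⟩
      exact congrArg Subtype.val ((hfin ⟨lev b, hlev b⟩).some.injective
        (Subtype.ext (h2.symm.trans ((congrArg Subtype.val h).trans h3))))
    · rintro ⟨φ, ⟨i, hi, h1⟩, h2⟩
      obtain ⟨b, hb⟩ := (hfin ⟨i, hi⟩).some.surjective ⟨φ, h1, h2⟩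
      exact ⟨b.1, Subtype.ext ((hs2 ⟨i, hi⟩ b).trans (congrArg Subtype.val hb))⟩
  let σ := Equiv.ofBijective s hs
  let : Fintype (LabelIrr ℓ r) := Fintype.ofEquiv L σ
  have hsum : ∀ (w : ℕ → ℕ) (κ : LabelIrr ℓ r → SymCore ℓ),
      ∑ b, w b.1.1 * (κ b).1.1 = ∑ b, w (ℓ ^ lev b) * (κ (σ b)).1.1 := by
    intro w κ
    rw [← σ.sum_comp]
    exact Finset.sum_congr rfl fun b _ => by rw [← hs1]; rfl
  let E : {κ : L → SymCore ℓ // ∑ b, ℓ ^ lev b * (κ b).1.1 < ℓ ^ r} ≃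
      {κ : LabelIrr ℓ r → SymCore ℓ // ∑ b, b.1.1 * (κ b).1.1 < ℓ ^ r} :=
    Equiv.subtypeEquiv (Equiv.arrowCongr σ (Equiv.refl _)) fun κ => by
      refine Eq.to_iff (congrArg (· < ℓ ^ r) (Eq.trans ?_ (hsum id _).symm))
      simp
  refine ⟨this, e.trans E, fun lam => ?_⟩
  have hE : ∀ b, ((e.trans E) lam).1 (σ b) = (e lam).1 b := fun b => by
    change (e lam).1 (σ.symm (σ b)) = _
    rw [Equiv.symm_apply_apply]
  constructor
  · rw [(he lam).1]
    refine Eq.trans ?_ (hsum id _).symm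
    simp only [hE, id]
  · rw [(he lam).2, hsum fun m => padicValNat ℓ m.factorial]
    simp only [hE]

theorem finite_labelIrr (hℓ : ℓ.Prime) (r : ℕ) : Finite (LabelIrr ℓ r) := by
  obtain ⟨_, -⟩ := exists_labelTowerEquiv hℓ r
  infer_instance

theorem nonempty_labelIrr (hℓ : ℓ.Prime) {r : ℕ} (hr : 0 < r) : Nonempty (LabelIrr ℓ r) := by
  have h1 := card_irr_not_dvd_degree hℓ 0
  rw [pow_zero] at h1
  obtain ⟨⟨φ, h2, h3⟩⟩ := (Nat.card_pos_iff.1 (h1.symm ▸ Nat.one_pos)).1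
  exact ⟨⟨φ, ⟨0, hr, by rw [h2, pow_zero]⟩, h3⟩⟩

variable {C : Type*} [Fintype C] {r : ℕ} [Fintype (LabelIrr ℓ r)]

open Classical in
/-- Counting families of characters of symmetric groups by families of characters of defect zero
indexed by towers. -/
theorem sum_twistWeight_tower (hℓ : ℓ.Prime) (δ : C → C) {n : ℕ} (hn0 : 0 < n) (hn : n < ℓ ^ r)
    (d : ℕ) :
    (∑ lam ∈ labelFamilies C n, if totalDefect ℓ lam = d then twistWeight δ lam else 0) =
    ∑ k ∈ Finset.range (n + 1), ∑ kap ∈ labelFamilies (LabelIrr ℓ r × C) k,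
      if ((∑ p, p.1.1.1 * (kap p).1 = n) ∧ ∑ p, padicValNat ℓ p.1.1.1.factorial * (kap p).1 = d) ∧
        totalDefect ℓ kap = 0 then twistWeight (Prod.map id δ) kap else 0 := by
  obtain ⟨e, he⟩ : ∃ e : {lam : SymIrr // lam.1 < ℓ ^ r} ≃
      {κ : LabelIrr ℓ r → SymCore ℓ // ∑ b, b.1.1 * (κ b).1.1 < ℓ ^ r},
      ∀ lam, lam.1.1 = ∑ b, b.1.1 * ((e lam).1 b).1.1 ∧ lam.1.2.defect ℓ =
        ((∑ b, padicValNat ℓ (b.1.1).factorial * ((e lam).1 b).1.1 : ℕ) : ℤ) := by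
    obtain ⟨inst, h⟩ := exists_labelTowerEquiv hℓ r
    convert h
  have hr : 0 < r := Nat.pos_of_ne_zero fun h => by subst h; simp at hn; omega
  obtain ⟨φ0⟩ := nonempty_labelIrr hℓ hr
  -- The tower of `lam`; the value for sizes at least `ℓ ^ r` is immaterial, since `n < ℓ ^ r`.
  let g : SymIrr → LabelIrr ℓ r → SymIrr := fun lam φ =>
    if h : lam.1 < ℓ ^ r then ((e ⟨lam, h⟩).1 φ).1 else lam
  have hg : ∀ lam (h : lam.1 < ℓ ^ r) φ, g lam φ = ((e ⟨lam, h⟩).1 φ).1 := fun lam h φ => dif_pos h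
  have hg1 : ∀ lam : SymIrr, lam.1 < ℓ ^ r → lam.1 = ∑ φ, φ.1.1 * (g lam φ).1 := fun lam h => by
    simp only [hg lam h]; exact (he ⟨lam, h⟩).1
  have hg2 : ∀ lam : SymIrr, lam.1 < ℓ ^ r → lam.2.defect ℓ =
      ((∑ φ, padicValNat ℓ φ.1.1.factorial * (g lam φ).1 : ℕ) : ℤ) := fun lam h => by
    simp only [hg lam h]; exact (he ⟨lam, h⟩).2
  have hg3 : ∀ lam : SymIrr, lam.1 < ℓ ^ r → ∀ φ, (g lam φ).2.defect ℓ = 0 := fun lam h φ => by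
    rw [hg lam h]; exact ((e ⟨lam, h⟩).1 φ).2
  have hg4 : ∀ lam mu : SymIrr, lam.1 < ℓ ^ r → mu.1 < ℓ ^ r → g lam = g mu → lam = mu := by
    intro lam mu h h' hgg
    refine congrArg Subtype.val (e.injective (a₁ := ⟨lam, h⟩) (a₂ := ⟨mu, h'⟩)
      (Subtype.ext (funext fun φ => Subtype.ext ?_)))
    rw [← hg, ← hg, hgg]
  have hg5 : ∀ κ : LabelIrr ℓ r → SymIrr, (∀ φ, (κ φ).2.defect ℓ = 0) →
      ∑ φ, φ.1.1 * (κ φ).1 < ℓ ^ r → ∃ lam : SymIrr, lam.1 < ℓ ^ r ∧ g lam = κ := by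
    intro κ h h'
    refine ⟨(e.symm ⟨fun φ => ⟨κ φ, h φ⟩, h'⟩).1, (e.symm ⟨fun φ => ⟨κ φ, h φ⟩, h'⟩).2, ?_⟩
    funext φ
    rw [hg _ (e.symm ⟨fun φ => ⟨κ φ, h φ⟩, h'⟩).2]
    simp
  have hlam : ∀ lam ∈ labelFamilies C n, ∀ c, (lam c).1 < ℓ ^ r := fun lam h c => by
    refine lt_of_le_of_lt ?_ hn
    rw [← mem_labelFamilies.1 h]
    exact Finset.single_le_sum (f := fun c => (lam c).1) (fun _ _ => Nat.zero_le _)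
      (Finset.mem_univ c)
  let Φ : (C → SymIrr) → LabelIrr ℓ r × C → SymIrr := fun lam p => g (lam p.2) p.1
  have hΦ1 : ∀ lam ∈ labelFamilies C n, ∑ p, p.1.1.1 * (Φ lam p).1 = n := fun lam h => by
    rw [Fintype.sum_prod_type_right, ← mem_labelFamilies.1 h]
    exact Finset.sum_congr rfl fun c _ => (hg1 _ (hlam lam h c)).symm
  have hΦ2 : ∀ lam ∈ labelFamilies C n, totalDefect ℓ lam =
      ((∑ p, padicValNat ℓ p.1.1.1.factorial * (Φ lam p).1 : ℕ) : ℤ) := fun lam h => by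
    rw [Fintype.sum_prod_type_right, totalDefect, Nat.cast_sum]
    exact Finset.sum_congr rfl fun c _ => hg2 _ (hlam lam h c)
  have hΦ3 : ∀ lam ∈ labelFamilies C n, totalDefect ℓ (Φ lam) = 0 := fun lam h =>
    Finset.sum_eq_zero fun p _ => hg3 _ (hlam lam h p.2) p.1
  have hΦ4 : ∀ lam ∈ labelFamilies C n, twistWeight (Prod.map id δ) (Φ lam) = twistWeight δ lam := by
    intro lam h
    rw [twistWeight, twistWeight]
    have e1 : (Prod.map id δ : LabelIrr ℓ r × C → LabelIrr ℓ r × C) = id ↔ δ = id := by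
      constructor
      · intro h
        funext c
        exact congrArg Prod.snd (congrFun h (φ0, c))
      · rintro rfl; rfl
    have e2 : Φ lam ∘ Prod.map id δ = Φ lam ↔ lam ∘ δ = lam := by
      constructor
      · intro h'
        funext c
        refine hg4 _ _ (hlam lam h _) (hlam lam h _) (funext fun φ => ?_)
        exact congrFun h' (φ, c)
      · intro h'
        funext p
        exact congrArg (fun mu => g mu p.1) (congrFun h' p.2)
    simp only [ne_eq, e1, e2]
  have hpos : ∀ φ : LabelIrr ℓ r, 0 < φ.1.1 := fun φ => by
    obtain ⟨i, -, hi⟩ := φ.2.1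
    rw [hi]; exact pow_pos hℓ.pos i
  rw [← Finset.sum_filter, Finset.sum_sigma', ← Finset.sum_filter]
  -- The index `k` is the total size of the cores. On the side of triples it is the number of blocks
  -- of the Young subgroup.
  refine Finset.sum_bij (fun lam _ => ⟨∑ p, (Φ lam p).1, Φ lam⟩) ?_ ?_ ?_ ?_
  · intro lam h
    rw [Finset.mem_filter] at h
    rw [Finset.mem_filter, Finset.mem_sigma, mem_labelFamilies, Finset.mem_range, Nat.lt_succ_iff]
    refine ⟨⟨?_, rfl⟩, ⟨hΦ1 lam h.1, ?_⟩, hΦ3 lam h.1⟩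
    · rw [← hΦ1 lam h.1]
      exact Finset.sum_le_sum fun p _ => Nat.le_mul_of_pos_left _ (hpos p.1)
    · have := hΦ2 lam h.1
      rw [h.2] at this
      exact (Nat.cast_injective this).symm
  · intro lam h mu h' hh
    rw [Finset.mem_filter] at h h'
    have h1 : Φ lam = Φ mu := by
      have := (Sigma.mk.inj_iff.1 hh).2
      exact eq_of_heq this
    funext c
    exact hg4 _ _ (hlam lam h.1 c) (hlam mu h'.1 c) (funext fun φ => congrFun h1 (φ, c))
  · rintro ⟨k, kap⟩ h
    rw [Finset.mem_filter, Finset.mem_sigma, mem_labelFamilies] at h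
    obtain ⟨⟨-, h1⟩, ⟨h2, h3⟩, h4⟩ := h
    simp only at h1 h2 h3 h4
    have h5 : ∀ p, (kap p).2.defect ℓ = 0 := by
      have := (Finset.sum_eq_zero_iff_of_nonneg fun p _ => SymIrr.defect_nonneg hℓ (kap p)).1 h4
      exact fun p => this p (Finset.mem_univ p)
    rw [Fintype.sum_prod_type_right] at h2
    have h6 : ∀ c, ∃ lam : SymIrr, lam.1 < ℓ ^ r ∧ g lam = fun φ => kap (φ, c) := fun c => by
      refine hg5 _ (fun φ => h5 _) (lt_of_le_of_lt ?_ hn)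
      rw [← h2]
      exact Finset.single_le_sum (f := fun c => ∑ φ : LabelIrr ℓ r, φ.1.1 * (kap (φ, c)).1)
        (fun _ _ => Nat.zero_le _) (Finset.mem_univ c)
    choose lam hl1 hl2 using h6
    have h7 : Φ lam = kap := funext fun p => congrFun (hl2 p.2) p.1
    have h8 : lam ∈ labelFamilies C n := by
      rw [mem_labelFamilies, ← h2]
      refine Finset.sum_congr rfl fun c _ => ?_
      rw [hg1 _ (hl1 c)]
      simp only [hl2]
    refine ⟨lam, Finset.mem_filter.2 ⟨h8, ?_⟩, ?_⟩
    · rw [hΦ2 lam h8, h7, h3]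
    · subst h7
      subst h1
      rfl
  · intro lam h
    exact (hΦ4 lam (Finset.mem_filter.1 h).1).symm

end TowerCount

/-! ### Young subgroups as stabilizers of set partitions -/

section Blocks

variable {B K K' X : Type*}

theorem exists_perm_comp_eq [Finite B] {x x0 : B → X} (h : labelType x = labelType x0) :
    ∃ τ : Perm B, ∀ b, x0 (τ b) = x b := by
  have e : ∀ a, {b // x b = a} ≃ {b // x0 b = a} := fun a =>
    (Finite.card_eq.1 (congrFun h a)).some
  refine ⟨((sigmaFiberEquiv x).symm.trans (sigmaCongrRight e)).trans (sigmaFiberEquiv x0), ?_⟩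
  intro b
  exact (e (x b) ⟨b, rfl⟩).2

theorem labelType_comp_equiv (p : B → K) (e : K ≃ K') (j : K) :
    labelType (fun b => e (p b)) (e j) = labelType p j :=
  Nat.card_congr (subtypeEquivRight fun _ => e.injective.eq_iff)

theorem surjective_of_labelType_pos [Finite B] {p : B → K} (h : ∀ j, 0 < labelType p j) :
    Function.Surjective p := fun j =>
  have : Nonempty {b // p b = j} := (Nat.card_pos_iff.1 (h j)).1
  ⟨this.some.1, this.some.2⟩

theorem swap_mem_labelStab [DecidableEq B] {p : B → K} {a b : B} :
    swap a b ∈ labelStab p ↔ p a = p b := by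
  constructor
  · intro h
    have := h b
    rwa [swap_apply_right] at this
  · intro h c
    rw [swap_apply_def]
    split_ifs with h1 h2
    · rw [h1, h]
    · rw [h2, h]
    · rfl

/-- The stabilizer determines the partition, because the transposition of `a` and `b` belongs to it
exactly when `a` and `b` lie in the same block. -/
theorem exists_equiv_of_conj {p : B → K} {p' : B → K'} (hp : Function.Surjective p)
    (hp' : Function.Surjective p') {h : Perm B}
    (hh : ∀ τ, τ ∈ labelStab p ↔ h * τ * h⁻¹ ∈ labelStab p') :
    ∃ e : K ≃ K', ∀ b, p' (h b) = e (p b) := by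
  classical
  have h1 : ∀ a b, p a = p b ↔ p' (h a) = p' (h b) := fun a b => by
    rw [← swap_mem_labelStab, hh, Equiv.mul_swap_eq_swap_mul, mul_inv_cancel_right,
      swap_mem_labelStab]
  choose s hs using hp
  have h2 : ∀ b, p' (h (s (p b))) = p' (h b) := fun b => (h1 _ _).1 (hs _)
  refine ⟨Equiv.ofBijective (fun j => p' (h (s j))) ⟨fun j j' hj => ?_, fun j' => ?_⟩,
    fun b => (h2 b).symm⟩
  · have := (h1 _ _).2 hj
    rwa [hs, hs] at this
  · obtain ⟨b, rfl⟩ := hp' j'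
    exact ⟨p (h⁻¹ b), (h2 (h⁻¹ b)).trans (congrArg p' (h.apply_symm_apply b))⟩

theorem conj_mem_labelStab {p : B → K} {p' : B → K'} {h : Perm B} {e : K ≃ K'}
    (he : ∀ b, p' (h b) = e (p b)) (τ : Perm B) :
    τ ∈ labelStab p ↔ h * τ * h⁻¹ ∈ labelStab p' := by
  constructor
  · intro hτ b
    obtain ⟨a, rfl⟩ := h.surjective b
    have h1 : (h * τ * h⁻¹) (h a) = h (τ a) := by simp
    rw [h1, he, he, hτ a]
  · intro hτ b
    have h1 := hτ (h b)
    rw [show (h * τ * h⁻¹) (h b) = h (τ b) by simp, he, he] at h1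
    exact e.injective h1

theorem labelChar_conj_equiv [Finite B] [Fintype K] [Fintype K'] {p : B → K} {p' : B → K'}
    {h : Perm B} {e : K ≃ K'} (he : ∀ b, p' (h b) = e (p b)) (lam : K' → SymIrr)
    (τ : labelStab p) :
    labelChar p' lam ⟨h * τ * h⁻¹, (conj_mem_labelStab he τ.1).1 τ.2⟩ =
      labelChar p (fun j => lam (e j)) τ := by
  rw [labelChar, labelChar, ← e.prod_comp]
  refine Finset.prod_congr rfl fun j _ => ?_
  let E : {b // p b = j} ≃ {b // p' b = e j} := h.subtypeEquiv fun b => by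
    rw [he, e.injective.eq_iff]
  rw [← SymIrr.char_permCongr _ E]
  congr 1

theorem card_index_fiber {n : ℕ} (μ : Composition n) (j : Fin μ.length) :
    labelType μ.index j = μ.blocksFun j := by
  have e : {b // μ.index b = j} ≃ Fin (μ.blocksFun j) :=
    { toFun := fun b => finCongr (by rw [b.2]) (μ.invEmbedding b.1)
      invFun := fun i => ⟨μ.embedding j i, μ.index_embedding j i⟩
      left_inv := by
        rintro ⟨b, rfl⟩
        exact Subtype.ext (μ.embedding_comp_inv b)
      right_inv := fun i => by
        apply Fin.ext
        simp }
  rw [labelType, Nat.card_congr e, Nat.card_fin]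

theorem youngSubgroup_map_conj {n : ℕ} (μ : Composition n) (g : Perm (Fin n)) :
    (youngSubgroup μ).map (MulAut.conj g).toMonoidHom =
      labelStab fun b => μ.index (g⁻¹ b) := by
  have he : ∀ b, (fun b => μ.index (g⁻¹ b)) (g b) = Equiv.refl _ (μ.index b) := fun b => by
    simp
  ext τ
  rw [Subgroup.mem_map_equiv]
  change _ ∈ labelStab μ.index ↔ _
  rw [conj_mem_labelStab (p' := fun b => μ.index (g⁻¹ b)) he]
  simp [mul_assoc]

theorem exists_labelStab_of_mem_symYoungSubgroups {ℓ n : ℕ} {Y : Subgroup (Perm (Fin n))}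
    (hY : Y ∈ symYoungSubgroups ℓ n) : ∃ (k : ℕ) (p : Fin n → Fin k), Y = labelStab p ∧
      ∀ j, ∃ i : ℕ, labelType p j = ℓ ^ i := by
  obtain ⟨μ, -, hμ, g, rfl⟩ := hY
  refine ⟨μ.length, fun b => μ.index (g⁻¹ b), youngSubgroup_map_conj μ g, fun j => ?_⟩
  obtain ⟨i, hi⟩ := hμ _ (μ.blocksFun_mem_blocks j)
  refine ⟨i, ?_⟩
  rw [← hi, ← card_index_fiber]
  exact congrFun (labelType_comp_perm μ.index g⁻¹) j

theorem labelStab_mem_symYoungSubgroups {ℓ n k : ℕ} (hℓ : 0 < ℓ) (p : Fin n → Fin k)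
    (hp : ∀ j, ∃ i : ℕ, labelType p j = ℓ ^ i) : labelStab p ∈ symYoungSubgroups ℓ n := by
  -- The order dual makes the sorted block sizes decrease, as the parts of a partition must.
  let f : Fin k → ℕᵒᵈ := fun j => OrderDual.toDual (labelType p j)
  let σ := Tuple.sort f
  have hσ : Monotone (f ∘ σ) := Tuple.monotone_sort f
  let bl : List ℕ := List.ofFn fun j => labelType p (σ j)
  have hmem : ∀ b ∈ bl, ∃ j, labelType p j = b := fun b hb => by
    obtain ⟨j, hj⟩ := (List.mem_ofFn' _ _).1 hb
    exact ⟨σ j, hj⟩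
  let μ : Composition n := ⟨bl, fun {b} hb => by
    obtain ⟨j, rfl⟩ := hmem b hb
    obtain ⟨i, hi⟩ := hp j
    rw [hi]; exact pow_pos hℓ i, by
    rw [List.sum_ofFn, Equiv.sum_comp σ (labelType p), sum_labelType, Nat.card_fin]⟩
  have hlen : μ.length = k := List.length_ofFn
  let e : Fin μ.length ≃ Fin k := (finCongr hlen).trans σ
  have hb : ∀ j, μ.blocksFun j = labelType p (e j) := fun j => by
    change bl.get j = _
    simp [bl, e]
    rfl
  obtain ⟨τ, hτ⟩ := exists_perm_comp_eq (x := fun b => e (μ.index b)) (x0 := p) (by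
    funext j
    obtain ⟨j, rfl⟩ := e.surjective j
    rw [labelType_comp_equiv, card_index_fiber, hb])
  refine ⟨μ, ?_, ?_, τ, ?_⟩
  · change bl.Pairwise (· ≥ ·)
    rw [List.pairwise_ofFn]
    intro i j hij
    exact hσ hij.le
  · intro b hb
    obtain ⟨j, rfl⟩ := hmem b hb
    exact hp j
  · rw [youngSubgroup_map_conj]
    ext ρ
    have h1 : ∀ b, e (μ.index (τ⁻¹ b)) = p b := fun b => by
      rw [← hτ]; exact congrArg p (τ.apply_symm_apply b)
    change (∀ b, _) ↔ ∀ b, _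
    simp only [← h1, e.injective.eq_iff]

end Blocks

/-! ### Preimages of subgroups of the complement, and invariant linear characters -/

namespace SplitExt

variable {N H G Z : Type*} [CommGroup N] [Group H] [Group G] [MulAction H Z]
  (E : SplitExt N H G Z)

/-- The projection of a split extension to the complement. -/
noncomputable def proj : G →* H where
  toFun g := ((Equiv.ofBijective _ E.bij).symm g).2
  map_one' := by
    have : (Equiv.ofBijective _ E.bij).symm 1 = ((1 : N), (1 : H)) := by
      rw [Equiv.symm_apply_eq]; simp
    rw [this]
  map_mul' a b := by
    obtain ⟨⟨ν, h⟩, rfl⟩ := (Equiv.ofBijective _ E.bij).surjective a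
    obtain ⟨⟨μ, k⟩, rfl⟩ := (Equiv.ofBijective _ E.bij).surjective b
    have : (Equiv.ofBijective _ E.bij) (ν, h) * (Equiv.ofBijective _ E.bij) (μ, k) =
        (Equiv.ofBijective _ E.bij) (ν * E.cj h μ, h * k) := E.mul_eq ν μ h k
    rw [this]
    simp only [Equiv.symm_apply_apply]

theorem proj_mul (ν : N) (h : H) : E.proj (E.i ν * E.s h) = h :=
  congrArg Prod.snd ((Equiv.ofBijective _ E.bij).symm_apply_apply (ν, h))

theorem proj_i (ν : N) : E.proj (E.i ν) = 1 := by
  have := E.proj_mul ν 1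
  rwa [map_one, mul_one] at this

theorem proj_s (h : H) : E.proj (E.s h) = h := by
  have := E.proj_mul 1 h
  rwa [map_one, one_mul] at this

theorem exists_eq_mul (g : G) : ∃ ν, g = E.i ν * E.s (E.proj g) := by
  obtain ⟨⟨ν, h⟩, rfl⟩ := E.bij.2 g
  exact ⟨ν, by simp only [proj_mul]⟩

theorem eq_of_mul_eq {ν μ : N} {h k : H} (e : E.i ν * E.s h = E.i μ * E.s k) : ν = μ ∧ h = k :=
  Prod.mk.inj (E.bij.1 (a₁ := (ν, h)) (a₂ := (μ, k)) e)

/-- The preimage of a subgroup of the complement, as a split extension. -/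
noncomputable def restrict (Y : Subgroup H) : SplitExt N Y (Y.comap E.proj) Z where
  i := E.i.codRestrict _ fun ν => by
    rw [Subgroup.mem_comap, proj_i]; exact one_mem _
  s := (E.s.comp Y.subtype).codRestrict _ fun h => by
    rw [Subgroup.mem_comap]
    change E.proj (E.s h.1) ∈ Y
    rw [proj_s]; exact h.2
  cj := E.cj.comp Y.subtype
  conj h ν := Subtype.ext (E.conj h.1 ν)
  bij := by
    constructor
    · rintro ⟨ν, h⟩ ⟨μ, k⟩ e
      have := E.eq_of_mul_eq (congrArg Subtype.val e)
      exact Prod.ext this.1 (Subtype.ext this.2)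
    · rintro ⟨g, hg⟩
      obtain ⟨ν, hν⟩ := E.exists_eq_mul g
      exact ⟨(ν, ⟨E.proj g, hg⟩), Subtype.ext hν.symm⟩
  ch := E.ch
  ch_smul h z ν := E.ch_smul h.1 z ν

/-- The extension of an invariant linear character. -/
noncomputable def extCh (z : Z) (hz : ∀ h : H, h • z = z) : G →* ℂˣ where
  toFun g := E.ch z ((Equiv.ofBijective _ E.bij).symm g).1
  map_one' := by
    have : (Equiv.ofBijective _ E.bij).symm 1 = ((1 : N), (1 : H)) := by
      rw [Equiv.symm_apply_eq]; simp
    rw [this, map_one]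
  map_mul' a b := by
    obtain ⟨⟨ν, h⟩, rfl⟩ := (Equiv.ofBijective _ E.bij).surjective a
    obtain ⟨⟨μ, k⟩, rfl⟩ := (Equiv.ofBijective _ E.bij).surjective b
    have : (Equiv.ofBijective _ E.bij) (ν, h) * (Equiv.ofBijective _ E.bij) (μ, k) =
        (Equiv.ofBijective _ E.bij) (ν * E.cj h μ, h * k) := E.mul_eq ν μ h k
    rw [this]
    simp only [Equiv.symm_apply_apply, map_mul]
    rw [E.ch_cj_of_mem (MulAction.mem_stabilizer_iff.2 (hz h))]

theorem extCh_mul (z : Z) (hz : ∀ h : H, h • z = z) (ν : N) (h : H) :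
    E.extCh z hz (E.i ν * E.s h) = E.ch z ν :=
  congrArg (fun p : N × H => E.ch z p.1) ((Equiv.ofBijective _ E.bij).symm_apply_apply (ν, h))

variable [Finite N] [Finite H]

/-- An invariant linear character of `N` extends to `G` by being trivial on the complement. Its
product with the inflation of `φ` has the same norm as `φ`. -/
theorem exists_irr_of_fixed (z : Z) (hz : ∀ h : H, h • z = z) (φ : Irr H) :
    ∃ χ : Irr G, ∀ ν h, χ.toFun (E.i ν * E.s h) = E.ch z ν * φ.toFun h := by
  classical
  have := E.finite_group
  cases nonempty_fintype N
  cases nonempty_fintype H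
  cases nonempty_fintype G
  let f : G → ℂ := (fun g => (E.extCh z hz g : ℂ)) * (φ.toFun ∘ E.proj)
  have hf : IsChar f := (isChar_monoidHom _).mul (φ.isChar.comp _)
  have hf' : ∀ ν h, f (E.i ν * E.s h) = E.ch z ν * φ.toFun h := fun ν h => by
    simp only [f, Pi.mul_apply, Function.comp_apply, extCh_mul, proj_mul]
  have hff : ip f f = 1 := by
    have h1 : ∀ g, f g * f g⁻¹ = φ.toFun (E.proj g) * φ.toFun (E.proj g)⁻¹ := fun g => by
      simp only [f, Pi.mul_apply, Function.comp_apply, map_inv, Units.val_inv_eq_inv_val]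
      have := (E.extCh z hz g).ne_zero
      field_simp
    have h2 := φ.ip_self
    have hH : (Nat.card H : ℂ) ≠ 0 := Nat.cast_ne_zero.2 Nat.card_pos.ne'
    have hN : (Nat.card N : ℂ) ≠ 0 := Nat.cast_ne_zero.2 Nat.card_pos.ne'
    rw [ip_eq, inv_mul_eq_iff_eq_mul₀ hH] at h2
    rw [ip_eq, Finset.sum_congr rfl fun g _ => h1 g, E.sum_eq, E.card_eq]
    simp only [proj_mul, h2, Finset.sum_const, Finset.card_univ, nsmul_eq_mul,
      ← Nat.card_eq_fintype_card]
    push_cast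
    field_simp
  obtain ⟨χ, hχ⟩ := hf.exists_irr hff
  exact ⟨χ, fun ν h => by rw [hχ, hf']⟩

theorem comp_of_fixed {f : G → ℂ} {z : Z} {φ : H → ℂ}
    (h : ∀ ν h, f (E.i ν * E.s h) = E.ch z ν * φ h) (k : H) : E.comp f z k = φ k := by
  cases nonempty_fintype N
  rw [comp_eq]
  have hN : (Nat.card N : ℂ) ≠ 0 := Nat.cast_ne_zero.2 Nat.card_pos.ne'
  have : ∀ ν, f (E.i ν * E.s k) * ((E.ch z ν)⁻¹ : ℂˣ) = φ k := fun ν => by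
    rw [h, Units.val_inv_eq_inv_val]
    have := (E.ch z ν).ne_zero
    field_simp
  rw [Finset.sum_congr rfl fun ν _ => this ν, Finset.sum_const, Finset.card_univ, nsmul_eq_mul,
    ← Nat.card_eq_fintype_card]
  field_simp

/-- The character built from the `z`-component of `χ` by `exists_irr_of_fixed` has the same
component, so `res_injective` identifies it with `χ`. -/
theorem exists_eq_of_fixed {z : Z} (hz : ∀ h : H, h • z = z) (χ : Irr G)
    (hχ : E.res χ.toFun z ≠ 0) :
    ∃ φ : Irr H, ∀ ν h, χ.toFun (E.i ν * E.s h) = E.ch z ν * φ.toFun h := by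
  obtain ⟨φ', hφ'⟩ := E.exists_irr_res χ hχ
  have htop : MulAction.stabilizer H z = ⊤ := by
    rw [Subgroup.eq_top_iff']; exact hz
  let e : MulAction.stabilizer H z ≃* H := (MulEquiv.subgroupCongr htop).trans Subgroup.topEquiv
  have he : ∀ h, e h = h := fun h => rfl
  let φ : Irr H := Irr.congr e φ'
  obtain ⟨χ', hχ'⟩ := E.exists_irr_of_fixed z hz φ
  have h1 : χ = χ' := by
    refine E.res_injective hχ ?_
    funext h
    rw [← hφ']
    change _ = E.comp χ'.toFun z h
    rw [E.comp_of_fixed hχ', Irr.congr_apply]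
    congr 1
  exact ⟨φ, h1 ▸ hχ'⟩

end SplitExt

/-! ### Conjugacy of pairs `(Y, ζ)` and the triples above them -/

section PairConj

variable {G : Type*} [Group G]

/-- Conjugation by `g` takes one pair of a subgroup and a character to another. -/
structure PairConj (g : G) (Y : Subgroup G) (ζ : Irr Y) (Y' : Subgroup G) (ζ' : Irr Y') :
    Prop where
  mem_iff : ∀ x : G, x ∈ Y ↔ g * x * g⁻¹ ∈ Y'
  apply_eq : ∀ (y : Y) (y' : Y'), (y' : G) = g * y * g⁻¹ → ζ' y' = ζ y

theorem mem_normalizerStabilizer_iff {g : G} {Y : Subgroup G} {ζ : Irr Y} :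
    g ∈ normalizerStabilizer Y ζ ↔ PairConj g Y ζ Y ζ :=
  ⟨fun h => ⟨Subgroup.mem_normalizer_iff.1 h.1, h.2⟩,
    fun h => ⟨Subgroup.mem_normalizer_iff.2 h.1, h.2⟩⟩

namespace PairConj

variable {g k : G} {Y Y' Y'' : Subgroup G} {ζ : Irr Y} {ζ' : Irr Y'} {ζ'' : Irr Y''}

theorem symm (h : PairConj g Y ζ Y' ζ') : PairConj g⁻¹ Y' ζ' Y ζ where
  mem_iff x := by
    rw [h.mem_iff]
    have : g * (g⁻¹ * x * g⁻¹⁻¹) * g⁻¹ = x := by group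
    rw [this]
  apply_eq y y' e := (h.apply_eq y' y (by rw [e]; group)).symm

theorem trans (h : PairConj g Y ζ Y' ζ') (h' : PairConj k Y' ζ' Y'' ζ'') :
    PairConj (k * g) Y ζ Y'' ζ'' where
  mem_iff x := by
    rw [h.mem_iff, h'.mem_iff]
    have : k * (g * x * g⁻¹) * k⁻¹ = k * g * x * (k * g)⁻¹ := by group
    rw [this]
  apply_eq y y' e := by
    rw [h'.apply_eq ⟨_, (h.mem_iff _).1 y.2⟩ y' (by rw [e]; group), h.apply_eq y _ rfl]

theorem conj_mem (h : PairConj g Y ζ Y' ζ') {t : G} (ht : t ∈ normalizerStabilizer Y ζ) :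
    g * t * g⁻¹ ∈ normalizerStabilizer Y' ζ' := by
  rw [mem_normalizerStabilizer_iff] at ht ⊢
  have := (h.symm.trans ht).trans h
  rwa [← mul_assoc] at this

/-- The isomorphism of stabilizers induced by conjugation of pairs. -/
def stabilizerEquiv (h : PairConj g Y ζ Y' ζ') :
    normalizerStabilizer Y ζ ≃* normalizerStabilizer Y' ζ' where
  toFun t := ⟨g * t * g⁻¹, h.conj_mem t.2⟩
  invFun t := ⟨g⁻¹ * t * g⁻¹⁻¹, h.symm.conj_mem t.2⟩
  left_inv t := Subtype.ext (by simp; group)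
  right_inv t := Subtype.ext (by simp; group)
  map_mul' t u := Subtype.ext (by simp)

theorem map_subgroupInStabilizer (h : PairConj g Y ζ Y' ζ') :
    (subgroupInStabilizer Y ζ).map (h.stabilizerEquiv : _ →* _) = subgroupInStabilizer Y' ζ' := by
  ext t
  change t ∈ Subgroup.map h.stabilizerEquiv.toMonoidHom _ ↔ _
  rw [Subgroup.mem_map_equiv, Subgroup.mem_subgroupOf, Subgroup.mem_subgroupOf]
  exact (h.symm.mem_iff t.1).symm

/-- Transport of a triple along a conjugation of pairs. -/
theorem exists_triple {ℓ : ℕ} {𝒴 : Set (Subgroup G)} {T : DZTriple ℓ 𝒴}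
    (h : PairConj g T.Y T.ζ Y' ζ') (hY : Y' ∈ 𝒴) (hζ : ¬ ℓ ∣ ζ'.degree) :
    ∃ (lam : Irr (normalizerStabilizer Y' ζ' ⧸ subgroupInStabilizer Y' ζ'))
      (hlam : lam.defect ℓ = 0), DZTriple.ConjBy g T ⟨Y', hY, ζ', hζ, lam, hlam⟩ := by
  let e := QuotientGroup.congr (subgroupInStabilizer T.Y T.ζ) (subgroupInStabilizer Y' ζ')
    h.stabilizerEquiv h.map_subgroupInStabilizer
  refine ⟨Irr.congr e T.lam, by rw [Irr.defect_congr]; exact T.lam_defect,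
    h.mem_iff, h.apply_eq, fun t t' ht => ?_⟩
  change T.lam.toFun (e.symm (QuotientGroup.mk t')) = T.lam.toFun (QuotientGroup.mk t)
  congr 1
  rw [MulEquiv.symm_apply_eq]
  change _ = QuotientGroup.mk (h.stabilizerEquiv t)
  congr 1
  exact Subtype.ext ht

end PairConj

theorem DZTriple.ConjBy.pairConj {ℓ : ℕ} {𝒴 : Set (Subgroup G)} {g : G} {S T : DZTriple ℓ 𝒴}
    (h : DZTriple.ConjBy g S T) : PairConj g S.Y S.ζ T.Y T.ζ := ⟨h.Y_eq, h.ζ_eq⟩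

/-- The number of classes of triples lying over the class of a given pair. -/
theorem card_classes_over [Finite G] {ℓ : ℕ} {𝒴 : Set (Subgroup G)} {Y : Subgroup G} (ζ : Irr Y)
    (hY : Y ∈ 𝒴) (hζ : ¬ ℓ ∣ ζ.degree) :
    Nat.card {c : DZTripleClass ℓ 𝒴 // ∃ T, ⟦T⟧ = c ∧ ∃ g, PairConj g T.Y T.ζ Y ζ} =
      irrCount ℓ (normalizerStabilizer Y ζ ⧸ subgroupInStabilizer Y ζ) 0 := by
  let f : {lam : Irr (normalizerStabilizer Y ζ ⧸ subgroupInStabilizer Y ζ) // lam.defect ℓ = 0} →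
      {c : DZTripleClass ℓ 𝒴 // ∃ T, ⟦T⟧ = c ∧ ∃ g, PairConj g T.Y T.ζ Y ζ} := fun lam =>
    ⟨⟦⟨Y, hY, ζ, hζ, lam.1, lam.2⟩⟧, _, rfl, 1, (DZTriple.ConjBy.one _).pairConj⟩
  refine (Nat.card_congr (Equiv.ofBijective f ⟨?_, ?_⟩)).symm
  · intro lam mu h
    obtain ⟨g, hg⟩ := Quotient.exact (congrArg Subtype.val h)
    refine Subtype.ext (Irr.ext (funext fun t => ?_))
    obtain ⟨t, rfl⟩ := QuotientGroup.mk_surjective t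
    -- An element conjugating one triple over `(Y, ζ)` to another stabilizes the pair, so it acts on
    -- the quotient by an inner automorphism, which fixes every character.
    have h1 : g ∈ normalizerStabilizer Y ζ := mem_normalizerStabilizer_iff.2 hg.pairConj
    let u : normalizerStabilizer Y ζ := ⟨g, h1⟩
    have h2 := hg.lam_eq t (u * t * u⁻¹) rfl
    have h3 : mu.1.toFun (QuotientGroup.mk (u * t * u⁻¹)) = mu.1.toFun (QuotientGroup.mk t) :=
      mu.1.apply_conj (QuotientGroup.mk u) (QuotientGroup.mk t)
    exact (h3.symm.trans h2).symm
  · rintro ⟨c, T, rfl, g, hg⟩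
    obtain ⟨lam, hlam, h⟩ := hg.exists_triple hY hζ
    exact ⟨⟨lam, hlam⟩, Subtype.ext (Quotient.sound ⟨g⁻¹, h.inv⟩)⟩

end PairConj

/-! ### Wreath-like extensions: block groups and their labelled characters -/

/-- A split extension of a symmetric group by a commutative group, such that the linear characters
of the latter are the labellings of the points by `C`, up to an involution of `C`. -/
structure WreathExt (N G Z B C : Type*) [CommGroup N] [Group G] [MulAction (Perm B) Z]
    (δ : C → C) extends SplitExt N (Perm B) G Z where
  q : (B → C) → Z
  q_surjective : Function.Surjective q
  q_eq_iff : ∀ f f', q f = q f' ↔ f' = f ∨ f' = δ ∘ f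
  smul_q : ∀ (h : Perm B) f, h • q f = q fun b => f (h⁻¹ b)

namespace WreathExt

variable {N G Z B C : Type*} [CommGroup N] [Group G] [MulAction (Perm B) Z] {δ : C → C}
  (W : WreathExt N G Z B C δ)

/-- The preimage of the group of permutations preserving the blocks of a set partition. -/
noncomputable abbrev blockGroup {K : Type*} (p : B → K) : Subgroup G :=
  (labelStab p).comap W.proj

variable {K K' : Type*} [Fintype K] [Fintype K'] [Finite B] [Finite N]

theorem smul_q_comp (p : B → K) (c : K → C) (h : labelStab p) :
    h • W.q (fun b => c (p b)) = W.q fun b => c (p b) := by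
  change h.1 • W.q (fun b => c (p b)) = _
  rw [W.smul_q]
  congr 1
  funext b
  exact congrArg c ((labelStab p).inv_mem h.2 b)

theorem exists_blockIrr (p : B → K) (c : K → C) (lam : K → SymIrr)
    (hlam : ∀ j, (lam j).1 = labelType p j) :
    ∃ ζ : Irr (W.blockGroup p), ∀ (g : W.blockGroup p) ν (h : labelStab p),
      (g : G) = W.i ν * W.s h →
        ζ.toFun g = W.ch (W.q fun b => c (p b)) ν * labelChar p lam h := by
  obtain ⟨χ, hχ⟩ := (W.toSplitExt.restrict (labelStab p)).exists_irr_of_fixed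
    (W.q fun b => c (p b)) (W.smul_q_comp p c) (labelIrr p ⟨lam, hlam⟩)
  refine ⟨χ, fun g ν h hg => ?_⟩
  rw [labelIrr_toFun] at hχ
  rw [show g = (W.toSplitExt.restrict (labelStab p)).i ν * (W.toSplitExt.restrict (labelStab p)).s h
    from Subtype.ext hg, hχ]
  rfl

/-- The character of a block group given by labels of the blocks. -/
noncomputable def blockIrr (p : B → K) (c : K → C) (lam : K → SymIrr)
    (hlam : ∀ j, (lam j).1 = labelType p j) : Irr (W.blockGroup p) :=
  (W.exists_blockIrr p c lam hlam).choose

variable {p : B → K} {c : K → C} {lam : K → SymIrr} (hlam : ∀ j, (lam j).1 = labelType p j)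
  {p' : B → K'} {c' : K' → C} {lam' : K' → SymIrr} (hlam' : ∀ j, (lam' j).1 = labelType p' j)

theorem blockIrr_apply (g : W.blockGroup p) (ν : N) (h : labelStab p)
    (hg : (g : G) = W.i ν * W.s h) :
    (W.blockIrr p c lam hlam).toFun g =
      W.ch (W.q fun b => c (p b)) ν * labelChar p lam h :=
  (W.exists_blockIrr p c lam hlam).choose_spec g ν h hg

omit [Finite N] in
theorem mem_blockGroup {p : B → K} (ν : N) (h : labelStab p) : W.i ν * W.s h ∈ W.blockGroup p := by
  rw [Subgroup.mem_comap, W.proj_mul]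
  exact h.2

theorem degree_blockIrr :
    (W.blockIrr p c lam hlam).degree = (labelIrr p ⟨lam, hlam⟩).degree := by
  apply Irr.degree_eq_of_apply_one
  rw [W.blockIrr_apply hlam 1 1 1 (by simp), map_one, Units.val_one, one_mul, Irr.degree_eq,
    ← labelIrr_toFun p ⟨lam, hlam⟩]

theorem pairConj_blockIrr_of_equiv {g : G} (e : K ≃ K')
    (he : ∀ b, p' (W.proj g b) = e (p b)) (hl : ∀ j, lam' (e j) = lam j)
    (hc : (∀ j, c' (e j) = c j) ∨ ∀ j, c' (e j) = δ (c j)) :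
    PairConj g (W.blockGroup p) (W.blockIrr p c lam hlam) (W.blockGroup p')
      (W.blockIrr p' c' lam' hlam') where
  mem_iff x := by
    rw [Subgroup.mem_comap, Subgroup.mem_comap, conj_mem_labelStab he, map_mul, map_mul, map_inv]
  apply_eq y y' hy := by
    obtain ⟨μ, hμ⟩ := W.exists_eq_mul g
    set h := W.proj g with hh
    obtain ⟨ν, hν⟩ := W.exists_eq_mul y
    let y0 : labelStab p := ⟨W.proj y, y.2⟩
    have hν : (y : G) = W.i ν * W.s y0.1 := hν
    -- Write `g` as `W.i μ * W.s h`. The factor from `N` lies in the target block group and acts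
    -- there by an inner automorphism, so only `h` matters.
    let y1 : labelStab p' := ⟨h * y0 * h⁻¹, (conj_mem_labelStab he _).1 y0.2⟩
    let y2 : W.blockGroup p' := ⟨W.i (W.cj h ν) * W.s y1.1, W.mem_blockGroup _ _⟩
    let m : W.blockGroup p' := ⟨W.i μ, by
      rw [Subgroup.mem_comap, W.proj_i]; exact one_mem _⟩
    have h1 : y' = m * y2 * m⁻¹ := by
      apply Subtype.ext
      rw [hy, hμ, hν]
      change _ = W.i μ * (W.i (W.cj h ν) * W.s (h * y0 * h⁻¹)) * (W.i μ)⁻¹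
      rw [← W.conj_eq]
      group
    have h2 : (W.blockIrr p' c' lam' hlam').toFun y' =
        (W.blockIrr p' c' lam' hlam').toFun y2 := by
      rw [h1]; exact Irr.apply_conj _ _ _
    refine h2.trans ?_
    rw [W.blockIrr_apply hlam' y2 (W.cj h ν) y1 rfl, W.blockIrr_apply hlam y ν y0 hν]
    congr 1
    · have h3 : h⁻¹ • W.q (fun b => c' (p' b)) = W.q fun b => c (p b) := by
        rw [W.smul_q]
        simp only [inv_inv, he]
        symm
        rw [W.q_eq_iff]
        rcases hc with hc | hc
        · exact Or.inl (funext fun b => hc _)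
        · exact Or.inr (funext fun b => hc _)
      have h4 := W.ch_smul h (W.q fun b => c (p b)) ν
      rw [← h3, smul_inv_smul] at h4
      rw [h4, h3]
    · rw [labelChar_conj_equiv he]
      congr 1
      funext j
      exact hl j

/-- A conjugating element induces a bijection `e` of blocks. Pulling the second labelling back along
`e` gives another character of the first block group, equal to the given one. Comparing values on
the complement recovers the characters of the blocks; comparing on `N` recovers the labels in `C` up
to `δ`, because `q` does. -/
theorem pairConj_blockIrr_iff (hp : Function.Surjective p)
    (hp' : Function.Surjective p') {g : G} :
    PairConj g (W.blockGroup p) (W.blockIrr p c lam hlam) (W.blockGroup p')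
      (W.blockIrr p' c' lam' hlam') ↔
    ∃ e : K ≃ K', (∀ b, p' (W.proj g b) = e (p b)) ∧ (∀ j, lam' (e j) = lam j) ∧
      ((∀ j, c' (e j) = c j) ∨ ∀ j, c' (e j) = δ (c j)) := by
  constructor
  · intro h
    obtain ⟨e, he⟩ := exists_equiv_of_conj hp hp' (h := W.proj g) fun τ => by
      have := h.mem_iff (W.s τ)
      rw [Subgroup.mem_comap, Subgroup.mem_comap, map_mul, map_mul, map_inv, W.proj_s] at this
      exact this
    refine ⟨e, he, ?_⟩
    have hsize : ∀ j, (lam' (e j)).1 = labelType p j := fun j => by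
      rw [hlam']
      refine (Nat.card_congr ((W.proj g).subtypeEquiv fun b => ?_)).symm
      rw [he, e.injective.eq_iff]
    have h1 := W.pairConj_blockIrr_of_equiv (c := fun j => c' (e j)) (lam := fun j => lam' (e j))
      hsize hlam' e he (fun _ => rfl) (Or.inl fun _ => rfl)
    have h2 : ∀ y, (W.blockIrr p c lam hlam).toFun y =
        (W.blockIrr p (fun j => c' (e j)) (fun j => lam' (e j)) hsize).toFun y := fun y =>
      (h.apply_eq y ⟨_, (h.mem_iff _).1 y.2⟩ rfl).symm.trans
        (h1.apply_eq y ⟨_, (h.mem_iff _).1 y.2⟩ rfl)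
    have h3 : ∀ ν (h : labelStab p), (W.ch (W.q fun b => c (p b)) ν : ℂ) * labelChar p lam h =
        W.ch (W.q fun b => c' (e (p b))) ν * labelChar p (fun j => lam' (e j)) h := fun ν h => by
      have := h2 ⟨W.i ν * W.s h, W.mem_blockGroup _ _⟩
      rwa [W.blockIrr_apply hlam _ ν h rfl, W.blockIrr_apply hsize _ ν h rfl] at this
    have h4 : labelChar p lam = labelChar p fun j => lam' (e j) := by
      funext h
      have := h3 1 h
      simpa only [map_one, Units.val_one, one_mul] using this
    constructor
    · have h5 : (⟨lam, hlam⟩ : {lam : K → SymIrr // ∀ a, (lam a).1 = labelType p a}) =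
          ⟨fun j => lam' (e j), hsize⟩ :=
        (labelIrr_bijective p).1 (Irr.ext (by rw [labelIrr_toFun, labelIrr_toFun, h4]))
      intro j
      exact (congrFun (congrArg Subtype.val h5) j).symm
    · have h6 : W.ch (W.q fun b => c (p b)) = W.ch (W.q fun b => c' (e (p b))) := by
        refine MonoidHom.ext fun ν => Units.ext ?_
        have := h3 ν 1
        rw [h4] at this
        refine mul_right_cancel₀ ?_ this
        rw [← labelIrr_toFun p ⟨fun j => lam' (e j), hsize⟩]
        have hd := Irr.degree_eq (labelIrr p ⟨fun j => lam' (e j), hsize⟩)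
        change ((labelIrr p ⟨fun j => lam' (e j), hsize⟩).degree : ℂ) = (labelIrr p _).toFun 1 at hd
        rw [← hd]
        exact Nat.cast_ne_zero.2 (Irr.degree_pos _).ne'
      rcases (W.q_eq_iff _ _).1 (W.ch.injective h6) with h7 | h7
      · refine Or.inl fun j => ?_
        obtain ⟨b, rfl⟩ := hp j
        exact congrFun h7 b
      · refine Or.inr fun j => ?_
        obtain ⟨b, rfl⟩ := hp j
        exact congrFun h7 b
  · rintro ⟨e, he, hl, hc⟩
    exact W.pairConj_blockIrr_of_equiv hlam hlam' e he hl hc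

/-- The character of a block group given by a labelling of the blocks. -/
noncomputable abbrev labelledIrr {X : Type*} (s : X → SymIrr) (p : B → K) (x : K → X × C)
    (hx : ∀ j, (s (x j).1).1 = labelType p j) : Irr (W.blockGroup p) :=
  W.blockIrr p (fun j => (x j).2) (fun j => s (x j).1) hx

section Labelled

variable {X : Type*} {s : X → SymIrr} (hs : Function.Injective s) {p : B → K} {p' : B → K'}
  {x : K → X × C} {x' : K' → X × C} (hx : ∀ j, (s (x j).1).1 = labelType p j)
  (hx' : ∀ j, (s (x' j).1).1 = labelType p' j)

include hs in
theorem pairConj_labelledIrr_iff (hp : Function.Surjective p) (hp' : Function.Surjective p')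
    {g : G} :
    PairConj g (W.blockGroup p) (W.labelledIrr s p x hx) (W.blockGroup p')
      (W.labelledIrr s p' x' hx') ↔
    ∃ e : K ≃ K', (∀ b, p' (W.proj g b) = e (p b)) ∧
      ((∀ j, x' (e j) = x j) ∨ ∀ j, x' (e j) = Prod.map id δ (x j)) := by
  rw [W.pairConj_blockIrr_iff hx hx' hp hp']
  simp only [hs.eq_iff, Prod.ext_iff, Prod.map_fst, Prod.map_snd, id_eq, forall_and, and_or_left]

include hs in
theorem exists_pairConj_labelledIrr_iff (hp : Function.Surjective p)
    (hp' : Function.Surjective p') :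
    (∃ g, PairConj g (W.blockGroup p) (W.labelledIrr s p x hx) (W.blockGroup p')
      (W.labelledIrr s p' x' hx')) ↔
    ∃ e : K ≃ K', (∀ j, x' (e j) = x j) ∨ ∀ j, x' (e j) = Prod.map id δ (x j) := by
  constructor
  · rintro ⟨g, hg⟩
    obtain ⟨e, -, he⟩ := (W.pairConj_labelledIrr_iff hs hx hx' hp hp').1 hg
    exact ⟨e, he⟩
  · rintro ⟨e, he⟩
    have h1 : ∀ j, (x' (e j)).1 = (x j).1 := by
      rcases he with he | he
      · exact fun j => by rw [he]
      · exact fun j => by rw [he]; rfl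
    obtain ⟨τ, hτ⟩ := exists_perm_comp_eq (x := fun b => e (p b)) (x0 := p') (by
      funext j
      obtain ⟨j, rfl⟩ := e.surjective j
      rw [labelType_comp_equiv, ← hx, ← hx', h1])
    exact ⟨W.s τ, (W.pairConj_labelledIrr_iff hs hx hx' hp hp').2
      ⟨e, fun b => by rw [W.proj_s]; exact hτ b, he⟩⟩

include hs in
/-- The quotient of the stabilizer of a labelled character is the group of permutations of the
blocks that preserve the labels, up to the involution. -/
theorem nonempty_stabilizerQuotientEquiv (hp : Function.Surjective p)
    (hδ : Function.Involutive (Prod.map id δ : X × C → X × C)) :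
    Nonempty (normalizerStabilizer (W.blockGroup p) (W.labelledIrr s p x hx) ⧸
      subgroupInStabilizer (W.blockGroup p) (W.labelledIrr s p x hx) ≃*
      twistedStab (Prod.map id δ) hδ x) := by
  have h1 : ∀ g : normalizerStabilizer (W.blockGroup p) (W.labelledIrr s p x hx),
      ∃ τ : twistedStab (Prod.map id δ) hδ x, ∀ b, p (W.proj g b) = τ.1 (p b) := fun g => by
    obtain ⟨e, he, he'⟩ := (W.pairConj_labelledIrr_iff hs hx hx hp hp).1
      (mem_normalizerStabilizer_iff.1 g.2)
    exact ⟨⟨e, he'⟩, he⟩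
  choose F hF using h1
  have hF' : ∀ (g : normalizerStabilizer (W.blockGroup p) (W.labelledIrr s p x hx)) (τ : twistedStab (Prod.map id δ) hδ x), (∀ b, p (W.proj g b) = τ.1 (p b)) →
      F g = τ := fun g τ h => by
    refine Subtype.ext (Equiv.ext fun j => ?_)
    obtain ⟨b, rfl⟩ := hp j
    rw [← hF, h]
  let f : normalizerStabilizer (W.blockGroup p) (W.labelledIrr s p x hx) →*
      twistedStab (Prod.map id δ) hδ x := MonoidHom.mk' F fun g h => hF' _ _ fun b => by
    rw [Subgroup.coe_mul, map_mul, Perm.mul_apply, hF, hF]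
    rfl
  -- The label of a block determines its size, and `δ` does not affect the first component; a
  -- permutation of the blocks respecting labels up to `δ` therefore lifts to the points.
  have hf : Function.Surjective f := fun τ => by
    have h1 : ∀ j, (x (τ.1 j)).1 = (x j).1 := by
      rcases τ.2 with he | he
      · exact fun j => by rw [he]
      · exact fun j => by rw [he]; rfl
    obtain ⟨σ, hσ⟩ := exists_perm_comp_eq (x := fun b => τ.1 (p b)) (x0 := p) (by
      funext j
      obtain ⟨j, rfl⟩ := τ.1.surjective j
      rw [labelType_comp_equiv, ← hx, ← hx, h1])
    have h2 : ∀ b, p (W.proj (W.s σ) b) = τ.1 (p b) := fun b => by rw [W.proj_s]; exact hσ b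
    exact ⟨⟨W.s σ, mem_normalizerStabilizer_iff.2
      ((W.pairConj_labelledIrr_iff hs hx hx hp hp).2 ⟨τ.1, h2, τ.2⟩)⟩, hF' _ _ h2⟩
  have hker : f.ker = subgroupInStabilizer (W.blockGroup p) (W.labelledIrr s p x hx) := by
    ext g
    rw [MonoidHom.mem_ker, Subgroup.mem_subgroupOf, Subgroup.mem_comap]
    constructor
    · intro h b
      rw [hF]
      exact congrArg (fun t : twistedStab (Prod.map id δ) hδ x => t.1 (p b)) h
    · intro h
      exact hF' g 1 fun b => h b
  exact ⟨(QuotientGroup.quotientMulEquivOfEq hker).symm.trans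
    (QuotientGroup.quotientKerEquivOfSurjective f hf)⟩

end Labelled

end WreathExt

/-! ### Valuations of orders of Young subgroups -/

section Valuation

variable {ℓ : ℕ}

theorem padicValNat_card_of_index_le_two (hℓ : ℓ.Prime) {S : Type*} [Group S] [Finite S]
    (A : Subgroup S) (hA : (∀ s, s ∈ A) ∨ ℓ ≠ 2 ∧ ∀ s t, s ∉ A → t ∉ A → s * t ∈ A) :
    padicValNat ℓ (Nat.card S) = padicValNat ℓ (Nat.card A) := by
  have := Fact.mk hℓ
  by_cases h : ∀ s, s ∈ A
  · rw [(Subgroup.eq_top_iff' A).2 h, Subgroup.card_top]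
  · push Not at h
    obtain ⟨s, hs⟩ := h
    obtain ⟨h2, hA⟩ := hA.resolve_left fun h => hs (h s)
    have hi : A.index = 2 := by
      rw [Subgroup.index_eq_two_iff]
      refine ⟨s, fun t => ?_⟩
      by_cases ht : t ∈ A
      · exact Or.inr ⟨ht, fun h => hs ((A.mul_mem_cancel_left ht).1 h)⟩
      · exact Or.inl ⟨hA t s ht hs, ht⟩
    rw [← A.card_mul_index, hi, padicValNat.mul Nat.card_pos.ne' two_ne_zero,
      padicValNat.eq_zero_of_not_dvd (n := 2), add_zero]
    intro h
    exact h2 ((Nat.prime_dvd_prime_iff_eq hℓ Nat.prime_two).1 h)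

variable {B K C : Type*} [Finite B] [Fintype K] [Fintype C]

theorem padicValNat_card_labelStab (hℓ : ℓ.Prime) (p : B → K) :
    padicValNat ℓ (Nat.card (labelStab p)) =
      ∑ j, padicValNat ℓ (labelType p j).factorial := by
  cases nonempty_fintype B
  rw [card_labelStab, ← Nat.factorization_def _ hℓ, Nat.factorization_prod_apply
    fun _ _ => Nat.factorial_ne_zero _]
  exact Finset.sum_congr rfl fun x _ => Nat.factorization_def _ hℓ

theorem sub_one_mul_padicValNat_factorial_add_le (hℓ : ℓ.Prime) (m : ℕ) :
    (ℓ - 1) * padicValNat ℓ m.factorial + (if m = 0 then 0 else 1) ≤ m := by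
  have := Fact.mk hℓ
  split_ifs with h
  · simp [h]
  · exact sub_one_mul_padicValNat_factorial_lt_of_ne_zero ℓ h

/-- A refinement of a set partition with blocks of prime power size, whose stabilizer has the same
`ℓ`-part, is trivial. -/
theorem apply_eq_of_padicValNat_le (hℓ : ℓ.Prime) {p : B → K}
    (hp : ∀ j, ∃ i : ℕ, labelType p j = ℓ ^ i) {f : B → C}
    (h : padicValNat ℓ (Nat.card (labelStab p)) ≤
      padicValNat ℓ (Nat.card (labelStab fun b => (p b, f b)))) {b b' : B} (hb : p b = p b') :
    f b = f b' := by
  classical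
  cases nonempty_fintype B
  rw [padicValNat_card_labelStab hℓ, padicValNat_card_labelStab hℓ] at h
  set x : B → K × C := fun b => (p b, f b) with hx
  -- For prime power blocks the bound `(ℓ - 1) ν_ℓ(m!) + 1 ≤ m` is an equality, so a refinement
  -- without loss of valuation has at most as many nonempty blocks as `p`. The projection to the
  -- blocks of `p` is then a surjection between sets of equal size, hence injective.
  have h1 : (ℓ - 1) * ∑ j, padicValNat ℓ (labelType p j).factorial + Fintype.card K =
      Nat.card B := by
    rw [← sum_labelType p, Finset.mul_sum, ← Finset.card_univ, Finset.card_eq_sum_ones,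
      ← Finset.sum_add_distrib]
    refine Finset.sum_congr rfl fun j _ => ?_
    obtain ⟨i, hi⟩ := hp j
    rw [hi, sub_one_mul_padicValNat_pow_factorial hℓ]
  have h2 : (ℓ - 1) * ∑ a, padicValNat ℓ (labelType x a).factorial +
      (Finset.univ.image x).card ≤ Nat.card B := by
    have h3 : (Finset.univ.image x).card = ∑ a, if labelType x a = 0 then 0 else 1 := by
      simp only [← ite_not (_ = 0)]
      rw [← Finset.card_filter]
      congr 1
      ext a
      rw [Finset.mem_image, Finset.mem_filter, labelType, Nat.card_eq_zero,
        or_iff_left (not_infinite_iff_finite.2 inferInstance)]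
      simp
    rw [h3, ← sum_labelType x, Finset.mul_sum, ← Finset.sum_add_distrib]
    exact Finset.sum_le_sum fun a _ => sub_one_mul_padicValNat_factorial_add_le hℓ _
  have h3 : (Finset.univ.image x).card ≤ (Finset.univ : Finset K).card := by
    rw [Finset.card_univ]
    have := Nat.mul_le_mul_left (ℓ - 1) h
    omega
  have h4 := Finset.inj_on_of_surj_on_of_card_le (s := Finset.univ.image x)
    (t := (Finset.univ : Finset K)) (fun a _ => a.1) (fun _ _ => Finset.mem_univ _)
    (fun j _ => by
      obtain ⟨b, rfl⟩ := surjective_of_labelType_pos (p := p) (fun j => by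
        obtain ⟨i, hi⟩ := hp j
        rw [hi]; exact pow_pos hℓ.pos i) j
      exact ⟨x b, Finset.mem_image_of_mem _ (Finset.mem_univ _), rfl⟩) h3
  exact (Prod.mk.inj (h4 (Finset.mem_image_of_mem x (Finset.mem_univ b))
    (Finset.mem_image_of_mem x (Finset.mem_univ b')) hb)).2

theorem SymIrr.defect_le (lam : SymIrr) :
    lam.2.defect ℓ ≤ padicValNat ℓ lam.1.factorial := by
  rw [Irr.defect, Nat.card_perm, Nat.card_fin]
  omega

theorem not_dvd_degree_labelIrr_iff (hℓ : ℓ.Prime) (p : B → K)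
    (lam : {lam : K → SymIrr // ∀ a, (lam a).1 = labelType p a}) :
    ¬ ℓ ∣ (labelIrr p lam).degree ↔ ∀ j, ¬ ℓ ∣ (lam.1 j).2.degree := by
  rw [Irr.not_dvd_degree_iff hℓ, defect_labelIrr hℓ, padicValNat_card_labelStab hℓ]
  rw [Nat.cast_sum]
  simp only [← lam.2]
  rw [Finset.sum_eq_sum_iff_of_le fun j _ => (lam.1 j).defect_le]
  refine ⟨fun h j => ?_, fun h j _ => ?_⟩
  · rw [Irr.not_dvd_degree_iff hℓ, h j (Finset.mem_univ j), Nat.card_perm, Nat.card_fin]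
  · rw [(Irr.not_dvd_degree_iff hℓ _).1 (h j), Nat.card_perm, Nat.card_fin]

end Valuation

/-! ### Characters of degree prime to `ℓ` of block groups -/

namespace WreathExt

variable {N G Z B C : Type*} [CommGroup N] [Group G] [MulAction (Perm B) Z] {δ : C → C}
  (W : WreathExt N G Z B C δ) {K : Type*} [Fintype K] [Finite B] [Finite N] [Fintype C]
  {ℓ : ℕ}

/-- Let `f` be a labelling below `ζ`. Since `ζ` has degree prime to `ℓ`, the degree formula of
Clifford theory gives the stabilizer of `q f` the full `ℓ`-part of `labelStab p`. The subgroup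
fixing `f` itself has the same `ℓ`-part, its index being 1, or at most 2 with `ℓ` odd, and it embeds
in the stabilizer of the common refinement of `p` and `f`. By `apply_eq_of_padicValNat_le`, `f` is
constant on blocks; its class is thus invariant and `exists_eq_of_fixed` applies. -/
theorem exists_eq_blockIrr (hℓ : ℓ.Prime) (hδ : Function.Involutive δ) (hδ' : IsTwist ℓ δ)
    {p : B → K} (hp : ∀ j, ∃ i : ℕ, labelType p j = ℓ ^ i) (ζ : Irr (W.blockGroup p))
    (hζ : ¬ ℓ ∣ ζ.degree) :
    ∃ (c : K → C) (lam : K → SymIrr) (hlam : ∀ j, (lam j).1 = labelType p j),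
      ζ = W.blockIrr p c lam hlam ∧ ∀ j, ¬ ℓ ∣ (lam j).2.degree := by
  classical
  have := Fact.mk hℓ
  let E := W.toSplitExt.restrict (labelStab p)
  have := E.finite_chars
  have : Finite (W.blockGroup p) := E.finite_group
  cases nonempty_fintype Z
  obtain ⟨z, hz⟩ : ∃ z, E.res ζ.toFun z ≠ 0 := by
    by_contra! h
    have h1 := E.sum_card_stabilizer ζ
    rw [Finset.filter_false_of_mem fun z _ => not_not.2 (h z), Finset.sum_empty] at h1
    exact Nat.card_pos.ne h1
  obtain ⟨f, rfl⟩ := W.q_surjective z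
  obtain ⟨φ, hφ⟩ := E.exists_irr_res ζ hz
  have h1 := congrArg (padicValNat ℓ) (E.degree_eq ζ _ φ hφ)
  rw [padicValNat.mul ζ.degree_pos.ne' Nat.card_pos.ne',
    padicValNat.mul Nat.card_pos.ne' φ.degree_pos.ne',
    padicValNat.eq_zero_of_not_dvd hζ, zero_add] at h1
  let S := MulAction.stabilizer (labelStab p) (W.q f)
  let A : Subgroup S := (labelStab f).comap ((labelStab p).subtype.comp S.subtype)
  have hS : ∀ s : S, (∀ b, f (s.1.1⁻¹ b) = f b) ∨ ∀ b, f (s.1.1⁻¹ b) = δ (f b) := fun s => by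
    have h2 : s.1.1 • W.q f = W.q f := s.2
    rw [W.smul_q, eq_comm, W.q_eq_iff] at h2
    exact h2.imp congrFun congrFun
  have hA : ∀ s : S, s ∈ A ↔ ∀ b, f (s.1.1⁻¹ b) = f b := fun s => by
    rw [← inv_mem_iff]; rfl
  have h3 : padicValNat ℓ (Nat.card S) = padicValNat ℓ (Nat.card A) := by
    refine padicValNat_card_of_index_le_two hℓ A ?_
    rcases hδ' with rfl | ⟨-, h2⟩
    · exact Or.inl fun s => (hA s).2 ((hS s).elim id id)
    · refine Or.inr ⟨h2, fun s t hs ht => (hA _).2 fun b => ?_⟩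
      have hs' := (hS s).resolve_left fun h => hs ((hA s).2 h)
      have ht' := (hS t).resolve_left fun h => ht ((hA t).2 h)
      have : ((s * t).1.1⁻¹ : Perm B) b = t.1.1⁻¹ (s.1.1⁻¹ b) := by simp
      rw [this, ht', hs', hδ]
  have h4 : Nat.card A ∣ Nat.card (labelStab fun b => (p b, f b)) := by
    let F : A →* labelStab fun b => (p b, f b) :=
      ((labelStab p).subtype.comp (S.subtype.comp A.subtype)).codRestrict _ fun a b =>
        Prod.ext (a.1.1.2 b) (a.2 b)
    exact Subgroup.card_dvd_of_injective F fun a a' h =>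
      Subtype.ext (Subtype.ext (Subtype.ext
        (congrArg (fun t : labelStab fun b => (p b, f b) => t.1) h)))
  have h5 : padicValNat ℓ (Nat.card (labelStab p)) ≤
      padicValNat ℓ (Nat.card (labelStab fun b => (p b, f b))) := by
    obtain ⟨m, hm⟩ := h4
    have hm0 : m ≠ 0 := by
      rintro rfl
      rw [mul_zero] at hm
      exact Nat.card_pos.ne' hm
    rw [hm, padicValNat.mul Nat.card_pos.ne' hm0, ← h3]
    exact le_add_right (le_of_le_of_eq (Nat.le_add_right _ _) h1.symm)
  have hsurj : Function.Surjective p := surjective_of_labelType_pos fun j => by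
    obtain ⟨i, hi⟩ := hp j
    rw [hi]; exact pow_pos hℓ.pos i
  choose s hs using hsurj
  have hc : f = fun b => f (s (p b)) :=
    funext fun b => apply_eq_of_padicValNat_le hℓ hp h5 (hs _).symm
  rw [hc] at hz
  obtain ⟨φ', hφ'⟩ := E.exists_eq_of_fixed (W.smul_q_comp p fun j => f (s j)) ζ hz
  obtain ⟨lam, rfl⟩ := (labelIrr_bijective p).2 φ'
  have h6 : ζ = W.blockIrr p (fun j => f (s j)) lam.1 lam.2 := by
    refine Irr.ext (funext fun g => ?_)
    obtain ⟨⟨ν, h⟩, hg⟩ := E.bij.2 g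
    rw [W.blockIrr_apply lam.2 g ν h (congrArg Subtype.val hg.symm), ← labelIrr_toFun, ← hg]
    exact hφ' ν h
  refine ⟨_, lam.1, lam.2, h6, ?_⟩
  rwa [h6, degree_blockIrr, not_dvd_degree_labelIrr_iff hℓ] at hζ

variable {r : ℕ}

theorem exists_eq_labelledIrr (hℓ : ℓ.Prime) (hδ : Function.Involutive δ) (hδ' : IsTwist ℓ δ)
    (hr : Nat.card B < ℓ ^ r) {p : B → K} (hp : ∀ j, ∃ i : ℕ, labelType p j = ℓ ^ i)
    (ζ : Irr (W.blockGroup p)) (hζ : ¬ ℓ ∣ ζ.degree) :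
    ∃ (x : K → LabelIrr ℓ r × C) (hx : ∀ j, (x j).1.1.1 = labelType p j),
      ζ = W.labelledIrr Subtype.val p x hx := by
  obtain ⟨c, lam, hlam, h, h'⟩ := W.exists_eq_blockIrr hℓ hδ hδ' hp ζ hζ
  refine ⟨fun j => (⟨lam j, ?_, h' j⟩, c j), hlam, h⟩
  obtain ⟨i, hi⟩ := hp j
  refine ⟨i, ?_, (hlam j).trans hi⟩
  rw [← Nat.pow_lt_pow_iff_right hℓ.one_lt, ← hi]
  refine lt_of_le_of_lt ?_ hr
  rw [← sum_labelType p]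
  exact Finset.single_le_sum (f := labelType p) (fun _ _ => Nat.zero_le _) (Finset.mem_univ j)

variable {p : B → K} {x : K → LabelIrr ℓ r × C} (hx : ∀ j, (x j).1.1.1 = labelType p j)

theorem not_dvd_degree_labelledIrr (hℓ : ℓ.Prime) :
    ¬ ℓ ∣ (W.labelledIrr Subtype.val p x hx).degree := by
  rw [degree_blockIrr, not_dvd_degree_labelIrr_iff hℓ]
  exact fun j => (x j).1.2.2

include hx in
theorem padicValNat_card_blockGroup (hℓ : ℓ.Prime) (hN : ¬ ℓ ∣ Nat.card N) :
    padicValNat ℓ (Nat.card (W.blockGroup p)) =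
      ∑ j, padicValNat ℓ (x j).1.1.1.factorial := by
  have := Fact.mk hℓ
  rw [(W.toSplitExt.restrict (labelStab p)).card_eq,
    padicValNat.mul Nat.card_pos.ne' Nat.card_pos.ne', padicValNat.eq_zero_of_not_dvd hN,
    zero_add, padicValNat_card_labelStab hℓ]
  simp only [hx]

omit [Fintype K] [Finite B] [Fintype C] in
include hx in
theorem labelType_eq_pow (j : K) : ∃ i : ℕ, labelType p j = ℓ ^ i := by
  obtain ⟨i, -, hi⟩ := (x j).1.2.1
  exact ⟨i, (hx j).symm.trans hi⟩

include hx in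
theorem surjective_of_labelled (hℓ : ℓ.Prime) : Function.Surjective p :=
  surjective_of_labelType_pos fun j => by
    obtain ⟨i, hi⟩ := labelType_eq_pow hx j
    rw [hi]; exact pow_pos hℓ.pos i

end WreathExt

/-- Orbit and stabilizer for permutations together with `{id, δ}` acting on labellings. As `δ` is
trivial or free and `B` is nonempty, a permutation determines the accompanying element of `{id, δ}`,
so the stabilizer of `x` has as many elements as `twistedStab δ hδ x`. -/
theorem sum_card_twistedStab {B X : Type*} [Fintype B] [DecidableEq B] [Nonempty B] [Fintype X]
    {δ : X → X} (hδ : Function.Involutive δ) (hδ' : δ = id ∨ ∀ a, δ a ≠ a) (x0 : B → X)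
    [DecidablePred fun x : B → X =>
      ∃ e : Perm B, (∀ j, x (e j) = x0 j) ∨ ∀ j, x (e j) = δ (x0 j)] [Decidable (δ = id)] :
    (∑ x : B → X, if ∃ e : Perm B, (∀ j, x (e j) = x0 j) ∨ ∀ j, x (e j) = δ (x0 j) then
      Nat.card (twistedStab δ hδ x) else 0) =
      (Nat.card B).factorial * if δ = id then 1 else 2 := by
  classical
  let D : Finset (X → X) := {id, δ}
  have hD : D.card = if δ = id then 1 else 2 := by
    split_ifs with h
    · simp [D, h]
    · exact Finset.card_pair (Ne.symm h)
  have hinj : ∀ ε ∈ D, ∀ ε' ∈ D, ∀ b, ε b = ε' b → ε = ε' := by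
    intro ε h ε' h' b hb
    simp only [D, Finset.mem_insert, Finset.mem_singleton] at h h'
    rcases hδ' with rfl | hfree
    · rw [h.elim id id, h'.elim id id]
    · rcases h with rfl | rfl <;> rcases h' with rfl | rfl
      · rfl
      · exact absurd hb.symm (hfree b)
      · exact absurd hb (hfree b)
      · rfl
  have hmul : ∀ ε ∈ D, ∀ ε' ∈ D, ε ∘ ε' ∈ D := by
    intro ε h ε' h'
    simp only [D, Finset.mem_insert, Finset.mem_singleton] at h h' ⊢
    rcases h with rfl | rfl <;> rcases h' with rfl | rfl
    · exact Or.inl rfl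
    · exact Or.inr rfl
    · exact Or.inr rfl
    · exact Or.inl hδ.comp_self
  have hself : ∀ ε ∈ D, ∀ a, ε (ε a) = a := by
    intro ε h
    simp only [D, Finset.mem_insert, Finset.mem_singleton] at h
    rcases h with rfl | rfl
    · exact fun _ => rfl
    · exact hδ
  have hst : ∀ x (σ : Perm B), σ ∈ twistedStab δ hδ x ↔ ∃ ε ∈ D, ∀ b, x (σ b) = ε (x b) := by
    intro x σ
    simp only [D, Finset.mem_insert, Finset.mem_singleton, exists_eq_or_imp, exists_eq_left]
    rfl
  rw [← hD, ← Nat.card_perm, Nat.card_eq_fintype_card, ← Finset.card_univ, ← Finset.card_product,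
    Finset.card_eq_sum_card_fiberwise (f := fun t : Perm B × (X → X) => t.2 ∘ x0 ∘ t.1)
      (t := Finset.univ) (fun _ _ => Finset.mem_univ _)]
  refine Finset.sum_congr rfl fun x _ => ?_
  have hmem : (∃ e : Perm B, (∀ j, x (e j) = x0 j) ∨ ∀ j, x (e j) = δ (x0 j)) ↔
      ∃ t : Perm B × (X → X), t.2 ∈ D ∧ t.2 ∘ x0 ∘ t.1 = x := by
    have h1 : ∀ e : Perm B, ((∀ j, x (e j) = x0 j) ∨ ∀ j, x (e j) = δ (x0 j)) ↔
        ∃ ε ∈ D, ∀ j, x (e j) = ε (x0 j) := fun e => by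
      simp only [D, Finset.mem_insert, Finset.mem_singleton, exists_eq_or_imp, exists_eq_left]
      rfl
    simp only [h1]
    constructor
    · rintro ⟨e, ε, hε, h⟩
      refine ⟨(e⁻¹, ε), hε, funext fun b => ?_⟩
      change ε (x0 (e⁻¹ b)) = x b
      rw [← h, show e (e⁻¹ b) = b from e.apply_symm_apply b]
    · rintro ⟨⟨τ, ε⟩, hε, rfl⟩
      refine ⟨τ⁻¹, ε, hε, fun b => ?_⟩
      change ε (x0 (τ (τ⁻¹ b))) = _
      rw [show τ (τ⁻¹ b) = b from τ.apply_symm_apply b]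
  rw [if_congr hmem rfl rfl]
  split_ifs with h
  · obtain ⟨⟨τ0, ε0⟩, hε0, rfl⟩ := h
    simp only at hε0
    have hx : ∀ (τ : Perm B) b, ε0 (x0 (τ0 ((τ0⁻¹ * τ) b))) = ε0 (x0 (τ b)) := fun τ b => by
      rw [Perm.mul_apply, show τ0 (τ0⁻¹ (τ b)) = τ b from τ0.apply_symm_apply _]
    rw [Nat.card_eq_fintype_card, ← Finset.card_univ]
    symm
    refine Finset.card_bij (fun t ht => ⟨τ0⁻¹ * t.1, (hst _ _).2 ⟨ε0 ∘ t.2 , ?_, ?_⟩⟩) ?_ ?_ ?_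
    · exact hmul _ hε0 _ (Finset.mem_product.1 (Finset.mem_filter.1 ht).1).2
    · intro b
      have h1 := congrFun (Finset.mem_filter.1 ht).2 b
      have h2 := hself _ (Finset.mem_product.1 (Finset.mem_filter.1 ht).1).2
      change ε0 (x0 (τ0 ((τ0⁻¹ * t.1) b))) = ε0 (t.2 (ε0 (x0 (τ0 b))))
      rw [hx, ← show t.2 (x0 (t.1 b)) = ε0 (x0 (τ0 b)) from h1, h2]
    · exact fun _ _ => Finset.mem_univ _
    · rintro ⟨τ, ε⟩ ht ⟨τ', ε'⟩ ht' h1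
      have h2 : τ = τ' := mul_left_cancel (congrArg Subtype.val h1)
      subst h2
      rw [Finset.mem_filter, Finset.mem_product] at ht ht'
      obtain ⟨b⟩ := ‹Nonempty B›
      rw [hinj ε ht.1.2 ε' ht'.1.2 _ (congrFun (ht.2.trans ht'.2.symm) b)]
    · rintro ⟨σ, hσ⟩ _
      obtain ⟨ε, hε, h1⟩ := (hst _ _).1 hσ
      refine ⟨(τ0 * σ, ε ∘ ε0), ?_, ?_⟩
      · rw [Finset.mem_filter, Finset.mem_product]
        refine ⟨⟨Finset.mem_univ _, hmul _ hε _ hε0⟩, funext fun b => ?_⟩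
        have h2 : ε0 (x0 (τ0 (σ b))) = ε (ε0 (x0 (τ0 b))) := h1 b
        change ε (ε0 (x0 (τ0 (σ b)))) = ε0 (x0 (τ0 b))
        rw [h2, hself ε hε]
      · exact Subtype.ext (by simp)
  · symm
    rw [Finset.card_eq_zero, Finset.filter_eq_empty_iff]
    rintro t ht rfl
    exact h ⟨t, (Finset.mem_product.1 ht).2, rfl⟩

/-! ### From equal counts to a bijection -/

section ClassCount

variable {G : Type*} [Group G] {ℓ : ℕ} {𝒴 : Set (Subgroup G)}

theorem PairConj.card_eq {g : G} {Y Y' : Subgroup G} {ζ : Irr Y} {ζ' : Irr Y'}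
    (h : PairConj g Y ζ Y' ζ') : Nat.card Y = Nat.card Y' :=
  Nat.card_congr ((MulAut.conj g).toEquiv.subtypeEquiv h.mem_iff)

instance [Finite G] : Finite (DZTriple ℓ 𝒴) := by
  let f : DZTriple ℓ 𝒴 → Σ (Y : Subgroup G) (ζ : Irr Y),
      Irr (normalizerStabilizer Y ζ ⧸ subgroupInStabilizer Y ζ) := fun T => ⟨T.Y, T.ζ, T.lam⟩
  refine Finite.of_injective f fun S T h => ?_
  obtain ⟨Y, _, ζ, _, lam, _⟩ := S
  obtain ⟨Y', _, ζ', _, lam', _⟩ := T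
  simp only [f, Sigma.mk.injEq] at h
  obtain ⟨rfl, h⟩ := h
  obtain ⟨rfl, h⟩ := Sigma.mk.inj (eq_of_heq h)
  obtain rfl := eq_of_heq h
  rfl

/-- The `ℓ`-valuation of the order of the subgroup in a class of triples. -/
noncomputable def DZTripleClass.val (c : DZTripleClass ℓ 𝒴) : ℕ :=
  Quotient.lift (s := DZTriple.conjSetoid ℓ 𝒴) (fun T => padicValNat ℓ (Nat.card T.Y))
    (fun _ _ ⟨_, h⟩ => congrArg (padicValNat ℓ) h.pairConj.card_eq) c

theorem DZTripleClass.val_mk (T : DZTriple ℓ 𝒴) :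
    DZTripleClass.val (⟦T⟧ : DZTripleClass ℓ 𝒴) = padicValNat ℓ (Nat.card T.Y) := rfl

theorem exists_equiv_of_card_eq [Finite G] (h0 : ∀ χ : Irr G, 0 ≤ χ.defect ℓ)
    (h : ∀ d : ℕ, irrCount ℓ G d = Nat.card {c : DZTripleClass ℓ 𝒴 // c.val = d}) :
    ∃ f : Irr G ≃ DZTripleClass ℓ 𝒴, ∀ (χ : Irr G) (T : DZTriple ℓ 𝒴),
      f χ = ⟦T⟧ → χ.defect ℓ = (padicValNat ℓ (Nat.card T.Y) : ℤ) := by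
  have e : ∀ d : ℕ, {χ : Irr G // (χ.defect ℓ).toNat = d} ≃ {c : DZTripleClass ℓ 𝒴 // c.val = d} :=
    fun d => (Finite.card_eq.1 ((Nat.card_congr (subtypeEquivRight fun χ => by
      have := h0 χ
      omega)).trans (h d))).some
  refine ⟨Equiv.ofFiberEquiv e, fun χ T hT => ?_⟩
  have h1 := Equiv.ofFiberEquiv_map e χ
  rw [hT, DZTripleClass.val_mk] at h1
  have := h0 χ
  omega

end ClassCount

/-! ### Classes of triples and labellings of blocks -/

namespace WreathExt

variable {N G Z C : Type*} {n : ℕ} [CommGroup N] [Group G] [MulAction (Perm (Fin n)) Z] {δ : C → C}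
  (W : WreathExt N G Z (Fin n) C δ) {ℓ r : ℕ}

/-- The preimages of the `ℓ`-Young subgroups. -/
def youngSubgroups (ℓ : ℕ) : Set (Subgroup G) :=
  {Y | ∃ Y' ∈ symYoungSubgroups ℓ n, Y = Y'.comap W.proj}

variable [Finite N] [Fintype C]

/-- The triples in the class `c` lie over the pair given by a labelling `x` of blocks. -/
def Lies (c : DZTripleClass ℓ (W.youngSubgroups ℓ)) {k : ℕ} (x : Fin k → LabelIrr ℓ r × C) : Prop :=
  ∃ T, ⟦T⟧ = c ∧ ∃ (p : Fin n → Fin k) (hx : ∀ j, (x j).1.1.1 = labelType p j) (g : G),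
    PairConj g T.Y T.ζ (W.blockGroup p) (W.labelledIrr Subtype.val p x hx)

variable {W} {c : DZTripleClass ℓ (W.youngSubgroups ℓ)} {k k' : ℕ} {x : Fin k → LabelIrr ℓ r × C}
  {x' : Fin k' → LabelIrr ℓ r × C}

theorem Lies.exists_equiv (hℓ : ℓ.Prime) (h : W.Lies c x) (h' : W.Lies c x') :
    ∃ e : Fin k ≃ Fin k', (∀ j, x' (e j) = x j) ∨ ∀ j, x' (e j) = Prod.map id δ (x j) := by
  obtain ⟨T, rfl, p, hx, g, hg⟩ := h
  obtain ⟨T', hT, p', hx', g', hg'⟩ := h'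
  obtain ⟨t, ht⟩ := Quotient.exact hT
  exact (W.exists_pairConj_labelledIrr_iff Subtype.val_injective hx hx'
    (surjective_of_labelled hx hℓ) (surjective_of_labelled hx' hℓ)).1
    ⟨_, (hg.symm.trans ht.pairConj.symm).trans hg'⟩

theorem Lies.of_equiv (hℓ : ℓ.Prime) (h : W.Lies c x) (e : Fin k ≃ Fin k')
    (he : (∀ j, x' (e j) = x j) ∨ ∀ j, x' (e j) = Prod.map id δ (x j)) : W.Lies c x' := by
  obtain ⟨T, rfl, p, hx, g, hg⟩ := h
  have hx' : ∀ j, (x' j).1.1.1 = labelType (fun b => e (p b)) j := fun j => by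
    obtain ⟨j, rfl⟩ := e.surjective j
    rw [labelType_comp_equiv, ← hx]
    rcases he with he | he
    · rw [he]
    · rw [he]; rfl
  obtain ⟨t, ht⟩ := (W.exists_pairConj_labelledIrr_iff Subtype.val_injective hx hx'
    (surjective_of_labelled hx hℓ) (surjective_of_labelled hx' hℓ)).2 ⟨e, he⟩
  exact ⟨T, rfl, _, hx', _, hg.trans ht⟩

theorem exists_lies (hℓ : ℓ.Prime) (hδ : Function.Involutive δ) (hδ' : IsTwist ℓ δ)
    (hr : n < ℓ ^ r) (c : DZTripleClass ℓ (W.youngSubgroups ℓ)) :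
    ∃ (k : ℕ) (x : Fin k → LabelIrr ℓ r × C), W.Lies c x := by
  obtain ⟨T, rfl⟩ := Quotient.exists_rep c
  obtain ⟨Y, hY, ζ, hζ, lam, hlam⟩ := T
  obtain ⟨Y', hY', rfl⟩ := id hY
  obtain ⟨k, p, rfl, hp⟩ := exists_labelStab_of_mem_symYoungSubgroups hY'
  obtain ⟨x, hx, rfl⟩ := W.exists_eq_labelledIrr hℓ hδ hδ' (by rwa [Nat.card_fin]) hp ζ hζ
  exact ⟨k, x, _, rfl, p, hx, 1, (DZTriple.ConjBy.one _).pairConj⟩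

theorem Lies.sum_eq (h : W.Lies c x) : ∑ j, (x j).1.1.1 = n := by
  obtain ⟨T, rfl, p, hx, g, hg⟩ := h
  simp only [hx]
  rw [sum_labelType, Nat.card_fin]

theorem Lies.val_eq (hℓ : ℓ.Prime) (hN : ¬ ℓ ∣ Nat.card N) (h : W.Lies c x) :
    c.val = ∑ j, padicValNat ℓ (x j).1.1.1.factorial := by
  obtain ⟨T, rfl, p, hx, g, hg⟩ := h
  rw [DZTripleClass.val_mk, hg.card_eq, W.padicValNat_card_blockGroup hx hℓ hN]

variable (W)

/-- The triples over the fixed pair given by `x` are counted by `card_classes_over`, and the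
quotient group in question is the twisted stabilizer of `x`. -/
theorem card_lies (hℓ : ℓ.Prime) (hδ : Function.Involutive (Prod.map id δ : LabelIrr ℓ r × C → _))
    (hx : ∑ j, (x j).1.1.1 = n) :
    Nat.card {c : DZTripleClass ℓ (W.youngSubgroups ℓ) // W.Lies c x} =
      irrCount ℓ (twistedStab (Prod.map id δ) hδ x) 0 := by
  have := W.finite_group
  obtain ⟨p, hp'⟩ := exists_labelType_eq (B := Fin n) (fun j => (x j).1.1.1) (by rwa [Nat.card_fin])
  have hp := fun j => (hp' j).symm
  obtain ⟨e⟩ := W.nonempty_stabilizerQuotientEquiv Subtype.val_injective hp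
    (surjective_of_labelled hp hℓ) hδ
  rw [← irrCount_congr ℓ e, ← card_classes_over (𝒴 := W.youngSubgroups ℓ)
    (W.labelledIrr Subtype.val p x hp)
    ⟨_, labelStab_mem_symYoungSubgroups hℓ.pos p (labelType_eq_pow hp), rfl⟩
    (W.not_dvd_degree_labelledIrr hp hℓ)]
  refine Nat.card_congr (subtypeEquivRight fun c => ⟨?_, ?_⟩)
  · rintro ⟨T, rfl, p', hx', g, hg⟩
    obtain ⟨t, ht⟩ := (W.exists_pairConj_labelledIrr_iff Subtype.val_injective hx' hp
      (surjective_of_labelled hx' hℓ) (surjective_of_labelled hp hℓ)).2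
      ⟨Equiv.refl _, Or.inl fun _ => rfl⟩
    exact ⟨T, rfl, _, hg.trans ht⟩
  · rintro ⟨T, rfl, g, hg⟩
    exact ⟨T, rfl, p, hp, g, hg⟩

end WreathExt

theorem sum_comp_eq_sum_labelType {B X : Type*} [Fintype B] [Fintype X] (x : B → X) (g : X → ℕ) :
    ∑ j, g (x j) = ∑ a, g a * labelType x a := by
  classical
  rw [← Finset.sum_fiberwise (s := Finset.univ) (g := x)]
  refine Finset.sum_congr rfl fun a _ => ?_
  rw [Finset.sum_congr rfl fun j hj => congrArg g (Finset.mem_filter.1 hj).2, Finset.sum_const,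
    smul_eq_mul, mul_comm, labelType, Nat.card_eq_fintype_card, Fintype.card_subtype]

/-! ### The two counts -/

namespace WreathExt

variable {N G Z C : Type*} {n : ℕ} [CommGroup N] [Group G] [MulAction (Perm (Fin n)) Z] {δ : C → C}
  (W : WreathExt N G Z (Fin n) C δ) {ℓ r : ℕ} [Finite N] [Fintype C] [Fintype (LabelIrr ℓ r)]

-- Double count pairs of a class `c` and a labelling `x` of `k` blocks below it, with weight the
-- order of the twisted stabilizer of `x`. For fixed `c` the labellings form one orbit under
-- permutations and `δ`, contributing `k!` or `2 · k!`. For fixed `x` the classes are the defect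
-- zero characters of that stabilizer, and `sum_twistedStab` sums them over all `x`.
open Classical in
theorem card_classes_of_blocks (hℓ : ℓ.Prime) (hN : ¬ ℓ ∣ Nat.card N)
    (hδ : Function.Involutive (Prod.map id δ : LabelIrr ℓ r × C → LabelIrr ℓ r × C))
    (hδ' : IsTwist ℓ (Prod.map id δ : LabelIrr ℓ r × C → LabelIrr ℓ r × C)) {k : ℕ} (hk : 0 < k)
    (d : ℕ) :
    (if (Prod.map id δ : LabelIrr ℓ r × C → LabelIrr ℓ r × C) = id then 1 else 2) *
      Nat.card {c : DZTripleClass ℓ (W.youngSubgroups ℓ) // c.val = d ∧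
        ∃ x : Fin k → LabelIrr ℓ r × C, W.Lies c x} =
      ∑ kap ∈ labelFamilies (LabelIrr ℓ r × C) k,
        if ((∑ p, p.1.1.1 * (kap p).1 = n) ∧
          ∑ p, padicValNat ℓ p.1.1.1.factorial * (kap p).1 = d) ∧ totalDefect ℓ kap = 0 then
        twistWeight (Prod.map id δ) kap else 0 := by
  have := W.finite_group
  have : Nonempty (Fin k) := ⟨⟨0, hk⟩⟩
  cases nonempty_fintype (DZTripleClass ℓ (W.youngSubgroups ℓ))
  obtain ⟨P, hP⟩ : ∃ P : (LabelIrr ℓ r × C → ℕ) → Prop, ∀ m, P m ↔ (∑ p, p.1.1.1 * m p = n) ∧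
      ∑ p, padicValNat ℓ p.1.1.1.factorial * m p = d := ⟨_, fun _ => Iff.rfl⟩
  have h1 := sum_twistedStab (B := Fin k) hℓ hδ hδ' 0 P
  rw [Nat.card_fin] at h1
  refine Nat.eq_of_mul_eq_mul_left k.factorial_pos (Eq.trans ?_ (h1.trans
    (congrArg _ (Finset.sum_congr rfl fun kap _ => if_congr (and_congr_left' (hP _)) rfl rfl))))
  have h2 : ∀ x : Fin k → LabelIrr ℓ r × C,
      (if P (labelType x) then
        Nat.card (twistedStab (Prod.map id δ) hδ x) *
          irrCount ℓ (twistedStab (Prod.map id δ) hδ x) 0 else 0) =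
      ∑ c : DZTripleClass ℓ (W.youngSubgroups ℓ), if c.val = d ∧ W.Lies c x then
        Nat.card (twistedStab (Prod.map id δ) hδ x) else 0 := by
    intro x
    rw [hP, ← sum_comp_eq_sum_labelType x fun p => p.1.1.1,
      ← sum_comp_eq_sum_labelType x fun p => padicValNat ℓ p.1.1.1.factorial]
    split_ifs with h
    · rw [← W.card_lies hℓ hδ h.1, ← Finset.sum_filter, Finset.sum_const, smul_eq_mul, mul_comm]
      refine congrArg (· * _) ?_
      rw [Nat.card_eq_fintype_card, Fintype.card_subtype]
      refine congrArg Finset.card (Finset.filter_congr fun c _ => ?_)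
      exact ⟨fun hc => ⟨(hc.val_eq hℓ hN).trans h.2, hc⟩, fun hc => hc.2⟩
    · symm
      refine Finset.sum_eq_zero fun c _ => if_neg ?_
      rintro ⟨hd, hc⟩
      exact h ⟨hc.sum_eq, (hc.val_eq hℓ hN).symm.trans hd⟩
  rw [Finset.sum_congr rfl fun x _ => h2 x, Finset.sum_comm, Nat.card_eq_fintype_card,
    Fintype.card_subtype, Finset.card_filter, Finset.mul_sum, Finset.mul_sum]
  refine Finset.sum_congr rfl fun c _ => ?_
  by_cases hc : c.val = d ∧ ∃ x : Fin k → LabelIrr ℓ r × C, W.Lies c x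
  · obtain ⟨hd, x0, hx0⟩ := hc
    have h3 := sum_card_twistedStab hδ (hδ'.imp id And.left) x0
    rw [Nat.card_fin] at h3
    rw [if_pos (show c.val = d ∧ _ from ⟨hd, x0, hx0⟩), mul_one, ← h3]
    refine Finset.sum_congr (Finset.ext fun x => by simp) fun x _ => if_congr ?_ rfl rfl
    exact ⟨fun ⟨e, he⟩ => ⟨hd, hx0.of_equiv hℓ e he⟩, fun h => hx0.exists_equiv hℓ h.2⟩
  · rw [if_neg hc, mul_zero, mul_zero]
    symm
    refine Finset.sum_eq_zero fun x _ => if_neg fun h => hc ⟨h.1, x, h.2⟩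

-- The labelled pair below a class is unique up to permuting blocks and applying `δ`, so every class
-- has a well-defined number of blocks. Summing `card_classes_of_blocks` over this number gives the
-- tower side of `sum_twistWeight_tower`.
open Classical in
theorem card_classes (hℓ : ℓ.Prime) (hN : ¬ ℓ ∣ Nat.card N) (hδ : Function.Involutive δ)
    (hδ' : IsTwist ℓ δ) (hn : 0 < n) (hr : n < ℓ ^ r) (d : ℕ) :
    (if δ = id then 1 else 2) * Nat.card {c : DZTripleClass ℓ (W.youngSubgroups ℓ) // c.val = d} =
      ∑ lam ∈ labelFamilies C n, if totalDefect ℓ lam = d then twistWeight δ lam else 0 := by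
  have := W.finite_group
  cases nonempty_fintype (DZTripleClass ℓ (W.youngSubgroups ℓ))
  have hr0 : 0 < r := Nat.pos_of_ne_zero fun h => by
    rw [h, pow_zero] at hr
    omega
  obtain ⟨φ⟩ := nonempty_labelIrr hℓ hr0
  have hid : (Prod.map id δ : LabelIrr ℓ r × C → LabelIrr ℓ r × C) = id ↔ δ = id :=
    ⟨fun h => funext fun a => (Prod.mk.inj (congrFun h (φ, a))).2, fun h => by rw [h, Prod.map_id]⟩
  have hD : Function.Involutive (Prod.map id δ : LabelIrr ℓ r × C → LabelIrr ℓ r × C) :=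
    fun a => Prod.ext rfl (hδ a.2)
  have hD' : IsTwist ℓ (Prod.map id δ : LabelIrr ℓ r × C → LabelIrr ℓ r × C) :=
    hδ'.imp hid.2 fun h => ⟨fun a ha => h.1 a.2 (Prod.mk.inj ha).2, h.2⟩
  have h0 : ∀ (c : DZTripleClass ℓ (W.youngSubgroups ℓ)) {k : ℕ} (x : Fin k → LabelIrr ℓ r × C),
      W.Lies c x → 0 < k ∧ k < n + 1 := by
    intro c k x h
    have h1 := h.sum_eq
    constructor
    · refine Nat.pos_of_ne_zero ?_
      rintro rfl
      rw [Finset.univ_eq_empty, Finset.sum_empty] at h1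
      omega
    · have h2 : ∑ _j : Fin k, 1 ≤ ∑ j, (x j).1.1.1 := Finset.sum_le_sum fun j _ => by
        obtain ⟨i, -, hi⟩ := (x j).1.2.1
        rw [hi]; exact Nat.pow_pos hℓ.pos
      rw [Finset.sum_const, Finset.card_univ, Fintype.card_fin, smul_eq_mul, mul_one] at h2
      omega
  rw [sum_twistWeight_tower hℓ δ hn hr d]
  have h1 : ∀ k ∈ Finset.range (n + 1), (∑ kap ∈ labelFamilies (LabelIrr ℓ r × C) k,
        if ((∑ p, p.1.1.1 * (kap p).1 = n) ∧
          ∑ p, padicValNat ℓ p.1.1.1.factorial * (kap p).1 = d) ∧ totalDefect ℓ kap = 0 then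
        twistWeight (Prod.map id δ) kap else 0) = (if δ = id then 1 else 2) *
      Nat.card {c : DZTripleClass ℓ (W.youngSubgroups ℓ) // c.val = d ∧
        ∃ x : Fin k → LabelIrr ℓ r × C, W.Lies c x} := by
    intro k _
    rcases Nat.eq_zero_or_pos k with rfl | hk
    · have h2 : IsEmpty {c : DZTripleClass ℓ (W.youngSubgroups ℓ) // c.val = d ∧
          ∃ x : Fin 0 → LabelIrr ℓ r × C, W.Lies c x} :=
        ⟨fun c => c.2.2.elim fun x hx => (h0 _ x hx).1.ne rfl⟩
      rw [Nat.card_of_isEmpty, mul_zero]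
      refine Finset.sum_eq_zero fun kap hkap => if_neg ?_
      rintro ⟨⟨h3, -⟩, -⟩
      rw [mem_labelFamilies, Finset.sum_eq_zero_iff] at hkap
      rw [Finset.sum_eq_zero fun p hp => by rw [hkap p hp, mul_zero]] at h3
      omega
    · rw [← if_congr hid rfl rfl, W.card_classes_of_blocks hℓ hN hD hD' hk d]
  rw [Finset.sum_congr rfl h1, ← Finset.mul_sum]
  congr 1
  simp only [Nat.card_eq_fintype_card, Fintype.card_subtype, Finset.card_filter]
  rw [Finset.sum_comm]
  refine Finset.sum_congr rfl fun c _ => ?_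
  obtain ⟨k, x, hx⟩ := exists_lies (r := r) hℓ hδ hδ' hr c
  rw [Finset.sum_eq_single k]
  · exact if_congr ⟨fun h => ⟨h, x, hx⟩, And.left⟩ rfl rfl
  · rintro k' - hne
    refine if_neg ?_
    rintro ⟨-, x', hx'⟩
    obtain ⟨e, -⟩ := hx.exists_equiv hℓ hx'
    exact hne (by simpa using (Fintype.card_congr e).symm)
  · exact fun h => absurd (Finset.mem_range.2 (h0 c x hx).2) h

-- The stabilizer of `q f` is the twisted stabilizer of `f`. Lifting the Clifford sum from linear
-- characters to labellings counts each term once if `δ = id` and otherwise twice, since then `f ≠ δ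
-- ∘ f`; here `n > 0` is needed.
omit [Fintype (LabelIrr ℓ r)] in
include W in
open Classical in
theorem card_irr (hℓ : ℓ.Prime) (hN : ¬ ℓ ∣ Nat.card N) (hδ : Function.Involutive δ)
    (hδ' : IsTwist ℓ δ) (hn : 0 < n) (d : ℤ) :
    (if δ = id then 1 else 2) * irrCount ℓ G d =
      ∑ lam ∈ labelFamilies C n, if totalDefect ℓ lam = d then twistWeight δ lam else 0 := by
  have := W.finite_chars
  cases nonempty_fintype Z
  have : Nonempty (Fin n) := ⟨⟨0, hn⟩⟩
  have h1 : ∑ f : Fin n → C, Nat.card (twistedStab δ hδ f) * irrCount ℓ (twistedStab δ hδ f) d =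
      n.factorial * ∑ lam ∈ labelFamilies C n,
        if totalDefect ℓ lam = d then twistWeight δ lam else 0 := by
    have h := sum_twistedStab (B := Fin n) hℓ hδ hδ' d fun _ => True
    simp only [if_true, true_and, Nat.card_fin] at h
    convert h
  refine Nat.eq_of_mul_eq_mul_left n.factorial_pos (Eq.trans ?_ h1)
  have h2 := W.card_mul_irrCount hℓ hN d
  rw [Nat.card_perm, Nat.card_fin] at h2
  have h3 : ∀ f, MulAction.stabilizer (Perm (Fin n)) (W.q f) = twistedStab δ hδ f := by
    intro f
    ext τ
    rw [← inv_mem_iff, MulAction.mem_stabilizer_iff,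
      W.smul_q, eq_comm, W.q_eq_iff]
    simp only [inv_inv]
    exact or_congr funext_iff funext_iff
  rw [mul_left_comm, h2, ← Finset.sum_fiberwise (s := Finset.univ) (g := W.q)
    (f := fun f => Nat.card (twistedStab δ hδ f) * irrCount ℓ (twistedStab δ hδ f) d),
    Finset.mul_sum]
  refine Finset.sum_congr rfl fun z _ => ?_
  obtain ⟨f, rfl⟩ := W.q_surjective z
  have h4 : (Finset.univ.filter fun f' => W.q f' = W.q f) = {f, δ ∘ f} := by
    ext f'
    rw [Finset.mem_filter, eq_comm, W.q_eq_iff, Finset.mem_insert, Finset.mem_singleton]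
    exact and_iff_right (Finset.mem_univ _)
  have h5 : (Finset.univ.filter fun f' => W.q f' = W.q f).card = if δ = id then 1 else 2 := by
    rw [h4]
    split_ifs with h
    · rw [h, Function.id_comp, Finset.pair_eq_singleton, Finset.card_singleton]
    · refine Finset.card_pair fun h' => ?_
      exact (hδ'.resolve_left h).1 _ (congrFun h' ⟨0, hn⟩).symm
  rw [← h5, ← smul_eq_mul, ← Finset.sum_const]
  refine Finset.sum_congr rfl fun f' hf' => ?_
  rw [← (Finset.mem_filter.1 hf').2, h3]

omit [Fintype (LabelIrr ℓ r)] in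
/-- The bijection between irreducible characters and classes of triples. -/
theorem exists_irr_equiv_classes (hℓ : ℓ.Prime) (hN : ¬ ℓ ∣ Nat.card N)
    (hδ : Function.Involutive δ) (hδ' : IsTwist ℓ δ) (hn : 0 < n) {𝒴 : Set (Subgroup G)}
    (h𝒴 : 𝒴 = W.youngSubgroups ℓ) :
    ∃ f : Irr G ≃ DZTripleClass ℓ 𝒴, ∀ (χ : Irr G) (T : DZTriple ℓ 𝒴),
      f χ = ⟦T⟧ → χ.defect ℓ = (padicValNat ℓ (Nat.card T.Y) : ℤ) := by
  classical
  subst h𝒴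
  have := W.finite_group
  have hpos : 0 < if δ = id then 1 else 2 := by split_ifs <;> norm_num
  have hr : n < ℓ ^ n := Nat.lt_pow_self hℓ.one_lt
  have := finite_labelIrr hℓ n
  cases nonempty_fintype (LabelIrr ℓ n)
  refine exists_equiv_of_card_eq (fun χ => ?_) fun d => ?_
  · by_contra h
    have h1 : irrCount ℓ G (χ.defect ℓ) = 0 := by
      refine (Nat.mul_eq_zero.1 ?_).resolve_left hpos.ne'
      rw [W.card_irr hℓ hN hδ hδ' hn]
      refine Finset.sum_eq_zero fun lam _ => if_neg fun h2 => h ?_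
      rw [← h2]
      exact Finset.sum_nonneg fun a _ => (lam a).defect_nonneg hℓ
    have : Nonempty {ψ : Irr G // ψ.defect ℓ = χ.defect ℓ} := ⟨⟨χ, rfl⟩⟩
    exact Nat.card_pos.ne' h1
  · refine Nat.eq_of_mul_eq_mul_left hpos ?_
    rw [W.card_irr hℓ hN hδ hδ' hn, W.card_classes hℓ hN hδ hδ' hn hr]

end WreathExt

/-! ### The three families of groups -/

/-- The bijection between characters and classes of triples, for a split extension of a symmetric
group by a commutative group whose linear characters are labellings up to an involution. -/
theorem exists_irr_equiv_classes_of_splitting {N G C : Type*} {n : ℕ} [CommGroup N] [Finite N]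
    [Group G] [Finite C] {δ : C → C} {i : N →* G} (hi : Function.Injective i)
    {π : G →* Perm (Fin n)} {s : Perm (Fin n) →* G} (hs : ∀ h, π (s h) = h) (hker : i.range = π.ker)
    {q : (Fin n → C) → N →* ℂˣ} (hq : Function.Surjective q)
    (hq' : ∀ f f', q f = q f' ↔ f' = f ∨ f' = δ ∘ f)
    (hsmul : ∀ h f ν μ, s h * i ν * (s h)⁻¹ = i μ → q (fun b => f (h⁻¹ b)) μ = q f ν)
    {ℓ : ℕ} (hℓ : ℓ.Prime) (hN : ¬ ℓ ∣ Nat.card N) (hδ : Function.Involutive δ)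
    (hδ' : IsTwist ℓ δ) (hn : 0 < n) {𝒴 : Set (Subgroup G)}
    (h𝒴 : 𝒴 = {Y | ∃ Y' ∈ symYoungSubgroups ℓ n, Y = Y'.comap π}) :
    ∃ f : Irr G ≃ DZTripleClass ℓ 𝒴, ∀ (χ : Irr G) (T : DZTriple ℓ 𝒴),
      f χ = ⟦T⟧ → χ.defect ℓ = (padicValNat ℓ (Nat.card T.Y) : ℤ) := by
  cases nonempty_fintype C
  let e : N ≃* π.ker := (MonoidHom.ofInjective hi).trans (MulEquiv.subgroupCongr hker)
  let cj : Perm (Fin n) →* MulAut N :=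
    (MulAut.congr e.symm).toMonoidHom.comp (MulAut.conjNormal.comp s)
  have he : ∀ x, i (e.symm x) = x.1 := fun x => by
    obtain ⟨ν, rfl⟩ := e.surjective x
    rw [e.symm_apply_apply]; rfl
  have hconj : ∀ h ν, s h * i ν * (s h)⁻¹ = i (cj h ν) := fun h ν =>
    (he (MulAut.conjNormal (s h) (e ν))).symm
  have hi1 : ∀ ν, π (i ν) = 1 := fun ν => by
    rw [← MonoidHom.mem_ker, ← hker]; exact ⟨ν, rfl⟩
  -- The set `Z` is taken to be the dual of `N` itself, with `h` acting by precomposition with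
  -- conjugation by `h⁻¹`.
  let _ : MulAction (Perm (Fin n)) (N →* ℂˣ) :=
    { smul := fun h χ => χ.comp (cj h⁻¹).toMonoidHom
      one_smul := fun χ => MonoidHom.ext fun ν => by
        change χ (cj 1⁻¹ ν) = χ ν
        simp
      mul_smul := fun h k χ => MonoidHom.ext fun ν => by
        change χ (cj (h * k)⁻¹ ν) = χ (cj k⁻¹ (cj h⁻¹ ν))
        rw [mul_inv_rev, map_mul, MulAut.mul_apply] }
  let W : WreathExt N G (N →* ℂˣ) (Fin n) C δ :=
    { i := i
      s := s
      cj := cj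
      conj := hconj
      bij := by
        constructor
        · rintro ⟨ν, h⟩ ⟨μ, k⟩ hh
          have h1 := congrArg π hh
          simp only [map_mul, hi1, hs, one_mul] at h1
          subst h1
          exact Prod.ext (hi (mul_right_cancel hh)) rfl
        · intro g
          have h1 : g * (s (π g))⁻¹ ∈ π.ker := by
            rw [MonoidHom.mem_ker, map_mul, map_inv, hs, mul_inv_cancel]
          rw [← hker] at h1
          obtain ⟨ν, hν⟩ := h1
          exact ⟨(ν, π g), by simp only [hν, inv_mul_cancel_right]⟩
      ch := Equiv.refl _
      ch_smul := fun h χ ν => by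
        change χ (cj h⁻¹ (cj h ν)) = χ ν
        rw [← MulAut.mul_apply, ← map_mul, inv_mul_cancel, map_one, MulAut.one_apply]
      q := q
      q_surjective := hq
      q_eq_iff := hq'
      smul_q := fun h f => MonoidHom.ext fun ν => by
        change q f (cj h⁻¹ ν) = _
        refine (hsmul h f _ _ ?_).symm
        rw [hconj, ← MulAut.mul_apply, ← map_mul, mul_inv_cancel, map_one, MulAut.one_apply] }
  have hW : W.proj = π := MonoidHom.ext fun g => by
    obtain ⟨ν, hν⟩ := W.exists_eq_mul g
    rw [hν, W.proj_mul, map_mul]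
    change _ = π (i ν) * π (s _)
    rw [hi1, hs, one_mul]
  exact W.exists_irr_equiv_classes hℓ hN hδ hδ' hn (by rw [h𝒴, WreathExt.youngSubgroups, hW])

theorem exists_irr_equiv_classes_symmetricGroup {ℓ n : ℕ} (hℓ : ℓ.Prime) (hn : 0 < n) :
    ∃ f : Irr (Perm (Fin n)) ≃ DZTripleClass ℓ (symYoungSubgroups ℓ n),
      ∀ (χ : Irr (Perm (Fin n))) (T : DZTriple ℓ (symYoungSubgroups ℓ n)),
        f χ = ⟦T⟧ → χ.defect ℓ = (padicValNat ℓ (Nat.card T.Y) : ℤ) := by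
  refine exists_irr_equiv_classes_of_splitting (N := Unit) (C := Unit) (δ := id) (i := 1)
    (Function.injective_of_subsingleton _) (π := MonoidHom.id _) (s := MonoidHom.id _)
    (fun _ => rfl) ?_ (q := fun _ => 1) (fun χ => ⟨fun _ => (), Subsingleton.elim _ _⟩)
    (fun f f' => ⟨fun _ => Or.inl (Subsingleton.elim _ _), fun _ => rfl⟩) (fun _ _ _ _ _ => rfl)
    hℓ ?_ (fun _ => rfl) (Or.inl rfl) hn ?_
  · rw [MonoidHom.range_one, MonoidHom.ker_id]
  · rw [Nat.card_unique, Nat.dvd_one]; exact hℓ.ne_one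
  · ext Y
    simp

section PiChar

variable {ι A : Type*} [Fintype ι] [CommGroup A]

/-- The linear character of a power of a group given by a family of linear characters. -/
def piChar (f : ι → A →* ℂˣ) : (ι → A) →* ℂˣ := ∏ b, (f b).comp (Pi.evalMonoidHom _ b)

theorem piChar_apply (f : ι → A →* ℂˣ) (ν : ι → A) : piChar f ν = ∏ b, f b (ν b) := by
  rw [piChar, MonoidHom.finsetProd_apply]
  rfl

theorem piChar_mulSingle [DecidableEq ι] (f : ι → A →* ℂˣ) (b : ι) (a : A) :
    piChar f (Pi.mulSingle b a) = f b a := by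
  rw [piChar_apply, Finset.prod_eq_single b]
  · rw [Pi.mulSingle_eq_same]
  · intro b' _ h
    rw [Pi.mulSingle_eq_of_ne h, map_one]
  · exact fun h => absurd (Finset.mem_univ b) h

/-- A linear character of a power is recovered from its restrictions to the coordinate subgroups. -/
theorem piChar_bijective : Function.Bijective (piChar : (ι → A →* ℂˣ) → _) := by
  classical
  constructor
  · intro f f' h
    funext b
    ext a
    rw [← piChar_mulSingle, h, piChar_mulSingle]
  · intro χ
    refine ⟨fun b => χ.comp (MonoidHom.mulSingle (fun _ => A) b), MonoidHom.ext fun ν => ?_⟩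
    rw [piChar_apply]
    conv_rhs => rw [← Finset.univ_prod_mulSingle ν, map_prod]
    rfl

theorem piChar_comp_inv (h : Perm ι) (f : ι → A →* ℂˣ) (ν : ι → A) :
    piChar (fun b => f (h⁻¹ b)) (mulAutArrow h ν) = piChar f ν := by
  rw [piChar_apply, piChar_apply]
  exact Equiv.prod_comp h⁻¹ fun b => f b (ν b)

end PiChar

theorem card_pi_zmod (e n : ℕ) : Nat.card (Fin n → Multiplicative (ZMod e)) = e ^ n := by
  rw [Nat.card_fun, Nat.card_fin]
  change Nat.card (ZMod e) ^ n = _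
  rw [Nat.card_zmod]

theorem exists_irr_equiv_classes_cyclicWreath {ℓ n e : ℕ} (hℓ : ℓ.Prime) (hn : 0 < n)
    (he : ¬ ℓ ∣ e) :
    ∃ f : Irr (CyclicWreath e n) ≃ DZTripleClass ℓ (wreathYoungSubgroups ℓ e n),
      ∀ (χ : Irr (CyclicWreath e n)) (T : DZTriple ℓ (wreathYoungSubgroups ℓ e n)),
        f χ = ⟦T⟧ → χ.defect ℓ = (padicValNat ℓ (Nat.card T.Y) : ℤ) := by
  have : NeZero e := ⟨fun h => he (h ▸ dvd_zero ℓ)⟩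
  refine exists_irr_equiv_classes_of_splitting (C := Multiplicative (ZMod e) →* ℂˣ) (δ := id)
    (i := SemidirectProduct.inl) SemidirectProduct.inl_injective
    (π := SemidirectProduct.rightHom) (s := SemidirectProduct.inr)
    SemidirectProduct.rightHom_inr SemidirectProduct.range_inl_eq_ker_rightHom
    (q := piChar) piChar_bijective.2 (fun f f' => ?_) ?_ hℓ ?_ (fun _ => rfl) (Or.inl rfl) hn rfl
  · rw [piChar_bijective.1.eq_iff, eq_comm, Function.id_comp, or_self]
  · intro h f ν μ hμ
    rw [← map_inv, ← SemidirectProduct.inl_aut] at hμ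
    rw [← SemidirectProduct.inl_injective hμ, piChar_comp_inv]
  · rw [card_pi_zmod]
    exact fun h => he (hℓ.dvd_of_dvd_pow h)

section Reflection

variable (e n : ℕ)

/-- The diagonal subgroup of `G(2e, 2, n)`. -/
def diagonalSubgroup : Subgroup (Fin n → Multiplicative (ZMod (2 * e))) where
  carrier := {a | (∏ b, a b) ^ e = 1}
  one_mem' := by simp
  mul_mem' {a b} ha hb := by
    simp only [Set.mem_ofPred_eq, Pi.mul_apply, Finset.prod_mul_distrib, mul_pow] at ha hb ⊢
    rw [ha, hb, one_mul]
  inv_mem' {a} ha := by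
    simp only [Set.mem_ofPred_eq, Pi.inv_apply, Finset.prod_inv_distrib, inv_pow] at ha ⊢
    rw [ha, inv_one]

/-- The inclusion of the diagonal subgroup. -/
def diagonalHom : diagonalSubgroup e n →* complexReflectionGroup (2 * e) 2 n :=
  (SemidirectProduct.inl.comp (diagonalSubgroup e n).subtype).codRestrict _ fun a => by
    change (∏ b, a.1 b) ^ (2 * e / 2) = 1
    rw [Nat.mul_div_cancel_left e two_pos]
    exact a.2

/-- The inclusion of the permutation matrices. -/
def permHom : Perm (Fin n) →* complexReflectionGroup (2 * e) 2 n :=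
  SemidirectProduct.inr.codRestrict _ fun h => by
    change (∏ b, (1 : Fin n → Multiplicative (ZMod (2 * e))) b) ^ (2 * e / 2) = 1
    simp

/-- The linear character of order two of a cyclic group. -/
noncomputable def signChar [NeZero (2 * e)] : Multiplicative (ZMod (2 * e)) →* ℂˣ :=
  AddChar.toMonoidHomEquiv (AddChar.zmodChar (2 * e) (ζ := (-1 : ℂˣ)) (by simp))

variable [NeZero (2 * e)]

theorem signChar_one : signChar e (Multiplicative.ofAdd 1) = -1 := by
  have := AddChar.zmodChar_apply' (n := 2 * e) (ζ := (-1 : ℂˣ)) (by simp) 1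
  rwa [Nat.cast_one, pow_one] at this

variable {e}

theorem exists_pow_eq (a : Multiplicative (ZMod (2 * e))) :
    ∃ k : ℕ, a = Multiplicative.ofAdd 1 ^ k :=
  ⟨a.toAdd.val, by
    rw [← ofAdd_nsmul, nsmul_one, ZMod.natCast_zmod_val]
    rfl⟩

theorem hom_ext_ofAdd_one {χ ψ : Multiplicative (ZMod (2 * e)) →* ℂˣ}
    (h : χ (Multiplicative.ofAdd 1) = ψ (Multiplicative.ofAdd 1)) : χ = ψ := by
  refine MonoidHom.ext fun a => ?_
  obtain ⟨k, rfl⟩ := exists_pow_eq a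
  rw [map_pow, map_pow, h]

theorem signChar_eq_one {a : Multiplicative (ZMod (2 * e))} (ha : a ^ e = 1) :
    signChar e a = 1 := by
  obtain ⟨k, rfl⟩ := exists_pow_eq a
  rw [← pow_mul, ← ofAdd_nsmul, nsmul_one, ← ofAdd_zero, Multiplicative.ofAdd.injective.eq_iff,
    ZMod.natCast_eq_zero_iff, mul_comm k] at ha
  have he : 0 < e := Nat.pos_of_ne_zero fun h => NeZero.ne (2 * e) (by rw [h, mul_zero])
  obtain ⟨m, rfl⟩ : 2 ∣ k := Nat.dvd_of_mul_dvd_mul_left he (by rwa [mul_comm e 2])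
  rw [map_pow, signChar_one, pow_mul, neg_one_sq, one_pow]

theorem signChar_mul_self : signChar e * signChar e = 1 :=
  hom_ext_ofAdd_one (by rw [MonoidHom.mul_apply, signChar_one]; simp)

/-- The square of the generator is killed by `e`, so `χ` takes a value of square 1 on the generator.
-/
theorem eq_one_or_eq_signChar {χ : Multiplicative (ZMod (2 * e)) →* ℂˣ}
    (h : ∀ a, a ^ e = 1 → χ a = 1) : χ = 1 ∨ χ = signChar e := by
  have h1 : χ (Multiplicative.ofAdd 1) * χ (Multiplicative.ofAdd 1) = 1 := by
    rw [← map_mul, ← sq]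
    refine h _ ?_
    rw [← pow_mul, ← ofAdd_nsmul, nsmul_one, ZMod.natCast_self, ofAdd_zero]
  rcases mul_self_eq_one_iff.1 (congrArg Units.val h1) with h2 | h2
  · exact Or.inl (hom_ext_ofAdd_one (Units.ext h2))
  · exact Or.inr (hom_ext_ofAdd_one ((Units.ext h2).trans (signChar_one e).symm))

variable {n}

/-- Testing on `a` in place `b` and `a⁻¹` in place `b'` shows that the quotients `f' b / f b` do not
depend on `b`. Testing on a single `a` with `a ^ e = 1` shows that this common quotient is trivial
or the sign character. Conversely, the product of the sign characters is trivial on `N`. -/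
theorem piChar_diagonal_eq_iff (hn : 0 < n) (f f' : Fin n → Multiplicative (ZMod (2 * e)) →* ℂˣ) :
    (piChar f).comp (diagonalSubgroup e n).subtype =
      (piChar f').comp (diagonalSubgroup e n).subtype ↔
    f' = f ∨ f' = (fun χ => χ * signChar e) ∘ f := by
  constructor
  · intro h
    have h0 : ∀ ν ∈ diagonalSubgroup e n, piChar f ν = piChar f' ν := fun ν hν =>
      DFunLike.congr_fun h (⟨ν, hν⟩ : diagonalSubgroup e n)
    have h1 : ∀ b b' a, f b a * f' b' a = f' b a * f b' a := by
      intro b b' a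
      have := h0 (Pi.mulSingle b a * Pi.mulSingle b' a⁻¹) (by
        change (∏ c, _) ^ e = 1
        simp only [Pi.mul_apply, Finset.prod_mul_distrib]
        simp [Pi.mulSingle_apply])
      rw [map_mul, map_mul] at this
      simp only [piChar_mulSingle, map_inv] at this
      rwa [← div_eq_mul_inv, ← div_eq_mul_inv, div_eq_div_iff_mul_eq_mul] at this
    have h2 : ∀ b, f' b / f b = 1 ∨ f' b / f b = signChar e := fun b => by
      refine eq_one_or_eq_signChar fun a ha => ?_
      have := h0 (Pi.mulSingle b a) (by
        change (∏ c, _) ^ e = 1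
        simpa [Pi.mulSingle_apply] using ha)
      rw [piChar_mulSingle, piChar_mulSingle] at this
      rw [MonoidHom.div_apply, this, div_self']
    have h3 : ∀ b b', f' b / f b = f' b' / f b' := fun b b' => MonoidHom.ext fun a => by
      rw [MonoidHom.div_apply, MonoidHom.div_apply, div_eq_div_iff_mul_eq_mul, ← h1 b b', mul_comm]
    rcases h2 ⟨0, hn⟩ with h4 | h4
    · refine Or.inl (funext fun b => ?_)
      rw [← div_eq_one, h3 b ⟨0, hn⟩, h4]
    · refine Or.inr (funext fun b => ?_)
      change f' b = f b * signChar e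
      rw [← h4, h3 _ b]
      exact (mul_div_cancel (f b) (f' b)).symm
  · rintro (rfl | rfl)
    · rfl
    · refine MonoidHom.ext fun ν => ?_
      change piChar f ν.1 = piChar (fun b => f b * signChar e) ν.1
      simp only [piChar_apply, MonoidHom.mul_apply, Finset.prod_mul_distrib]
      rw [← map_prod, signChar_eq_one ν.2, mul_one]

end Reflection

/-- The involution is multiplication by the sign character. It has no fixed point since that
character is nontrivial, and `ℓ ∤ 2 * e` makes `ℓ` odd, as `IsTwist` requires. -/
theorem exists_irr_equiv_classes_reflection {ℓ n e : ℕ} (hℓ : ℓ.Prime) (hn : 0 < n)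
    (he : ¬ ℓ ∣ 2 * e) :
    ∃ f : Irr (complexReflectionGroup (2 * e) 2 n) ≃
        DZTripleClass ℓ (reflectionYoungSubgroups ℓ (2 * e) 2 n),
      ∀ (χ : Irr (complexReflectionGroup (2 * e) 2 n))
        (T : DZTriple ℓ (reflectionYoungSubgroups ℓ (2 * e) 2 n)),
        f χ = ⟦T⟧ → χ.defect ℓ = (padicValNat ℓ (Nat.card T.Y) : ℤ) := by
  have : NeZero (2 * e) := ⟨fun h => he (h ▸ dvd_zero ℓ)⟩
  have hneg : (-1 : ℂˣ) ≠ 1 := by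
    intro h
    have := congrArg Units.val h
    norm_num at this
  refine exists_irr_equiv_classes_of_splitting (C := Multiplicative (ZMod (2 * e)) →* ℂˣ)
    (δ := fun χ => χ * signChar e) (i := diagonalHom e n) ?_
    (π := SemidirectProduct.rightHom.comp (complexReflectionGroup (2 * e) 2 n).subtype)
    (s := permHom e n) (fun _ => rfl) ?_
    (q := fun f => (piChar f).comp (diagonalSubgroup e n).subtype) ?_
    (piChar_diagonal_eq_iff hn) ?_ hℓ ?_ (fun χ => ?_) (Or.inr ⟨fun χ h => ?_, ?_⟩) hn rfl
  · intro ν μ h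
    exact Subtype.ext (SemidirectProduct.inl_injective (congrArg Subtype.val h))
  · ext g
    rw [MonoidHom.mem_ker]
    constructor
    · rintro ⟨ν, rfl⟩
      rfl
    · intro hg
      have h1 : g.1 ∈ (SemidirectProduct.rightHom :
          CyclicWreath (2 * e) n →* Perm (Fin n)).ker := hg
      rw [← SemidirectProduct.range_inl_eq_ker_rightHom] at h1
      obtain ⟨ν, hν⟩ := h1
      refine ⟨⟨ν, ?_⟩, Subtype.ext hν⟩
      have h2 : (∏ b, g.1.left b) ^ (2 * e / 2) = 1 := g.2
      rw [← hν, Nat.mul_div_cancel_left e two_pos] at h2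
      exact h2
  · intro χ
    -- Linear characters of a subgroup of a finite abelian group extend to the whole group.
    obtain ⟨ψ, hψ⟩ := MonoidHom.domRestrict_surjective (M := ℂ) (diagonalSubgroup e n) χ
    obtain ⟨f, rfl⟩ := piChar_bijective.2 ψ
    exact ⟨f, hψ⟩
  · intro h f ν μ hμ
    have h1 := congrArg Subtype.val hμ
    change SemidirectProduct.inr h * SemidirectProduct.inl ν.1 * (SemidirectProduct.inr h)⁻¹ =
      SemidirectProduct.inl μ.1 at h1
    rw [← map_inv, ← SemidirectProduct.inl_aut] at h1
    change piChar _ μ.1 = piChar f ν.1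
    rw [← SemidirectProduct.inl_injective h1, piChar_comp_inv]
  · intro h
    have h1 := h.trans (diagonalSubgroup e n).card_subgroup_dvd_card
    rw [card_pi_zmod] at h1
    exact he (hℓ.dvd_of_dvd_pow h1)
  · change χ * signChar e * signChar e = χ
    exact (mul_assoc _ _ _).trans ((congrArg _ signChar_mul_self).trans (mul_one χ))
  · have h1 := DFunLike.congr_fun h (Multiplicative.ofAdd 1)
    rw [MonoidHom.mul_apply, mul_eq_left, signChar_one] at h1
    exact hneg h1
  · rintro rfl
    exact he (dvd_mul_right 2 e)

end

theorem proposition6p12 (ℓ n : ℕ) (hℓ : ℓ.Prime) (hn : 0 < n) :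
    (∃ f : Irr (Equiv.Perm (Fin n)) ≃ DZTripleClass ℓ (symYoungSubgroups ℓ n),
      ∀ (χ : Irr (Equiv.Perm (Fin n))) (T : DZTriple ℓ (symYoungSubgroups ℓ n)),
        f χ = ⟦T⟧ → χ.defect ℓ = (padicValNat ℓ (Nat.card T.Y) : ℤ)) ∧
    (∀ e : ℕ, ¬ ℓ ∣ e →
      ∃ f : Irr (CyclicWreath e n) ≃ DZTripleClass ℓ (wreathYoungSubgroups ℓ e n),
        ∀ (χ : Irr (CyclicWreath e n)) (T : DZTriple ℓ (wreathYoungSubgroups ℓ e n)),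
          f χ = ⟦T⟧ → χ.defect ℓ = (padicValNat ℓ (Nat.card T.Y) : ℤ)) ∧
    (∀ e : ℕ, ¬ ℓ ∣ 2 * e →
      ∃ f : Irr (complexReflectionGroup (2 * e) 2 n) ≃
          DZTripleClass ℓ (reflectionYoungSubgroups ℓ (2 * e) 2 n),
        ∀ (χ : Irr (complexReflectionGroup (2 * e) 2 n))
          (T : DZTriple ℓ (reflectionYoungSubgroups ℓ (2 * e) 2 n)),
          f χ = ⟦T⟧ → χ.defect ℓ = (padicValNat ℓ (Nat.card T.Y) : ℤ)) :=
  ⟨exists_irr_equiv_classes_symmetricGroup hℓ hn,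
    fun _ he => exists_irr_equiv_classes_cyclicWreath hℓ hn he,
    fun _ he => exists_irr_equiv_classes_reflection hℓ hn he⟩
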